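/- Let $k\ge 1$ be an integer, $\ell>1$ and $\gamma>1/\sqrt\ell$, and put $m=k/(1+\gamma)$, $$\varepsilon=\ell\gamma^2-1,\quad A=k+2-(k-2\ell)\gamma,\quad B=2k+1-\ell,\quad f(z)=-\varepsilon-Az+Bz^2 .$$ **The $Z$–$v$ equation.** Consider $\Delta_Z(Z,v)\,v'(Z)=\Delta_v(Z,v)$ with $$\Delta_v=(1-v^2)\big[m(1-v^2)Z-kv(1-vZ)\big],\qquad \Delta_Z=Z\big[(1-Zv)^2-\ell(v-Z)^2\big],$$ and its singular points $P_0=(0,0)$ and $P_1=(Z_1,v_1)=\Big(\frac{k\sqrt\ell}{\ell(k-m)+m},\frac{m}{(k-m)\sqrt\ell}\Big)$ (the sonic point). The $P_0$–$P_1$ solution $v_F$ is the unique $v\in C^\infty([0,Z_1))$ with $v(0)=0$ and $v'=\Delta_v/\Delta_Z$ on $(0,Z_1)$. **The $z$–$u$ equation.** The map $$\Psi(Z,v)=\Big(\frac{m(1-v^2)Z-kv(1-vZ)}{mZ(1-v^2)},\ \frac{k^2(1-vZ)^2}{m^2(1-v^2)Z^2}\Big)=(z,u)$$ turns this into $\Delta_z(z,u)\,u'(z)=\Delta_u(z,u)$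 with $$\Delta_u=2u\big[u+f(z)+kz(1-z)\big],\qquad \Delta_z=\big((k+1)z-1\big)u+(z-1)f(z),$$ and $P_1$ into $Q_1=(0,\varepsilon)$. The $Q_0$–$Q_1$ curve $u_F:(0,\frac1{k+1})\to\mathbb R$ is the function whose graph is the image under $\Psi$ of $\{(Z,v_F(Z)):0<Z<Z_1\}$; it tends to $\varepsilon$ as $z\downarrow0$ and to $+\infty$ as $z\uparrow\frac1{k+1}$ (that is, to $Q_0=(\frac1{k+1},+\infty)$). **The local solution.** Let $\lambda_+\ge\lambda_-$ be the roots of $\lambda^2-((k+2)\varepsilon+A)\lambda+2k\varepsilon(1+\varepsilon)$ (the eigenvalues of the linearization at $Q_1$), $\delta=\lambda_-$ and $R=\lambda_+/\lambda_-$. On the set $\Gamma(k,\ell)=\{\gamma>1/\sqrt\ell: A>0\}$ the map $\gamma\mapsto R$ is injective, and objects depending on $\gamma\in\Gamma(k,\ell)$ are regarded as depending on $R$. Let $a_0=\varepsilon$, let $a_1$ be the larger root of $x^2-((k-2)\varepsilon+A)x+2(k-A)\varepsilon$, and for $n\ge2$ let $$(R-n)\delta a_n=-\tfrac{n+1}2\sum_{j=2}^{n-1}a_ja_{n+1-j}-\big(2-\tfrac{k+1}2n\big)\sum_{j=1}^{n-1}a_ja_{n-j}-\big((n-3)A+(n-1)B+2k\big)a_{n-1}+\big((n-4)B+2k\big)a_{n-2},$$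 and $u_L(z)=u_L(z;R)=\sum_{n\ge0}a_nz^n$. **Admissible parameters.** Let $\mathcal K$ be the set of $(k,\ell)$ with $k\ge1$ an integer, $\ell\ge1$, and either $k\le5$, or $k\ge6$ and $1<\ell<\ell_0(k):=\frac{1}{24}\big(3k^2-8k+12-\sqrt{(3k-2)(k-6)(3k^2+4k+12)}\big)$. For $k\ge2$ let $E_k=(0,\infty)$ if $k\le6$ and $E_k=\big(0,\frac{32k}{(3k-2)(k-6)}\big)$ if $k\ge7$, and let $\ell_1(k)$ be the unique $\ell>1$ for which some $\varepsilon\in E_k$ satisfies $$(k+2)\sqrt{1+\varepsilon}-4\sqrt{\tfrac{2k\varepsilon}3}=\tfrac{k}{\sqrt\ell}-2\sqrt\ell,\qquad (68k+12)\varepsilon-(33k+64)\sqrt{\tfrac{2k}3}\sqrt{\varepsilon(1+\varepsilon)}+52k-12\ell+12=0 .$$ Let $\ell_*(1)=\ell_*(2)=+\infty$, $\ell_*(k)=\ell_1(k)$ for $k\ge3$, and $\mathcal K_*=\{(k,\ell)\in\mathcal K:1<\ell<\ell_*(k)\}$. **Proposition.** Let $(k,\ell)\in\mathcal K_*$. Then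 there are $R_0\in(3,4)$ and $\gamma\in\Gamma(k,\ell)$ with $R(k,\ell,\gamma)=R_0$ such that, for this $\gamma$, the solution $v_F$ and the curve $u_F$ exist and $u_L(\cdot;R_0)\equiv u_F(\cdot;R_0)$ near $Q_1$: there is $\zeta\in(0,\frac1{k+1})$ such that the series $u_L$ converges on $[-\zeta,\zeta]$, is an analytic solution of the $z$–$u$ equation on $(-\zeta,\zeta)$, and $u_L=u_F$ on $(0,\zeta)$. Consequently $u_F$ continues smoothly through $Q_1$: the function $U$ equal to $u_L$ on $(-\zeta,\zeta)$ and to $u_F$ on $(0,\frac1{k+1})$ is $C^\infty$ on $(-\zeta,\frac1{k+1})$, satisfies $U(0)=\varepsilon$ and solves $\Delta_z(z,U)U'=\Delta_u(z,U)$ there. Likewise $v_F$ continues smoothly through the sonic point $P_1$: for some $\upsilon>0$ there is a $C^\infty$ function $V$ on $[0,Z_1+\upsilon)$ with $V=v_F$ on $[0,Z_1)$, $V(Z_1)=v_1$ and $\Delta_Z(Z,V)V'=\Delta_v(Z,V)$ on $(0,Z_1+\upsilon)$. -/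

import Mathlib

open Set Filter Topology
open scoped ContDiff

noncomputable section

namespace RelEuler

/-! ### Parameters

The free parameters are `k` (space dimension minus one), `ℓ` (inverse square of the sound speed)
and `γ = k / m - 1`, so that `m = k / (1 + γ)`. -/

/-- The parameter `m` in terms of `k` and `γ`. -/
def mPar (k γ : ℝ) : ℝ := k / (1 + γ)

/-- `ε = ℓ γ² - 1`. -/
def eps (ℓ γ : ℝ) : ℝ := ℓ * γ ^ 2 - 1

/-- `A = k + 2 - (k - 2ℓ) γ`. -/
def cA (k ℓ γ : ℝ) : ℝ := k + 2 - (k - 2 * ℓ) * γ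

/-- `B = 2k + 1 - ℓ`. -/
def cB (k ℓ : ℝ) : ℝ := 2 * k + 1 - ℓ

/-! ### The `Z-v` equation `dv/dZ = Δ_v / Δ_Z` -/

def DeltaV (k γ : ℝ) (Z v : ℝ) : ℝ :=
  (1 - v ^ 2) * (mPar k γ * (1 - v ^ 2) * Z - k * v * (1 - v * Z))

def DeltaZ (ℓ : ℝ) (Z v : ℝ) : ℝ :=
  Z * ((1 - Z * v) ^ 2 - ℓ * (v - Z) ^ 2)

/-- `Z`-coordinate of the sonic point `P₁`. -/
def Z₁ (k ℓ γ : ℝ) : ℝ :=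
  k * √ℓ / (ℓ * (k - mPar k γ) + mPar k γ)

/-- `v`-coordinate of the sonic point `P₁`. -/
def v₁ (k ℓ γ : ℝ) : ℝ :=
  mPar k γ / ((k - mPar k γ) * √ℓ)

/-- `v` is (on `[0, Z₁)`) the smooth solution of the `Z-v` equation starting at `P₀ = (0, 0)`,
that is, the `P₀-P₁` solution. -/
structure IsP0P1Solution (k ℓ γ : ℝ) (v : ℝ → ℝ) : Prop where
  smooth : ContDiffOn ℝ ∞ v (Ico 0 (Z₁ k ℓ γ))
  init : v 0 = 0
  regular : ∀ Z ∈ Ioo 0 (Z₁ k ℓ γ), DeltaZ ℓ Z (v Z) ≠ 0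
  ode : ∀ Z ∈ Ioo 0 (Z₁ k ℓ γ), HasDerivAt v (DeltaV k γ Z (v Z) / DeltaZ ℓ Z (v Z)) Z

/-! ### The change of variables `Ψ : (Z, v) ↦ (z, u)` and the `z-u` equation -/

/-- `Ψ(Z, v) = (z, u)`. -/
def Psi (k γ : ℝ) (Z v : ℝ) : ℝ × ℝ :=
  ((mPar k γ * (1 - v ^ 2) * Z - k * v * (1 - v * Z)) / (mPar k γ * Z * (1 - v ^ 2)),
    k ^ 2 * (1 - v * Z) ^ 2 / (mPar k γ ^ 2 * (1 - v ^ 2) * Z ^ 2))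

/-- `f(z) = -ε - A z + B z²`. -/
def fPoly (k ℓ γ : ℝ) (z : ℝ) : ℝ := -eps ℓ γ - cA k ℓ γ * z + cB k ℓ * z ^ 2

def DeltaU (k ℓ γ : ℝ) (z u : ℝ) : ℝ :=
  2 * u * (u + fPoly k ℓ γ z + k * z * (1 - z))

def DeltaSmallZ (k ℓ γ : ℝ) (z u : ℝ) : ℝ :=
  ((k + 1) * z - 1) * u + (z - 1) * fPoly k ℓ γ z

/-- `u` is differentiable at `z` and solves the `z-u` equation `Δ_z u' = Δ_u` there. The equation
is in quasi-linear form, since `Δ_z` and `Δ_u` both vanish at the sonic point `Q₁ = (0, ε)`. -/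
def SolvesZU (k ℓ γ : ℝ) (u : ℝ → ℝ) (z : ℝ) : Prop :=
  DifferentiableAt ℝ u z ∧ DeltaSmallZ k ℓ γ z (u z) * deriv u z = DeltaU k ℓ γ z (u z)

/-- `u` is (on `(0, 1/(k+1))`) the `Q₀-Q₁` curve `u_F`: its graph is the image under `Ψ` of the
graph of the `P₀-P₁` solution `v`, and it joins `Q₁ = (0, ε)` to `Q₀ = (1/(k+1), +∞)`. -/
structure IsQ0Q1Curve (k ℓ γ : ℝ) (v u : ℝ → ℝ) : Prop where
  graph : (fun z => (z, u z)) '' Ioo 0 (1 / (k + 1)) =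
    (fun Z => Psi k γ Z (v Z)) '' Ioo 0 (Z₁ k ℓ γ)
  tendsto_Q1 : Tendsto u (𝓝[>] 0) (𝓝 (eps ℓ γ))
  tendsto_Q0 : Tendsto u (𝓝[<] (1 / (k + 1))) atTop

/-! ### Linearization of the `z-u` equation at `Q₁` -/

/-- The entries `c₁ = ∂_u Δ_u(Q₁)`, `c₂ = ∂_u Δ_z(Q₁)`, `c₃ = ∂_z Δ_u(Q₁)`, `c₄ = ∂_z Δ_z(Q₁)` give
the discriminant `(c₁ - c₄)² + 4 c₂ c₃`; here `c₂ = -1`. -/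
def c₁ (ℓ γ : ℝ) : ℝ := 2 * eps ℓ γ

def c₃ (k ℓ γ : ℝ) : ℝ := 2 * eps ℓ γ * (k - cA k ℓ γ)

def c₄ (k ℓ γ : ℝ) : ℝ := k * eps ℓ γ + cA k ℓ γ

def disc (k ℓ γ : ℝ) : ℝ := (c₁ ℓ γ - c₄ k ℓ γ) ^ 2 - 4 * c₃ k ℓ γ

/-- The larger eigenvalue of the linearization at `Q₁`. -/
def lamPlus (k ℓ γ : ℝ) : ℝ := (c₁ ℓ γ + c₄ k ℓ γ + √(disc k ℓ γ)) / 2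

/-- The smaller eigenvalue of the linearization at `Q₁` (also called `δ`). -/
def lamMinus (k ℓ γ : ℝ) : ℝ := (c₁ ℓ γ + c₄ k ℓ γ - √(disc k ℓ γ)) / 2

/-- The ratio `R = λ₊ / λ₋`. -/
def ratioR (k ℓ γ : ℝ) : ℝ := lamPlus k ℓ γ / lamMinus k ℓ γ

/-- The set of `γ > 1/√ℓ` with `A > 0`; on it `γ ↦ R` is injective, so that `R` can be used as the
free parameter instead of `γ`. -/
def GammaSet (k ℓ : ℝ) : Set ℝ := {γ | 1 / √ℓ < γ ∧ 0 < cA k ℓ γ}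

/-- The slope of the local analytic solution at `Q₁`. -/
def slope (k ℓ γ : ℝ) : ℝ := (c₄ k ℓ γ - c₁ ℓ γ + √(disc k ℓ γ)) / 2

/-! ### The local analytic solution at `Q₁` -/

/-- The Taylor coefficients `aₙ`: `a₀ = ε`, `a₁` is the slope, and, for `N ≥ 2`,
`(R - N) δ a_N = - (N+1)/2 ∑_{j=2}^{N-1} a_j a_{N+1-j} - (2 - (k+1)N/2) ∑_{j=1}^{N-1} a_j a_{N-j}
  - ((N-3)A + (N-1)B + 2k) a_{N-1} + ((N-4)B + 2k) a_{N-2}`;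
below `N = n + 2`, and `j = i + 2`, `j = i + 1` in the two sums. -/
def coeffL (k ℓ γ : ℝ) : ℕ → ℝ
  | 0 => eps ℓ γ
  | 1 => slope k ℓ γ
  | n + 2 =>
    (-(((n : ℝ) + 2 + 1) / 2) *
          ∑ i : Fin n, coeffL k ℓ γ (i.val + 2) * coeffL k ℓ γ (n + 1 - i.val)
        - (2 - (k + 1) / 2 * ((n : ℝ) + 2)) *
          ∑ i : Fin (n + 1), coeffL k ℓ γ (i.val + 1) * coeffL k ℓ γ (n + 1 - i.val)
        - (((n : ℝ) + 2 - 3) * cA k ℓ γ + ((n : ℝ) + 2 - 1) * cB k ℓ + 2 * k) *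
          coeffL k ℓ γ (n + 1)
        + (((n : ℝ) + 2 - 4) * cB k ℓ + 2 * k) * coeffL k ℓ γ n)
      / ((ratioR k ℓ γ - ((n : ℝ) + 2)) * lamMinus k ℓ γ)
termination_by n => n
decreasing_by all_goals omega

/-- The local analytic solution `u_L(z) = ∑ aₙ zⁿ`. -/
def uL (k ℓ γ : ℝ) (z : ℝ) : ℝ := ∑' n : ℕ, coeffL k ℓ γ n * z ^ n

/-! ### The admissible sets -/

/-- The critical value `ℓ₀(k)`, used for `k ≥ 6`. -/
def ellZero (k : ℝ) : ℝ :=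
  (3 * k ^ 2 - 8 * k + 12 - √((3 * k - 2) * (k - 6) * (3 * k ^ 2 + 4 * k + 12))) / 24

/-- The admissible set `𝒦`. -/
def setK : Set (ℕ × ℝ) :=
  {p | 1 ≤ p.1 ∧ 1 ≤ p.2 ∧ (p.1 ≤ 5 ∨ (6 ≤ p.1 ∧ 1 < p.2 ∧ p.2 < ellZero p.1))}

/-- The range `E_k` of `ε` when `R = 3`, for `k ≥ 2`. -/
def epsRange (k : ℕ) : Set ℝ :=
  if k ≤ 6 then Ioi 0 else Ioo 0 (32 * k / ((3 * k - 2) * (k - 6)))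

def f₁ (k ε : ℝ) : ℝ := (k + 2) * √(1 + ε) - 4 * √(2 * k * ε / 3)

def f₂ (k ℓ : ℝ) : ℝ := k / √ℓ - 2 * √ℓ

def f₃ (k ε : ℝ) : ℝ :=
  (68 * k + 12) * ε - (33 * k + 64) * √(2 * k / 3) * √(ε * (1 + ε))

/-- The critical value `ℓ₁(k)`, for `k ≥ 2`: the zero in `(1, ∞)` of the strictly decreasing function
`ℓ ↦ F(k, ℓ) = f₃(k, ε) + 52 k - 12 ℓ + 12`, where `ε = ε(k, ℓ) ∈ E_k` is the solution of
`f₁(k, ε) = f₂(k, ℓ)`. The set below is a singleton for `k ≥ 2`. -/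
def ellOne (k : ℕ) : ℝ :=
  sInf {ℓ : ℝ | 1 < ℓ ∧ ∃ ε ∈ epsRange k,
    f₁ k ε = f₂ k ℓ ∧ f₃ k ε + 52 * k - 12 * ℓ + 12 = 0}

/-- The critical value `ℓ_*(k)`. -/
def ellStar (k : ℕ) : EReal := if k ≤ 2 then ⊤ else (ellOne k : EReal)

/-- The admissible set `𝒦_*`. -/
def setKStar : Set (ℕ × ℝ) :=
  {p | p ∈ setK ∧ 1 < p.2 ∧ (p.2 : EReal) < ellStar p.1}

end RelEuler

end

/-! The proof is a shooting argument in the ratio R of the two positive eigenvalues at Q₁. The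
coefficient a_n of u_L carries the denominator (R - n)δ, so a₃ blows up as R decreases to 3 and a₄
as R increases to 4, with signs decided by the numerators `N₃` and `N₄` of the recursion. If both
numerators are positive at the respective ends, then a₃ tends to +∞ and a₄ to -∞. Hence, immediately
to the right of Q₁, u_L lies above a suitable quartic when R is near 3, and below its own cubic
Taylor polynomial when R is near 4. The curve u_F is shown to lie on the other side in both cases
(`exists_eventually_curve_lt_quartic`, `exists_eventually_cubic_lt_curve`). At a fixed small ζ both
u_L(ζ) and u_F(ζ) depend continuously on the parameter, so they agree for some R in (3, 4), and
uniqueness for the equation away from Q₁ turns this into equality on (0, ζ] (`exists_matching`).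

The position of u_F comes from polynomial barriers: a polynomial b whose defect Δ_z b' - Δ_u has a
fixed sign is crossed in one direction only. A barrier needs one point where u_F is on the correct
side. This point is found exactly at R = 3 or R = 4: if u_F stayed on the wrong side all the way to
Q₁, the difference divided by z² or z⁴ would have a derivative comparable to 1/z or larger and would
diverge logarithmically. Continuity of u_F in the parameter carries the point over to neighbouring
R.

The curve u_F is built from Q₀. In the variable y = 1/u the point Q₀ becomes a regular singular
point with a convergent power series solution, uniformly in γ (`Adm.exists_chartOn`). The region
above the sonic parabola with Δ_z > 0 is invariant to the left, so the solution continues down to z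
= 0; with Grönwall's inequality this also yields continuity in γ (`continuousAt_curve`).

The sign conditions at R = 3 and R = 4 are algebraic (`exists_good`). The quantity T = Rδ/ε
parametrizes the γ with a given R, and lower bounds on T imply the signs. For k = 1, 2 they hold for
every ℓ > 1; for k ≥ 3 the condition ℓ < ℓ₁(k) places T to the right of explicit linear thresholds.
Since trace²/determinant is monotone in γ, R stays in (3, 4) between the two end parameters
(`good_interval`).

Finally Ψ is inverted explicitly. Along the continued curve Z is a strictly decreasing smooth
function of z, also across z = 0, so v is a smooth function of Z across the sonic point
(`Continuation.exists_transport`). -/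

noncomputable section

namespace RelEuler

/-! ### Comparison and existence tools for scalar ordinary differential equations -/

/-- A function that is positive at the right end of an interval and has negative right derivative
at each of its zeros is positive on the whole interval. -/
theorem pos_of_deriv_neg_at_zeros {g : ℝ → ℝ} {a c : ℝ} (hg : ContinuousOn g (Icc a c))
    (hc : 0 < g c)
    (hd : ∀ z ∈ Ico a c, g z = 0 → ∃ g' < 0, HasDerivWithinAt g g' (Ioi z) z) :
    ∀ z ∈ Icc a c, 0 < g z := by
  intro z₁ hz₁
  by_contra! hneg
  -- The last point of S is a zero of g with g > 0 to its right, which is incompatible with a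
  -- negative right derivative.
  set S := {z ∈ Icc z₁ c | g z ≤ 0} with hS
  have hsub : Icc z₁ c ⊆ Icc a c := Icc_subset_Icc_left hz₁.1
  have hScl : IsClosed S := by
    have := (hg.mono hsub).preimage_isClosed_of_isClosed isClosed_Icc (isClosed_Iic (a := (0 : ℝ)))
    exact this
  have hScpt : IsCompact S := isCompact_Icc.of_isClosed_subset hScl (fun z hz => hz.1)
  have hSne : S.Nonempty := ⟨z₁, ⟨le_rfl, hz₁.2⟩, hneg⟩
  obtain ⟨zc, hzcS, hzc⟩ := hScpt.exists_isGreatest hSne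
  have hlt : zc < c := lt_of_le_of_ne hzcS.1.2 (fun h => by
    have := hzcS.2; rw [h] at this; linarith)
  have hpos : ∀ z ∈ Ioc zc c, 0 < g z := by
    intro z hz
    by_contra! h
    exact absurd (hzc ⟨⟨hzcS.1.1.trans hz.1.le, hz.2⟩, h⟩) (not_le.2 hz.1)
  have hzca : zc ∈ Icc a c := hsub hzcS.1
  have hcw : ContinuousWithinAt g (Ioc zc c) zc :=
    (hg zc hzca).mono (fun z hz => ⟨hzca.1.trans hz.1.le, hz.2⟩)
  have hne : (𝓝[Ioc zc c] zc).NeBot := by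
    rw [nhdsWithin_Ioc_eq_nhdsGT hlt]; infer_instance
  have hge : 0 ≤ g zc := ge_of_tendsto hcw (eventually_of_mem self_mem_nhdsWithin
    fun z hz => (hpos z hz).le)
  have h0 : g zc = 0 := le_antisymm hzcS.2 hge
  obtain ⟨g', hg', hder⟩ := hd zc ⟨hzca.1, hlt⟩ h0
  rw [hasDerivWithinAt_iff_tendsto_slope' (by simp)] at hder
  have : 0 ≤ g' := ge_of_tendsto hder (by
    filter_upwards [Ioc_mem_nhdsGT hlt] with z hz
    rw [slope_def_field, h0, sub_zero]
    exact div_nonneg (hpos z hz).le (sub_nonneg.2 hz.1.le))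
  linarith

/-- A bounded vector field, globally Lipschitz in space, has solutions on a whole compact interval,
with prescribed value at the right end. -/
theorem exists_solution_of_bounded_lipschitz {F : ℝ → ℝ → ℝ} {a b : ℝ} (hab : a ≤ b)
    {K L : NNReal} (hK : ∀ t ∈ Icc a b, LipschitzWith K (F t))
    (hF : ∀ x, ContinuousOn (fun t => F t x) (Icc a b)) (hL : ∀ t ∈ Icc a b, ∀ x, ‖F t x‖ ≤ L)
    (x₀ : ℝ) :
    ∃ u : ℝ → ℝ, u b = x₀ ∧ ∀ t ∈ Icc a b, HasDerivWithinAt u (F t (u t)) (Icc a b) t := by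
  -- Boundedness by L confines the solution to a ball of radius L(b - a), so a global Lipschitz
  -- bound gives existence on all of [a, b] without a smallness condition.
  have hpl : IsPicardLindelof F (⟨b, right_mem_Icc.2 hab⟩ : Icc a b) x₀
      (L * ⟨b - a, sub_nonneg.2 hab⟩) 0 L K :=
    { lipschitzOnWith := fun t ht => (hK t ht).lipschitzOnWith
      continuousOn := fun x _ => hF x
      norm_le := fun t ht x _ => hL t ht x
      mul_max_le := by
        simp only [sub_self, NNReal.coe_zero, sub_zero]
        rw [max_eq_right (sub_nonneg.2 hab)]
        exact le_rfl }
  exact hpl.exists_eq_forall_mem_Icc_hasDerivWithinAt₀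

/-- Grönwall's inequality, going to the left from the right end of the interval. -/
theorem dist_le_gronwallBound_left {F : ℝ → ℝ → ℝ} {a b e : ℝ} {K : NNReal}
    (hK : ∀ t ∈ Icc a b, LipschitzWith K (F t)) {u w u' w' : ℝ → ℝ}
    (hu : ∀ t ∈ Icc a b, HasDerivWithinAt u (u' t) (Icc a b) t)
    (hw : ∀ t ∈ Icc a b, HasDerivWithinAt w (w' t) (Icc a b) t)
    (hue : ∀ t ∈ Icc a b, u' t = F t (u t))
    (hwe : ∀ t ∈ Icc a b, |w' t - F t (w t)| ≤ e) :
    ∀ t ∈ Icc a b, |u t - w t| ≤ gronwallBound |u b - w b| K e (b - t) := by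
  -- The substitution t ↦ -t reduces the claim to the usual forward inequality.
  have hrefl : ∀ {f f' : ℝ → ℝ}, (∀ t ∈ Icc a b, HasDerivWithinAt f (f' t) (Icc a b) t) →
      ∀ t ∈ Icc (-b) (-a), HasDerivWithinAt (fun t => f (-t)) (-f' (-t)) (Icc (-b) (-a)) t := by
    intro f f' hf t ht
    have ht' : -t ∈ Icc a b := ⟨by linarith [ht.2], by linarith [ht.1]⟩
    have h1 : HasDerivWithinAt (fun t : ℝ => -t) (-1) (Icc (-b) (-a)) t :=
      (hasDerivAt_neg t).hasDerivWithinAt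
    have := (hf (-t) ht').scomp t h1 (fun s hs => ⟨by linarith [hs.2], by linarith [hs.1]⟩)
    simpa [Function.comp_def] using this
  have hIci : ∀ {f : ℝ → ℝ} {d t : ℝ}, t ∈ Ico (-b) (-a) →
      HasDerivWithinAt f d (Icc (-b) (-a)) t → HasDerivWithinAt f d (Ici t) t := by
    intro f d t ht h
    exact h.mono_of_mem_nhdsWithin (Icc_mem_nhdsGE_of_mem ht)
  have key := dist_le_of_approx_trajectories_ODE_of_mem (a := -b) (b := -a) (K := K)
    (v := fun t x => -F (-t) x) (s := fun _ => univ)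
    (f := fun t => u (-t)) (f' := fun t => -u' (-t)) (g := fun t => w (-t))
    (g' := fun t => -w' (-t)) (εf := 0) (εg := e) (δ := |u b - w b|)
    (fun t ht => by
      have := (hK (-t) ⟨by linarith [ht.2], by linarith [ht.1]⟩).neg
      exact this.lipschitzOnWith)
    (fun t ht => (hrefl hu t ht).continuousWithinAt)
    (fun t ht => hIci ht (hrefl hu t (Ico_subset_Icc_self ht)))
    (fun t ht => by
      rw [hue (-t) ⟨by linarith [ht.2], by linarith [ht.1]⟩, dist_self])
    (fun _ _ => trivial)
    (fun t ht => (hrefl hw t ht).continuousWithinAt)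
    (fun t ht => hIci ht (hrefl hw t (Ico_subset_Icc_self ht)))
    (fun t ht => by
      rw [dist_neg_neg, Real.dist_eq]
      exact hwe (-t) ⟨by linarith [ht.2], by linarith [ht.1]⟩)
    (fun _ _ => trivial)
    (by simp [Real.dist_eq])
  intro t ht
  have := key (-t) ⟨by linarith [ht.2], by linarith [ht.1]⟩
  simpa [Real.dist_eq, sub_eq_neg_add, add_comm] using this

/-- Quotients with a denominator cut off from below are Lipschitz. -/
theorem lipschitz_div_max {n d : ℝ → ℝ} {a b c κ : ℝ} (hκ : 0 < κ) (ha : 0 ≤ a) (hb : 0 ≤ b)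
    (hc : 0 ≤ c)
    (hn : ∀ x y, |n x - n y| ≤ a * |x - y|) (hnb : ∀ x, |n x| ≤ b)
    (hd : ∀ x y, |d x - d y| ≤ c * |x - y|) :
    LipschitzWith (Real.toNNReal (a / κ + b * c / κ ^ 2)) (fun x => n x / max (d x) κ) := by
  apply LipschitzWith.of_dist_le_mul
  intro x y
  rw [Real.coe_toNNReal _ (by positivity), Real.dist_eq, Real.dist_eq]
  have hx : 0 < max (d x) κ := lt_max_of_lt_right hκ
  have hy : 0 < max (d y) κ := lt_max_of_lt_right hκ
  have e : n x / max (d x) κ - n y / max (d y) κ =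
      (n x - n y) / max (d x) κ + n y * (max (d y) κ - max (d x) κ) /
        (max (d x) κ * max (d y) κ) := by
    field_simp; ring
  have h1 : |(n x - n y) / max (d x) κ| ≤ a * |x - y| / κ := by
    rw [abs_div, abs_of_pos hx]
    exact div_le_div₀ (by positivity) (hn x y) hκ (le_max_right _ _)
  have h2 : |n y * (max (d y) κ - max (d x) κ) / (max (d x) κ * max (d y) κ)| ≤
      b * (c * |x - y|) / κ ^ 2 := by
    rw [abs_div, abs_mul, abs_of_pos (mul_pos hx hy)]
    apply div_le_div₀ (by positivity) _ (by positivity)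
    · rw [pow_two]
      exact mul_le_mul (le_max_right _ _) (le_max_right _ _) hκ.le hx.le
    · refine mul_le_mul (hnb y) ?_ (abs_nonneg _) hb
      calc |max (d y) κ - max (d x) κ| ≤ |d y - d x| := by
            simpa using abs_max_sub_max_le_abs (d y) (d x) κ
        _ ≤ c * |x - y| := by rw [abs_sub_comm]; exact hd x y
  calc |n x / max (d x) κ - n y / max (d y) κ| ≤ a * |x - y| / κ + b * (c * |x - y|) / κ ^ 2 := by
        rw [e]; exact (abs_add_le _ _).trans (add_le_add h1 h2)
    _ = (a / κ + b * c / κ ^ 2) * |x - y| := by ring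

/-- A function on `(0, c]` whose derivative is at least `q / z` is unbounded below. -/
theorem exists_lt_of_deriv_ge_div {W W' : ℝ → ℝ} {c q : ℝ} (hc : 0 < c) (hq : 0 < q)
    (hW : ∀ z ∈ Ioc 0 c, HasDerivAt W (W' z) z) (hW' : ∀ z ∈ Ioc 0 c, q / z ≤ W' z) (M : ℝ) :
    ∃ z ∈ Ioc 0 c, W z < M := by
  -- W - q log z is nondecreasing, so W is at most a constant plus q log z, which tends to -∞ at 0.
  have hmono : MonotoneOn (fun z => W z - q * Real.log z) (Ioc 0 c) := by
    apply monotoneOn_of_hasDerivWithinAt_nonneg (f' := fun z => W' z - q * z⁻¹) (convex_Ioc 0 c)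
    · intro z hz
      exact ((hW z hz).sub ((Real.hasDerivAt_log hz.1.ne').const_mul q)).continuousAt.continuousWithinAt
    · intro z hz
      rw [interior_Ioc] at hz
      exact ((hW z ⟨hz.1, hz.2.le⟩).sub
        ((Real.hasDerivAt_log hz.1.ne').const_mul q)).hasDerivWithinAt
    · intro z hz
      rw [interior_Ioc] at hz
      have := hW' z ⟨hz.1, hz.2.le⟩
      rw [div_eq_mul_inv] at this
      linarith
  have hlog : Tendsto (fun z => W c - q * Real.log c + q * Real.log z) (𝓝[>] 0) atBot :=
    tendsto_atBot_add_const_left _ _ (Real.tendsto_log_nhdsGT_zero.const_mul_atBot hq)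
  obtain ⟨z, hz, hzc⟩ := ((hlog.eventually (eventually_lt_atBot M)).and
    (Ioc_mem_nhdsGT hc)).exists
  refine ⟨z, hzc, ?_⟩
  have := hmono hzc ⟨hc, le_rfl⟩ hzc.2
  simp only at this
  linarith

/-- A solution of a smooth scalar equation on an open set is smooth. -/
theorem contDiffOn_of_hasDerivAt_comp {F : ℝ × ℝ → ℝ} {u : ℝ → ℝ} {s : Set ℝ} (hs : IsOpen s)
    (hF : ∀ z ∈ s, ContDiffAt ℝ ∞ F (z, u z))
    (hu : ∀ z ∈ s, HasDerivAt u (F (z, u z)) z) : ContDiffOn ℝ ∞ u s := by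
  have hd : DifferentiableOn ℝ u s := fun z hz => (hu z hz).differentiableAt.differentiableWithinAt
  have key : ∀ n : ℕ, ContDiffOn ℝ n u s := by
    intro n
    induction n with
    | zero => exact contDiffOn_zero.2 hd.continuousOn
    | succ n ih =>
      rw [show ((n + 1 : ℕ) : WithTop ℕ∞) = (n : WithTop ℕ∞) + 1 by norm_cast]
      rw [contDiffOn_succ_iff_deriv_of_isOpen hs]
      refine ⟨hd, by simp, ?_⟩
      have : ContDiffOn ℝ n (fun z => F (z, u z)) s := by
        intro z hz
        have h1 : ContDiffAt ℝ n F (z, u z) := (hF z hz).of_le (by exact_mod_cast le_top)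
        exact h1.comp_contDiffWithinAt z (contDiffWithinAt_id.prodMk (ih z hz))
      exact this.congr (fun z hz => (hu z hz).deriv)
  exact contDiffOn_infty.2 key

/-! ### Sums of absolutely convergent real power series -/

open PowerSeries in
/-- The sum of a formal power series at a real point. -/
def psSum (f : PowerSeries ℝ) (z : ℝ) : ℝ := ∑' n, coeff n f * z ^ n

/-- Absolute convergence of a formal power series at radius `r`. -/
def PsConv (r : ℝ) (f : PowerSeries ℝ) : Prop :=
  Summable fun n => |PowerSeries.coeff n f| * r ^ n

theorem PsConv.mono {r ρ : ℝ} {f : PowerSeries ℝ} (h : PsConv r f) (hρ : 0 ≤ ρ) (hr : ρ ≤ r) :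
    PsConv ρ f :=
  Summable.of_nonneg_of_le (fun _ => by positivity)
    (fun n => by gcongr) h

theorem PsConv.summable_abs {r z : ℝ} {f : PowerSeries ℝ} (h : PsConv r f) (hz : |z| ≤ r) :
    Summable fun n => ‖PowerSeries.coeff n f * z ^ n‖ := by
  have h' : PsConv |z| f := h.mono (abs_nonneg z) hz
  simpa [abs_mul, abs_pow, PsConv] using h'

theorem PsConv.summable {r z : ℝ} {f : PowerSeries ℝ} (h : PsConv r f) (hz : |z| ≤ r) :
    Summable fun n => PowerSeries.coeff n f * z ^ n :=
  (h.summable_abs hz).of_norm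

theorem PsConv.add {r : ℝ} (hr : 0 ≤ r) {f g : PowerSeries ℝ} (hf : PsConv r f)
    (hg : PsConv r g) : PsConv r (f + g) := by
  refine Summable.of_nonneg_of_le (fun _ => by positivity) (fun n => ?_) (Summable.add hf hg)
  rw [map_add, ← add_mul]
  gcongr
  exact abs_add_le _ _

theorem PsConv.neg {r : ℝ} {f : PowerSeries ℝ} (hf : PsConv r f) : PsConv r (-f) := by
  simpa [PsConv] using hf

theorem PsConv.sub {r : ℝ} (hr : 0 ≤ r) {f g : PowerSeries ℝ} (hf : PsConv r f)
    (hg : PsConv r g) : PsConv r (f - g) := by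
  rw [sub_eq_add_neg]; exact hf.add hr hg.neg

theorem PsConv.mul {r : ℝ} (hr : 0 ≤ r) {f g : PowerSeries ℝ} (hf : PsConv r f)
    (hg : PsConv r g) : PsConv r (f * g) := by
  have h := summable_norm_sum_mul_antidiagonal_of_summable_norm
    (hf.summable_abs (z := r) (by rw [abs_of_nonneg hr]))
    (hg.summable_abs (z := r) (by rw [abs_of_nonneg hr]))
  refine h.congr (fun n => ?_)
  rw [PowerSeries.coeff_mul, Real.norm_eq_abs, ← abs_of_nonneg (pow_nonneg hr n), ← abs_mul,
    Finset.sum_mul]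
  congr 1
  refine Finset.sum_congr rfl (fun p hp => ?_)
  rw [← Finset.HasAntidiagonal.mem_antidiagonal.1 hp, pow_add]; ring

theorem PsConv.C (r a : ℝ) : PsConv r (PowerSeries.C a) := by
  refine summable_of_ne_finset_zero (s := {0}) (fun n hn => ?_)
  rw [PowerSeries.coeff_C, if_neg (by simpa using hn)]; simp

theorem PsConv.X (r : ℝ) : PsConv r (PowerSeries.X) := by
  refine summable_of_ne_finset_zero (s := {1}) (fun n hn => ?_)
  rw [PowerSeries.coeff_X, if_neg (by simpa using hn)]; simp

theorem psSum_add {r z : ℝ} {f g : PowerSeries ℝ} (hf : PsConv r f) (hg : PsConv r g)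
    (hz : |z| ≤ r) : psSum (f + g) z = psSum f z + psSum g z := by
  simp only [psSum, map_add, add_mul]
  exact (hf.summable hz).tsum_add (hg.summable hz)

theorem psSum_neg (f : PowerSeries ℝ) (z : ℝ) : psSum (-f) z = -psSum f z := by
  simp [psSum, tsum_neg]

theorem psSum_sub {r z : ℝ} {f g : PowerSeries ℝ} (hf : PsConv r f) (hg : PsConv r g)
    (hz : |z| ≤ r) : psSum (f - g) z = psSum f z - psSum g z := by
  rw [sub_eq_add_neg, psSum_add hf hg.neg hz, psSum_neg, sub_eq_add_neg]

theorem psSum_mul {r z : ℝ} {f g : PowerSeries ℝ} (hf : PsConv r f) (hg : PsConv r g)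
    (hz : |z| ≤ r) : psSum (f * g) z = psSum f z * psSum g z := by
  simp only [psSum]
  rw [tsum_mul_tsum_eq_tsum_sum_antidiagonal_of_summable_norm (hf.summable_abs hz)
    (hg.summable_abs hz)]
  refine tsum_congr (fun n => ?_)
  rw [PowerSeries.coeff_mul, Finset.sum_mul]
  refine Finset.sum_congr rfl (fun p hp => ?_)
  rw [← Finset.HasAntidiagonal.mem_antidiagonal.1 hp, pow_add]; ring

theorem psSum_C (a z : ℝ) : psSum (PowerSeries.C a) z = a := by
  rw [psSum, tsum_eq_single 0 (fun n hn => by simp [PowerSeries.coeff_C, hn])]; simp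

theorem psSum_X (z : ℝ) : psSum PowerSeries.X z = z := by
  rw [psSum, tsum_eq_single 1 (fun n hn => by simp [PowerSeries.coeff_X, hn])]; simp

theorem succ_mul_pow_le {q : ℝ} (hq : 0 ≤ q) (hq1 : q < 1) (n : ℕ) :
    ((n : ℝ) + 1) * q ^ n ≤ (1 - q)⁻¹ := by
  calc ((n : ℝ) + 1) * q ^ n = ∑ _i ∈ Finset.range (n + 1), q ^ n := by simp
    _ ≤ ∑ i ∈ Finset.range (n + 1), q ^ i := Finset.sum_le_sum (fun i hi =>
        pow_le_pow_of_le_one hq hq1.le (Nat.lt_succ_iff.1 (Finset.mem_range.1 hi)))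
    _ ≤ ∑' i, q ^ i := (summable_geometric_of_lt_one hq hq1).sum_le_tsum _
        (fun i _ => pow_nonneg hq i)
    _ = (1 - q)⁻¹ := tsum_geometric_of_lt_one hq hq1

theorem PsConv.derivative {r ρ : ℝ} {f : PowerSeries ℝ} (hf : PsConv r f) (hρ : 0 ≤ ρ)
    (hr : ρ < r) : PsConv ρ (PowerSeries.derivative ℝ f) := by
  have hr0 : 0 < r := hρ.trans_lt hr
  have hs : Summable fun n => |PowerSeries.coeff (n + 1) f| * r ^ (n + 1) :=
    (summable_nat_add_iff (f := fun n => |PowerSeries.coeff n f| * r ^ n) 1).2 hf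
  refine Summable.of_nonneg_of_le (fun _ => by positivity) (fun n => ?_)
    (hs.mul_left ((1 - ρ / r)⁻¹ / r))
  have h := succ_mul_pow_le (div_nonneg hρ hr0.le) ((div_lt_one hr0).2 hr) n
  rw [PowerSeries.coeff_derivative, abs_mul, abs_of_nonneg (by positivity : (0 : ℝ) ≤ (n : ℝ) + 1)]
  calc |PowerSeries.coeff (n + 1) f| * ((n : ℝ) + 1) * ρ ^ n
      = (((n : ℝ) + 1) * (ρ / r) ^ n) / r * (|PowerSeries.coeff (n + 1) f| * r ^ (n + 1)) := by
        rw [div_pow, pow_succ]; field_simp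
    _ ≤ (1 - ρ / r)⁻¹ / r * (|PowerSeries.coeff (n + 1) f| * r ^ (n + 1)) := by gcongr

theorem hasDerivAt_psSum {r z : ℝ} {f : PowerSeries ℝ} (hf : PsConv r f) (hz : |z| < r) :
    HasDerivAt (psSum f) (psSum (PowerSeries.derivative ℝ f) z) z := by
  obtain ⟨ρ, hzρ, hρr⟩ := exists_between hz
  have hρ : 0 < ρ := (abs_nonneg z).trans_lt hzρ
  have hd := hf.derivative hρ.le hρr
  have hu : Summable fun n : ℕ => |PowerSeries.coeff n f| * (n * ρ ^ (n - 1)) := by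
    rw [← summable_nat_add_iff 1]
    refine Summable.congr hd (fun n => ?_)
    rw [PowerSeries.coeff_derivative, abs_mul,
      abs_of_nonneg (by positivity : (0 : ℝ) ≤ (n : ℝ) + 1)]
    push_cast
    simp [mul_assoc]
  have key := hasDerivAt_tsum_of_isPreconnected (t := Metric.ball (0 : ℝ) ρ) (y₀ := z) (y := z)
    (g := fun n y => PowerSeries.coeff n f * y ^ n)
    (g' := fun n y => PowerSeries.coeff n f * (n * y ^ (n - 1))) hu Metric.isOpen_ball
    (convex_ball (0 : ℝ) ρ).isPreconnected
    (fun n y _ => (hasDerivAt_pow n y).const_mul _)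
    (fun n y hy => by
      rw [mem_ball_zero_iff, Real.norm_eq_abs] at hy
      rw [Real.norm_eq_abs, abs_mul, abs_mul, abs_pow, Nat.abs_cast]
      gcongr)
    (by rwa [mem_ball_zero_iff]) (hf.summable hz.le) (by rwa [mem_ball_zero_iff])
  have e : (∑' n, PowerSeries.coeff n f * (n * z ^ (n - 1))) =
      psSum (PowerSeries.derivative ℝ f) z := by
    rw [Summable.tsum_eq_zero_add (hu.of_norm_bounded (fun n => by
      rw [Real.norm_eq_abs, abs_mul, abs_mul, abs_pow, Nat.abs_cast]
      gcongr))]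
    simp only [psSum, PowerSeries.coeff_derivative]
    simp [mul_assoc]
  rw [e] at key
  exact key

theorem hasFPowerSeriesOnBall_psSum {r : NNReal} (hr : 0 < r) {f : PowerSeries ℝ}
    (hf : PsConv r f) :
    HasFPowerSeriesOnBall (psSum f)
      (FormalMultilinearSeries.ofScalars ℝ (fun n => PowerSeries.coeff n f)) 0 r := by
  set p := FormalMultilinearSeries.ofScalars ℝ (fun n => PowerSeries.coeff n f) with hp
  have hrad : (r : ENNReal) ≤ p.radius := by
    apply p.le_radius_of_summable_norm
    simpa [hp, FormalMultilinearSeries.ofScalars_norm, PsConv] using hf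
  have h := (p.hasFPowerSeriesOnBall ((ENNReal.coe_pos.2 hr).trans_le hrad)).mono
    (ENNReal.coe_pos.2 hr) hrad
  have e : p.sum = psSum f := by
    funext z
    have := FormalMultilinearSeries.ofScalars_sum_eq (E := ℝ) (fun n => PowerSeries.coeff n f) z
    simpa [FormalMultilinearSeries.ofScalarsSum, psSum] using this
  rwa [e] at h

theorem analyticOnNhd_psSum {r : ℝ} {f : PowerSeries ℝ} (hf : PsConv r f) :
    AnalyticOnNhd ℝ (psSum f) (Ioo (-r) r) := by
  intro z hz
  have hr : 0 < r := by linarith [hz.1, hz.2]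
  have h := (hasFPowerSeriesOnBall_psSum (r := r.toNNReal) (Real.toNNReal_pos.2 hr)
    (by rwa [Real.coe_toNNReal _ hr.le])).analyticOnNhd
  apply h z
  rw [Metric.mem_eball, edist_zero_right, ← ofReal_norm]
  exact (ENNReal.ofReal_lt_ofReal_iff hr).2 (abs_lt.2 hz)

theorem contDiffOn_psSum {r : ℝ} {f : PowerSeries ℝ} (hf : PsConv r f) :
    ContDiffOn ℝ ∞ (psSum f) (Ioo (-r) r) :=
  fun z hz => ((analyticOnNhd_psSum hf) z hz).contDiffAt.contDiffWithinAt

/-- Remainder estimate for a power series truncated at order `m`. -/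
theorem abs_psSum_sub_sum_le {r z : ℝ} {f : PowerSeries ℝ} (hr : 0 < r) (hf : PsConv r f)
    (hz : |z| ≤ r) (m : ℕ) :
    |psSum f z - ∑ i ∈ Finset.range m, PowerSeries.coeff i f * z ^ i| ≤
      (|z| / r) ^ m * ∑' n, |PowerSeries.coeff (n + m) f| * r ^ (n + m) := by
  have hs := hf.summable hz
  have hs' : Summable fun n => |PowerSeries.coeff (n + m) f| * r ^ (n + m) :=
    (summable_nat_add_iff (f := fun n => |PowerSeries.coeff n f| * r ^ n) m).2 hf
  rw [psSum, ← hs.sum_add_tsum_nat_add m, add_sub_cancel_left, ← tsum_mul_left]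
  rw [← Real.norm_eq_abs]
  refine tsum_of_norm_bounded ((hs'.mul_left _).hasSum) (fun n => ?_)
  rw [Real.norm_eq_abs, abs_mul, abs_pow]
  have : |z| ^ (n + m) ≤ (|z| / r) ^ m * r ^ (n + m) := by
    rw [div_pow, pow_add, pow_add]
    have : |z| ^ n ≤ r ^ n := by gcongr
    calc |z| ^ n * |z| ^ m ≤ r ^ n * |z| ^ m := by gcongr
      _ = |z| ^ m / r ^ m * (r ^ n * r ^ m) := by field_simp
  calc |PowerSeries.coeff (n + m) f| * |z| ^ (n + m)
      ≤ |PowerSeries.coeff (n + m) f| * ((|z| / r) ^ m * r ^ (n + m)) := by gcongr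
    _ = _ := by ring

/-- Truncated absolute norm of a power series. -/
def psNorm (r : ℝ) (N : ℕ) (f : PowerSeries ℝ) : ℝ :=
  ∑ i ∈ Finset.range N, |PowerSeries.coeff i f| * r ^ i

theorem psNorm_nonneg {r : ℝ} (hr : 0 ≤ r) (N : ℕ) (f : PowerSeries ℝ) : 0 ≤ psNorm r N f :=
  Finset.sum_nonneg (fun _ _ => by positivity)

theorem psNorm_add_le {r : ℝ} (hr : 0 ≤ r) (N : ℕ) (f g : PowerSeries ℝ) :
    psNorm r N (f + g) ≤ psNorm r N f + psNorm r N g := by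
  rw [psNorm, psNorm, psNorm, ← Finset.sum_add_distrib]
  refine Finset.sum_le_sum (fun i _ => ?_)
  rw [map_add, ← add_mul]
  gcongr
  exact abs_add_le _ _

theorem psNorm_C_le {r : ℝ} (N : ℕ) (a : ℝ) : psNorm r N (PowerSeries.C a) ≤ |a| := by
  cases N with
  | zero => simp [psNorm]
  | succ N =>
    rw [psNorm, Finset.sum_range_succ']
    simp [PowerSeries.coeff_C]

/-- Truncated norms are finite sums, so this submultiplicativity allows majorant estimates by
induction on N before any convergence is known. -/
theorem psNorm_mul_le {r : ℝ} (hr : 0 ≤ r) (N : ℕ) (f g : PowerSeries ℝ) :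
    psNorm r N (f * g) ≤ psNorm r N f * psNorm r N g := by
  have h1 : psNorm r N (f * g) ≤ ∑ i ∈ Finset.range N, ∑ p ∈ Finset.HasAntidiagonal.antidiagonal i,
      (|PowerSeries.coeff p.1 f| * r ^ p.1) * (|PowerSeries.coeff p.2 g| * r ^ p.2) := by
    refine Finset.sum_le_sum (fun i _ => ?_)
    rw [PowerSeries.coeff_mul]
    calc |∑ p ∈ Finset.HasAntidiagonal.antidiagonal i, PowerSeries.coeff p.1 f * PowerSeries.coeff p.2 g| * r ^ i
        ≤ (∑ p ∈ Finset.HasAntidiagonal.antidiagonal i, |PowerSeries.coeff p.1 f * PowerSeries.coeff p.2 g|)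
            * r ^ i := by gcongr; exact Finset.abs_sum_le_sum_abs _ _
      _ = _ := by
        rw [Finset.sum_mul]
        refine Finset.sum_congr rfl (fun p hp => ?_)
        rw [← Finset.HasAntidiagonal.mem_antidiagonal.1 hp, abs_mul, pow_add]; ring
  refine h1.trans ?_
  rw [psNorm, psNorm, Finset.sum_mul_sum, ← Finset.sum_product', ← Finset.sum_biUnion]
  · refine Finset.sum_le_sum_of_subset_of_nonneg (fun p hp => ?_) (fun p _ _ => by positivity)
    obtain ⟨i, hi, hpi⟩ := Finset.mem_biUnion.1 hp
    have h1 := Finset.mem_range.1 hi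
    have h2 := Finset.HasAntidiagonal.mem_antidiagonal.1 hpi
    rw [Finset.mem_product, Finset.mem_range, Finset.mem_range]
    omega
  · intro i _ j _ hij
    refine Finset.disjoint_left.2 (fun p hp hq => hij ?_)
    rw [← Finset.HasAntidiagonal.mem_antidiagonal.1 hp,
      ← Finset.HasAntidiagonal.mem_antidiagonal.1 hq]

/-- Without constant terms, a coefficient of order N of the product involves only coefficients of
order below N of the factors. This gain of one order closes the induction in
`exists_radius_of_quadratic_recursion`. -/
theorem psNorm_mul_le_of_constantCoeff_zero {r : ℝ} (hr : 0 ≤ r) (N : ℕ) {f g : PowerSeries ℝ}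
    (hf : PowerSeries.coeff 0 f = 0) (hg : PowerSeries.coeff 0 g = 0) :
    psNorm r (N + 1) (f * g) ≤ psNorm r N f * psNorm r N g := by
  set F := PowerSeries.mk (fun n => if n < N then PowerSeries.coeff n f else 0) with hF
  set G := PowerSeries.mk (fun n => if n < N then PowerSeries.coeff n g else 0) with hG
  have hpF : psNorm r (N + 1) F = psNorm r N f := by
    rw [psNorm, Finset.sum_range_succ, psNorm]
    simp only [hF, PowerSeries.coeff_mk, lt_irrefl, if_false, abs_zero, zero_mul, add_zero]
    exact Finset.sum_congr rfl (fun i hi => by rw [if_pos (Finset.mem_range.1 hi)])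
  have hpG : psNorm r (N + 1) G = psNorm r N g := by
    rw [psNorm, Finset.sum_range_succ, psNorm]
    simp only [hG, PowerSeries.coeff_mk, lt_irrefl, if_false, abs_zero, zero_mul, add_zero]
    exact Finset.sum_congr rfl (fun i hi => by rw [if_pos (Finset.mem_range.1 hi)])
  have e : psNorm r (N + 1) (f * g) = psNorm r (N + 1) (F * G) := by
    refine Finset.sum_congr rfl (fun i hi => ?_)
    rw [PowerSeries.coeff_mul, PowerSeries.coeff_mul]
    congr 2
    refine Finset.sum_congr rfl (fun p hp => ?_)
    have h1 := Finset.mem_range.1 hi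
    have h2 := Finset.HasAntidiagonal.mem_antidiagonal.1 hp
    simp only [hF, hG, PowerSeries.coeff_mk]
    rcases Nat.eq_zero_or_pos p.1 with h | h
    · rw [h, hf]; simp
    rcases Nat.eq_zero_or_pos p.2 with h' | h'
    · rw [h', hg]; simp
    rw [if_pos (by omega), if_pos (by omega)]
  rw [e, ← hpF, ← hpG]
  exact psNorm_mul_le hr _ _ _

/-- Continuity of the sum of a power series with respect to a parameter. -/
theorem continuousOn_psSum_param {f : ℝ → PowerSeries ℝ} {s : Set ℝ} {r c z : ℝ} (hr : 0 < r)
    (hf : ∀ n, ContinuousOn (fun t => PowerSeries.coeff n (f t)) s)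
    (hc : ∀ t ∈ s, ∀ n, |PowerSeries.coeff n (f t)| * r ^ n ≤ c) (hz : |z| < r) :
    ContinuousOn (fun t => psSum (f t) z) s := by
  have hq : |z| / r < 1 := (div_lt_one hr).2 hz
  refine continuousOn_tsum (u := fun n => c * (|z| / r) ^ n) (fun n => (hf n).mul_const _)
    ((summable_geometric_of_lt_one (by positivity) hq).mul_left c) (fun n t ht => ?_)
  rw [Real.norm_eq_abs, abs_mul, abs_pow, div_pow]
  calc |PowerSeries.coeff n (f t)| * |z| ^ n
      = (|PowerSeries.coeff n (f t)| * r ^ n) * (|z| ^ n / r ^ n) := by field_simp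
    _ ≤ c * (|z| ^ n / r ^ n) := by gcongr; exact hc t ht n

theorem psConv_of_psNorm_le {r c : ℝ} (hr : 0 ≤ r) {f : PowerSeries ℝ}
    (h : ∀ N, psNorm r N f ≤ c) : PsConv r f :=
  summable_of_sum_range_le (fun _ => by positivity) h

theorem tsum_le_of_psNorm_le {r c : ℝ} (hr : 0 ≤ r) {f : PowerSeries ℝ}
    (h : ∀ N, psNorm r N f ≤ c) : ∑' n, |PowerSeries.coeff n f| * r ^ n ≤ c :=
  Real.tsum_le_of_sum_range_le (fun _ => by positivity) h

/-! ### The parameters -/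

/-- Standing assumptions on the parameters: `γ ∈ Γ(k, ℓ)`, `k ≥ 1` and `ℓ > 1`. -/
structure Adm (k ℓ γ : ℝ) : Prop where
  one_le_k : 1 ≤ k
  one_lt_ℓ : 1 < ℓ
  γ_gt : 1 / √ℓ < γ
  A_pos : 0 < cA k ℓ γ

theorem gamma_pos {ℓ γ : ℝ} (hℓ : 1 < ℓ) (hγ : 1 / √ℓ < γ) : 0 < γ :=
  (div_pos one_pos (Real.sqrt_pos.2 (by linarith))).trans hγ

theorem one_lt_sqrt_mul_gamma {ℓ γ : ℝ} (hℓ : 1 < ℓ) (hγ : 1 / √ℓ < γ) : 1 < √ℓ * γ := by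
  have hs : 0 < √ℓ := Real.sqrt_pos.2 (by linarith)
  rw [div_lt_iff₀ hs] at hγ
  linarith

theorem eps_pos {ℓ γ : ℝ} (hℓ : 1 < ℓ) (hγ : 1 / √ℓ < γ) : 0 < eps ℓ γ := by
  have h := one_lt_sqrt_mul_gamma hℓ hγ
  have hs : √ℓ ^ 2 = ℓ := Real.sq_sqrt (by linarith)
  have : ℓ * γ ^ 2 = (√ℓ * γ) ^ 2 := by rw [mul_pow, hs]
  rw [eps, this]
  nlinarith

theorem one_lt_ell_mul_gamma {ℓ γ : ℝ} (hℓ : 1 < ℓ) (hγ : 1 / √ℓ < γ) : 1 < ℓ * γ := by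
  have h := one_lt_sqrt_mul_gamma hℓ hγ
  have hs : √ℓ * √ℓ = ℓ := Real.mul_self_sqrt (by linarith)
  have hs1 : 1 < √ℓ := by rw [Real.lt_sqrt] <;> linarith
  have : ℓ * γ = √ℓ * (√ℓ * γ) := by rw [← mul_assoc, hs]
  rw [this]
  nlinarith

/-- The relations between the eigenvalues, their ratio and the slope at `Q₁`. -/
structure SpecRel (k ℓ γ : ℝ) : Prop where
  lam_pos : 0 < lamMinus k ℓ γ
  sum_eq : (k + 2) * eps ℓ γ + cA k ℓ γ = (ratioR k ℓ γ + 1) * lamMinus k ℓ γ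
  prod_eq : ratioR k ℓ γ * lamMinus k ℓ γ ^ 2 = 2 * k * eps ℓ γ * (1 + eps ℓ γ)
  slope_eq : slope k ℓ γ = ratioR k ℓ γ * lamMinus k ℓ γ - 2 * eps ℓ γ

theorem specRel_of_lamMinus_pos {k ℓ γ : ℝ} (hd : 0 ≤ disc k ℓ γ) (hl : 0 < lamMinus k ℓ γ) :
    SpecRel k ℓ γ := by
  have hR : ratioR k ℓ γ * lamMinus k ℓ γ = lamPlus k ℓ γ := div_mul_cancel₀ _ hl.ne'
  have hsq := Real.sq_sqrt hd
  refine ⟨hl, ?_, ?_, ?_⟩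
  · rw [add_mul _ _ (lamMinus k ℓ γ), hR, lamPlus, lamMinus, c₁, c₄]; ring
  · rw [pow_two, ← mul_assoc, hR]
    have : lamPlus k ℓ γ * lamMinus k ℓ γ =
        ((c₁ ℓ γ + c₄ k ℓ γ) ^ 2 - √(disc k ℓ γ) ^ 2) / 4 := by rw [lamPlus, lamMinus]; ring
    rw [this, hsq, disc, c₁, c₃, c₄]; ring
  · rw [hR, lamPlus, slope, c₁]; ring

/-- If the trace and the determinant of the linearization are those of the eigenvalues
`R δ ≥ δ > 0`, then `R` is the ratio and `δ` the smaller eigenvalue. -/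
theorem ratioR_eq_of_sum_prod {k ℓ γ R δ : ℝ} (hδ : 0 < δ) (hR : 1 ≤ R)
    (hsum : (k + 2) * eps ℓ γ + cA k ℓ γ = (R + 1) * δ)
    (hprod : 2 * k * eps ℓ γ * (1 + eps ℓ γ) = R * δ ^ 2) :
    lamMinus k ℓ γ = δ ∧ ratioR k ℓ γ = R ∧ 0 ≤ disc k ℓ γ := by
  have hd : disc k ℓ γ = ((R - 1) * δ) ^ 2 := by
    have : disc k ℓ γ = ((k + 2) * eps ℓ γ + cA k ℓ γ) ^ 2 -
        4 * (2 * k * eps ℓ γ * (1 + eps ℓ γ)) := by rw [disc, c₁, c₃, c₄]; ring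
    rw [this, hsum, hprod]; ring
  have hs : √(disc k ℓ γ) = (R - 1) * δ := by
    rw [hd, Real.sqrt_sq (mul_nonneg (by linarith) hδ.le)]
  have hc : c₁ ℓ γ + c₄ k ℓ γ = (R + 1) * δ := by rw [← hsum, c₁, c₄]; ring
  have hm : lamMinus k ℓ γ = δ := by rw [lamMinus, hs, hc]; ring
  have hp : lamPlus k ℓ γ = R * δ := by rw [lamPlus, hs, hc]; ring
  exact ⟨hm, by rw [ratioR, hm, hp]; field_simp, by rw [hd]; positivity⟩

/-! ### The Taylor series at `Q₁` -/

/-- The formal power series with coefficients `coeffL`. -/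
def uLps (k ℓ γ : ℝ) : PowerSeries ℝ := PowerSeries.mk (coeffL k ℓ γ)

theorem uL_eq_psSum (k ℓ γ : ℝ) : uL k ℓ γ = psSum (uLps k ℓ γ) := by
  funext z; simp [uL, psSum, uLps]

theorem coeffL_zero (k ℓ γ : ℝ) : coeffL k ℓ γ 0 = eps ℓ γ := by rw [coeffL]

theorem coeffL_one (k ℓ γ : ℝ) : coeffL k ℓ γ 1 = slope k ℓ γ := by rw [coeffL]

theorem coeffL_succ_succ (k ℓ γ : ℝ) (n : ℕ) : coeffL k ℓ γ (n + 2) =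
    (-(((n : ℝ) + 2 + 1) / 2) *
          ∑ i ∈ Finset.range n, coeffL k ℓ γ (i + 2) * coeffL k ℓ γ (n + 1 - i)
        - (2 - (k + 1) / 2 * ((n : ℝ) + 2)) *
          ∑ i ∈ Finset.range (n + 1), coeffL k ℓ γ (i + 1) * coeffL k ℓ γ (n + 1 - i)
        - (((n : ℝ) + 2 - 3) * cA k ℓ γ + ((n : ℝ) + 2 - 1) * cB k ℓ + 2 * k) *
          coeffL k ℓ γ (n + 1)
        + (((n : ℝ) + 2 - 4) * cB k ℓ + 2 * k) * coeffL k ℓ γ n)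
      / ((ratioR k ℓ γ - ((n : ℝ) + 2)) * lamMinus k ℓ γ) := by
  rw [coeffL, ← Fin.sum_univ_eq_sum_range (fun i => coeffL k ℓ γ (i + 2) * coeffL k ℓ γ (n + 1 - i)),
    ← Fin.sum_univ_eq_sum_range (fun i => coeffL k ℓ γ (i + 1) * coeffL k ℓ γ (n + 1 - i))]

/-- The terms with the highest index are split off, since in the recursion they belong to the side
of the unknown coefficient. -/
theorem coeff_mul_self_mk_succ_succ (a : ℕ → ℝ) (n : ℕ) :
    PowerSeries.coeff (n + 2) (PowerSeries.mk a * PowerSeries.mk a) =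
      2 * a 0 * a (n + 2) + ∑ i ∈ Finset.range (n + 1), a (i + 1) * a (n + 1 - i) := by
  rw [PowerSeries.coeff_mul]
  simp only [PowerSeries.coeff_mk]
  rw [Finset.Nat.sum_antidiagonal_eq_sum_range_succ_mk, Finset.sum_range_succ,
    Finset.sum_range_succ']
  simp only [Nat.sub_self, Nat.sub_zero]
  have : ∀ i, n + 2 - (i + 1) = n + 1 - i := fun i => by omega
  simp only [this]
  ring

theorem coeff_mul_self_mk_succ_succ_succ (a : ℕ → ℝ) (n : ℕ) :
    PowerSeries.coeff (n + 3) (PowerSeries.mk a * PowerSeries.mk a) =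
      2 * a 0 * a (n + 3) + 2 * a 1 * a (n + 2)
        + ∑ i ∈ Finset.range n, a (i + 2) * a (n + 1 - i) := by
  rw [coeff_mul_self_mk_succ_succ, Finset.sum_range_succ, Finset.sum_range_succ']
  have : ∀ i, n + 1 + 1 - (i + 1) = n + 1 - i := fun i => by omega
  simp only [this]
  have h2 : n + 1 - n = 1 := by omega
  simp only [h2, Nat.sub_zero]
  ring

open PowerSeries in
/-- The series at `Q₁` solves the `z-u` equation formally. -/
theorem uLps_ode {k ℓ γ : ℝ} (h : SpecRel k ℓ γ) (hR : ∀ n : ℕ, ratioR k ℓ γ ≠ (n : ℝ) + 2) :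
    ((C (k + 1) * X - C 1) * uLps k ℓ γ + (X - C 1) *
        (C (-eps ℓ γ) - C (cA k ℓ γ) * X + C (cB k ℓ) * (X * X))) *
          derivative ℝ (uLps k ℓ γ) =
      C 2 * uLps k ℓ γ * (uLps k ℓ γ + (C (-eps ℓ γ) - C (cA k ℓ γ) * X + C (cB k ℓ) * (X * X)) +
        C k * X * (C 1 - X)) := by
  set a := coeffL k ℓ γ with ha
  set u := uLps k ℓ γ with hu
  set A := cA k ℓ γ
  set B := cB k ℓ
  set e := eps ℓ γ with he
  have hcu : ∀ n, coeff n u = a n := fun n => by simp [hu, uLps, ha]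
  have hsq : derivative ℝ (u * u) = C 2 * (u * derivative ℝ u) := by
    rw [Derivation.leibniz]
    simp only [smul_eq_mul, map_ofNat]
    ring
  set sq := u * u with hsqd
  have e1 : ((C (k + 1) * X - C 1) * u + (X - C 1) * (C (-e) - C A * X + C B * (X * X))) *
      derivative ℝ u - C 2 * u * (u + (C (-e) - C A * X + C B * (X * X)) + C k * X * (C 1 - X)) =
      C ((k + 1) / 2) * (X * derivative ℝ sq) - C (1 / 2) * derivative ℝ sq
        + C e * derivative ℝ u + C (A - e) * (X * derivative ℝ u)
        - C (A + B) * (X * (X * derivative ℝ u)) + C B * (X * (X * (X * derivative ℝ u)))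
        - C 2 * sq + C (2 * e) * u - C (2 * (k - A)) * (X * u)
        - C (2 * (B - k)) * (X * (X * u)) := by
    rw [hsq]
    have c2 : (C (1 / 2) : PowerSeries ℝ) * C 2 = 1 := by rw [← map_mul]; norm_num
    have c3 : (C ((k + 1) / 2) : PowerSeries ℝ) * C 2 = C k + 1 := by
      rw [← map_mul, div_mul_cancel₀ _ (by norm_num), map_add, map_one]
    simp only [map_add, map_sub, map_mul, map_neg, map_one]
    linear_combination (-(X * (u * derivative ℝ u))) * c3 + (u * derivative ℝ u) * c2
  rw [← sub_eq_zero, e1]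
  have ha0 : a 0 = e := coeffL_zero k ℓ γ
  have ha1 : a 1 = slope k ℓ γ := coeffL_one k ℓ γ
  have hs0 : coeff 0 sq = a 0 * a 0 := by
    rw [hsqd, coeff_mul]; simp [hcu]
  have hs1 : coeff 1 sq = 2 * a 0 * a 1 := by
    rw [hsqd, coeff_mul, Finset.Nat.sum_antidiagonal_eq_sum_range_succ_mk]
    simp [Finset.sum_range_succ, hcu]; ring
  have hs2 : coeff 2 sq = 2 * a 0 * a 2 + a 1 * a 1 := by
    rw [hsqd, coeff_mul, Finset.Nat.sum_antidiagonal_eq_sum_range_succ_mk]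
    simp [Finset.sum_range_succ, hcu]; ring
  have hX1 : ∀ g : PowerSeries ℝ, coeff 1 (X * g) = coeff 0 g := fun g => coeff_succ_X_mul 0 g
  -- Opaque names keep `simp` from distributing `C` over the sums and differences inside the
  -- constants.
  obtain ⟨q1, hq1⟩ : ∃ q, q = A - e := ⟨_, rfl⟩
  obtain ⟨q2, hq2⟩ : ∃ q, q = A + B := ⟨_, rfl⟩
  obtain ⟨q3, hq3⟩ : ∃ q, q = 2 * (k - A) := ⟨_, rfl⟩
  obtain ⟨q4, hq4⟩ : ∃ q, q = 2 * (B - k) := ⟨_, rfl⟩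
  rw [← hq1, ← hq2, ← hq3, ← hq4]
  ext n
  simp only [map_sub, map_add, coeff_C_mul, map_zero]
  rw [hq1, hq2, hq3, hq4]
  match n with
  | 0 =>
    simp only [coeff_zero_X_mul, coeff_derivative, zero_add, hs1, hs0, hcu, ha0]
    push_cast; ring
  | 1 =>
    simp only [hX1, coeff_zero_X_mul, coeff_derivative, zero_add, hcu]
    rw [show (1 + 1 : ℕ) = 2 from rfl, hs2, hs1, ha0, ha1]
    -- In the coefficient of z the terms with `a 2` cancel, and the quadratic equation of the slope
    -- remains.
    have hs := h.slope_eq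
    have hsum := h.sum_eq
    have hprod := h.prod_eq
    rw [hs]
    push_cast
    set R := ratioR k ℓ γ
    set d := lamMinus k ℓ γ
    have hA : A = (R + 1) * d - (k + 2) * e := by linarith
    rw [hA]
    linear_combination hprod
  | n + 2 =>
    simp only [coeff_succ_X_mul, coeff_derivative, hcu]
    have e2 : coeff (n + 2) sq = _ := coeff_mul_self_mk_succ_succ a n
    have e3 : coeff (n + 2 + 1) sq = _ := coeff_mul_self_mk_succ_succ_succ a n
    have hθ : coeff (n + 1 + 1) (X * (X * (X * derivative ℝ u))) = a n * n := by
      rw [coeff_succ_X_mul, coeff_succ_X_mul]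
      cases n with
      | zero => simp
      | succ n => rw [coeff_succ_X_mul, coeff_derivative, hcu]; push_cast; ring
    rw [coeff_succ_X_mul, coeff_succ_X_mul] at hθ
    rw [hθ, e2, e3, ha0, ha1]
    -- The terms with `a (n + 3)` cancel because Δ_z vanishes at Q₁, and the factor collected by `a
    -- (n + 2)` is (R - (n + 2))δ up to sign. So the coefficient vanishes exactly by the recursion.
    have hrec := coeffL_succ_succ k ℓ γ n
    have hden : (ratioR k ℓ γ - ((n : ℝ) + 2)) * lamMinus k ℓ γ ≠ 0 :=
      mul_ne_zero (sub_ne_zero.2 (hR n)) h.lam_pos.ne'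
    rw [eq_div_iff hden] at hrec
    rw [← ha] at hrec
    have hs := h.slope_eq
    have hsum := h.sum_eq
    rw [hs]
    set S1 := ∑ i ∈ Finset.range n, a (i + 2) * a (n + 1 - i)
    set S2 := ∑ i ∈ Finset.range (n + 1), a (i + 1) * a (n + 1 - i)
    push_cast
    change _ * ((ratioR k ℓ γ - ((n : ℝ) + 2)) * lamMinus k ℓ γ) = (-(((n : ℝ) + 2 + 1) / 2) * S1 -
      (2 - (k + 1) / 2 * ((n : ℝ) + 2)) * S2 - (((n : ℝ) + 2 - 3) * A + ((n : ℝ) + 2 - 1) * B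
      + 2 * k) * a (n + 1) + (((n : ℝ) + 2 - 4) * B + 2 * k) * a n) at hrec
    have hA : A = (ratioR k ℓ γ + 1) * lamMinus k ℓ γ - (k + 2) * e := by linarith
    linear_combination (-1 : ℝ) * hrec + a (n + 2) * ((n : ℝ) + 2) * hA

/-- Sequences satisfying a quadratic recursive inequality have a radius of convergence bounded
below in terms of the constants only. -/
theorem exists_radius_of_quadratic_recursion {K α₀ α₁ : ℝ} (hK : 1 ≤ K) (h₀ : 0 ≤ α₀)
    (h₁ : 0 ≤ α₁) : ∃ r ∈ Ioc (0 : ℝ) 1, ∀ a : ℕ → ℝ, |a 0| ≤ α₀ → |a 1| ≤ α₁ →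
      (∀ n, |a (n + 2)| ≤ K * (∑ i ∈ Finset.range n, |a (i + 2)| * |a (n + 1 - i)|
        + ∑ i ∈ Finset.range (n + 1), |a (i + 1)| * |a (n + 1 - i)| + |a (n + 1)| + |a n|)) →
      ∀ N, ∑ i ∈ Finset.range N, |a (i + 2)| * r ^ (i + 1) ≤ 1 := by
  -- The invariant of the induction is that the truncated norm of V is at most σ. The quadratic term
  -- then contributes Kσ² = σ/4, and r is chosen so that all terms carrying a factor r contribute at
  -- most σ/2.
  set σ : ℝ := 1 / (4 * K) with hσ
  have hσ0 : 0 < σ := by positivity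
  have hσ1 : σ ≤ 1 := by rw [hσ, div_le_one (by positivity)]; linarith
  have hKσ : K * σ = 1 / 4 := by rw [hσ]; field_simp
  set Q : ℝ := (α₁ + 1) ^ 2 + 2 * (α₁ + 1) + α₀ with hQ
  have hQ0 : 0 < Q := by positivity
  set r : ℝ := min 1 (σ / (2 * K * Q)) with hr
  have hr0 : 0 < r := lt_min one_pos (by positivity)
  have hr1 : r ≤ 1 := min_le_left _ _
  have hrQ : K * r * Q ≤ σ / 2 := by
    have : r ≤ σ / (2 * K * Q) := min_le_right _ _
    rw [le_div_iff₀ (by positivity)] at this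
    nlinarith
  refine ⟨r, ⟨hr0, hr1⟩, fun a ha0 ha1 hrec N => ?_⟩
  refine le_trans ?_ hσ1
  -- V collects the coefficients from `a 2` on, shifted by one so that its constant term is 0; U₁ is
  -- the shift that includes `a 1`. The two convolutions of the recursion are then V² and U₁².
  set V := PowerSeries.mk (fun n => if n = 0 then 0 else |a (n + 1)|) with hV
  set U₁ := PowerSeries.mk (fun n => |a (n + 1)|) with hU₁
  set U₀ := PowerSeries.mk (fun n => |a n|) with hU₀
  have hTV : ∀ N, psNorm r (N + 1) V = ∑ i ∈ Finset.range N, |a (i + 2)| * r ^ (i + 1) := by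
    intro N
    rw [psNorm, Finset.sum_range_succ']
    simp [hV, add_assoc]
  have hcV : PowerSeries.coeff 0 V = 0 := by simp [hV]
  have hVV : ∀ n, PowerSeries.coeff (n + 1) (V * V) =
      ∑ i ∈ Finset.range n, |a (i + 2)| * |a (n + 1 - i)| := by
    intro n
    rw [PowerSeries.coeff_mul, Finset.Nat.sum_antidiagonal_eq_sum_range_succ_mk,
      Finset.sum_range_succ, Finset.sum_range_succ', Nat.sub_self, hcV]
    simp only [zero_mul, mul_zero, add_zero]
    refine Finset.sum_congr rfl (fun i hi => ?_)
    have hi' := Finset.mem_range.1 hi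
    simp only [hV, PowerSeries.coeff_mk]
    rw [if_neg (by omega), if_neg (by omega)]
    congr 3; omega
  have hUU : ∀ n, PowerSeries.coeff n (U₁ * U₁) =
      ∑ i ∈ Finset.range (n + 1), |a (i + 1)| * |a (n + 1 - i)| := by
    intro n
    rw [PowerSeries.coeff_mul, Finset.Nat.sum_antidiagonal_eq_sum_range_succ_mk]
    refine Finset.sum_congr rfl (fun i hi => ?_)
    have hi' := Finset.mem_range.1 hi
    simp only [hU₁, PowerSeries.coeff_mk]
    congr 3; omega
  have hU1V : U₁ = PowerSeries.C |a 1| + V := by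
    ext n
    cases n with
    | zero => simp [hU₁, hV]
    | succ n => simp [hU₁, hV]
  rw [← hTV]
  induction N with
  | zero => rw [hTV]; simpa using hσ0.le
  | succ N ih =>
    set t := psNorm r (N + 1) V with ht
    have ht0 : 0 ≤ t := psNorm_nonneg hr0.le _ _
    have hU1 : psNorm r (N + 1) U₁ ≤ α₁ + t := by
      rw [hU1V]
      refine (psNorm_add_le hr0.le _ _ _).trans (add_le_add ?_ le_rfl)
      exact (psNorm_C_le _ _).trans (by rwa [abs_abs])
    have hU1' : 0 ≤ psNorm r (N + 1) U₁ := psNorm_nonneg hr0.le _ _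
    have hU0 : psNorm r (N + 1) U₀ ≤ α₀ + (α₁ + t) := by
      have e : psNorm r (N + 1) U₀ = r * psNorm r N U₁ + |a 0| := by
        rw [psNorm, Finset.sum_range_succ', psNorm, Finset.mul_sum]
        simp only [hU₀, hU₁, PowerSeries.coeff_mk, abs_abs, pow_zero, mul_one]
        congr 1
        exact Finset.sum_congr rfl (fun i _ => by rw [pow_succ]; ring)
      have hm : psNorm r N U₁ ≤ psNorm r (N + 1) U₁ := by
        rw [psNorm, psNorm, Finset.sum_range_succ]
        have : 0 ≤ |PowerSeries.coeff N U₁| * r ^ N := by positivity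
        linarith
      have hm0 : 0 ≤ psNorm r N U₁ := psNorm_nonneg hr0.le _ _
      rw [e]
      nlinarith
    have hstep : psNorm r (N + 1 + 1) V ≤ K * (psNorm r (N + 2) (V * V)
        + r * psNorm r (N + 1) (U₁ * U₁) + r * psNorm r (N + 1) U₁ + r * psNorm r (N + 1) U₀) := by
      rw [hTV]
      have e : psNorm r (N + 2) (V * V) = ∑ n ∈ Finset.range (N + 1),
          |PowerSeries.coeff (n + 1) (V * V)| * r ^ (n + 1) := by
        rw [psNorm, Finset.sum_range_succ']
        simp [PowerSeries.coeff_mul, hV]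
      rw [e]
      simp only [psNorm, Finset.mul_sum, ← Finset.sum_add_distrib]
      refine Finset.sum_le_sum (fun n _ => ?_)
      have h1 := hrec n
      have h2 : 0 < r ^ (n + 1) := by positivity
      have a1 : |PowerSeries.coeff (n + 1) (V * V)| =
          ∑ i ∈ Finset.range n, |a (i + 2)| * |a (n + 1 - i)| := by
        rw [hVV, abs_of_nonneg (Finset.sum_nonneg fun _ _ => by positivity)]
      have a2 : |PowerSeries.coeff n (U₁ * U₁)| =
          ∑ i ∈ Finset.range (n + 1), |a (i + 1)| * |a (n + 1 - i)| := by
        rw [hUU, abs_of_nonneg (Finset.sum_nonneg fun _ _ => by positivity)]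
      rw [a1, a2]
      simp only [hU₁, hU₀, PowerSeries.coeff_mk, abs_abs]
      calc |a (n + 2)| * r ^ (n + 1) ≤ _ := mul_le_mul_of_nonneg_right h1 h2.le
        _ = _ := by rw [pow_succ]; ring
    have hVV2 : psNorm r (N + 2) (V * V) ≤ t * t :=
      psNorm_mul_le_of_constantCoeff_zero hr0.le (N + 1) hcV hcV
    have hUU2 : psNorm r (N + 1) (U₁ * U₁) ≤ (α₁ + t) * (α₁ + t) :=
      (psNorm_mul_le hr0.le _ _ _).trans (mul_le_mul hU1 hU1 hU1' (by positivity))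
    have htσ : t ≤ 1 := ih.trans hσ1
    calc psNorm r (N + 1 + 1) V ≤ K * (t * t + r * ((α₁ + t) * (α₁ + t)) + r * (α₁ + t)
          + r * (α₀ + (α₁ + t))) := by
          refine hstep.trans ?_
          gcongr
      _ ≤ K * (σ * σ + r * ((α₁ + 1) * (α₁ + 1)) + r * (α₁ + 1) + r * (α₀ + (α₁ + 1))) := by
          gcongr
      _ = K * σ * σ + K * r * Q := by rw [hQ]; ring
      _ ≤ σ := by rw [hKσ]; linarith

/-- The conditions on the coefficients of the recursion under which the Taylor series at `Q₁` has
a radius of convergence controlled by `K`. -/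
structure RecBound (K k ℓ γ : ℝ) : Prop where
  quad₁ : ∀ n : ℕ, ((n : ℝ) + 2 + 1) / 2 ≤
    K * (|ratioR k ℓ γ - ((n : ℝ) + 2)| * |lamMinus k ℓ γ|)
  quad₂ : ∀ n : ℕ, |2 - (k + 1) / 2 * ((n : ℝ) + 2)| ≤
    K * (|ratioR k ℓ γ - ((n : ℝ) + 2)| * |lamMinus k ℓ γ|)
  lin₁ : ∀ n : ℕ, |((n : ℝ) + 2 - 3) * cA k ℓ γ + ((n : ℝ) + 2 - 1) * cB k ℓ + 2 * k| ≤
    K * (|ratioR k ℓ γ - ((n : ℝ) + 2)| * |lamMinus k ℓ γ|)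
  lin₂ : ∀ n : ℕ, |((n : ℝ) + 2 - 4) * cB k ℓ + 2 * k| ≤
    K * (|ratioR k ℓ γ - ((n : ℝ) + 2)| * |lamMinus k ℓ γ|)

theorem RecBound.abs_coeffL_le {K k ℓ γ : ℝ} (hK : 0 ≤ K) (h : RecBound K k ℓ γ) (n : ℕ) :
    |coeffL k ℓ γ (n + 2)| ≤
      K * (∑ i ∈ Finset.range n, |coeffL k ℓ γ (i + 2)| * |coeffL k ℓ γ (n + 1 - i)|
        + ∑ i ∈ Finset.range (n + 1), |coeffL k ℓ γ (i + 1)| * |coeffL k ℓ γ (n + 1 - i)|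
        + |coeffL k ℓ γ (n + 1)| + |coeffL k ℓ γ n|) := by
  have e := coeffL_succ_succ k ℓ γ n
  set a := coeffL k ℓ γ
  set D := (ratioR k ℓ γ - ((n : ℝ) + 2)) * lamMinus k ℓ γ with hD
  have hDabs : |ratioR k ℓ γ - ((n : ℝ) + 2)| * |lamMinus k ℓ γ| = |D| := (abs_mul _ _).symm
  have b1 := h.quad₁ n
  have b2 := h.quad₂ n
  have b3 := h.lin₁ n
  have b4 := h.lin₂ n
  rw [hDabs] at b1 b2 b3 b4
  set S1 := ∑ i ∈ Finset.range n, a (i + 2) * a (n + 1 - i) with hS1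
  set S2 := ∑ i ∈ Finset.range (n + 1), a (i + 1) * a (n + 1 - i) with hS2
  have c1 : |S1| ≤ ∑ i ∈ Finset.range n, |a (i + 2)| * |a (n + 1 - i)| := by
    refine (Finset.abs_sum_le_sum_abs _ _).trans (le_of_eq ?_)
    simp only [abs_mul]
  have c2 : |S2| ≤ ∑ i ∈ Finset.range (n + 1), |a (i + 1)| * |a (n + 1 - i)| := by
    refine (Finset.abs_sum_le_sum_abs _ _).trans (le_of_eq ?_)
    simp only [abs_mul]
  -- The left-hand side of `quad₁` is positive, so that bound itself excludes a vanishing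
  -- denominator.
  have hDpos : 0 < |D| := by
    by_contra! hcon
    have : (0 : ℝ) < ((n : ℝ) + 2 + 1) / 2 := by positivity
    have := mul_nonpos_of_nonneg_of_nonpos hK hcon
    linarith
  rw [e, abs_div, div_le_iff₀ hDpos]
  set X1 := ∑ i ∈ Finset.range n, |a (i + 2)| * |a (n + 1 - i)|
  set X2 := ∑ i ∈ Finset.range (n + 1), |a (i + 1)| * |a (n + 1 - i)|
  set p1 := -(((n : ℝ) + 2 + 1) / 2)
  have b1' : |p1| ≤ K * |D| := by rw [abs_neg, abs_of_nonneg (by positivity)]; exact b1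
  set p2 := 2 - (k + 1) / 2 * ((n : ℝ) + 2)
  set p3 := ((n : ℝ) + 2 - 3) * cA k ℓ γ + ((n : ℝ) + 2 - 1) * cB k ℓ + 2 * k
  set p4 := ((n : ℝ) + 2 - 4) * cB k ℓ + 2 * k
  have hKD : 0 ≤ K * |D| := by positivity
  calc |p1 * S1 - p2 * S2 - p3 * a (n + 1) + p4 * a n|
      ≤ |p1 * S1| + |p2 * S2| + |p3 * a (n + 1)| + |p4 * a n| := by
        refine (abs_add_le _ _).trans (add_le_add ?_ le_rfl)
        refine (abs_sub _ _).trans (add_le_add ?_ le_rfl)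
        exact abs_sub _ _
    _ ≤ K * |D| * X1 + K * |D| * X2 + K * |D| * |a (n + 1)| + K * |D| * |a n| := by
        simp only [abs_mul p1, abs_mul p2, abs_mul p3, abs_mul p4]
        gcongr
    _ = _ := by ring

/-- A common radius of convergence for the Taylor series at `Q₁`. -/
theorem exists_radius_uLps {K α₀ α₁ : ℝ} (hK : 1 ≤ K) (h₀ : 0 ≤ α₀) (h₁ : 0 ≤ α₁) :
    ∃ r ∈ Ioc (0 : ℝ) 1, ∀ k ℓ γ : ℝ, |eps ℓ γ| ≤ α₀ → |slope k ℓ γ| ≤ α₁ → RecBound K k ℓ γ →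
      ∀ N, psNorm r N (uLps k ℓ γ) ≤ α₀ + α₁ + 1 := by
  obtain ⟨r, hr, H⟩ := exists_radius_of_quadratic_recursion hK h₀ h₁
  refine ⟨r, hr, fun k ℓ γ he hs hb N => ?_⟩
  have key := H (coeffL k ℓ γ) (by rwa [coeffL_zero]) (by rwa [coeffL_one])
    (hb.abs_coeffL_le (by linarith)) N
  have hmono : psNorm r N (uLps k ℓ γ) ≤ psNorm r (N + 2) (uLps k ℓ γ) :=
    Finset.sum_le_sum_of_subset_of_nonneg (Finset.range_mono (by omega))
      (fun i _ _ => mul_nonneg (abs_nonneg _) (pow_nonneg hr.1.le _))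
  refine hmono.trans ?_
  rw [psNorm, Finset.sum_range_succ', Finset.sum_range_succ']
  simp only [uLps, PowerSeries.coeff_mk, zero_add, pow_one, pow_zero, mul_one, coeffL_zero,
    coeffL_one]
  have h3 : ∑ i ∈ Finset.range N, |coeffL k ℓ γ (i + 1 + 1)| * r ^ (i + 1 + 1) ≤ 1 := by
    refine le_trans (Finset.sum_le_sum (fun i _ => ?_)) key
    rw [pow_succ r (i + 1)]
    have h4 : 0 ≤ r ^ (i + 1) := pow_nonneg hr.1.le _
    refine mul_le_mul_of_nonneg_left ?_ (abs_nonneg _)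
    nlinarith [hr.2]
  have h5 : |slope k ℓ γ| * r ≤ α₁ := by
    nlinarith [hr.2, hr.1, abs_nonneg (slope k ℓ γ)]
  linarith

open PowerSeries in
/-- Where it converges, the Taylor series at `Q₁` solves the `z-u` equation. -/
theorem uL_solves {k ℓ γ r z : ℝ} (h : SpecRel k ℓ γ)
    (hR : ∀ n : ℕ, ratioR k ℓ γ ≠ (n : ℝ) + 2) (hr : PsConv r (uLps k ℓ γ)) (hz : |z| < r) :
    SolvesZU k ℓ γ (uL k ℓ γ) z := by
  rw [uL_eq_psSum]
  have hd := hasDerivAt_psSum hr hz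
  refine ⟨hd.differentiableAt, ?_⟩
  rw [hd.deriv]
  obtain ⟨ρ, hzρ, hρr⟩ := exists_between hz
  have hρ : 0 ≤ ρ := (abs_nonneg z).trans hzρ.le
  have hode := congrArg (fun f => psSum f z) (uLps_ode h hR)
  have cu := hr.mono hρ hρr.le
  have cd := hr.derivative hρ hρr
  have cC := PsConv.C ρ
  have cX := PsConv.X ρ
  have hz' := hzρ.le
  have cXX := cX.mul hρ cX
  have cf1 := (cC (cA k ℓ γ)).mul hρ cX
  have cf2 := (cC (-eps ℓ γ)).sub hρ cf1
  have cf3 := (cC (cB k ℓ)).mul hρ cXX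
  have cf := cf2.add hρ cf3
  have ck := (cC (k + 1)).mul hρ cX
  have ck1 := ck.sub hρ (cC 1)
  have ck2 := ck1.mul hρ cu
  have cx1 := cX.sub hρ (cC 1)
  have cx2 := cx1.mul hρ cf
  have cl := ck2.add hρ cx2
  have c2u := (cC 2).mul hρ cu
  have ckx := (cC k).mul hρ cX
  have c1x := (cC 1).sub hρ cX
  have ckx1 := ckx.mul hρ c1x
  have cuf := cu.add hρ cf
  have cr := cuf.add hρ ckx1
  simp only [psSum_mul cl cd hz', psSum_add ck2 cx2 hz', psSum_mul ck1 cu hz',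
    psSum_sub ck (cC 1) hz', psSum_mul (cC (k + 1)) cX hz', psSum_mul cx1 cf hz',
    psSum_sub cX (cC 1) hz', psSum_add cf2 cf3 hz', psSum_sub (cC (-eps ℓ γ)) cf1 hz',
    psSum_mul (cC (cA k ℓ γ)) cX hz', psSum_mul (cC (cB k ℓ)) cXX hz', psSum_mul cX cX hz',
    psSum_mul c2u cr hz', psSum_mul (cC 2) cu hz', psSum_add cuf ckx1 hz', psSum_add cu cf hz',
    psSum_mul ckx c1x hz', psSum_mul (cC k) cX hz', psSum_sub (cC 1) cX hz', psSum_C,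
    psSum_X] at hode
  rw [DeltaSmallZ, DeltaU, fPoly]
  linear_combination hode

/-! ### Power series solutions of a singular equation

We solve `2 y s' + κ s = y g(s) - 2 y² (H(s))'`, `s(0) = 0`, for cubic polynomials `g`, `H`. -/

/-- A cubic polynomial evaluated at a power series. -/
def polyPs (g : Fin 4 → ℝ) (s : PowerSeries ℝ) : PowerSeries ℝ :=
  ∑ i, PowerSeries.C (g i) * s ^ (i : ℕ)

/-- One step of the recursion for the coefficients. -/
def singStep (κ : ℝ) (g H : Fin 4 → ℝ) (s : PowerSeries ℝ) : PowerSeries ℝ :=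
  PowerSeries.mk fun n => match n with
    | 0 => 0
    | n + 1 => (PowerSeries.coeff n (polyPs g s) - 2 * n * PowerSeries.coeff n (polyPs H s)) /
        (2 * ((n : ℝ) + 1) + κ)

/-- The formal solution. -/
def singPs (κ : ℝ) (g H : Fin 4 → ℝ) : PowerSeries ℝ :=
  PowerSeries.mk fun n => PowerSeries.coeff n ((singStep κ g H)^[n + 1] 0)

/-- Two power series agree below order `n`. -/
def AgreeBelow (n : ℕ) (a b : PowerSeries ℝ) : Prop :=
  ∀ i < n, PowerSeries.coeff i a = PowerSeries.coeff i b

theorem AgreeBelow.mul {n : ℕ} {a b c d : PowerSeries ℝ} (h : AgreeBelow n a b)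
    (h' : AgreeBelow n c d) : AgreeBelow n (a * c) (b * d) := by
  intro i hi
  rw [PowerSeries.coeff_mul, PowerSeries.coeff_mul]
  refine Finset.sum_congr rfl (fun p hp => ?_)
  have := Finset.HasAntidiagonal.mem_antidiagonal.1 hp
  rw [h p.1 (by omega), h' p.2 (by omega)]

theorem AgreeBelow.pow {n : ℕ} {a b : PowerSeries ℝ} (h : AgreeBelow n a b) (m : ℕ) :
    AgreeBelow n (a ^ m) (b ^ m) := by
  induction m with
  | zero => simp [AgreeBelow]
  | succ m ih => rw [pow_succ, pow_succ]; exact ih.mul h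

theorem AgreeBelow.polyPs {n : ℕ} {a b : PowerSeries ℝ} (h : AgreeBelow n a b) (g : Fin 4 → ℝ) :
    AgreeBelow n (polyPs g a) (polyPs g b) := by
  intro i hi
  simp only [RelEuler.polyPs, map_sum, PowerSeries.coeff_C_mul]
  exact Finset.sum_congr rfl (fun j _ => by rw [h.pow j i hi])

/-- One step computes the coefficient of order n + 1 from those of order at most n. Each iteration
therefore fixes one further coefficient, and the iterates stabilize coefficientwise to a fixed point
of the step, namely `singPs`. -/
theorem AgreeBelow.singStep {n : ℕ} {a b : PowerSeries ℝ} (h : AgreeBelow n a b) (κ : ℝ)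
    (g H : Fin 4 → ℝ) : AgreeBelow (n + 1) (singStep κ g H a) (singStep κ g H b) := by
  intro i hi
  cases i with
  | zero => simp [RelEuler.singStep]
  | succ i =>
    simp only [RelEuler.singStep, PowerSeries.coeff_mk]
    rw [h.polyPs g i (by omega), h.polyPs H i (by omega)]

theorem agreeBelow_iterate (κ : ℝ) (g H : Fin 4 → ℝ) (n : ℕ) :
    AgreeBelow n ((singStep κ g H)^[n] 0) ((singStep κ g H)^[n + 1] 0) := by
  induction n with
  | zero => intro i hi; omega
  | succ n ih =>
    rw [Function.iterate_succ_apply', Function.iterate_succ_apply' _ (n + 1)]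
    exact ih.singStep κ g H

theorem agreeBelow_singPs (κ : ℝ) (g H : Fin 4 → ℝ) (n : ℕ) :
    AgreeBelow n (singPs κ g H) ((singStep κ g H)^[n] 0) := by
  induction n with
  | zero => intro i hi; omega
  | succ n ih =>
    intro i hi
    rcases Nat.lt_succ_iff_lt_or_eq.1 hi with h | rfl
    · rw [ih i h, agreeBelow_iterate κ g H n i h]
    · simp [singPs]

theorem singStep_singPs (κ : ℝ) (g H : Fin 4 → ℝ) :
    singStep κ g H (singPs κ g H) = singPs κ g H := by
  ext n
  have h1 := (agreeBelow_singPs κ g H n).singStep κ g H n (Nat.lt_succ_self n)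
  rw [h1, ← Function.iterate_succ_apply' (singStep κ g H), agreeBelow_singPs κ g H (n + 1) n (Nat.lt_succ_self n)]

theorem coeff_zero_singPs (κ : ℝ) (g H : Fin 4 → ℝ) : PowerSeries.coeff 0 (singPs κ g H) = 0 := by
  rw [← singStep_singPs]; simp [singStep]

theorem coeff_succ_singPs (κ : ℝ) (g H : Fin 4 → ℝ) (n : ℕ) :
    PowerSeries.coeff (n + 1) (singPs κ g H) =
      (PowerSeries.coeff n (polyPs g (singPs κ g H)) -
        2 * n * PowerSeries.coeff n (polyPs H (singPs κ g H))) / (2 * ((n : ℝ) + 1) + κ) := by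
  conv_lhs => rw [← singStep_singPs]
  simp [singStep]

theorem coeff_one_singPs (κ : ℝ) (g H : Fin 4 → ℝ) :
    PowerSeries.coeff 1 (singPs κ g H) = g 0 / (2 + κ) := by
  have h1 := coeff_succ_singPs κ g H 0
  have : PowerSeries.coeff 0 (polyPs g (singPs κ g H)) = g 0 := by
    simp only [polyPs, Fin.sum_univ_four]
    have h0 := coeff_zero_singPs κ g H
    rw [PowerSeries.coeff_zero_eq_constantCoeff] at h0 ⊢
    simp [h0]
  rw [this] at h1
  simpa using h1

theorem psNorm_pow_le_one {r : ℝ} (hr : 0 ≤ r) {N : ℕ} {s : PowerSeries ℝ} (h : psNorm r N s ≤ 1)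
    (m : ℕ) : psNorm r N (s ^ m) ≤ 1 := by
  induction m with
  | zero =>
    rw [pow_zero, ← map_one PowerSeries.C]
    exact (psNorm_C_le N 1).trans (by simp)
  | succ m ih =>
    rw [pow_succ]
    exact (psNorm_mul_le hr _ _ _).trans (mul_le_one₀ ih (psNorm_nonneg hr _ _) h)

theorem psNorm_polyPs_le {r : ℝ} (hr : 0 ≤ r) {N : ℕ} {s : PowerSeries ℝ} (h : psNorm r N s ≤ 1)
    (g : Fin 4 → ℝ) : psNorm r N (polyPs g s) ≤ ∑ i, |g i| := by
  have key : ∀ i : Fin 4, psNorm r N (PowerSeries.C (g i) * s ^ (i : ℕ)) ≤ |g i| := by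
    intro i
    refine (psNorm_mul_le hr _ _ _).trans ?_
    calc _ ≤ |g i| * 1 := mul_le_mul (psNorm_C_le N _) (psNorm_pow_le_one hr h _)
          (psNorm_nonneg hr _ _) (abs_nonneg _)
      _ = |g i| := mul_one _
  rw [polyPs, Fin.sum_univ_four, Fin.sum_univ_four]
  refine (psNorm_add_le hr _ _ _).trans (add_le_add ?_ (key 3))
  refine (psNorm_add_le hr _ _ _).trans (add_le_add ?_ (key 2))
  exact (psNorm_add_le hr _ _ _).trans (add_le_add (key 0) (key 1))

/-- Majorant induction: the denominator 2(n + 1) + κ absorbs the factor 2n coming from the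
derivative of H, so each step costs only a factor r. As long as the norm is at most 1, the cubics
are bounded by the sums of the absolute values of their coefficients. -/
theorem psNorm_singPs_le_one {κ r : ℝ} {g H : Fin 4 → ℝ} (hκ : 0 ≤ κ) (hr : 0 ≤ r)
    (hb : r * (∑ i, |g i| + ∑ i, |H i|) ≤ 1) (N : ℕ) : psNorm r N (singPs κ g H) ≤ 1 := by
  induction N with
  | zero => simp [psNorm]
  | succ N ih =>
    have hg := psNorm_polyPs_le hr ih g
    have hH := psNorm_polyPs_le hr ih H
    have hstep : psNorm r (N + 1) (singPs κ g H) ≤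
        r * (psNorm r N (polyPs g (singPs κ g H)) + psNorm r N (polyPs H (singPs κ g H))) := by
      rw [psNorm, Finset.sum_range_succ', coeff_zero_singPs, psNorm, psNorm,
        ← Finset.sum_add_distrib, Finset.mul_sum]
      simp only [abs_zero, zero_mul, add_zero]
      refine Finset.sum_le_sum (fun n _ => ?_)
      rw [coeff_succ_singPs]
      set G := PowerSeries.coeff n (polyPs g (singPs κ g H))
      set L := PowerSeries.coeff n (polyPs H (singPs κ g H))
      have hd : 0 < 2 * ((n : ℝ) + 1) + κ := by positivity
      have h1 : |(G - 2 * n * L) / (2 * ((n : ℝ) + 1) + κ)| ≤ |G| + |L| := by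
        rw [abs_div, abs_of_pos hd, div_le_iff₀ hd]
        calc |G - 2 * n * L| ≤ |G| + |2 * n * L| := abs_sub _ _
          _ = |G| + 2 * n * |L| := by rw [abs_mul, abs_of_nonneg (by positivity : (0:ℝ) ≤ 2 * n)]
          _ ≤ _ := by
            have hn : (0 : ℝ) ≤ n := by positivity
            nlinarith [abs_nonneg G, abs_nonneg L, mul_nonneg hn (abs_nonneg G),
              mul_nonneg hκ (abs_nonneg G), mul_nonneg hκ (abs_nonneg L)]
      calc _ ≤ (|G| + |L|) * r ^ (n + 1) := by gcongr
        _ = _ := by rw [pow_succ]; ring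
    calc _ ≤ _ := hstep
      _ ≤ r * (∑ i, |g i| + ∑ i, |H i|) := by gcongr
      _ ≤ 1 := hb

theorem PsConv.pow {r : ℝ} (hr : 0 ≤ r) {s : PowerSeries ℝ} (h : PsConv r s) (m : ℕ) :
    PsConv r (s ^ m) := by
  induction m with
  | zero => rw [pow_zero, ← map_one PowerSeries.C]; exact PsConv.C r 1
  | succ m ih => rw [pow_succ]; exact ih.mul hr h

theorem psSum_pow {r z : ℝ} (hr : 0 ≤ r) {s : PowerSeries ℝ} (h : PsConv r s) (hz : |z| ≤ r)
    (m : ℕ) : psSum (s ^ m) z = psSum s z ^ m := by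
  induction m with
  | zero => rw [pow_zero, pow_zero, ← map_one PowerSeries.C, psSum_C]
  | succ m ih => rw [pow_succ, pow_succ, psSum_mul (h.pow hr m) h hz, ih]

theorem PsConv.polyPs {r : ℝ} (hr : 0 ≤ r) {s : PowerSeries ℝ} (h : PsConv r s)
    (g : Fin 4 → ℝ) : PsConv r (polyPs g s) := by
  have key : ∀ i : Fin 4, PsConv r (PowerSeries.C (g i) * s ^ (i : ℕ)) :=
    fun i => (PsConv.C r _).mul hr (h.pow hr _)
  rw [RelEuler.polyPs, Fin.sum_univ_four]
  exact (((key 0).add hr (key 1)).add hr (key 2)).add hr (key 3)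

theorem psSum_polyPs {r z : ℝ} (hr : 0 ≤ r) {s : PowerSeries ℝ} (h : PsConv r s) (hz : |z| ≤ r)
    (g : Fin 4 → ℝ) : psSum (polyPs g s) z =
      g 0 + g 1 * psSum s z + g 2 * psSum s z ^ 2 + g 3 * psSum s z ^ 3 := by
  have key : ∀ i : Fin 4, PsConv r (PowerSeries.C (g i) * s ^ (i : ℕ)) :=
    fun i => (PsConv.C r _).mul hr (h.pow hr _)
  have val : ∀ i : Fin 4, psSum (PowerSeries.C (g i) * s ^ (i : ℕ)) z = g i * psSum s z ^ (i : ℕ) :=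
    fun i => by rw [psSum_mul (PsConv.C r _) (h.pow hr _) hz, psSum_C, psSum_pow hr h hz]
  rw [RelEuler.polyPs, Fin.sum_univ_four,
    psSum_add (((key 0).add hr (key 1)).add hr (key 2)) (key 3) hz,
    psSum_add ((key 0).add hr (key 1)) (key 2) hz, psSum_add (key 0) (key 1) hz, val, val, val, val]
  simp

open PowerSeries in
theorem singPs_ode_formal {κ : ℝ} (hκ : 0 ≤ κ) (g H : Fin 4 → ℝ) :
    C 2 * (X * derivative ℝ (singPs κ g H)) + C κ * singPs κ g H =
      X * polyPs g (singPs κ g H) -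
        C 2 * (X * (X * derivative ℝ (polyPs H (singPs κ g H)))) := by
  ext n
  cases n with
  | zero =>
    have h0 := coeff_zero_singPs κ g H
    simp only [map_add, map_sub, coeff_C_mul, coeff_zero_X_mul, h0]
    ring
  | succ n =>
    simp only [map_add, map_sub, coeff_C_mul, coeff_succ_X_mul, coeff_derivative]
    have hX : coeff n (X * derivative ℝ (polyPs H (singPs κ g H))) =
        n * coeff n (polyPs H (singPs κ g H)) := by
      cases n with
      | zero => simp
      | succ n => rw [coeff_succ_X_mul, coeff_derivative]; push_cast; ring
    rw [hX]
    have h1 := coeff_succ_singPs κ g H n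
    have hd : 2 * ((n : ℝ) + 1) + κ ≠ 0 := by positivity
    rw [eq_div_iff hd] at h1
    linear_combination h1

/-- The sum of the formal solution solves the singular equation. -/
theorem singPs_ode {κ r y : ℝ} (hκ : 0 ≤ κ) {g H : Fin 4 → ℝ} (hc : PsConv r (singPs κ g H))
    (hy : |y| < r) :
    2 * y * deriv (psSum (singPs κ g H)) y + κ * psSum (singPs κ g H) y =
      y * (g 0 + g 1 * psSum (singPs κ g H) y + g 2 * psSum (singPs κ g H) y ^ 2
        + g 3 * psSum (singPs κ g H) y ^ 3)
      - 2 * y ^ 2 * ((H 1 + 2 * H 2 * psSum (singPs κ g H) y + 3 * H 3 * psSum (singPs κ g H) y ^ 2)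
        * deriv (psSum (singPs κ g H)) y) := by
  set s := singPs κ g H with hs
  obtain ⟨ρ, hyρ, hρr⟩ := exists_between hy
  have hρ : 0 ≤ ρ := (abs_nonneg y).trans hyρ.le
  have hr : 0 ≤ r := hρ.trans hρr.le
  have hds := hasDerivAt_psSum hc hy
  have hcH := hc.polyPs hr H
  have hdH := hasDerivAt_psSum hcH hy
  have hdH2 : HasDerivAt (psSum (polyPs H s))
      ((H 1 + 2 * H 2 * psSum s y + 3 * H 3 * psSum s y ^ 2) *
        psSum (PowerSeries.derivative ℝ s) y) y := by
    have e : (fun x => H 0 + H 1 * psSum s x + H 2 * psSum s x ^ 2 + H 3 * psSum s x ^ 3)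
        =ᶠ[𝓝 y] psSum (polyPs H s) := by
      have : ∀ᶠ x in 𝓝 y, |x| < r := (continuous_abs.tendsto y).eventually_lt_const hy
      filter_upwards [this] with x hx
      rw [psSum_polyPs hr hc hx.le]
    refine HasDerivAt.congr_of_eventuallyEq ?_ e.symm
    have h1 := ((hds.const_mul (H 1)).const_add (H 0)).add ((hds.pow 2).const_mul (H 2))
    have h2 := h1.add ((hds.pow 3).const_mul (H 3))
    refine h2.congr_deriv ?_
    simp only [Nat.cast_ofNat]
    ring
  have hformal := congrArg (fun f => psSum f y) (singPs_ode_formal hκ g H)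
  rw [← hs] at hformal
  have cs := hc.mono hρ hρr.le
  have cd := hc.derivative hρ hρr
  have cX := PsConv.X ρ
  have cXd := cX.mul hρ cd
  have c1 := (PsConv.C ρ 2).mul hρ cXd
  have c2 := (PsConv.C ρ κ).mul hρ cs
  have cg := cs.polyPs hρ g
  have c3 := cX.mul hρ cg
  have cdH := hcH.derivative hρ hρr
  have c4 := cX.mul hρ cdH
  have c5 := cX.mul hρ c4
  have c6 := (PsConv.C ρ 2).mul hρ c5
  have hz := hyρ.le
  simp only [psSum_add c1 c2 hz, psSum_mul (PsConv.C ρ 2) cXd hz, psSum_mul cX cd hz,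
    psSum_mul (PsConv.C ρ κ) cs hz, psSum_sub c3 c6 hz, psSum_mul cX cg hz,
    psSum_mul (PsConv.C ρ 2) c5 hz, psSum_mul cX c4 hz, psSum_mul cX cdH hz, psSum_C, psSum_X,
    psSum_polyPs hρ cs hz] at hformal
  rw [hds.deriv]
  rw [hdH.unique hdH2] at hformal
  linear_combination hformal

/-- Continuous dependence of the coefficients on parameters. -/
theorem continuousOn_coeff_singPs {κ : ℝ} {g H : ℝ → Fin 4 → ℝ} {S : Set ℝ}
    (hg : ∀ i, ContinuousOn (fun t => g t i) S) (hH : ∀ i, ContinuousOn (fun t => H t i) S)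
    (n : ℕ) : ContinuousOn (fun t => PowerSeries.coeff n (singPs κ (g t) (H t))) S := by
  have hmul : ∀ a b : ℝ → PowerSeries ℝ, (∀ n, ContinuousOn (fun t => PowerSeries.coeff n (a t)) S) →
      (∀ n, ContinuousOn (fun t => PowerSeries.coeff n (b t)) S) →
      ∀ n, ContinuousOn (fun t => PowerSeries.coeff n (a t * b t)) S := by
    intro a b ha hb n
    simp only [PowerSeries.coeff_mul]
    exact continuousOn_finsetSum _ (fun p _ => (ha p.1).mul (hb p.2))
  have hpow : ∀ a : ℝ → PowerSeries ℝ, (∀ n, ContinuousOn (fun t => PowerSeries.coeff n (a t)) S) →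
      ∀ m n, ContinuousOn (fun t => PowerSeries.coeff n (a t ^ m)) S := by
    intro a ha m
    induction m with
    | zero => intro n; simp only [pow_zero]; exact continuousOn_const
    | succ m ih => simp only [pow_succ]; exact hmul _ _ ih ha
  have hpoly : ∀ (c : ℝ → Fin 4 → ℝ), (∀ i, ContinuousOn (fun t => c t i) S) →
      ∀ a : ℝ → PowerSeries ℝ, (∀ n, ContinuousOn (fun t => PowerSeries.coeff n (a t)) S) →
      ∀ n, ContinuousOn (fun t => PowerSeries.coeff n (polyPs (c t) (a t))) S := by
    intro c hc a ha n
    simp only [polyPs, map_sum, PowerSeries.coeff_C_mul]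
    exact continuousOn_finsetSum _ (fun i _ => (hc i).mul (hpow a ha _ n))
  have hiter : ∀ m n, ContinuousOn
      (fun t => PowerSeries.coeff n ((singStep κ (g t) (H t))^[m] 0)) S := by
    intro m
    induction m with
    | zero => intro n; simp only [Function.iterate_zero, id]; exact continuousOn_const
    | succ m ih =>
      intro n
      simp only [Function.iterate_succ_apply']
      cases n with
      | zero => simp only [singStep, PowerSeries.coeff_mk]; exact continuousOn_const
      | succ n =>
        simp only [singStep, PowerSeries.coeff_mk]
        exact ((hpoly g hg _ ih n).sub ((hpoly H hH _ ih n).const_mul _)).div_const _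
  simp only [singPs, PowerSeries.coeff_mk]
  exact hiter (n + 1) n

/-! ### The phase plane of the `z-u` equation -/

/-- The sonic curve in the `z-u` plane. -/
def uSonic (ℓ γ z : ℝ) : ℝ := ℓ * (γ + z) ^ 2 - (1 - z) ^ 2

theorem DeltaU_uSonic (k ℓ γ z : ℝ) :
    DeltaU k ℓ γ z (uSonic ℓ γ z) = 2 * uSonic ℓ γ z * (k * z * (γ + z)) := by
  simp only [DeltaU, uSonic, fPoly, eps, cA, cB]; ring

theorem DeltaSmallZ_uSonic (k ℓ γ z : ℝ) : DeltaSmallZ k ℓ γ z (uSonic ℓ γ z) =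
    k * z * (γ + z) * (ℓ * (γ + z) - (1 - z)) := by
  simp only [DeltaSmallZ, uSonic, fPoly, eps, cA, cB]; ring

theorem hasDerivAt_uSonic (ℓ γ z : ℝ) :
    HasDerivAt (uSonic ℓ γ) (2 * ℓ * (γ + z) + 2 * (1 - z)) z := by
  have h := ((((hasDerivAt_id z).const_add γ).pow 2).const_mul ℓ).sub
    (((hasDerivAt_id z).const_sub 1).pow 2)
  refine h.congr_deriv ?_
  simp; ring

theorem continuous_uSonic (ℓ γ : ℝ) : Continuous (uSonic ℓ γ) := by
  unfold uSonic; fun_prop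

theorem uSonic_eq (ℓ γ z : ℝ) :
    uSonic ℓ γ z = eps ℓ γ + 2 * (1 + ℓ * γ) * z + (ℓ - 1) * z ^ 2 := by
  rw [uSonic, eps]; ring

theorem uSonic_mono {ℓ γ z w : ℝ} (hℓ : 1 < ℓ) (hγ : 0 < γ) (hz : 0 ≤ z) (hzw : z ≤ w) :
    uSonic ℓ γ z ≤ uSonic ℓ γ w := by
  rw [uSonic_eq, uSonic_eq]
  have h1 : 0 ≤ 1 + ℓ * γ := by positivity
  have h2 : 0 ≤ ℓ - 1 := by linarith
  gcongr

theorem DeltaSmallZ_uSonic_pos {k ℓ γ z : ℝ} (h : Adm k ℓ γ) (hz : 0 < z) :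
    0 < DeltaSmallZ k ℓ γ z (uSonic ℓ γ z) := by
  have hγ := gamma_pos h.one_lt_ℓ h.γ_gt
  have h1 := one_lt_ell_mul_gamma h.one_lt_ℓ h.γ_gt
  have hℓ := h.one_lt_ℓ
  have hk := h.one_le_k
  rw [DeltaSmallZ_uSonic]
  have : 0 < ℓ * (γ + z) - (1 - z) := by nlinarith
  positivity

/-- The sonic curve is crossed in one direction only. -/
theorem DeltaU_div_lt_deriv_uSonic {k ℓ γ z : ℝ} (h : Adm k ℓ γ) (hz : 0 < z) :
    DeltaU k ℓ γ z (uSonic ℓ γ z) / DeltaSmallZ k ℓ γ z (uSonic ℓ γ z) <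
      2 * ℓ * (γ + z) + 2 * (1 - z) := by
  rw [div_lt_iff₀ (DeltaSmallZ_uSonic_pos h hz), DeltaU_uSonic, DeltaSmallZ_uSonic]
  have hγ := gamma_pos h.one_lt_ℓ h.γ_gt
  have hk := h.one_le_k
  have hℓ : 0 < ℓ - 1 := sub_pos.2 h.one_lt_ℓ
  have hℓ0 : 0 < ℓ := by linarith
  -- After clearing the denominator the difference of the slopes is this positive multiple of ℓ(ℓ -
  -- 1); ℓ > 1 is essential here.
  have hpos : 0 < 2 * k * z * (γ + z) ^ 3 * (ℓ * (ℓ - 1)) := by positivity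
  have e : (2 * ℓ * (γ + z) + 2 * (1 - z)) * (k * z * (γ + z) * (ℓ * (γ + z) - (1 - z))) -
      2 * uSonic ℓ γ z * (k * z * (γ + z)) = 2 * k * z * (γ + z) ^ 3 * (ℓ * (ℓ - 1)) := by
    rw [uSonic]; ring
  linarith

/-- Above the sonic curve `Δ_u` is positive, quantitatively. -/
theorem DeltaU_ge {k ℓ γ z u : ℝ} (h : Adm k ℓ γ) (hz : 0 ≤ z) (hu : uSonic ℓ γ z ≤ u) :
    2 * eps ℓ γ * (k * z * γ) ≤ DeltaU k ℓ γ z u := by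
  have hγ := gamma_pos h.one_lt_ℓ h.γ_gt
  have hε := eps_pos h.one_lt_ℓ h.γ_gt
  have hk : 0 < k := by linarith [h.one_le_k]
  have hS : eps ℓ γ ≤ uSonic ℓ γ z := by
    have := uSonic_mono h.one_lt_ℓ hγ le_rfl hz
    rw [uSonic_eq ℓ γ 0] at this
    linarith
  have e : uSonic ℓ γ z + fPoly k ℓ γ z + k * z * (1 - z) = k * z * (γ + z) := by
    simp only [uSonic, fPoly, eps, cA, cB]; ring
  have h1 : k * z * γ ≤ u + fPoly k ℓ γ z + k * z * (1 - z) := by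
    have : 0 ≤ k * z * z := by positivity
    nlinarith
  rw [DeltaU]
  have h2 : 0 ≤ k * z * γ := by positivity
  calc 2 * eps ℓ γ * (k * z * γ) ≤ 2 * u * (k * z * γ) := by gcongr; linarith
    _ ≤ _ := by
      have : 0 ≤ 2 * u := by linarith
      exact mul_le_mul_of_nonneg_left h1 this

theorem DeltaU_pos {k ℓ γ z u : ℝ} (h : Adm k ℓ γ) (hz : 0 < z) (hu : uSonic ℓ γ z ≤ u) :
    0 < DeltaU k ℓ γ z u := by
  have hγ := gamma_pos h.one_lt_ℓ h.γ_gt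
  have hε := eps_pos h.one_lt_ℓ h.γ_gt
  have hk : 0 < k := by linarith [h.one_le_k]
  exact lt_of_lt_of_le (by positivity) (DeltaU_ge h hz.le hu)

/-- For B ≤ 0 no term is positive. For B > 0 the polynomial is convex and lies below its chord on
the interval: its value at 0 is -ε, and its value at 1/(k+1) factors, with a sign given by ℓγ > 1.
The value at 1/(k+1) makes the leading coefficient of the chart at Q₀ positive. -/
theorem fPoly_neg {k ℓ γ z : ℝ} (h : Adm k ℓ γ) (hz : z ∈ Icc 0 (1 / (k + 1))) :
    fPoly k ℓ γ z < 0 := by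
  have hγ := gamma_pos h.one_lt_ℓ h.γ_gt
  have hε := eps_pos h.one_lt_ℓ h.γ_gt
  have hA := h.A_pos
  have hk := h.one_le_k
  have hℓ := h.one_lt_ℓ
  have h1 := one_lt_ell_mul_gamma h.one_lt_ℓ h.γ_gt
  have hk1 : 0 < k + 1 := by linarith
  have hz0 := hz.1
  have hz1 : z * (k + 1) ≤ 1 := by rw [← le_div_iff₀ hk1]; exact hz.2
  rcases le_or_gt (cB k ℓ) 0 with hB | hB
  · rw [fPoly]
    have : 0 ≤ cA k ℓ γ * z := by positivity
    have : cB k ℓ * z ^ 2 ≤ 0 := mul_nonpos_of_nonpos_of_nonneg hB (by positivity)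
    linarith
  · have hend : 0 < (k + 1) ^ 2 * eps ℓ γ + (k + 1) * cA k ℓ γ - cB k ℓ := by
      have e : (k + 1) ^ 2 * eps ℓ γ + (k + 1) * cA k ℓ γ - cB k ℓ =
          ((k + 1) * γ + 1) * (ℓ * ((k + 1) * γ + 1) - k) := by
        rw [eps, cA, cB]; ring
      rw [e]
      have : 0 < ℓ * ((k + 1) * γ + 1) - k := by nlinarith
      positivity
    rw [fPoly]
    have h2 : cB k ℓ * z ^ 2 * (k + 1) ≤ cB k ℓ * z := by
      have : 0 ≤ cB k ℓ * z := by positivity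
      nlinarith
    have h3 : 0 < eps ℓ γ * (1 - z * (k + 1)) + (z * (k + 1)) *
        ((k + 1) ^ 2 * eps ℓ γ + (k + 1) * cA k ℓ γ - cB k ℓ) / (k + 1) ^ 2 := by
      rcases hz0.eq_or_lt with h0 | h0
      · rw [← h0]; simpa using hε
      · have : 0 ≤ eps ℓ γ * (1 - z * (k + 1)) := mul_nonneg hε.le (by linarith)
        positivity
    have h4 : (z * (k + 1)) * ((k + 1) ^ 2 * eps ℓ γ + (k + 1) * cA k ℓ γ - cB k ℓ) / (k + 1) ^ 2 =
        z * (k + 1) * eps ℓ γ + z * cA k ℓ γ - cB k ℓ * z / (k + 1) := by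
      field_simp
    have h5 : cB k ℓ * z ^ 2 ≤ cB k ℓ * z / (k + 1) := by rw [le_div_iff₀ hk1]; exact h2
    linarith

/-! ### The equation with cut-off right-hand side -/

/-- The right-hand side `Δ_u / Δ_z` with `u` restricted to `[0, M]` and `Δ_z` cut off at `κ`. -/
def clampRHS (k ℓ γ κ M z u : ℝ) : ℝ :=
  DeltaU k ℓ γ z (max 0 (min u M)) / max (DeltaSmallZ k ℓ γ z (max 0 (min u M))) κ

/-- The cut-offs make the field bounded and globally Lipschitz, so existence and Grönwall estimates
hold on whole intervals. A priori bounds then show that the cut-offs are inactive, and this identity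
returns to the original equation. -/
theorem clampRHS_eq {k ℓ γ κ M z u : ℝ} (h0 : 0 ≤ u) (hM : u ≤ M)
    (hκ : κ ≤ DeltaSmallZ k ℓ γ z u) :
    clampRHS k ℓ γ κ M z u = DeltaU k ℓ γ z u / DeltaSmallZ k ℓ γ z u := by
  rw [clampRHS, min_eq_left hM, max_eq_right h0, max_eq_left hκ]

theorem clamp_mem {M : ℝ} (hM : 0 ≤ M) (u : ℝ) : max 0 (min u M) ∈ Icc 0 M :=
  ⟨le_max_left _ _, max_le hM (min_le_right _ _)⟩

theorem abs_clamp_sub_le (M u v : ℝ) : |max 0 (min u M) - max 0 (min v M)| ≤ |u - v| := by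
  rw [max_comm 0, max_comm 0]
  refine (abs_max_sub_max_le_abs _ _ 0).trans ?_
  simpa using abs_min_sub_min_le_max u M v M

theorem abs_DeltaU_le {k ℓ γ z u M G : ℝ} (hu : u ∈ Icc 0 M)
    (hG : |fPoly k ℓ γ z + k * z * (1 - z)| ≤ G) :
    |DeltaU k ℓ γ z u| ≤ 2 * M * (M + G) := by
  rw [DeltaU, add_assoc, abs_mul, abs_mul, abs_two, abs_of_nonneg hu.1]
  have hG0 : 0 ≤ G := (abs_nonneg _).trans hG
  have h1 : |u + (fPoly k ℓ γ z + k * z * (1 - z))| ≤ M + G :=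
    (abs_add_le _ _).trans (add_le_add (by rw [abs_of_nonneg hu.1]; exact hu.2) hG)
  have hM : 0 ≤ M := hu.1.trans hu.2
  have := hu.2
  gcongr

theorem abs_one_sub_mul_le {k z : ℝ} (hk : 1 ≤ k) (hz : z ∈ Icc 0 (1 / (k + 1))) :
    |(k + 1) * z - 1| ≤ 1 := by
  have hk1 : 0 < k + 1 := by linarith
  have hz1 : z * (k + 1) ≤ 1 := by rw [← le_div_iff₀ hk1]; exact hz.2
  have : 0 ≤ (k + 1) * z := mul_nonneg hk1.le hz.1
  rw [abs_le]; constructor <;> linarith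

/-- The Lipschitz constant of the cut-off equation. -/
def clampLip (κ M G : ℝ) : NNReal :=
  Real.toNNReal ((4 * M + 2 * G) / κ + 2 * M * (M + G) * 1 / κ ^ 2)

theorem lipschitzWith_clampRHS {k ℓ γ κ M z G : ℝ} (hκ : 0 < κ) (hM : 0 ≤ M) (hk : 1 ≤ k)
    (hz : z ∈ Icc 0 (1 / (k + 1))) (hG : |fPoly k ℓ γ z + k * z * (1 - z)| ≤ G) :
    LipschitzWith (clampLip κ M G) (clampRHS k ℓ γ κ M z) := by
  have hG0 : 0 ≤ G := (abs_nonneg _).trans hG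
  refine lipschitz_div_max hκ (by positivity) (by positivity) zero_le_one (fun x y => ?_)
    (fun x => abs_DeltaU_le (clamp_mem hM x) hG) (fun x y => ?_)
  · have hx := clamp_mem hM x
    have hy := clamp_mem hM y
    have hc := abs_clamp_sub_le M x y
    set X := max 0 (min x M)
    set Y := max 0 (min y M)
    have e : DeltaU k ℓ γ z X - DeltaU k ℓ γ z Y =
        (2 * (X + Y) + 2 * (fPoly k ℓ γ z + k * z * (1 - z))) * (X - Y) := by
      simp only [DeltaU]; ring
    rw [e, abs_mul]
    have h1 : |2 * (X + Y) + 2 * (fPoly k ℓ γ z + k * z * (1 - z))| ≤ 4 * M + 2 * G := by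
      refine (abs_add_le _ _).trans (add_le_add ?_ ?_)
      · rw [abs_of_nonneg (by linarith [hx.1, hy.1])]; linarith [hx.2, hy.2]
      · rw [abs_mul, abs_two]; linarith
    exact mul_le_mul h1 hc (abs_nonneg _) (by positivity)
  · have hc := abs_clamp_sub_le M x y
    set X := max 0 (min x M)
    set Y := max 0 (min y M)
    have e : DeltaSmallZ k ℓ γ z X - DeltaSmallZ k ℓ γ z Y = ((k + 1) * z - 1) * (X - Y) := by
      simp only [DeltaSmallZ]; ring
    rw [e, abs_mul]
    exact mul_le_mul (abs_one_sub_mul_le hk hz) hc (abs_nonneg _) zero_le_one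

theorem abs_clampRHS_le {k ℓ γ κ M z G : ℝ} (hκ : 0 < κ) (hM : 0 ≤ M)
    (hG : |fPoly k ℓ γ z + k * z * (1 - z)| ≤ G) (u : ℝ) :
    |clampRHS k ℓ γ κ M z u| ≤ 2 * M * (M + G) / κ := by
  have hG0 : 0 ≤ G := (abs_nonneg _).trans hG
  rw [clampRHS, abs_div, abs_of_pos (lt_max_of_lt_right hκ)]
  exact div_le_div₀ (by positivity) (abs_DeltaU_le (clamp_mem hM u) hG) hκ (le_max_right _ _)

theorem continuous_fPoly (k ℓ γ : ℝ) : Continuous (fPoly k ℓ γ) := by unfold fPoly; fun_prop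

theorem continuous_DeltaU (k ℓ γ : ℝ) : Continuous fun p : ℝ × ℝ => DeltaU k ℓ γ p.1 p.2 := by
  unfold DeltaU fPoly; fun_prop

theorem continuous_DeltaSmallZ (k ℓ γ : ℝ) :
    Continuous fun p : ℝ × ℝ => DeltaSmallZ k ℓ γ p.1 p.2 := by
  unfold DeltaSmallZ fPoly; fun_prop

theorem continuous_clampRHS {k ℓ γ κ M : ℝ} (hκ : 0 < κ) (u : ℝ) :
    Continuous fun z => clampRHS k ℓ γ κ M z u := by
  unfold clampRHS
  refine Continuous.div ?_ ?_ (fun z => (lt_max_of_lt_right hκ).ne')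
  · exact (continuous_DeltaU k ℓ γ).comp (continuous_id.prodMk continuous_const)
  · exact ((continuous_DeltaSmallZ k ℓ γ).comp (continuous_id.prodMk continuous_const)).max
      continuous_const

theorem exists_abs_fPoly_le (k ℓ γ : ℝ) :
    ∃ G, ∀ z ∈ Icc 0 (1 / (k + 1)), |fPoly k ℓ γ z + k * z * (1 - z)| ≤ G := by
  obtain ⟨G, hG⟩ := isCompact_Icc (a := (0 : ℝ)) (b := 1 / (k + 1)) |>.exists_bound_of_continuousOn
    (f := fun z => fPoly k ℓ γ z + k * z * (1 - z))
    (((continuous_fPoly k ℓ γ).add (by fun_prop)).continuousOn)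
  exact ⟨G, hG⟩

/-- `u` solves the `z-u` equation on `s`, in the region above the sonic curve where `Δ_z > 0`. -/
structure SolOn (k ℓ γ : ℝ) (u : ℝ → ℝ) (s : Set ℝ) : Prop where
  ode : ∀ z ∈ s, HasDerivWithinAt u (DeltaU k ℓ γ z (u z) / DeltaSmallZ k ℓ γ z (u z)) s z
  den_pos : ∀ z ∈ s, 0 < DeltaSmallZ k ℓ γ z (u z)
  above : ∀ z ∈ s, uSonic ℓ γ z < u z

theorem SolOn.mono {k ℓ γ : ℝ} {u : ℝ → ℝ} {s t : Set ℝ} (h : SolOn k ℓ γ u s) (hst : t ⊆ s) :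
    SolOn k ℓ γ u t :=
  ⟨fun z hz => (h.ode z (hst hz)).mono hst, fun z hz => h.den_pos z (hst hz),
    fun z hz => h.above z (hst hz)⟩

theorem SolOn.continuousOn {k ℓ γ : ℝ} {u : ℝ → ℝ} {s : Set ℝ} (h : SolOn k ℓ γ u s) :
    ContinuousOn u s := fun z hz => (h.ode z hz).continuousWithinAt

theorem uSonic_pos {ℓ γ z : ℝ} (hℓ : 1 < ℓ) (hγ : 1 / √ℓ < γ) (hz : 0 ≤ z) :
    0 < uSonic ℓ γ z := by
  have h := uSonic_mono hℓ (gamma_pos hℓ hγ) le_rfl hz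
  rw [uSonic_eq ℓ γ 0] at h
  have := eps_pos hℓ hγ
  linarith

theorem continuousOn_DeltaSmallZ_comp {k ℓ γ : ℝ} {u : ℝ → ℝ} {s : Set ℝ} (h : ContinuousOn u s) :
    ContinuousOn (fun z => DeltaSmallZ k ℓ γ z (u z)) s :=
  (continuous_DeltaSmallZ k ℓ γ).comp_continuousOn (continuousOn_id.prodMk h)

/-- Solutions of the `z-u` equation are determined by their value at the right end. -/
theorem SolOn.eqOn {k ℓ γ a b : ℝ} (h : Adm k ℓ γ) (ha : 0 ≤ a) (hb : b ≤ 1 / (k + 1))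
    {u w : ℝ → ℝ} (hu : SolOn k ℓ γ u (Icc a b)) (hw : SolOn k ℓ γ w (Icc a b))
    (hbb : u b = w b) : EqOn u w (Icc a b) := by
  rcases lt_or_ge b a with hab | hab
  · rw [Icc_eq_empty (not_le.2 hab)]; exact eqOn_empty _ _
  obtain ⟨G, hG⟩ := exists_abs_fPoly_le k ℓ γ
  have hne : (Icc a b).Nonempty := nonempty_Icc.2 hab
  obtain ⟨z₁, hz₁, hm₁⟩ := isCompact_Icc.exists_isMinOn hne
    (continuousOn_DeltaSmallZ_comp (k := k) (ℓ := ℓ) (γ := γ) hu.continuousOn)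
  obtain ⟨z₂, hz₂, hm₂⟩ := isCompact_Icc.exists_isMinOn hne
    (continuousOn_DeltaSmallZ_comp (k := k) (ℓ := ℓ) (γ := γ) hw.continuousOn)
  obtain ⟨z₃, hz₃, hm₃⟩ := isCompact_Icc.exists_isMaxOn hne hu.continuousOn
  obtain ⟨z₄, hz₄, hm₄⟩ := isCompact_Icc.exists_isMaxOn hne hw.continuousOn
  -- With these κ and M the cut-offs are inactive along both solutions.
  set κ := min (DeltaSmallZ k ℓ γ z₁ (u z₁)) (DeltaSmallZ k ℓ γ z₂ (w z₂))
  set M := max (u z₃) (w z₄)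
  have hκ : 0 < κ := lt_min (hu.den_pos z₁ hz₁) (hw.den_pos z₂ hz₂)
  have hup : ∀ z ∈ Icc a b, 0 ≤ u z := fun z hz =>
    (uSonic_pos h.one_lt_ℓ h.γ_gt (ha.trans hz.1)).le.trans (hu.above z hz).le
  have hwp : ∀ z ∈ Icc a b, 0 ≤ w z := fun z hz =>
    (uSonic_pos h.one_lt_ℓ h.γ_gt (ha.trans hz.1)).le.trans (hw.above z hz).le
  have hM : 0 ≤ M := (hup z₃ hz₃).trans (le_max_left _ _)
  have hsub : Icc a b ⊆ Icc 0 (1 / (k + 1)) := Icc_subset_Icc ha hb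
  have key := dist_le_gronwallBound_left (F := clampRHS k ℓ γ κ M) (K := clampLip κ M G) (e := 0)
    (fun t ht => lipschitzWith_clampRHS hκ hM h.one_le_k (hsub ht) (hG t (hsub ht)))
    hu.ode hw.ode
    (fun t ht => (clampRHS_eq (hup t ht) ((hm₃ ht).trans (le_max_left _ _))
      ((min_le_left _ _).trans (hm₁ ht))).symm)
    (fun t ht => by
      rw [clampRHS_eq (hwp t ht) ((hm₄ ht).trans (le_max_right _ _))
        ((min_le_right _ _).trans (hm₂ ht)), sub_self, abs_zero])
  intro z hz
  have := key z hz
  rw [hbb, sub_self, abs_zero, gronwallBound_ε0_δ0] at this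
  exact sub_eq_zero.1 (abs_nonpos_iff.1 this)

theorem hasDerivWithinAt_DeltaSmallZ_comp {k ℓ γ z d : ℝ} {u : ℝ → ℝ} {s : Set ℝ}
    (hu : HasDerivWithinAt u d s z) :
    HasDerivWithinAt (fun z => DeltaSmallZ k ℓ γ z (u z))
      ((k + 1) * u z + ((k + 1) * z - 1) * d + fPoly k ℓ γ z
        + (z - 1) * (-cA k ℓ γ + 2 * cB k ℓ * z)) s z := by
  have hid := hasDerivWithinAt_id z s
  have hf : HasDerivWithinAt (fPoly k ℓ γ) (-cA k ℓ γ + 2 * cB k ℓ * z) s z := by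
    have := ((hid.const_mul (cA k ℓ γ)).const_sub (-eps ℓ γ)).add
      ((hid.pow 2).const_mul (cB k ℓ))
    refine this.congr_deriv ?_
    simp; ring
  have h1 := (((hid.const_mul (k + 1)).sub_const 1).mul hu).add ((hid.sub_const 1).mul hf)
  refine h1.congr_deriv ?_
  simp; ring

/-- This is the part of the derivative of Δ_z(z, u(z)) that does not contain u'. -/
theorem abs_drift_le {k ℓ γ z u M : ℝ} (h : Adm k ℓ γ) (hz : z ∈ Icc (0 : ℝ) 1)
    (hu : u ∈ Icc 0 M) :
    |(k + 1) * u + fPoly k ℓ γ z + (z - 1) * (-cA k ℓ γ + 2 * cB k ℓ * z)| ≤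
      (k + 1) * M + eps ℓ γ + 2 * cA k ℓ γ + 3 * |cB k ℓ| := by
  have hA := h.A_pos
  have hε := eps_pos h.one_lt_ℓ h.γ_gt
  have hk := h.one_le_k
  have hz0 := hz.1
  have hz1 := hz.2
  have e : (k + 1) * u + fPoly k ℓ γ z + (z - 1) * (-cA k ℓ γ + 2 * cB k ℓ * z) =
      (k + 1) * u - eps ℓ γ + (1 - 2 * z) * cA k ℓ γ + (3 * z ^ 2 - 2 * z) * cB k ℓ := by
    rw [fPoly]; ring
  rw [e]
  have b1 : |(k + 1) * u| ≤ (k + 1) * M := by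
    rw [abs_of_nonneg (mul_nonneg (by linarith) hu.1)]
    exact mul_le_mul_of_nonneg_left hu.2 (by linarith)
  have b2 : |(1 - 2 * z) * cA k ℓ γ| ≤ 2 * cA k ℓ γ := by
    rw [abs_mul, abs_of_pos hA]
    refine mul_le_mul_of_nonneg_right ?_ hA.le
    rw [abs_le]; constructor <;> linarith
  have b3 : |(3 * z ^ 2 - 2 * z) * cB k ℓ| ≤ 3 * |cB k ℓ| := by
    rw [abs_mul]
    refine mul_le_mul_of_nonneg_right ?_ (abs_nonneg _)
    rw [abs_le]; constructor <;> nlinarith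
  calc _ ≤ |(k + 1) * u| + |eps ℓ γ| + |(1 - 2 * z) * cA k ℓ γ| +
        |(3 * z ^ 2 - 2 * z) * cB k ℓ| := by
        refine (abs_add_le _ _).trans (add_le_add ?_ le_rfl)
        refine (abs_add_le _ _).trans (add_le_add ?_ le_rfl)
        exact abs_sub _ _
    _ ≤ _ := by rw [abs_of_pos hε]; linarith

/-- A lower bound for `Δ_z` along solutions is preserved to the left. -/
theorem lt_DeltaSmallZ_of_lt_right {k ℓ γ a b κ M : ℝ} (h : Adm k ℓ γ) (ha : 0 < a)
    (hb : b < 1 / (k + 1)) {u d : ℝ → ℝ} (hκ : 0 < κ)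
    (hκ' : κ * ((k + 1) * M + eps ℓ γ + 2 * cA k ℓ γ + 3 * |cB k ℓ|) <
      (1 - (k + 1) * b) * (2 * eps ℓ γ * (k * a * γ)))
    (hu : ∀ z ∈ Icc a b, HasDerivWithinAt u (d z) (Icc a b) z)
    (hd : ∀ z ∈ Icc a b, DeltaSmallZ k ℓ γ z (u z) = κ → d z = DeltaU k ℓ γ z (u z) / κ)
    (hS : ∀ z ∈ Icc a b, uSonic ℓ γ z ≤ u z) (hM : ∀ z ∈ Icc a b, u z ≤ M)
    (hbκ : κ < DeltaSmallZ k ℓ γ b (u b)) :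
    ∀ z ∈ Icc a b, κ < DeltaSmallZ k ℓ γ z (u z) := by
  have hk : 1 ≤ k := h.one_le_k
  have hk1 : 0 < k + 1 := by linarith
  have hcont : ContinuousOn u (Icc a b) := fun z hz => (hu z hz).continuousWithinAt
  -- Where Δ_z = κ, the slope u' = Δ_u/κ is large and enters the derivative of Δ_z with the negative
  -- factor (k+1)z - 1. The hypothesis `hκ'` says that it dominates the remaining terms, so Δ_z can
  -- only decrease through κ.
  have key := pos_of_deriv_neg_at_zeros (g := fun z => DeltaSmallZ k ℓ γ z (u z) - κ)
    (a := a) (c := b) ((continuousOn_DeltaSmallZ_comp hcont).sub continuousOn_const)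
    (sub_pos.2 hbκ) (fun z hz h0 => ?_)
  · intro z hz; exact sub_pos.1 (key z hz)
  have hz' : z ∈ Icc a b := Ico_subset_Icc_self hz
  have h0' : DeltaSmallZ k ℓ γ z (u z) = κ := sub_eq_zero.1 h0
  have hder := ((hasDerivWithinAt_DeltaSmallZ_comp (k := k) (ℓ := ℓ) (γ := γ) (hu z hz')).sub_const
    κ).mono_of_mem_nhdsWithin (mem_of_superset (Ioc_mem_nhdsGT hz.2)
      (fun w hw => ⟨hz.1.trans hw.1.le, hw.2⟩) : Icc a b ∈ 𝓝[>] z)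
  refine ⟨_, ?_, hder⟩
  rw [hd z hz' h0']
  have hz0 : 0 < z := ha.trans_le hz.1
  have hzb : (k + 1) * z ≤ (k + 1) * b := by gcongr; exact hz'.2
  have hb1 : b * (k + 1) < 1 := by rw [← lt_div_iff₀ hk1]; exact hb
  have hz1 : z ≤ 1 := by nlinarith [hz'.2]
  have hup : 0 ≤ u z := (uSonic_pos h.one_lt_ℓ h.γ_gt hz0.le).le.trans (hS z hz')
  have hdrift := (abs_le.1 (abs_drift_le h (z := z) ⟨hz0.le, hz1⟩ ⟨hup, hM z hz'⟩)).2
  have hDU := DeltaU_ge h hz0.le (hS z hz')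
  have hε := eps_pos h.one_lt_ℓ h.γ_gt
  have hγ := gamma_pos h.one_lt_ℓ h.γ_gt
  have hDU' : 2 * eps ℓ γ * (k * a * γ) ≤ DeltaU k ℓ γ z (u z) := by
    refine le_trans ?_ hDU
    have := hz.1
    gcongr
  set C₁ := (k + 1) * M + eps ℓ γ + 2 * cA k ℓ γ + 3 * |cB k ℓ|
  have h2 : (1 - (k + 1) * b) * (2 * eps ℓ γ * (k * a * γ)) ≤
      (1 - (k + 1) * z) * DeltaU k ℓ γ z (u z) := by
    refine mul_le_mul (by linarith) hDU' (by positivity) (by linarith)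
  have h3 : C₁ < (1 - (k + 1) * z) * (DeltaU k ℓ γ z (u z) / κ) := by
    rw [← mul_div_assoc, lt_div_iff₀ hκ]
    linarith [mul_comm κ C₁]
  linarith

/-! ### Solutions of the `z-u` equation to the left of a given point -/

/-- A function above the sonic curve at the right end stays above it, if it solves the equation
wherever it meets the curve. -/
theorem uSonic_lt_of_lt_right {k ℓ γ a b : ℝ} (h : Adm k ℓ γ) (ha : 0 < a) {u d : ℝ → ℝ}
    (hu : ∀ z ∈ Icc a b, HasDerivWithinAt u (d z) (Icc a b) z)
    (hd : ∀ z ∈ Icc a b, u z = uSonic ℓ γ z →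
      d z = DeltaU k ℓ γ z (u z) / DeltaSmallZ k ℓ γ z (u z))
    (hb : uSonic ℓ γ b < u b) : ∀ z ∈ Icc a b, uSonic ℓ γ z < u z := by
  have hcont : ContinuousOn u (Icc a b) := fun z hz => (hu z hz).continuousWithinAt
  have key := pos_of_deriv_neg_at_zeros (g := fun z => u z - uSonic ℓ γ z) (a := a) (c := b)
    (hcont.sub (continuous_uSonic ℓ γ).continuousOn) (sub_pos.2 hb) (fun z hz h0 => ?_)
  · intro z hz; exact sub_pos.1 (key z hz)
  have hz' : z ∈ Icc a b := Ico_subset_Icc_self hz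
  have h0' : u z = uSonic ℓ γ z := sub_eq_zero.1 h0
  have hmem : Icc a b ∈ 𝓝[>] z := mem_of_superset (Ioc_mem_nhdsGT hz.2)
      (fun w hw => ⟨hz.1.trans hw.1.le, hw.2⟩)
  refine ⟨_, ?_, ((hu z hz').mono_of_mem_nhdsWithin hmem).sub
    (hasDerivAt_uSonic ℓ γ z).hasDerivWithinAt⟩
  rw [hd z hz' h0', h0']
  linarith [DeltaU_div_lt_deriv_uSonic h (ha.trans_le hz.1)]

theorem monotoneOn_of_deriv_nonneg_Icc {a b : ℝ} {u d : ℝ → ℝ}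
    (hu : ∀ z ∈ Icc a b, HasDerivWithinAt u (d z) (Icc a b) z) (hd : ∀ z ∈ Icc a b, 0 ≤ d z) :
    MonotoneOn u (Icc a b) :=
  monotoneOn_of_hasDerivWithinAt_nonneg (f' := d) (convex_Icc a b)
    (fun z hz => (hu z hz).continuousWithinAt)
    (fun z hz => (hu z (interior_subset hz)).mono interior_subset)
    (fun z hz => hd z (interior_subset hz))

theorem SolOn.monotoneOn {k ℓ γ a b : ℝ} (h : Adm k ℓ γ) (ha : 0 < a) {u : ℝ → ℝ}
    (hu : SolOn k ℓ γ u (Icc a b)) : MonotoneOn u (Icc a b) :=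
  monotoneOn_of_deriv_nonneg_Icc hu.ode (fun z hz =>
    (div_pos (DeltaU_pos h (ha.trans_le hz.1) (hu.above z hz).le) (hu.den_pos z hz)).le)

theorem uSonic_DeltaSmallZ_ge {k ℓ γ a z : ℝ} (h : Adm k ℓ γ) (ha : 0 < a) (hz : a ≤ z) :
    k * a * γ * (ℓ * γ - 1) ≤ DeltaSmallZ k ℓ γ z (uSonic ℓ γ z) := by
  have hγ := gamma_pos h.one_lt_ℓ h.γ_gt
  have h1 := one_lt_ell_mul_gamma h.one_lt_ℓ h.γ_gt
  have hℓ := h.one_lt_ℓ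
  have hk := h.one_le_k
  rw [DeltaSmallZ_uSonic]
  have hz0 : 0 < z := ha.trans_le hz
  have h2 : ℓ * γ - 1 ≤ ℓ * (γ + z) - (1 - z) := by nlinarith
  have h3 : 0 ≤ ℓ * γ - 1 := by linarith
  have h4 : γ ≤ γ + z := by linarith
  gcongr

/-- Solutions extend to the left. -/
theorem exists_solOn_Icc {k ℓ γ a b c : ℝ} (h : Adm k ℓ γ) (ha : 0 < a) (hab : a ≤ b)
    (hb : b < 1 / (k + 1)) (hc : uSonic ℓ γ b < c) (hden : 0 < DeltaSmallZ k ℓ γ b c) :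
    ∃ u, SolOn k ℓ γ u (Icc a b) ∧ u b = c := by
  have hγ := gamma_pos h.one_lt_ℓ h.γ_gt
  have hε := eps_pos h.one_lt_ℓ h.γ_gt
  have hℓγ := one_lt_ell_mul_gamma h.one_lt_ℓ h.γ_gt
  have hk := h.one_le_k
  have hk1 : 0 < k + 1 := by linarith
  have hA := h.A_pos
  have hb1 : b * (k + 1) < 1 := by rw [← lt_div_iff₀ hk1]; exact hb
  have hc0 : 0 < c := (uSonic_pos h.one_lt_ℓ h.γ_gt (ha.le.trans hab)).trans hc
  obtain ⟨G, hG⟩ := exists_abs_fPoly_le k ℓ γ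
  have hsub : Icc a b ⊆ Icc 0 (1 / (k + 1)) := Icc_subset_Icc ha.le hb.le
  set C₁ := (k + 1) * c + eps ℓ γ + 2 * cA k ℓ γ + 3 * |cB k ℓ| with hC₁
  have hC₁0 : 0 < C₁ := by positivity
  set p := (1 - (k + 1) * b) * (2 * eps ℓ γ * (k * a * γ)) with hp
  have hp0 : 0 < p := mul_pos (by linarith) (by positivity)
  have hq0 : 0 < k * a * γ * (ℓ * γ - 1) := mul_pos (by positivity) (by linarith)
  -- κ lies below Δ_z at the starting point, below Δ_z on the sonic curve (so that the cut-off is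
  -- inactive there), and below the threshold required by `lt_DeltaSmallZ_of_lt_right`.
  obtain ⟨κ, hκ, hκm⟩ := exists_between (lt_min (lt_min hden hq0) (div_pos hp0 hC₁0))
  have hκ1 : κ < DeltaSmallZ k ℓ γ b c := hκm.trans_le ((min_le_left _ _).trans (min_le_left _ _))
  have hκ2 : κ < k * a * γ * (ℓ * γ - 1) :=
    hκm.trans_le ((min_le_left _ _).trans (min_le_right _ _))
  have hκ3 : κ * C₁ < p := by
    rw [← lt_div_iff₀ hC₁0]; exact hκm.trans_le (min_le_right _ _)
  have hG0 : 0 ≤ G := (abs_nonneg _).trans (hG a (hsub ⟨le_rfl, hab⟩))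
  obtain ⟨u, hub, hu⟩ := exists_solution_of_bounded_lipschitz (F := clampRHS k ℓ γ κ c) hab
    (K := clampLip κ c G) (L := Real.toNNReal (2 * c * (c + G) / κ))
    (fun t ht => lipschitzWith_clampRHS hκ hc0.le hk (hsub ht) (hG t (hsub ht)))
    (fun x => (continuous_clampRHS hκ x).continuousOn)
    (fun t ht x => by
      rw [Real.coe_toNNReal _ (by positivity)]
      exact abs_clampRHS_le hκ hc0.le (hG t (hsub ht)) x) c
  have hbmem : b ∈ Icc a b := ⟨hab, le_rfl⟩
  have hSc : ∀ z ∈ Icc a b, uSonic ℓ γ z ≤ c := fun z hz =>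
    (uSonic_mono h.one_lt_ℓ hγ (ha.le.trans hz.1) hz.2).trans hc.le
  have hS : ∀ z ∈ Icc a b, uSonic ℓ γ z < u z := by
    refine uSonic_lt_of_lt_right h ha hu (fun z hz hzS => ?_) (by rw [hub]; exact hc)
    refine clampRHS_eq ?_ ?_ ?_
    · rw [hzS]; exact (uSonic_pos h.one_lt_ℓ h.γ_gt (ha.le.trans hz.1)).le
    · rw [hzS]; exact hSc z hz
    · rw [hzS]; exact hκ2.le.trans (uSonic_DeltaSmallZ_ge h ha hz.1)
  -- Monotonicity already holds for the cut-off equation, because the clamped value still lies above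
  -- the sonic curve. It gives u ≤ c to the left of b, so the upper cut-off is inactive.
  have hmono : MonotoneOn u (Icc a b) := by
    refine monotoneOn_of_deriv_nonneg_Icc hu (fun z hz => ?_)
    rw [clampRHS]
    refine div_nonneg (DeltaU_pos h (ha.trans_le hz.1) ?_).le (hκ.le.trans (le_max_right _ _))
    exact le_max_of_le_right (le_min (hS z hz).le (hSc z hz))
  have hle : ∀ z ∈ Icc a b, u z ≤ c := fun z hz => by
    rw [← hub]; exact hmono hz hbmem hz.2
  have hpos : ∀ z ∈ Icc a b, 0 ≤ u z := fun z hz =>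
    (uSonic_pos h.one_lt_ℓ h.γ_gt (ha.le.trans hz.1)).le.trans (hS z hz).le
  have hDz : ∀ z ∈ Icc a b, κ < DeltaSmallZ k ℓ γ z (u z) := by
    refine lt_DeltaSmallZ_of_lt_right h ha hb hκ hκ3 hu (fun z hz hz0 => ?_)
      (fun z hz => (hS z hz).le) hle (by rw [hub]; exact hκ1)
    rw [clampRHS_eq (hpos z hz) (hle z hz) hz0.ge, hz0]
  refine ⟨u, ⟨fun z hz => ?_, fun z hz => hκ.trans (hDz z hz), hS⟩, hub⟩
  rw [← clampRHS_eq (hpos z hz) (hle z hz) (hDz z hz).le]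
  exact hu z hz

/-- Solutions extend to the left up to the sonic point. -/
theorem exists_solOn_Ioc {k ℓ γ b c : ℝ} (h : Adm k ℓ γ) (hb0 : 0 < b)
    (hb : b < 1 / (k + 1)) (hc : uSonic ℓ γ b < c) (hden : 0 < DeltaSmallZ k ℓ γ b c) :
    ∃ u, SolOn k ℓ γ u (Ioc 0 b) ∧ u b = c := by
  have hex : ∀ a : ℝ, ∃ u, 0 < a → a ≤ b → SolOn k ℓ γ u (Icc a b) ∧ u b = c := fun a => by
    by_cases haa : 0 < a ∧ a ≤ b
    · obtain ⟨u, hu⟩ := exists_solOn_Icc h haa.1 haa.2 hb hc hden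
      exact ⟨u, fun _ _ => hu⟩
    · exact ⟨0, fun h1 h2 => absurd ⟨h1, h2⟩ haa⟩
  choose U hU using hex
  have hagree : ∀ a z, 0 < a → a ≤ z → z ≤ b → U a z = U (z / 2) z := by
    intro a z ha haz hzb
    have hz : 0 < z := ha.trans_le haz
    have h1 := hU a ha (haz.trans hzb)
    have h2 := hU (z / 2) (by linarith) (by linarith)
    exact SolOn.eqOn h hz.le hb.le (h1.1.mono (Icc_subset_Icc_left haz))
      (h2.1.mono (Icc_subset_Icc_left (by linarith))) (h1.2.trans h2.2.symm) ⟨le_rfl, hzb⟩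
  have hval : ∀ a, 0 < a → ∀ z ∈ Icc a b, U (z / 2) z = U a z := fun a ha z hz =>
    (hagree a z ha hz.1 hz.2).symm
  -- The value at z is taken from the solution on [z/2, b], so that z lies away from its left end;
  -- by uniqueness every other left end below z gives the same value.
  refine ⟨fun z => U (z / 2) z, ⟨fun z hz => ?_, fun z hz => ?_, fun z hz => ?_⟩, ?_⟩
  · have ha : 0 < z / 2 := by linarith [hz.1]
    have hzm : z ∈ Icc (z / 2) b := ⟨by linarith [hz.1], hz.2⟩
    have h1 := ((hU (z / 2) ha (hzm.1.trans hzm.2)).1.ode z hzm)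
    have h2 := h1.congr (hval (z / 2) ha) (hval (z / 2) ha z hzm)
    refine h2.mono_of_mem_nhdsWithin ?_
    exact mem_of_superset (inter_mem_nhdsWithin (Ioc 0 b) (Ioi_mem_nhds (by linarith [hz.1])))
      (fun w hw => ⟨le_of_lt hw.2, hw.1.2⟩)
  · have ha : 0 < z / 2 := by linarith [hz.1]
    have hzm : z ∈ Icc (z / 2) b := ⟨by linarith [hz.1], hz.2⟩
    exact (hU (z / 2) ha (hzm.1.trans hzm.2)).1.den_pos z hzm
  · have ha : 0 < z / 2 := by linarith [hz.1]
    have hzm : z ∈ Icc (z / 2) b := ⟨by linarith [hz.1], hz.2⟩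
    exact (hU (z / 2) ha (hzm.1.trans hzm.2)).1.above z hzm
  · exact (hU (b / 2) (by linarith) (by linarith)).2

/-! ### Inverse functions on intervals -/

theorem strictMonoOn_Ioo_of_hasDerivAt_pos {f f' : ℝ → ℝ} {a b : ℝ}
    (hf : ∀ x ∈ Ioo a b, HasDerivAt f (f' x) x) (hpos : ∀ x ∈ Ioo a b, 0 < f' x) :
    StrictMonoOn f (Ioo a b) := by
  refine strictMonoOn_of_deriv_pos (convex_Ioo a b)
    (fun x hx => (hf x hx).continuousAt.continuousWithinAt) (fun x hx => ?_)
  rw [interior_Ioo] at hx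
  rw [(hf x hx).deriv]; exact hpos x hx

/-- A function with positive derivative on an open interval has a differentiable inverse. -/
theorem exists_inverse_Ioo {f f' : ℝ → ℝ} {a b : ℝ}
    (hf : ∀ x ∈ Ioo a b, HasDerivAt f (f' x) x) (hpos : ∀ x ∈ Ioo a b, 0 < f' x) :
    ∃ g : ℝ → ℝ, (∀ x ∈ Ioo a b, g (f x) = x) ∧
      (∀ x ∈ Ioo a b, HasDerivAt g (f' x)⁻¹ (f x)) ∧
      ∀ x ∈ Ioo a b, f '' Ioo a b ∈ 𝓝 (f x) := by
  have hmono := strictMonoOn_Ioo_of_hasDerivAt_pos hf hpos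
  have hcont : ContinuousOn f (Ioo a b) := fun x hx => (hf x hx).continuousAt.continuousWithinAt
  set g := Function.invFunOn f (Ioo a b) with hg
  have hleft : ∀ x ∈ Ioo a b, g (f x) = x := fun x hx => hmono.injOn.leftInvOn_invFunOn hx
  have himg : ∀ x ∈ Ioo a b, f '' Ioo a b ∈ 𝓝 (f x) := by
    intro x hx
    obtain ⟨x₁, h1, h1'⟩ := exists_between hx.1
    obtain ⟨x₂, h2, h2'⟩ := exists_between hx.2
    have m1 : x₁ ∈ Ioo a b := ⟨h1, h1'.trans hx.2⟩
    have m2 : x₂ ∈ Ioo a b := ⟨hx.1.trans h2, h2'⟩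
    have hsub : Icc x₁ x₂ ⊆ Ioo a b := fun y hy => ⟨h1.trans_le hy.1, hy.2.trans_lt h2'⟩
    refine mem_of_superset (Icc_mem_nhds (hmono m1 hx h1') (hmono hx m2 h2)) ?_
    exact (intermediate_value_Icc (h1'.trans h2).le (hcont.mono hsub)).trans (image_mono hsub)
  refine ⟨g, hleft, fun x hx => ?_, himg⟩
  have hgm : MonotoneOn g (f '' Ioo a b) := by
    rintro _ ⟨x, hx, rfl⟩ _ ⟨y, hy, rfl⟩ hxy
    rw [hleft x hx, hleft y hy]
    exact (hmono.le_iff_le hx hy).1 hxy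
  have hgi : g '' (f '' Ioo a b) = Ioo a b := by
    ext y; constructor
    · rintro ⟨_, ⟨x, hx, rfl⟩, rfl⟩; rw [hleft x hx]; exact hx
    · intro hy; exact ⟨f y, ⟨y, hy, rfl⟩, hleft y hy⟩
  have hgc : ContinuousAt g (f x) := by
    refine continuousAt_of_monotoneOn_of_image_mem_nhds hgm (himg x hx) ?_
    rw [hgi, hleft x hx]; exact Ioo_mem_nhds hx.1 hx.2
  refine HasDerivAt.of_local_left_inverse (f := f) hgc ?_ (hpos x hx).ne' ?_
  · rw [hleft x hx]; exact hf x hx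
  · filter_upwards [himg x hx] with y hy
    obtain ⟨w, hw, rfl⟩ := hy
    rw [hleft w hw]

/-! ### The chart at `Q₀` -/

/-- Coefficients of the polynomial `(1 - z) (-f(z))` at `z = 1 / (k + 1) - s`. -/
def chartG (k ℓ γ : ℝ) : Fin 4 → ℝ :=
  let z₀ := 1 / (k + 1)
  let F₀ := eps ℓ γ + cA k ℓ γ * z₀ - cB k ℓ * z₀ ^ 2
  let F₁ := -cA k ℓ γ + 2 * cB k ℓ * z₀
  ![(1 - z₀) * F₀, (1 - z₀) * F₁ + F₀, (1 - z₀) * (-cB k ℓ) + F₁, -cB k ℓ]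

/-- Coefficients of the primitive of `f(z) + k z (1 - z)` at `z = 1 / (k + 1) - s`. -/
def chartH (k ℓ γ : ℝ) : Fin 4 → ℝ :=
  let z₀ := 1 / (k + 1)
  ![0, -eps ℓ γ + (k - cA k ℓ γ) * z₀ + (cB k ℓ - k) * z₀ ^ 2,
    (-(k - cA k ℓ γ) - 2 * (cB k ℓ - k) * z₀) / 2, (cB k ℓ - k) / 3]

theorem chartG_eq (k ℓ γ s : ℝ) :
    chartG k ℓ γ 0 + chartG k ℓ γ 1 * s + chartG k ℓ γ 2 * s ^ 2 + chartG k ℓ γ 3 * s ^ 3 =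
      (1 - (1 / (k + 1) - s)) * (-fPoly k ℓ γ (1 / (k + 1) - s)) := by
  simp only [chartG, fPoly, Matrix.cons_val]
  ring

theorem chartH_eq (k ℓ γ s : ℝ) :
    chartH k ℓ γ 1 + 2 * chartH k ℓ γ 2 * s + 3 * chartH k ℓ γ 3 * s ^ 2 =
      fPoly k ℓ γ (1 / (k + 1) - s) +
        k * (1 / (k + 1) - s) * (1 - (1 / (k + 1) - s)) := by
  simp only [chartH, fPoly, Matrix.cons_val]
  ring

theorem chartG_zero_pos {k ℓ γ : ℝ} (h : Adm k ℓ γ) : 0 < chartG k ℓ γ 0 := by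
  have hk := h.one_le_k
  have hk1 : 0 < k + 1 := by linarith
  have e := chartG_eq k ℓ γ 0
  simp only [mul_zero, add_zero, ne_eq, OfNat.ofNat_ne_zero, not_false_eq_true, zero_pow,
    sub_zero] at e
  rw [e]
  have h1 := fPoly_neg h (z := 1 / (k + 1)) ⟨by positivity, le_rfl⟩
  have h2 : 1 / (k + 1) < 1 := by rw [div_lt_one hk1]; linarith
  exact mul_pos (by linarith) (by linarith)

theorem continuous_chartG (k ℓ : ℝ) (i : Fin 4) : Continuous fun γ => chartG k ℓ γ i := by
  fin_cases i <;> simp [chartG, eps, cA] <;> fun_prop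

theorem continuous_chartH (k ℓ : ℝ) (i : Fin 4) : Continuous fun γ => chartH k ℓ γ i := by
  fin_cases i <;> simp [chartH, eps, cA] <;> fun_prop

/-- The power series `s(y)` for which `z = 1 / (k + 1) - s(1 / u)` is the curve through `Q₀`. -/
def chartPs (k ℓ γ : ℝ) : PowerSeries ℝ := singPs (k + 1) (chartG k ℓ γ) (chartH k ℓ γ)

/-- The curve through `Q₀`, as a graph over `y = 1 / u`. -/
def chartZ (k ℓ γ y : ℝ) : ℝ := 1 / (k + 1) - psSum (chartPs k ℓ γ) y

theorem coeff_zero_chartPs (k ℓ γ : ℝ) : PowerSeries.coeff 0 (chartPs k ℓ γ) = 0 :=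
  coeff_zero_singPs _ _ _

theorem psSum_chartPs_zero (k ℓ γ : ℝ) : psSum (chartPs k ℓ γ) 0 = 0 := by
  rw [psSum, tsum_eq_single 0 (fun n hn => by simp [hn]), coeff_zero_chartPs]; simp

/-- The chart is good up to `y₁`. -/
structure ChartOn (k ℓ γ y₁ : ℝ) : Prop where
  pos : 0 < y₁
  conv : ∃ r > y₁, PsConv r (chartPs k ℓ γ)
  z_pos : ∀ y ∈ Ioc 0 y₁, 0 < chartZ k ℓ γ y
  den_pos : ∀ y ∈ Ioc 0 y₁, 0 < DeltaSmallZ k ℓ γ (chartZ k ℓ γ y) (1 / y)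
  above : ∀ y ∈ Ioc 0 y₁, uSonic ℓ γ (chartZ k ℓ γ y) < 1 / y

theorem ChartOn.mono {k ℓ γ y₁ y₂ : ℝ} (h : ChartOn k ℓ γ y₁) (h2 : 0 < y₂) (hy : y₂ ≤ y₁) :
    ChartOn k ℓ γ y₂ := by
  obtain ⟨r, hr, hc⟩ := h.conv
  exact ⟨h2, ⟨r, by linarith, hc⟩, fun y hy' => h.z_pos y ⟨hy'.1, hy'.2.trans hy⟩,
    fun y hy' => h.den_pos y ⟨hy'.1, hy'.2.trans hy⟩, fun y hy' => h.above y ⟨hy'.1, hy'.2.trans hy⟩⟩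

/-- With u = 1/y and z = 1/(k+1) - s, both y Δ_z and y² Δ_u are polynomials in y and s, and the z-u
equation reads s' y² Δ_u = Δ_z. Multiplied by y, this is the singular equation solved by `singPs`
with κ = k + 1. The slope du/dz is 1/(y² s'). -/
theorem ChartOn.hasDerivAt {k ℓ γ y₁ y : ℝ} (h : ChartOn k ℓ γ y₁) (ha : Adm k ℓ γ)
    (hy : y ∈ Ioc 0 y₁) :
    HasDerivAt (psSum (chartPs k ℓ γ)) (deriv (psSum (chartPs k ℓ γ)) y) y ∧
      0 < deriv (psSum (chartPs k ℓ γ)) y ∧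
      (deriv (psSum (chartPs k ℓ γ)) y)⁻¹ / y ^ 2 =
        DeltaU k ℓ γ (chartZ k ℓ γ y) (1 / y) / DeltaSmallZ k ℓ γ (chartZ k ℓ γ y) (1 / y) := by
  obtain ⟨r, hr, hc⟩ := h.conv
  have hyr : |y| < r := by rw [abs_of_pos hy.1]; exact hy.2.trans_lt hr
  have hd := (hasDerivAt_psSum hc hyr).differentiableAt.hasDerivAt
  have hk := ha.one_le_k
  have hode := singPs_ode (κ := k + 1) (by linarith) hc hyr
  change 2 * y * deriv (psSum (chartPs k ℓ γ)) y + (k + 1) * psSum (chartPs k ℓ γ) y = _ at hode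
  change _ = y * (_ + _ * psSum (chartPs k ℓ γ) y + _ * psSum (chartPs k ℓ γ) y ^ 2 +
    _ * psSum (chartPs k ℓ γ) y ^ 3) - 2 * y ^ 2 * ((_ + _ * psSum (chartPs k ℓ γ) y
      + _ * psSum (chartPs k ℓ γ) y ^ 2) * deriv (psSum (chartPs k ℓ γ)) y) at hode
  rw [chartG_eq, chartH_eq] at hode
  have hz := h.z_pos y hy
  have hden := h.den_pos y hy
  have hU := DeltaU_pos ha hz (h.above y hy).le
  set s' := deriv (psSum (chartPs k ℓ γ)) y
  set s := psSum (chartPs k ℓ γ) y with hs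
  have hzs : chartZ k ℓ γ y = 1 / (k + 1) - s := rfl
  rw [← hzs] at hode
  set z := chartZ k ℓ γ y
  have hsz : (k + 1) * s = 1 - (k + 1) * z := by rw [hzs]; field_simp; ring
  have hy0 := hy.1
  have e1 : y * DeltaSmallZ k ℓ γ z (1 / y) = -((k + 1) * s) + y * ((1 - z) * (-fPoly k ℓ γ z)) := by
    rw [DeltaSmallZ, hsz]; field_simp; ring
  have e2 : y ^ 2 * DeltaU k ℓ γ z (1 / y) = 2 * (1 + y * (fPoly k ℓ γ z + k * z * (1 - z))) := by
    rw [DeltaU]; field_simp; ring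
  have e3 : s' * (y ^ 2 * DeltaU k ℓ γ z (1 / y)) = DeltaSmallZ k ℓ γ z (1 / y) := by
    rw [e2]
    have : y * (s' * (2 * (1 + y * (fPoly k ℓ γ z + k * z * (1 - z))))) =
        y * DeltaSmallZ k ℓ γ z (1 / y) := by
      rw [e1]; linear_combination hode
    exact mul_left_cancel₀ hy0.ne' this
  have hpos : 0 < s' := by
    have h1 : 0 < y ^ 2 * DeltaU k ℓ γ z (1 / y) := by positivity
    rw [← e3] at hden
    exact pos_of_mul_pos_left hden h1.le
  refine ⟨hd, hpos, ?_⟩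
  rw [← e3]
  field_simp

theorem ChartOn.strictMonoOn {k ℓ γ y₁ : ℝ} (h : ChartOn k ℓ γ y₁) (ha : Adm k ℓ γ) :
    StrictMonoOn (psSum (chartPs k ℓ γ)) (Icc 0 y₁) := by
  obtain ⟨r, hr, hc⟩ := h.conv
  refine strictMonoOn_of_deriv_pos (convex_Icc 0 y₁) (fun y hy => ?_) (fun y hy => ?_)
  · have : |y| < r := by rw [abs_of_nonneg hy.1]; exact hy.2.trans_lt hr
    exact (hasDerivAt_psSum hc this).continuousAt.continuousWithinAt
  · rw [interior_Icc] at hy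
    exact (h.hasDerivAt ha ⟨hy.1, hy.2.le⟩).2.1

theorem ChartOn.continuousOn {k ℓ γ y₁ : ℝ} (h : ChartOn k ℓ γ y₁) :
    ContinuousOn (psSum (chartPs k ℓ γ)) (Icc 0 y₁) := by
  obtain ⟨r, hr, hc⟩ := h.conv
  intro y hy
  have : |y| < r := by rw [abs_of_nonneg hy.1]; exact hy.2.trans_lt hr
  exact (hasDerivAt_psSum hc this).continuousAt.continuousWithinAt

theorem ChartOn.psSum_pos {k ℓ γ y₁ y : ℝ} (h : ChartOn k ℓ γ y₁) (ha : Adm k ℓ γ)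
    (hy : y ∈ Ioc 0 y₁) : 0 < psSum (chartPs k ℓ γ) y := by
  have := h.strictMonoOn ha (left_mem_Icc.2 h.pos.le) (Ioc_subset_Icc_self hy) hy.1
  rwa [psSum_chartPs_zero] at this

theorem ChartOn.chartZ_mem {k ℓ γ y₁ y : ℝ} (h : ChartOn k ℓ γ y₁) (ha : Adm k ℓ γ)
    (hy : y ∈ Ioc 0 y₁) : chartZ k ℓ γ y ∈ Ioo 0 (1 / (k + 1)) :=
  ⟨h.z_pos y hy, by have := h.psSum_pos ha hy; rw [chartZ]; linarith⟩

theorem ChartOn.chartZ_lt {k ℓ γ y₁ x y : ℝ} (h : ChartOn k ℓ γ y₁) (ha : Adm k ℓ γ)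
    (hx : x ∈ Icc 0 y₁) (hy : y ∈ Icc 0 y₁) (hxy : x < y) : chartZ k ℓ γ y < chartZ k ℓ γ x := by
  have := h.strictMonoOn ha hx hy hxy
  rw [chartZ, chartZ]; linarith

/-- The solution near `Q₀` in the original variables. -/
theorem ChartOn.exists_solOn {k ℓ γ y₁ : ℝ} (h : ChartOn k ℓ γ y₁) (ha : Adm k ℓ γ) :
    ∃ u, SolOn k ℓ γ u (Ioo (chartZ k ℓ γ y₁) (1 / (k + 1))) ∧
      ∀ y ∈ Ioo 0 y₁, u (chartZ k ℓ γ y) = 1 / y := by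
  obtain ⟨g, hg, hg', -⟩ := exists_inverse_Ioo (f := psSum (chartPs k ℓ γ)) (a := 0) (b := y₁)
    (fun y hy => (h.hasDerivAt ha ⟨hy.1, hy.2.le⟩).1)
    (fun y hy => (h.hasDerivAt ha ⟨hy.1, hy.2.le⟩).2.1)
  have hval : ∀ y ∈ Ioo 0 y₁, 1 / g (1 / (k + 1) - chartZ k ℓ γ y) = 1 / y := fun y hy => by
    rw [chartZ, sub_sub_cancel, hg y hy]
  have hsurj : ∀ z ∈ Ioo (chartZ k ℓ γ y₁) (1 / (k + 1)), ∃ y ∈ Ioo 0 y₁, chartZ k ℓ γ y = z := by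
    intro z hz
    have := intermediate_value_Ioo h.pos.le h.continuousOn
    rw [psSum_chartPs_zero] at this
    obtain ⟨y, hy, hyz⟩ := this (a := 1 / (k + 1) - z)
      ⟨by linarith [hz.2], by have := hz.1; rw [chartZ] at this; linarith⟩
    exact ⟨y, hy, by rw [chartZ, hyz]; ring⟩
  refine ⟨fun z => 1 / g (1 / (k + 1) - z), ⟨fun z hz => ?_, fun z hz => ?_, fun z hz => ?_⟩, hval⟩
  · obtain ⟨y, hy, rfl⟩ := hsurj z hz
    have hy' : y ∈ Ioc 0 y₁ := ⟨hy.1, hy.2.le⟩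
    rw [hval y hy, ← (h.hasDerivAt ha hy').2.2]
    have hge : g (1 / (k + 1) - chartZ k ℓ γ y) = y := by rw [chartZ, sub_sub_cancel, hg y hy]
    have h1 : HasDerivAt g (deriv (psSum (chartPs k ℓ γ)) y)⁻¹ (1 / (k + 1) - chartZ k ℓ γ y) := by
      have := hg' y hy
      rwa [show psSum (chartPs k ℓ γ) y = 1 / (k + 1) - chartZ k ℓ γ y by rw [chartZ]; ring] at this
    have h2 := h1.comp (chartZ k ℓ γ y) ((hasDerivAt_id _).const_sub (1 / (k + 1)))
    have h3 := h2.inv (by simp only [Function.comp]; rw [hge]; exact hy.1.ne')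
    have h4 : HasDerivAt (fun z => 1 / g (1 / (k + 1) - z))
        ((deriv (psSum (chartPs k ℓ γ)) y)⁻¹ / y ^ 2) (chartZ k ℓ γ y) := by
      simp only [one_div]
      refine (h3.congr_deriv ?_).congr_of_eventuallyEq ?_
      · simp only [Function.comp, hge]; ring
      · exact Eventually.of_forall (fun z => by simp)
    exact h4.hasDerivWithinAt
  · obtain ⟨y, hy, rfl⟩ := hsurj z hz
    rw [hval y hy]; exact h.den_pos y ⟨hy.1, hy.2.le⟩
  · obtain ⟨y, hy, rfl⟩ := hsurj z hz
    rw [hval y hy]; exact h.above y ⟨hy.1, hy.2.le⟩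

/-- `u` is the solution of the `z-u` equation on `(0, 1/(k+1))` emanating from `Q₀`. -/
structure IsCurve (k ℓ γ : ℝ) (u : ℝ → ℝ) : Prop where
  sol : SolOn k ℓ γ u (Ioo 0 (1 / (k + 1)))
  chart : ∃ y₀ > 0, ∀ y ∈ Ioc 0 y₀, u (chartZ k ℓ γ y) = 1 / y

/-- The chart solution and its continuation to the left from the chart point y₁/2 overlap on an
interval, where uniqueness identifies them; the glued function is therefore differentiable at the
junction. -/
theorem ChartOn.exists_isCurve {k ℓ γ y₁ : ℝ} (h : ChartOn k ℓ γ y₁) (ha : Adm k ℓ γ) :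
    ∃ u, IsCurve k ℓ γ u ∧ ∀ y ∈ Ioo 0 y₁, u (chartZ k ℓ γ y) = 1 / y := by
  obtain ⟨w, hw, hwy⟩ := h.exists_solOn ha
  have hp := h.pos
  have hm : ∀ t ∈ Ioc (0 : ℝ) 1, t * y₁ ∈ Ioc 0 y₁ := fun t ht =>
    ⟨mul_pos ht.1 hp, by nlinarith [ht.2]⟩
  set yb := 1 / 2 * y₁ with hyb
  have hybm : yb ∈ Ioc 0 y₁ := hm _ (by norm_num)
  set zb := chartZ k ℓ γ yb with hzb
  have hzbm := h.chartZ_mem ha hybm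
  obtain ⟨v, hv, hvb⟩ := exists_solOn_Ioc ha hzbm.1 hzbm.2 (h.above yb hybm) (h.den_pos yb hybm)
  have hwb : w zb = 1 / yb := hwy yb ⟨hybm.1, by rw [hyb]; linarith⟩
  have heq : ∀ z ∈ Ioc (chartZ k ℓ γ y₁) zb, w z = v z := by
    intro z hz
    have hz0 : 0 < z := (h.z_pos y₁ ⟨hp, le_rfl⟩).trans hz.1
    exact SolOn.eqOn ha hz0.le hzbm.2.le
      (hw.mono (fun x hx => ⟨hz.1.trans_le hx.1, hx.2.trans_lt hzbm.2⟩))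
      (hv.mono (fun x hx => ⟨hz0.trans_le hx.1, hx.2⟩)) (hwb.trans hvb.symm) ⟨le_rfl, hz.2⟩
  have hzlt : chartZ k ℓ γ y₁ < zb := h.chartZ_lt ha ⟨hybm.1.le, hybm.2⟩ ⟨hp.le, le_rfl⟩
    (by rw [hyb]; linarith)
  set u : ℝ → ℝ := fun z => if z < zb then v z else w z with hu
  have huw : ∀ z, chartZ k ℓ γ y₁ < z → u z = w z := by
    intro z hz
    simp only [hu]
    split_ifs with h1
    · exact (heq z ⟨hz, h1.le⟩).symm
    · rfl
  have huv : ∀ z, z < zb → u z = v z := fun z hz => by simp only [hu, if_pos hz]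
  have hval : ∀ y ∈ Ioo 0 y₁, u (chartZ k ℓ γ y) = 1 / y := fun y hy => by
    rw [huw _ (h.chartZ_lt ha ⟨hy.1.le, hy.2.le⟩ ⟨hp.le, le_rfl⟩ hy.2), hwy y hy]
  refine ⟨u, ⟨⟨fun z hz => ?_, fun z hz => ?_, fun z hz => ?_⟩,
    yb, hybm.1, fun y hy => hval y ⟨hy.1, hy.2.trans_lt (by rw [hyb]; linarith)⟩⟩, hval⟩
  · rcases lt_or_ge z zb with hzz | hzz
    · have h1 := hv.ode z ⟨hz.1, hzz.le⟩
      have h2 : HasDerivAt v _ z := h1.hasDerivAt (mem_of_superset (Ioo_mem_nhds hz.1 hzz)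
        Ioo_subset_Ioc_self)
      rw [huv z hzz]
      exact (h2.congr_of_eventuallyEq (by
        filter_upwards [Iio_mem_nhds hzz] with x hx using huv x hx)).hasDerivWithinAt
    · have hzc : chartZ k ℓ γ y₁ < z := hzlt.trans_le hzz
      have h2 : HasDerivAt w _ z := (hw.ode z ⟨hzc, hz.2⟩).hasDerivAt (Ioo_mem_nhds hzc hz.2)
      rw [huw z hzc]
      exact (h2.congr_of_eventuallyEq (by
        filter_upwards [Ioi_mem_nhds hzc] with x hx using huw x hx)).hasDerivWithinAt
  · rcases lt_or_ge z zb with hzz | hzz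
    · rw [huv z hzz]; exact hv.den_pos z ⟨hz.1, hzz.le⟩
    · have hzc : chartZ k ℓ γ y₁ < z := hzlt.trans_le hzz
      rw [huw z hzc]; exact hw.den_pos z ⟨hzc, hz.2⟩
  · rcases lt_or_ge z zb with hzz | hzz
    · rw [huv z hzz]; exact hv.above z ⟨hz.1, hzz.le⟩
    · have hzc : chartZ k ℓ γ y₁ < z := hzlt.trans_le hzz
      rw [huw z hzc]; exact hw.above z ⟨hzc, hz.2⟩

/-- Both curves agree at chart points arbitrarily close to 1/(k+1), and uniqueness propagates the
equality to the left. -/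
theorem ChartOn.eqOn {k ℓ γ y₁ : ℝ} (h : ChartOn k ℓ γ y₁) (ha : Adm k ℓ γ) {u w : ℝ → ℝ}
    (hu : IsCurve k ℓ γ u) (hw : IsCurve k ℓ γ w) : EqOn u w (Ioo 0 (1 / (k + 1))) := by
  obtain ⟨y₀, hy₀, hy⟩ := hu.chart
  obtain ⟨y₂, hy₂, hy'⟩ := hw.chart
  intro z hz
  have hc : ContinuousWithinAt (psSum (chartPs k ℓ γ)) (Ioc 0 y₁) 0 :=
    (h.continuousOn 0 (left_mem_Icc.2 h.pos.le)).mono Ioc_subset_Icc_self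
  have ht : Tendsto (psSum (chartPs k ℓ γ)) (𝓝[>] 0) (𝓝 0) := by
    rw [ContinuousWithinAt, nhdsWithin_Ioc_eq_nhdsGT h.pos, psSum_chartPs_zero] at hc
    exact hc
  have e₁ : ∀ᶠ y in 𝓝[>] (0 : ℝ), y ∈ Ioc 0 (min y₀ y₂) := Ioc_mem_nhdsGT (lt_min hy₀ hy₂)
  have e₂ : ∀ᶠ y in 𝓝[>] (0 : ℝ), y ∈ Ioc 0 y₁ := Ioc_mem_nhdsGT h.pos
  obtain ⟨y, h1, h2, h3⟩ := ((ht.eventually_lt_const (sub_pos.2 hz.2)).and (e₁.and e₂)).exists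
  have hzy : z < chartZ k ℓ γ y := by rw [chartZ]; linarith
  have hm := h.chartZ_mem ha h3
  have hsub : Icc z (chartZ k ℓ γ y) ⊆ Ioo 0 (1 / (k + 1)) :=
    fun x hx => ⟨hz.1.trans_le hx.1, hx.2.trans_lt hm.2⟩
  refine SolOn.eqOn ha hz.1.le hm.2.le (hu.sol.mono hsub) (hw.sol.mono hsub) ?_ ⟨le_rfl, hzy.le⟩
  rw [hy y ⟨h2.1, h2.2.trans (min_le_left _ _)⟩, hy' y ⟨h2.1, h2.2.trans (min_le_right _ _)⟩]

/-! ### Uniformity of the chart at `Q₀` in the parameter -/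

theorem continuous_eps (ℓ : ℝ) : Continuous (eps ℓ) := by unfold eps; fun_prop

theorem continuous_cA (k ℓ : ℝ) : Continuous (cA k ℓ) := by unfold cA; fun_prop

theorem Adm.eventually {k ℓ γ₀ : ℝ} (h : Adm k ℓ γ₀) : ∀ᶠ γ in 𝓝 γ₀, Adm k ℓ γ := by
  filter_upwards [Ioi_mem_nhds h.γ_gt,
    (continuous_cA k ℓ).continuousAt.eventually_const_lt h.A_pos] with γ h1 h2
  exact ⟨h.one_le_k, h.one_lt_ℓ, h1, h2⟩

theorem exists_psNorm_chartPs_le {k : ℝ} (hk : 1 ≤ k) (ℓ γ₀ : ℝ) :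
    ∃ r > 0, ∀ᶠ γ in 𝓝 γ₀, ∀ N, psNorm r N (chartPs k ℓ γ) ≤ 1 := by
  set S : ℝ → ℝ := fun γ => ∑ i, |chartG k ℓ γ i| + ∑ i, |chartH k ℓ γ i| with hS
  have hcont : Continuous S := by
    refine (continuous_finsetSum _ (fun i _ => (continuous_chartG k ℓ i).abs)).add
      (continuous_finsetSum _ (fun i _ => (continuous_chartH k ℓ i).abs))
  have hS0 : ∀ γ, 0 ≤ S γ := fun γ => add_nonneg (Finset.sum_nonneg fun _ _ => abs_nonneg _)
    (Finset.sum_nonneg fun _ _ => abs_nonneg _)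
  have hp : 0 < S γ₀ + 1 := by linarith [hS0 γ₀]
  refine ⟨1 / (S γ₀ + 1), by positivity, ?_⟩
  filter_upwards [hcont.continuousAt.eventually_lt_const (lt_add_one (S γ₀))] with γ hγ N
  refine psNorm_singPs_le_one (by linarith) (by positivity) ?_ N
  rw [one_div, inv_mul_le_iff₀ hp, mul_one]
  exact hγ.le

theorem tsum_tail_le_of_psNorm_le {r c : ℝ} (hr : 0 ≤ r) {f : PowerSeries ℝ}
    (h : ∀ N, psNorm r N f ≤ c) (m : ℕ) :
    ∑' n, |PowerSeries.coeff (n + m) f| * r ^ (n + m) ≤ c := by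
  have h1 := tsum_le_of_psNorm_le hr h
  have h2 := (psConv_of_psNorm_le hr h).sum_add_tsum_nat_add m
  have h3 := psNorm_nonneg hr m f
  rw [psNorm] at h3
  linarith

theorem abs_psSum_chartPs_le {k ℓ γ r y : ℝ} (hr : 0 < r)
    (h : ∀ N, psNorm r N (chartPs k ℓ γ) ≤ 1) (hy : |y| ≤ r) :
    |psSum (chartPs k ℓ γ) y| ≤ |y| / r := by
  have h1 := abs_psSum_sub_sum_le hr (psConv_of_psNorm_le hr.le h) hy 1
  rw [Finset.sum_range_one, coeff_zero_chartPs, zero_mul, sub_zero, pow_one] at h1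
  refine h1.trans ?_
  exact mul_le_of_le_one_right (by positivity) (tsum_tail_le_of_psNorm_le hr.le h 1)

theorem abs_psSum_chartPs_sub_le {k ℓ γ r y : ℝ} (hr : 0 < r)
    (h : ∀ N, psNorm r N (chartPs k ℓ γ) ≤ 1) (hy : |y| ≤ r) :
    |psSum (chartPs k ℓ γ) y - chartG k ℓ γ 0 / (k + 3) * y| ≤ (|y| / r) ^ 2 := by
  have h1 := abs_psSum_sub_sum_le hr (psConv_of_psNorm_le hr.le h) hy 2
  rw [Finset.sum_range_succ, Finset.sum_range_one, coeff_zero_chartPs, zero_mul, zero_add,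
    pow_one, chartPs, coeff_one_singPs, show (2 + (k + 1) : ℝ) = k + 3 by ring] at h1
  refine h1.trans ?_
  exact mul_le_of_le_one_right (by positivity) (tsum_tail_le_of_psNorm_le hr.le h 2)

/-- The chart is good on an interval that is locally uniform in `γ`. -/
theorem Adm.exists_chartOn {k ℓ γ₀ : ℝ} (h : Adm k ℓ γ₀) :
    ∃ y₁ > 0, ∀ᶠ γ in 𝓝 γ₀, ChartOn k ℓ γ y₁ := by
  have hk := h.one_le_k
  have hk1 : 0 < k + 1 := by linarith
  obtain ⟨r, hr, hev⟩ := exists_psNorm_chartPs_le hk ℓ γ₀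
  -- All limits are taken jointly in γ and y; the y-interval obtained is then uniform in γ.
  set F := 𝓝 γ₀ ×ˢ 𝓝[>] (0 : ℝ) with hF
  have t1 : Tendsto (fun p : ℝ × ℝ => p.1) F (𝓝 γ₀) := tendsto_fst
  have t2 : Tendsto (fun p : ℝ × ℝ => p.2) F (𝓝[>] 0) := tendsto_snd
  have t2' : Tendsto (fun p : ℝ × ℝ => p.2) F (𝓝 0) := t2.mono_right nhdsWithin_le_nhds
  have e1 : ∀ᶠ p in F, ∀ N, psNorm r N (chartPs k ℓ p.1) ≤ 1 := t1.eventually hev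
  have e2 : ∀ᶠ p in F, 0 < p.2 ∧ p.2 < r := by
    have : ∀ᶠ y in 𝓝[>] (0 : ℝ), y ∈ Ioo 0 r := Ioo_mem_nhdsGT hr
    exact t2.eventually this
  have ts : Tendsto (fun p : ℝ × ℝ => psSum (chartPs k ℓ p.1) p.2) F (𝓝 0) := by
    have hb : Tendsto (fun p : ℝ × ℝ => |p.2| / r) F (𝓝 0) := by
      simpa using t2'.abs.div_const r
    refine squeeze_zero_norm' ?_ hb
    filter_upwards [e1, e2] with p h1 h2
    exact abs_psSum_chartPs_le hr h1 (by rw [abs_of_pos h2.1]; exact h2.2.le)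
  have tg : Tendsto (fun p : ℝ × ℝ => chartG k ℓ p.1 0) F (𝓝 (chartG k ℓ γ₀ 0)) :=
    ((continuous_chartG k ℓ 0).tendsto γ₀).comp t1
  have tq : Tendsto (fun p : ℝ × ℝ => psSum (chartPs k ℓ p.1) p.2 / p.2) F
      (𝓝 (chartG k ℓ γ₀ 0 / (k + 3))) := by
    have hb : Tendsto (fun p : ℝ × ℝ => |p.2| / r ^ 2) F (𝓝 0) := by
      simpa using t2'.abs.div_const (r ^ 2)
    have hd : Tendsto (fun p : ℝ × ℝ => psSum (chartPs k ℓ p.1) p.2 / p.2 -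
        chartG k ℓ p.1 0 / (k + 3)) F (𝓝 0) := by
      refine squeeze_zero_norm' ?_ hb
      filter_upwards [e1, e2] with p h1 h2
      have h3 := abs_psSum_chartPs_sub_le hr h1 (by rw [abs_of_pos h2.1]; exact h2.2.le)
      have e : psSum (chartPs k ℓ p.1) p.2 / p.2 - chartG k ℓ p.1 0 / (k + 3) =
          (psSum (chartPs k ℓ p.1) p.2 - chartG k ℓ p.1 0 / (k + 3) * p.2) / p.2 := by
        have := h2.1.ne'
        rw [sub_div, mul_div_assoc, div_self this, mul_one]
      rw [e, Real.norm_eq_abs, abs_div, div_le_iff₀ (abs_pos.2 h2.1.ne')]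
      refine h3.trans (le_of_eq ?_)
      ring
    have := hd.add (tg.div_const (k + 3))
    simpa using this
  have tz : Tendsto (fun p : ℝ × ℝ => chartZ k ℓ p.1 p.2) F (𝓝 (1 / (k + 1))) := by
    have := ts.const_sub (1 / (k + 1))
    simpa [chartZ] using this
  have tε : Tendsto (fun p : ℝ × ℝ => eps ℓ p.1) F (𝓝 (eps ℓ γ₀)) :=
    ((continuous_eps ℓ).tendsto γ₀).comp t1
  have tA : Tendsto (fun p : ℝ × ℝ => cA k ℓ p.1) F (𝓝 (cA k ℓ γ₀)) :=
    ((continuous_cA k ℓ).tendsto γ₀).comp t1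
  have tf : Tendsto (fun p : ℝ × ℝ => fPoly k ℓ p.1 (chartZ k ℓ p.1 p.2)) F
      (𝓝 (fPoly k ℓ γ₀ (1 / (k + 1)))) := by
    unfold fPoly
    exact (tε.neg.sub (tA.mul tz)).add (tendsto_const_nhds.mul (tz.pow 2))
  have tden : Tendsto (fun p : ℝ × ℝ => -(k + 1) * (psSum (chartPs k ℓ p.1) p.2 / p.2) +
      (chartZ k ℓ p.1 p.2 - 1) * fPoly k ℓ p.1 (chartZ k ℓ p.1 p.2)) F
      (𝓝 (-(k + 1) * (chartG k ℓ γ₀ 0 / (k + 3)) +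
        (1 / (k + 1) - 1) * fPoly k ℓ γ₀ (1 / (k + 1)))) :=
    (tq.const_mul _).add ((tz.sub_const 1).mul tf)
  have hg0 := chartG_zero_pos h
  -- Along the chart s/y tends to g₀/(k+3), where g₀ = `chartG` 0, so Δ_z tends to g₀ -
  -- (k+1)g₀/(k+3) = 2g₀/(k+3) > 0.
  have hlim : 0 < -(k + 1) * (chartG k ℓ γ₀ 0 / (k + 3)) +
        (1 / (k + 1) - 1) * fPoly k ℓ γ₀ (1 / (k + 1)) := by
    have e := chartG_eq k ℓ γ₀ 0
    simp only [mul_zero, add_zero, ne_eq, OfNat.ofNat_ne_zero, not_false_eq_true, zero_pow,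
      sub_zero] at e
    have : -(k + 1) * (chartG k ℓ γ₀ 0 / (k + 3)) +
        (1 / (k + 1) - 1) * fPoly k ℓ γ₀ (1 / (k + 1)) = 2 * chartG k ℓ γ₀ 0 / (k + 3) := by
      have e' : (1 / (k + 1) - 1) * fPoly k ℓ γ₀ (1 / (k + 1)) = chartG k ℓ γ₀ 0 := by
        rw [e]; ring
      rw [e']; field_simp; ring
    rw [this]; positivity
  have tS : Tendsto (fun p : ℝ × ℝ => p.2 * uSonic ℓ p.1 (chartZ k ℓ p.1 p.2)) F (𝓝 0) := by
    have : Tendsto (fun p : ℝ × ℝ => uSonic ℓ p.1 (chartZ k ℓ p.1 p.2)) F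
        (𝓝 (uSonic ℓ γ₀ (1 / (k + 1)))) := by
      unfold uSonic
      exact (((t1.add tz).pow 2).const_mul ℓ).sub ((tz.const_sub 1).pow 2)
    simpa using t2'.mul this
  have hall : ∀ᶠ p in F, 0 < chartZ k ℓ p.1 p.2 ∧
      0 < DeltaSmallZ k ℓ p.1 (chartZ k ℓ p.1 p.2) (1 / p.2) ∧
      uSonic ℓ p.1 (chartZ k ℓ p.1 p.2) < 1 / p.2 := by
    filter_upwards [e2, tz.eventually_const_lt (by positivity : 0 < 1 / (k + 1)),
      tden.eventually_const_lt hlim, tS.eventually_lt_const one_pos] with p h2 h3 h4 h5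
    refine ⟨h3, ?_, ?_⟩
    · have e : DeltaSmallZ k ℓ p.1 (chartZ k ℓ p.1 p.2) (1 / p.2) =
          -(k + 1) * (psSum (chartPs k ℓ p.1) p.2 / p.2) +
            (chartZ k ℓ p.1 p.2 - 1) * fPoly k ℓ p.1 (chartZ k ℓ p.1 p.2) := by
        have hz : (k + 1) * chartZ k ℓ p.1 p.2 - 1 = -(k + 1) * psSum (chartPs k ℓ p.1) p.2 := by
          rw [chartZ]; field_simp; ring
        rw [DeltaSmallZ, hz]; ring
      rw [e]; exact h4
    · rw [lt_div_iff₀ h2.1, mul_comm]; exact h5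
  obtain ⟨pa, hpa, pb, hpb, hab⟩ := eventually_prod_iff.1 hall
  obtain ⟨c, hc, hsub⟩ := mem_nhdsGT_iff_exists_Ioc_subset.1 hpb
  have hc0 : (0 : ℝ) < c := hc
  have hm : 0 < min c (r / 2) := lt_min hc0 (by linarith)
  refine ⟨min c (r / 2), hm, ?_⟩
  filter_upwards [hpa, hev] with γ hγ hγ'
  have key : ∀ y ∈ Ioc 0 (min c (r / 2)), _ := fun y hy =>
    hab hγ (hsub ⟨hy.1, hy.2.trans (min_le_left _ _)⟩)
  exact ⟨hm, ⟨r, (min_le_right _ _).trans_lt (by linarith), psConv_of_psNorm_le hr.le hγ'⟩,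
    fun y hy => (key y hy).1, fun y hy => (key y hy).2.1, fun y hy => (key y hy).2.2⟩

theorem exists_continuousAt_chartZ {k : ℝ} (hk : 1 ≤ k) (ℓ γ₀ : ℝ) :
    ∃ r > 0, ∀ y, |y| < r → ContinuousAt (fun γ => chartZ k ℓ γ y) γ₀ := by
  obtain ⟨r, hr, hev⟩ := exists_psNorm_chartPs_le hk ℓ γ₀
  refine ⟨r, hr, fun y hy => ?_⟩
  have h1 : ContinuousOn (fun γ => psSum (chartPs k ℓ γ) y)
      {γ | ∀ N, psNorm r N (chartPs k ℓ γ) ≤ 1} := by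
    refine continuousOn_psSum_param hr (c := 1) (fun n => continuousOn_coeff_singPs
      (fun i => (continuous_chartG k ℓ i).continuousOn)
      (fun i => (continuous_chartH k ℓ i).continuousOn) n) (fun γ hγ n => ?_) hy
    refine le_trans ?_ (hγ (n + 1))
    rw [psNorm, Finset.sum_range_succ]
    have := psNorm_nonneg hr.le n (chartPs k ℓ γ)
    rw [psNorm] at this
    linarith
  have h2 := h1.continuousAt hev
  exact continuousAt_const.sub h2

/-! ### The `Q₀-Q₁` curve and its dependence on the parameter -/

theorem Adm.exists_isCurve {k ℓ γ : ℝ} (h : Adm k ℓ γ) : ∃ u, IsCurve k ℓ γ u := by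
  obtain ⟨y₁, -, hev⟩ := h.exists_chartOn
  obtain ⟨u, hu, -⟩ := hev.self_of_nhds.exists_isCurve h
  exact ⟨u, hu⟩

open Classical in
/-- The `Q₀-Q₁` curve. -/
def curve (k ℓ γ : ℝ) : ℝ → ℝ := if h : ∃ u, IsCurve k ℓ γ u then h.choose else 0

theorem Adm.isCurve {k ℓ γ : ℝ} (h : Adm k ℓ γ) : IsCurve k ℓ γ (curve k ℓ γ) := by
  have hex := h.exists_isCurve
  rw [curve, dif_pos hex]
  exact hex.choose_spec

theorem ChartOn.curve_chartZ {k ℓ γ y₁ y : ℝ} (h : ChartOn k ℓ γ y₁) (ha : Adm k ℓ γ)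
    (hy : y ∈ Ioo 0 y₁) : curve k ℓ γ (chartZ k ℓ γ y) = 1 / y := by
  obtain ⟨u, hu, huy⟩ := h.exists_isCurve ha
  rw [h.eqOn ha ha.isCurve hu (h.chartZ_mem ha ⟨hy.1, hy.2.le⟩), huy y hy]

theorem IsCurve.hasDerivAt {k ℓ γ z : ℝ} {u : ℝ → ℝ} (h : IsCurve k ℓ γ u)
    (hz : z ∈ Ioo 0 (1 / (k + 1))) :
    HasDerivAt u (DeltaU k ℓ γ z (u z) / DeltaSmallZ k ℓ γ z (u z)) z :=
  (h.sol.ode z hz).hasDerivAt (Ioo_mem_nhds hz.1 hz.2)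

theorem IsCurve.strictMonoOn {k ℓ γ : ℝ} {u : ℝ → ℝ} (h : IsCurve k ℓ γ u) (ha : Adm k ℓ γ) :
    StrictMonoOn u (Ioo 0 (1 / (k + 1))) :=
  strictMonoOn_Ioo_of_hasDerivAt_pos (fun _ hz => h.hasDerivAt hz)
    (fun z hz => div_pos (DeltaU_pos ha hz.1 (h.sol.above z hz).le) (h.sol.den_pos z hz))

/-- Near Q₀ the curve takes the value 1/x at `chartZ` x, and `chartZ` is continuous in γ. Since
every curve increases in z, a chart point slightly to the left or right of z bounds the value at z
from below or above; no continuity of inverse functions is needed. -/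
theorem continuousAt_curve_right {k ℓ γ₀ : ℝ} (h : Adm k ℓ γ₀) :
    ∃ c < 1 / (k + 1), 0 < c ∧ ∀ z ∈ Ioo c (1 / (k + 1)),
      ContinuousAt (fun γ => curve k ℓ γ z) γ₀ := by
  obtain ⟨y₁', hy₁', hev'⟩ := h.exists_chartOn
  obtain ⟨r, hr, hcont⟩ := exists_continuousAt_chartZ h.one_le_k ℓ γ₀
  set y₁ := min y₁' (r / 2) with hy₁d
  have hy₁ : 0 < y₁ := lt_min hy₁' (by linarith)
  have hev : ∀ᶠ γ in 𝓝 γ₀, ChartOn k ℓ γ y₁ := by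
    filter_upwards [hev'] with γ hγ using hγ.mono hy₁ (min_le_left _ _)
  have hyr : ∀ y ∈ Ioo 0 y₁, |y| < r := fun y hy => by
    rw [abs_of_pos hy.1]; linarith [hy.2, min_le_right y₁' (r / 2)]
  have hc0 := hev.self_of_nhds
  have hm1 := hc0.chartZ_mem h ⟨hy₁, le_rfl⟩
  refine ⟨chartZ k ℓ γ₀ y₁, hm1.2, hm1.1, fun z hz => ?_⟩
  have hz' : z ∈ Ioo 0 (1 / (k + 1)) := ⟨hm1.1.trans hz.1, hz.2⟩
  obtain ⟨y, hy, hyz⟩ : ∃ y ∈ Ioo 0 y₁, chartZ k ℓ γ₀ y = z := by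
    have := intermediate_value_Ioo hy₁.le hc0.continuousOn
    rw [psSum_chartPs_zero] at this
    obtain ⟨y, hy, hyz⟩ := this (a := 1 / (k + 1) - z)
      ⟨by linarith [hz.2], by have := hz.1; rw [chartZ] at this; linarith⟩
    exact ⟨y, hy, by rw [chartZ, hyz]; ring⟩
  have hv : curve k ℓ γ₀ z = 1 / y := by rw [← hyz]; exact hc0.curve_chartZ h hy
  have hinv : ContinuousAt (fun x : ℝ => 1 / x) y :=
    continuousAt_const.div continuousAt_id hy.1.ne'
  refine tendsto_order.2 ⟨fun a (ha : a < curve k ℓ γ₀ z) => ?_,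
    fun a (ha : curve k ℓ γ₀ z < a) => ?_⟩
  · rw [hv] at ha
    have e1 : ∀ᶠ x in 𝓝[>] y, a < 1 / x :=
      (hinv.eventually_const_lt ha).filter_mono nhdsWithin_le_nhds
    have e2 : ∀ᶠ x in 𝓝[>] y, x ∈ Ioo y y₁ := Ioo_mem_nhdsGT hy.2
    obtain ⟨x, hx1, hx2⟩ := (e1.and e2).exists
    have hxm : x ∈ Ioo 0 y₁ := ⟨hy.1.trans hx2.1, hx2.2⟩
    have hlt : chartZ k ℓ γ₀ x < z := by
      rw [← hyz]; exact hc0.chartZ_lt h ⟨hy.1.le, hy.2.le⟩ ⟨hxm.1.le, hxm.2.le⟩ hx2.1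
    filter_upwards [hev, h.eventually, (hcont x (hyr x hxm)).eventually_lt_const hlt]
      with γ h1 h2 h3
    have h4 := (h2.isCurve.strictMonoOn h2) (h1.chartZ_mem h2 ⟨hxm.1, hxm.2.le⟩) hz' h3
    rw [h1.curve_chartZ h2 hxm] at h4
    exact hx1.trans h4
  · rw [hv] at ha
    have e1 : ∀ᶠ x in 𝓝[<] y, 1 / x < a :=
      (hinv.eventually_lt_const ha).filter_mono nhdsWithin_le_nhds
    have e2 : ∀ᶠ x in 𝓝[<] y, x ∈ Ioo 0 y := Ioo_mem_nhdsLT hy.1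
    obtain ⟨x, hx1, hx2⟩ := (e1.and e2).exists
    have hxm : x ∈ Ioo 0 y₁ := ⟨hx2.1, hx2.2.trans hy.2⟩
    have hlt : z < chartZ k ℓ γ₀ x := by
      rw [← hyz]; exact hc0.chartZ_lt h ⟨hxm.1.le, hxm.2.le⟩ ⟨hy.1.le, hy.2.le⟩ hx2.2
    filter_upwards [hev, h.eventually, (hcont x (hyr x hxm)).eventually_const_lt hlt]
      with γ h1 h2 h3
    have h4 := (h2.isCurve.strictMonoOn h2) hz' (h1.chartZ_mem h2 ⟨hxm.1, hxm.2.le⟩) h3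
    rw [h1.curve_chartZ h2 hxm] at h4
    exact h4.trans hx1

theorem continuousAt_clampRHS_param {k ℓ γ₀ κ M t : ℝ} (hκ : 0 < κ) {w : ℝ → ℝ}
    (hw : ContinuousAt w t) :
    ContinuousAt (fun p : ℝ × ℝ => clampRHS k ℓ p.1 κ M p.2 (w p.2)) (γ₀, t) := by
  have hw' : ContinuousAt (fun p : ℝ × ℝ => w p.2) (γ₀, t) :=
    ContinuousAt.comp (f := fun p : ℝ × ℝ => p.2) hw continuousAt_snd
  have hc : ContinuousAt (fun p : ℝ × ℝ => max 0 (min (w p.2) M)) (γ₀, t) :=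
    continuousAt_const.max (hw'.min continuousAt_const)
  unfold clampRHS
  refine ContinuousAt.div ?_ ?_ (lt_max_of_lt_right hκ).ne'
  · unfold DeltaU fPoly eps cA; fun_prop
  · have : ContinuousAt (fun p : ℝ × ℝ =>
        DeltaSmallZ k ℓ p.1 p.2 (max 0 (min (w p.2) M))) (γ₀, t) := by
      unfold DeltaSmallZ fPoly eps cA; fun_prop
    exact this.max continuousAt_const

theorem abs_fPoly_add_le {k ℓ γ z : ℝ} (hk : 1 ≤ k) (hz : z ∈ Icc 0 (1 / (k + 1))) :
    |fPoly k ℓ γ z + k * z * (1 - z)| ≤ |eps ℓ γ| + |cA k ℓ γ| + |cB k ℓ| + k := by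
  have hk1 : 0 < k + 1 := by linarith
  have hz1 : z ≤ 1 := hz.2.trans (by rw [div_le_one hk1]; linarith)
  have hz0 := hz.1
  have b2 : |cA k ℓ γ * z| ≤ |cA k ℓ γ| := by
    rw [abs_mul, abs_of_nonneg hz0]; exact mul_le_of_le_one_right (abs_nonneg _) hz1
  have b3 : |cB k ℓ * z ^ 2| ≤ |cB k ℓ| := by
    rw [abs_mul, abs_of_nonneg (sq_nonneg z)]
    exact mul_le_of_le_one_right (abs_nonneg _) (pow_le_one₀ hz0 hz1)
  have b4 : |k * z * (1 - z)| ≤ k := by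
    rw [abs_of_nonneg (mul_nonneg (mul_nonneg (by linarith) hz0) (by linarith))]
    nlinarith [mul_nonneg hz0 hz0]
  rw [fPoly]
  refine (abs_add_le _ _).trans (add_le_add ?_ b4)
  refine (abs_add_le _ _).trans (add_le_add ?_ b3)
  refine (abs_sub _ _).trans (add_le_add ?_ b2)
  rw [abs_neg]

/-- The `Q₀-Q₁` curve depends continuously on the parameter. -/
theorem continuousAt_curve {k ℓ γ₀ z : ℝ} (h : Adm k ℓ γ₀) (hz : z ∈ Ioo 0 (1 / (k + 1))) :
    ContinuousAt (fun γ => curve k ℓ γ z) γ₀ := by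
  obtain ⟨c, hc, hc0, hcb⟩ := continuousAt_curve_right h
  obtain ⟨b, hb1, hb2⟩ := exists_between (max_lt hz.2 hc)
  have hzb : z < b := (le_max_left _ _).trans_lt hb1
  have hbm : b ∈ Ioo 0 (1 / (k + 1)) := ⟨hz.1.trans hzb, hb2⟩
  have hcont := hcb b ⟨(le_max_right _ _).trans_lt hb1, hb2⟩
  have hk := h.one_le_k
  have hk1 : 0 < k + 1 := by linarith
  have hb' : b * (k + 1) < 1 := by rw [← lt_div_iff₀ hk1]; exact hb2
  have hγ := gamma_pos h.one_lt_ℓ h.γ_gt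
  have hε := eps_pos h.one_lt_ℓ h.γ_gt
  have hA := h.A_pos
  have hz0 := hz.1
  set w := curve k ℓ γ₀ with hw
  have hcw := h.isCurve
  have hwb : 0 < w b := (uSonic_pos h.one_lt_ℓ h.γ_gt hbm.1.le).trans (hcw.sol.above b hbm)
  set M := w b + 1 with hM
  have hM0 : 0 < M := by linarith
  set C₁ : ℝ → ℝ := fun γ => (k + 1) * M + eps ℓ γ + 2 * cA k ℓ γ + 3 * |cB k ℓ| with hC₁
  set p : ℝ → ℝ := fun γ => (1 - (k + 1) * b) * (2 * eps ℓ γ * (k * z * γ)) with hp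
  have hC₁0 : 0 < C₁ γ₀ := by simp only [hC₁]; positivity
  have hp0 : 0 < p γ₀ := mul_pos (by linarith) (by positivity)
  -- Both inequalities for κ are strict at γ₀, hence persist nearby. They bound Δ_z below by one κ
  -- along all neighbouring curves, so a single cut-off equation serves them all.
  obtain ⟨κ, hκ, hκm⟩ := exists_between (lt_min (hcw.sol.den_pos b hbm) (div_pos hp0 hC₁0))
  have hκ1 := hκm.trans_le (min_le_left _ _)
  have hκ3 : κ * C₁ γ₀ < p γ₀ := by
    rw [← lt_div_iff₀ hC₁0]; exact hκm.trans_le (min_le_right _ _)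
  have hsub : Icc z b ⊆ Ioo 0 (1 / (k + 1)) := fun x hx => ⟨hz.1.trans_le hx.1, hx.2.trans_lt hb2⟩
  have cε := continuous_eps ℓ
  have cA' := continuous_cA k ℓ
  have hevκ : ∀ᶠ γ in 𝓝 γ₀, κ * C₁ γ < p γ := by
    have c1 : Continuous fun γ => κ * C₁ γ := by simp only [hC₁]; fun_prop
    have c2 : Continuous p := by simp only [hp]; fun_prop
    exact c1.continuousAt.eventually_lt c2.continuousAt hκ3
  have hevden : ∀ᶠ γ in 𝓝 γ₀, κ < DeltaSmallZ k ℓ γ b (curve k ℓ γ b) := by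
    have : ContinuousAt (fun γ => DeltaSmallZ k ℓ γ b (curve k ℓ γ b)) γ₀ := by
      unfold DeltaSmallZ fPoly
      fun_prop
    exact this.eventually_const_lt hκ1
  set G : ℝ := |eps ℓ γ₀| + |cA k ℓ γ₀| + |cB k ℓ| + k + 1 with hG
  have hevG : ∀ᶠ γ in 𝓝 γ₀, |eps ℓ γ| + |cA k ℓ γ| + |cB k ℓ| + k < G := by
    have : ContinuousAt (fun γ => |eps ℓ γ| + |cA k ℓ γ| + |cB k ℓ| + k) γ₀ := by fun_prop
    exact this.eventually_lt_const (by rw [hG]; linarith)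
  have hevM : ∀ᶠ γ in 𝓝 γ₀, curve k ℓ γ b < M := hcont.eventually_lt_const (by rw [hM]; linarith)
  -- bounds along the curves
  have hin : ∀ γ, Adm k ℓ γ → κ * C₁ γ < p γ → κ < DeltaSmallZ k ℓ γ b (curve k ℓ γ b) →
      curve k ℓ γ b ≤ M → ∀ t ∈ Icc z b, 0 ≤ curve k ℓ γ t ∧ curve k ℓ γ t ≤ M ∧
        κ ≤ DeltaSmallZ k ℓ γ t (curve k ℓ γ t) := by
    intro γ ha h1 h2 h3
    have hsol := ha.isCurve.sol.mono hsub
    have hmono := hsol.monotoneOn ha hz.1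
    have hle : ∀ t ∈ Icc z b, curve k ℓ γ t ≤ M := fun t ht =>
      (hmono ht (right_mem_Icc.2 hzb.le) ht.2).trans h3
    have hD := lt_DeltaSmallZ_of_lt_right ha hz.1 hb2 hκ h1 hsol.ode
      (fun t ht h0 => by rw [h0]) (fun t ht => (hsol.above t ht).le) hle h2
    exact fun t ht => ⟨(uSonic_pos ha.one_lt_ℓ ha.γ_gt (hsub ht).1.le).le.trans
      (hsol.above t ht).le, hle t ht, (hD t ht).le⟩
  have hin₀ := hin γ₀ h hκ3 hκ1 (by rw [hM]; linarith)
  set K := clampLip κ M G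
  rw [Metric.continuousAt_iff']
  intro η hη
  -- `gronwallBound` is defined by cases on K = 0.
  have hgb : Continuous fun q : ℝ × ℝ => gronwallBound q.1 K q.2 (b - z) := by
    by_cases hK : (K : ℝ) = 0
    · simp only [gronwallBound, hK, if_true]; fun_prop
    · simp only [gronwallBound, hK, if_false]; fun_prop
  have hg0 : gronwallBound 0 K 0 (b - z) < η := by rw [gronwallBound_ε0_δ0]; exact hη
  obtain ⟨e, he, hge⟩ : ∃ e > 0, gronwallBound 0 K e (b - z) < η := by
    have hc1 : ContinuousAt (fun e : ℝ => gronwallBound 0 K e (b - z)) 0 :=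
      (hgb.comp (continuous_const.prodMk continuous_id)).continuousAt
    have e1 : ∀ᶠ e in 𝓝[>] (0 : ℝ), gronwallBound 0 K e (b - z) < η :=
      (hc1.eventually_lt_const hg0).filter_mono nhdsWithin_le_nhds
    obtain ⟨e, h1, h2⟩ := (e1.and self_mem_nhdsWithin).exists
    exact ⟨e, h2, h1⟩
  have hunif : ∀ᶠ γ in 𝓝 γ₀, ∀ t ∈ Icc z b,
      |clampRHS k ℓ γ₀ κ M t (w t) - clampRHS k ℓ γ κ M t (w t)| < e := by
    refine (isCompact_Icc (a := z) (b := b)).eventually_forall_of_forall_eventually (fun t ht => ?_)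
    have hwt : ContinuousAt w t := (hcw.hasDerivAt (hsub ht)).continuousAt
    have hcc := continuousAt_clampRHS_param (k := k) (ℓ := ℓ) (γ₀ := γ₀) (M := M) hκ hwt
    have hcc' : ContinuousAt (fun p : ℝ × ℝ => clampRHS k ℓ γ₀ κ M p.2 (w p.2)) (γ₀, t) := by
      have hmap : ContinuousAt (fun p : ℝ × ℝ => (γ₀, p.2)) (γ₀, t) := by fun_prop
      exact ContinuousAt.comp (f := fun p : ℝ × ℝ => (γ₀, p.2)) hcc hmap
    have := (hcc'.sub hcc).abs
    exact this.eventually_lt_const (by simpa using he)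
  have hbd : ∀ᶠ γ in 𝓝 γ₀, gronwallBound |curve k ℓ γ b - w b| K e (b - z) < η := by
    have hc1 : ContinuousAt (fun γ => gronwallBound |curve k ℓ γ b - w b| K e (b - z)) γ₀ :=
      ContinuousAt.comp (f := fun γ => (|curve k ℓ γ b - w b|, e)) hgb.continuousAt
        (((hcont.sub continuousAt_const).abs).prodMk continuousAt_const)
    refine hc1.eventually_lt_const ?_
    simpa [hw] using hge
  filter_upwards [hevκ, hevden, hevG, hevM, hunif, hbd, h.eventually] with γ g1 g2 g3 g4 g5 g6 ga
  have hinγ := hin γ ga g1 g2 g4.le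
  have key := dist_le_gronwallBound_left (F := clampRHS k ℓ γ κ M) (K := K) (e := e)
    (fun t ht => lipschitzWith_clampRHS hκ hM0.le hk (Ioo_subset_Icc_self (hsub ht))
      ((abs_fPoly_add_le hk (Ioo_subset_Icc_self (hsub ht))).trans g3.le))
    (ga.isCurve.sol.mono hsub).ode (hcw.sol.mono hsub).ode
    (fun t ht => (clampRHS_eq (hinγ t ht).1 (hinγ t ht).2.1 (hinγ t ht).2.2).symm)
    (fun t ht => by
      have := (g5 t ht).le
      rwa [clampRHS_eq (hin₀ t ht).1 (hin₀ t ht).2.1 (hin₀ t ht).2.2] at this)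
    z (left_mem_Icc.2 hzb.le)
  rw [Real.dist_eq]
  exact key.trans_lt g6

/-! ### Polynomial approximations at `Q₁` -/

/-- The quartic polynomial with the given coefficients. -/
def quartic (a₀ a₁ a₂ a₃ a₄ z : ℝ) : ℝ := a₀ + a₁ * z + a₂ * z ^ 2 + a₃ * z ^ 3 + a₄ * z ^ 4

def quarticDeriv (a₁ a₂ a₃ a₄ z : ℝ) : ℝ := a₁ + 2 * a₂ * z + 3 * a₃ * z ^ 2 + 4 * a₄ * z ^ 3

theorem hasDerivAt_quartic (a₀ a₁ a₂ a₃ a₄ z : ℝ) :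
    HasDerivAt (quartic a₀ a₁ a₂ a₃ a₄) (quarticDeriv a₁ a₂ a₃ a₄ z) z := by
  have hid := hasDerivAt_id z
  have h := ((((hid.const_mul a₁).const_add a₀).add ((hid.pow 2).const_mul a₂)).add
    ((hid.pow 3).const_mul a₃)).add ((hid.pow 4).const_mul a₄)
  refine h.congr_deriv ?_
  simp [quarticDeriv]; ring

/-- `N₂`, `N₃`, `N₄` are the right-hand sides (R - n)δ a_n of the recursion for n = 2, 3, 4. They
are also what the defect of a polynomial with lower Taylor coefficients shows at order zⁿ, so their
signs decide both the blow-up of a_n and the side on which a barrier works. -/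
def N₂ (k A B a₀ a₁ : ℝ) : ℝ := (k - 1) * a₁ ^ 2 + (A - B - 2 * k) * a₁ + (2 * k - 2 * B) * a₀

def N₃ (k B a₁ a₂ : ℝ) : ℝ :=
  -2 * a₂ ^ 2 + (3 * k - 1) * a₁ * a₂ - (2 * B + 2 * k) * a₂ + (2 * k - B) * a₁

def N₄ (k A B a₁ a₂ a₃ : ℝ) : ℝ :=
  -5 * a₂ * a₃ + 2 * k * (2 * a₁ * a₃ + a₂ ^ 2) - (A + 3 * B + 2 * k) * a₃ + 2 * k * a₂

/-- The terms of order at least five of the defect of a quartic polynomial. -/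
def defectTail (k A B a₁ a₂ a₃ a₄ z : ℝ) : ℝ :=
  (-3 * (2 * a₂ * a₄ + a₃ ^ 2) + (5 * k + 1) * (a₁ * a₄ + a₂ * a₃) - (2 * A + 4 * B + 2 * k) * a₄
    + (B + 2 * k) * a₃) +
  (-7 * a₃ * a₄ + (3 * k + 1) * (2 * a₂ * a₄ + a₃ ^ 2) + (2 * B + 2 * k) * a₄) * z +
  (-4 * a₄ ^ 2 + (7 * k + 3) * a₃ * a₄) * z ^ 2 + (4 * k + 2) * a₄ ^ 2 * z ^ 3

theorem SpecRel.delta_eq {k ℓ γ : ℝ} (h : SpecRel k ℓ γ) :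
    k * eps ℓ γ + cA k ℓ γ - slope k ℓ γ = lamMinus k ℓ γ := by
  linear_combination h.sum_eq - h.slope_eq

theorem SpecRel.slope_quadratic {k ℓ γ : ℝ} (h : SpecRel k ℓ γ) :
    slope k ℓ γ ^ 2 - ((k - 2) * eps ℓ γ + cA k ℓ γ) * slope k ℓ γ
      + 2 * (k - cA k ℓ γ) * eps ℓ γ = 0 := by
  have h1 := h.prod_eq
  have h2 := h.sum_eq
  have h3 := h.slope_eq
  have hA : cA k ℓ γ = (ratioR k ℓ γ + 1) * lamMinus k ℓ γ - (k + 2) * eps ℓ γ := by linarith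
  rw [h3, hA]
  linear_combination -h1

/-- The defect of a quartic polynomial in the `z-u` equation. -/
theorem SpecRel.defect_quartic {k ℓ γ : ℝ} (h : SpecRel k ℓ γ) (a₂ a₃ a₄ z : ℝ) :
    DeltaSmallZ k ℓ γ z (quartic (eps ℓ γ) (slope k ℓ γ) a₂ a₃ a₄ z) *
        quarticDeriv (slope k ℓ γ) a₂ a₃ a₄ z
      - DeltaU k ℓ γ z (quartic (eps ℓ γ) (slope k ℓ γ) a₂ a₃ a₄ z) =
    z ^ 2 * (N₂ k (cA k ℓ γ) (cB k ℓ) (eps ℓ γ) (slope k ℓ γ)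
        - (ratioR k ℓ γ - 2) * lamMinus k ℓ γ * a₂) +
    z ^ 3 * (N₃ k (cB k ℓ) (slope k ℓ γ) a₂ - (ratioR k ℓ γ - 3) * lamMinus k ℓ γ * a₃) +
    z ^ 4 * (N₄ k (cA k ℓ γ) (cB k ℓ) (slope k ℓ γ) a₂ a₃
        - (ratioR k ℓ γ - 4) * lamMinus k ℓ γ * a₄) +
    z ^ 5 * defectTail k (cA k ℓ γ) (cB k ℓ) (slope k ℓ γ) a₂ a₃ a₄ z := by
  have hR : ratioR k ℓ γ * lamMinus k ℓ γ = slope k ℓ γ + 2 * eps ℓ γ := by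
    linarith [h.slope_eq]
  have hq := h.slope_quadratic
  have e : ∀ n : ℝ, (ratioR k ℓ γ - n) * lamMinus k ℓ γ = slope k ℓ γ + 2 * eps ℓ γ
      - n * (k * eps ℓ γ + cA k ℓ γ - slope k ℓ γ) := fun n => by
    rw [sub_mul, hR, h.delta_eq]
  rw [e, e, e]
  simp only [quartic, quarticDeriv, DeltaSmallZ, DeltaU, fPoly, N₂, N₃, N₄, defectTail]
  linear_combination (-z) * hq

theorem coeffL_two {k ℓ γ : ℝ} (hR : ratioR k ℓ γ ≠ 2) (hl : lamMinus k ℓ γ ≠ 0) :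
    (ratioR k ℓ γ - 2) * lamMinus k ℓ γ * coeffL k ℓ γ 2 =
      N₂ k (cA k ℓ γ) (cB k ℓ) (eps ℓ γ) (slope k ℓ γ) := by
  have h := coeffL_succ_succ k ℓ γ 0
  simp only [Finset.sum_range_zero, zero_add, Finset.sum_range_one, Nat.sub_zero, coeffL_one,
    coeffL_zero, Nat.cast_zero] at h
  rw [h, mul_div_cancel₀ _ (mul_ne_zero (sub_ne_zero.2 hR) hl), N₂]
  norm_num
  ring

theorem coeffL_three {k ℓ γ : ℝ} (hR : ratioR k ℓ γ ≠ 3) (hl : lamMinus k ℓ γ ≠ 0) :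
    (ratioR k ℓ γ - 3) * lamMinus k ℓ γ * coeffL k ℓ γ 3 =
      N₃ k (cB k ℓ) (slope k ℓ γ) (coeffL k ℓ γ 2) := by
  have h := coeffL_succ_succ k ℓ γ 1
  simp only [Finset.sum_range_succ, Finset.sum_range_zero, zero_add, coeffL_one,
    Nat.cast_one, Nat.reduceAdd, Nat.reduceSub] at h
  have e : (1 : ℝ) + 2 = 3 := by norm_num
  rw [e] at h
  rw [h, mul_div_cancel₀ _ (mul_ne_zero (sub_ne_zero.2 hR) hl), N₃]
  ring

theorem coeffL_four {k ℓ γ : ℝ} (hR : ratioR k ℓ γ ≠ 4) (hl : lamMinus k ℓ γ ≠ 0) :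
    (ratioR k ℓ γ - 4) * lamMinus k ℓ γ * coeffL k ℓ γ 4 =
      N₄ k (cA k ℓ γ) (cB k ℓ) (slope k ℓ γ) (coeffL k ℓ γ 2) (coeffL k ℓ γ 3) := by
  have h := coeffL_succ_succ k ℓ γ 2
  simp only [Finset.sum_range_succ, Finset.sum_range_zero, zero_add, coeffL_one,
    Nat.cast_ofNat, Nat.reduceAdd, Nat.reduceSub] at h
  have e : (2 : ℝ) + 2 = 4 := by norm_num
  rw [e] at h
  rw [h, mul_div_cancel₀ _ (mul_ne_zero (sub_ne_zero.2 hR) hl), N₄]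
  ring

/-! ### Barriers -/

/-- Where u meets b, the derivative of u - b is minus the defect divided by Δ_z, hence negative;
thus u - b cannot reach zero when followed to the left. -/
theorem SolOn.gt_of_defect_pos {k ℓ γ c : ℝ} {u b b' : ℝ → ℝ}
    (hu : SolOn k ℓ γ u (Ioo 0 (1 / (k + 1)))) (hc : c < 1 / (k + 1))
    (hb : ∀ z, HasDerivAt b (b' z) z)
    (hE : ∀ z ∈ Ioo 0 c, 0 < DeltaSmallZ k ℓ γ z (b z) * b' z - DeltaU k ℓ γ z (b z))
    (hbc : b c < u c) : ∀ z ∈ Ioc 0 c, b z < u z := by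
  intro z₁ hz₁
  have hsub : Icc z₁ c ⊆ Ioo 0 (1 / (k + 1)) := fun x hx => ⟨hz₁.1.trans_le hx.1, hx.2.trans_lt hc⟩
  have key := pos_of_deriv_neg_at_zeros (g := fun z => u z - b z) (a := z₁) (c := c)
    ((hu.continuousOn.mono hsub).sub (fun z _ => (hb z).continuousAt.continuousWithinAt))
    (sub_pos.2 hbc) (fun z hz h0 => ?_)
  · exact sub_pos.1 (key z₁ ⟨le_rfl, hz₁.2⟩)
  have hz' := hsub (Ico_subset_Icc_self hz)
  have h0' : u z = b z := sub_eq_zero.1 h0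
  have hder := (hu.ode z hz').hasDerivAt (Ioo_mem_nhds hz'.1 hz'.2)
  refine ⟨_, ?_, (hder.sub (hb z)).hasDerivWithinAt⟩
  have hden := hu.den_pos z hz'
  have hE' := hE z ⟨hz'.1, hz.2⟩
  rw [h0'] at hden ⊢
  rw [sub_neg, div_lt_iff₀ hden]
  linarith

theorem SolOn.lt_of_defect_neg {k ℓ γ c : ℝ} {u b b' : ℝ → ℝ}
    (hu : SolOn k ℓ γ u (Ioo 0 (1 / (k + 1)))) (hc : c < 1 / (k + 1))
    (hb : ∀ z, HasDerivAt b (b' z) z)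
    (hE : ∀ z ∈ Ioo 0 c, DeltaSmallZ k ℓ γ z (b z) * b' z - DeltaU k ℓ γ z (b z) < 0)
    (hbc : u c < b c) : ∀ z ∈ Ioc 0 c, u z < b z := by
  intro z₁ hz₁
  have hsub : Icc z₁ c ⊆ Ioo 0 (1 / (k + 1)) := fun x hx => ⟨hz₁.1.trans_le hx.1, hx.2.trans_lt hc⟩
  have key := pos_of_deriv_neg_at_zeros (g := fun z => b z - u z) (a := z₁) (c := c)
    (ContinuousOn.sub (fun z _ => (hb z).continuousAt.continuousWithinAt)
      (hu.continuousOn.mono hsub))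
    (sub_pos.2 hbc) (fun z hz h0 => ?_)
  · exact sub_pos.1 (key z₁ ⟨le_rfl, hz₁.2⟩)
  have hz' := hsub (Ico_subset_Icc_self hz)
  have h0' : b z = u z := sub_eq_zero.1 h0
  have hder := (hu.ode z hz').hasDerivAt (Ioo_mem_nhds hz'.1 hz'.2)
  refine ⟨_, ?_, ((hb z).sub hder).hasDerivWithinAt⟩
  have hden := hu.den_pos z hz'
  have hE' := hE z ⟨hz'.1, hz.2⟩
  rw [← h0'] at hden ⊢
  rw [sub_neg, lt_div_iff₀ hden]
  linarith

/-! ### Continuity of the Taylor data -/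

theorem continuous_disc (k ℓ : ℝ) : Continuous (disc k ℓ) := by
  unfold disc c₁ c₃ c₄ eps cA; fun_prop

theorem continuous_lamMinus (k ℓ : ℝ) : Continuous (lamMinus k ℓ) := by
  have := continuous_disc k ℓ
  unfold lamMinus c₁ c₄ eps cA; fun_prop

theorem continuous_lamPlus (k ℓ : ℝ) : Continuous (lamPlus k ℓ) := by
  have := continuous_disc k ℓ
  unfold lamPlus c₁ c₄ eps cA; fun_prop

theorem continuous_slope (k ℓ : ℝ) : Continuous (slope k ℓ) := by
  have := continuous_disc k ℓ
  unfold slope c₁ c₄ eps cA; fun_prop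

theorem SpecRel.continuousAt_ratioR {k ℓ γ : ℝ} (h : SpecRel k ℓ γ) :
    ContinuousAt (ratioR k ℓ) γ := by
  unfold ratioR
  exact (continuous_lamPlus k ℓ).continuousAt.div (continuous_lamMinus k ℓ).continuousAt h.lam_pos.ne'

theorem SpecRel.disc_pos {k ℓ γ : ℝ} (h : SpecRel k ℓ γ) (hR : 1 < ratioR k ℓ γ) :
    0 < disc k ℓ γ := by
  have hd : disc k ℓ γ = ((k + 2) * eps ℓ γ + cA k ℓ γ) ^ 2 -
        4 * (2 * k * eps ℓ γ * (1 + eps ℓ γ)) := by rw [disc, c₁, c₃, c₄]; ring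
  rw [hd, h.sum_eq, ← h.prod_eq]
  have : ((ratioR k ℓ γ + 1) * lamMinus k ℓ γ) ^ 2 - 4 * (ratioR k ℓ γ * lamMinus k ℓ γ ^ 2) =
      ((ratioR k ℓ γ - 1) * lamMinus k ℓ γ) ^ 2 := by ring
  rw [this]
  have := mul_pos (sub_pos.2 hR) h.lam_pos
  positivity

theorem SpecRel.eventually {k ℓ γ₀ : ℝ} (h : SpecRel k ℓ γ₀) (hR : 1 < ratioR k ℓ γ₀) :
    ∀ᶠ γ in 𝓝 γ₀, SpecRel k ℓ γ := by
  filter_upwards [(continuous_disc k ℓ).continuousAt.eventually_const_lt (h.disc_pos hR),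
    (continuous_lamMinus k ℓ).continuousAt.eventually_const_lt h.lam_pos] with γ h1 h2
  exact specRel_of_lamMinus_pos h1.le h2

theorem SpecRel.continuousAt_coeffL {k ℓ γ : ℝ} (h : SpecRel k ℓ γ) (n : ℕ)
    (hR : ∀ m, 2 ≤ m → m ≤ n → ratioR k ℓ γ ≠ m) :
    ContinuousAt (fun γ => coeffL k ℓ γ n) γ := by
  induction n using Nat.strong_induction_on with
  | _ n ih =>
    match n with
    | 0 => simp only [coeffL_zero]; exact (continuous_eps ℓ).continuousAt
    | 1 => simp only [coeffL_one]; exact (continuous_slope k ℓ).continuousAt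
    | n + 2 =>
      have ih' : ∀ m, m < n + 2 → ContinuousAt (fun γ => coeffL k ℓ γ m) γ := fun m hm =>
        ih m hm (fun j h2 hj => hR j h2 (by omega))
      have hA := (continuous_cA k ℓ).continuousAt (x := γ)
      have hl := (continuous_lamMinus k ℓ).continuousAt (x := γ)
      have hRc := h.continuousAt_ratioR
      have s1 : ContinuousAt (fun γ => ∑ i ∈ Finset.range n,
          coeffL k ℓ γ (i + 2) * coeffL k ℓ γ (n + 1 - i)) γ := by
        refine tendsto_finsetSum _ (fun i hi => ?_)
        have := Finset.mem_range.1 hi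
        exact (ih' (i + 2) (by omega)).mul (ih' (n + 1 - i) (by omega))
      have s2 : ContinuousAt (fun γ => ∑ i ∈ Finset.range (n + 1),
          coeffL k ℓ γ (i + 1) * coeffL k ℓ γ (n + 1 - i)) γ := by
        refine tendsto_finsetSum _ (fun i hi => ?_)
        have := Finset.mem_range.1 hi
        exact (ih' (i + 1) (by omega)).mul (ih' (n + 1 - i) (by omega))
      have s3 := ih' (n + 1) (by omega)
      have s4 := ih' n (by omega)
      have e : (fun γ => coeffL k ℓ γ (n + 2)) = _ := funext (fun γ => coeffL_succ_succ k ℓ γ n)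
      rw [e]
      refine ContinuousAt.div (by fun_prop) (by fun_prop) (mul_ne_zero (sub_ne_zero.2 ?_) h.lam_pos.ne')
      have := hR (n + 2) (by omega) le_rfl
      push_cast at this
      exact this

/-! ### The behaviour of the `Q₀-Q₁` curve near `Q₁` when `R = 3` and `R = 4` -/

theorem exists_forall_pos_of_continuousAt {F : ℝ × ℝ → ℝ} {γ₀ : ℝ} (hF : ContinuousAt F (γ₀, 0))
    (h0 : 0 < F (γ₀, 0)) : ∃ c > 0, ∀ᶠ γ in 𝓝 γ₀, ∀ z ∈ Icc 0 c, 0 < F (γ, z) := by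
  have h := hF.eventually_const_lt h0
  rw [nhds_prod_eq] at h
  obtain ⟨pa, hpa, pb, hpb, hab⟩ := eventually_prod_iff.1 h
  obtain ⟨c, hc, hsub⟩ := Metric.eventually_nhds_iff.1 hpb
  refine ⟨c / 2, by linarith, ?_⟩
  filter_upwards [hpa] with γ hγ z hz
  refine hab hγ (hsub ?_)
  rw [Real.dist_eq, sub_zero, abs_of_nonneg hz.1]
  linarith [hz.2]

theorem IsCurve.tendsto_atTop {k ℓ γ : ℝ} {u : ℝ → ℝ} (h : IsCurve k ℓ γ u) (ha : Adm k ℓ γ) :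
    Tendsto u (𝓝[<] (1 / (k + 1))) atTop := by
  obtain ⟨y₁, hy₁, hev⟩ := ha.exists_chartOn
  have hc := hev.self_of_nhds
  obtain ⟨y₀, hy₀, hy⟩ := h.chart
  refine Filter.tendsto_atTop.2 (fun N => ?_)
  have hm : 0 < min (min y₀ y₁) (1 / (|N| + 1)) := lt_min (lt_min hy₀ hy₁) (by positivity)
  set y := min (min y₀ y₁) (1 / (|N| + 1)) with hyd
  have hyc : y ∈ Ioc 0 y₁ := ⟨hm, (min_le_left _ _).trans (min_le_right _ _)⟩
  have hz := hc.chartZ_mem ha hyc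
  have hN : N ≤ 1 / y := by
    have h1 : y ≤ 1 / (|N| + 1) := min_le_right _ _
    rw [le_div_iff₀ (by positivity)] at h1
    rw [le_div_iff₀ hm]
    nlinarith [le_abs_self N]
  filter_upwards [Ioo_mem_nhdsLT hz.2] with z hzz
  have := (h.strictMonoOn ha) hz ⟨hz.1.trans hzz.1, hzz.2⟩ hzz.1
  rw [hy y ⟨hm, (min_le_left _ _).trans (min_le_left _ _)⟩] at this
  linarith

theorem DeltaSmallZ_add (k ℓ γ z b w : ℝ) :
    DeltaSmallZ k ℓ γ z (b + w) = DeltaSmallZ k ℓ γ z b - (1 - (k + 1) * z) * w := by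
  simp only [DeltaSmallZ]; ring

theorem DeltaU_add (k ℓ γ z b w : ℝ) :
    DeltaU k ℓ γ z (b + w) = DeltaU k ℓ γ z b
      + w * (4 * b + 2 * (fPoly k ℓ γ z + k * z * (1 - z))) + 2 * w ^ 2 := by
  simp only [DeltaU]; ring

/-- This is the differential inequality for W = w/z². To leading order z W' is at least (Q W - e)/D
- 2W; at R = 3 the ratio Q/D tends to 3 and e/D to a₂, so this is W - a₂, which is positive as long
as W ≥ M > a₂. -/
theorem deriv_quotient_lower_bound {z w D Q e q Dz num M : ℝ} (hz : 0 < z)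
    (hM : M * z ^ 2 ≤ w) (hM0 : 0 ≤ M) (hD : 0 < D) (hDz : 0 < Dz) (hDz' : Dz ≤ z * D)
    (hnum : num = -(z ^ 2 * e) + w * Q + 2 * w ^ 2) (hQ : 0 ≤ Q - 2 * D) (hq0 : 0 < q)
    (hq : q * D ≤ M * (Q - 2 * D) - e) :
    q / z ≤ (num / Dz * z ^ 2 - w * (2 * z)) / (z ^ 2) ^ 2 := by
  set W := w / z ^ 2 with hW
  have hw : w = W * z ^ 2 := by rw [hW]; field_simp
  have hMW : M ≤ W := by rw [hW, le_div_iff₀ (by positivity)]; exact hM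
  have hn : q * D + 2 * W * D ≤ W * Q - e := by
    nlinarith [mul_le_mul_of_nonneg_right hMW hQ]
  have hW0 : 0 ≤ W := hM0.trans hMW
  have hn0 : 0 ≤ W * Q - e := le_trans (by positivity) hn
  have h1 : z * (q + 2 * W) ≤ num / Dz := by
    rw [le_div_iff₀ hDz]
    calc z * (q + 2 * W) * Dz ≤ z * (q + 2 * W) * (z * D) := by gcongr
      _ = z ^ 2 * (q * D + 2 * W * D) := by ring
      _ ≤ z ^ 2 * (W * Q - e) := by gcongr
      _ ≤ num := by rw [hnum, hw]; nlinarith [sq_nonneg (W * z ^ 2)]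
  have h2 : (z * (q + 2 * W) * z ^ 2 - w * (2 * z)) / (z ^ 2) ^ 2 = q / z := by
    rw [hw]; field_simp; ring
  rw [← h2]
  gcongr

/-- When `R = 3`, the curve comes below every parabola that is above the second order Taylor
polynomial. -/
theorem SolOn.exists_lt_parabola {k ℓ γ M c : ℝ} {u : ℝ → ℝ} (ha : Adm k ℓ γ)
    (hs : SpecRel k ℓ γ) (hR : ratioR k ℓ γ = 3) (hu : SolOn k ℓ γ u (Ioo 0 (1 / (k + 1))))
    (hM0 : 0 ≤ M) (hM : coeffL k ℓ γ 2 < M) (hc : 0 < c) :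
    ∃ z ∈ Ioo 0 (1 / (k + 1)), z < c ∧ u z < quartic (eps ℓ γ) (slope k ℓ γ) M 0 0 z := by
  -- Otherwise W = (u - p)/z², with p the tangent at Q₁, stays at least M near 0 while W' ≥ q/z; the
  -- logarithm then forces W below M.
  by_contra! H
  have hk := ha.one_le_k
  have hk1 : 0 < k + 1 := by linarith
  have hδ := hs.lam_pos
  set δ := lamMinus k ℓ γ with hδd
  set a₁ := slope k ℓ γ with ha₁
  set ε := eps ℓ γ with hε
  set p : ℝ → ℝ := fun z => ε + a₁ * z with hp
  -- z² e is the defect of the tangent p, z D is Δ_z along p, and Q is the coefficient linear in u -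
  -- p of the numerator Δ_u - p' Δ_z.
  set e : ℝ → ℝ := fun z => (1 * δ * coeffL k ℓ γ 2) + (2 * k - cB k ℓ) * a₁ * z with he
  set D : ℝ → ℝ := fun z => δ + ((k + 1) * a₁ - cA k ℓ γ - cB k ℓ) * z + cB k ℓ * z ^ 2 with hD
  set Q : ℝ → ℝ := fun z => (1 - (k + 1) * z) * a₁ + 4 * p z +
    2 * (fPoly k ℓ γ z + k * z * (1 - z)) with hQ
  have hQ0 : Q 0 = 3 * δ := by
    have h1 := hs.slope_eq
    rw [hR, ← ha₁, ← hδd] at h1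
    simp only [hQ, hp, fPoly]; rw [← hε]; linear_combination h1
  have hD0 : D 0 = δ := by simp [hD]
  have he0 : e 0 = δ * coeffL k ℓ γ 2 := by simp [he]
  have hdef : ∀ z, DeltaSmallZ k ℓ γ z (p z) * a₁ - DeltaU k ℓ γ z (p z) = z ^ 2 * e z := by
    intro z
    have h1 := hs.defect_quartic 0 0 0 z
    have h2 := coeffL_two (by rw [hR]; norm_num) hδ.ne' (k := k) (ℓ := ℓ) (γ := γ)
    rw [hR, ← hδd] at h2
    simp only [quartic, quarticDeriv, ← h2, mul_zero, zero_mul, add_zero] at h1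
    rw [← ha₁, ← hε] at h1
    refine h1.trans ?_
    simp only [N₃, N₄, defectTail, he]
    ring
  have hDz : ∀ z, DeltaSmallZ k ℓ γ z (p z) = z * D z := by
    intro z
    have h1 := hs.delta_eq
    rw [← hδd, ← ha₁, ← hε] at h1
    simp only [hp, hD, DeltaSmallZ, fPoly, ← h1, ← hε]; ring
  have cD : Continuous D := by simp only [hD]; fun_prop
  have ce : Continuous e := by simp only [he]; fun_prop
  have cQ : Continuous Q := by
    have := continuous_fPoly k ℓ γ
    simp only [hQ, hp]; fun_prop
  set q := (M - coeffL k ℓ γ 2) / 2 with hq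
  have hq0 : 0 < q := by rw [hq]; linarith
  have e1 : ∀ᶠ z in 𝓝 (0 : ℝ), 0 < D z := cD.continuousAt.eventually_const_lt (by rw [hD0]; exact hδ)
  have e2 : ∀ᶠ z in 𝓝 (0 : ℝ), 0 < Q z - 2 * D z :=
    (cQ.sub (cD.const_mul 2)).continuousAt.eventually_const_lt
      (show 0 < Q 0 - 2 * D 0 by rw [hQ0, hD0]; linarith)
  have e3 : ∀ᶠ z in 𝓝 (0 : ℝ), 0 < M * (Q z - 2 * D z) - e z - q * D z := by
    have : Continuous fun z => M * (Q z - 2 * D z) - e z - q * D z := by fun_prop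
    refine this.continuousAt.eventually_const_lt ?_
    change 0 < M * (Q 0 - 2 * D 0) - e 0 - q * D 0
    rw [hQ0, hD0, he0, hq]
    nlinarith
  have e4 : ∀ᶠ z in 𝓝 (0 : ℝ), z < min c (1 / (k + 1)) :=
    Iio_mem_nhds (lt_min hc (by positivity))
  obtain ⟨r, hr, hball⟩ := Metric.eventually_nhds_iff.1 (e1.and (e2.and (e3.and e4)))
  have hz : ∀ z ∈ Ioc 0 (r / 2), dist z 0 < r := fun z hz => by
    rw [Real.dist_eq, sub_zero, abs_of_pos hz.1]; linarith [hz.2]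
  have hmem : ∀ z ∈ Ioc 0 (r / 2), z ∈ Ioo 0 (1 / (k + 1)) := fun z hzz =>
    ⟨hzz.1, ((hball (hz z hzz)).2.2.2).trans_le (min_le_right _ _)⟩
  have hge : ∀ z ∈ Ioc 0 (r / 2), M * z ^ 2 ≤ u z - p z := fun z hzz => by
    have h1 := H z (hmem z hzz) (((hball (hz z hzz)).2.2.2).trans_le (min_le_left _ _))
    simp only [quartic] at h1
    simp only [hp]; linarith
  obtain ⟨z, hz1, hz2⟩ := exists_lt_of_deriv_ge_div (c := r / 2) (q := q)
    (W := fun z => (u z - p z) / z ^ 2)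
    (W' := fun z => ((DeltaU k ℓ γ z (u z) / DeltaSmallZ k ℓ γ z (u z) - a₁) * z ^ 2
      - (u z - p z) * (2 * z)) / (z ^ 2) ^ 2) (by linarith) hq0
    (fun z hzz => by
      have h1 := (hu.ode z (hmem z hzz)).hasDerivAt (Ioo_mem_nhds hzz.1 (hmem z hzz).2)
      have h2 : HasDerivAt p a₁ z := by
        exact (((hasDerivAt_id z).const_mul a₁).const_add ε).congr_deriv (mul_one _)
      have h3 : HasDerivAt (fun z : ℝ => z ^ 2) (2 * z) z := by simpa using hasDerivAt_pow 2 z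
      exact (h1.sub h2).div h3 (by have := hzz.1; positivity))
    (fun z hzz => by
      obtain ⟨g1, g2, g3, -⟩ := hball (hz z hzz)
      have hw := hge z hzz
      have hden := hu.den_pos z (hmem z hzz)
      set w := u z - p z with hwd
      have huw : u z = p z + w := by rw [hwd]; ring
      have hz0 := hzz.1
      have hkz : 0 ≤ 1 - (k + 1) * z := by
        have := (hmem z hzz).2; rw [lt_div_iff₀ hk1] at this; linarith
      have hw0 : 0 ≤ w := le_trans (by positivity) hw
      have hnum : (DeltaU k ℓ γ z (u z) / DeltaSmallZ k ℓ γ z (u z) - a₁) =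
          (DeltaU k ℓ γ z (u z) - a₁ * DeltaSmallZ k ℓ γ z (u z)) / DeltaSmallZ k ℓ γ z (u z) := by
        field_simp
      rw [hnum]
      refine deriv_quotient_lower_bound (D := D z) (Q := Q z) (e := e z) (M := M) hz0 hw hM0 g1
        hden ?_ ?_ g2.le hq0 (by linarith)
      · rw [huw, DeltaSmallZ_add, hDz]
        have := mul_nonneg hkz hw0
        linarith
      · rw [huw, DeltaSmallZ_add, DeltaU_add]
        have := hdef z
        simp only [hQ]
        linear_combination -this)
    M
  have h1 := hge z hz1
  have h0 := hz1.1
  rw [div_lt_iff₀ (by positivity)] at hz2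
  linarith

/-- Here V = w/z⁴ with w = p - u. At R = 4 the ratio Q/D tends to 4, so the terms proportional to V
cancel to leading order: this is the resonance. The positive e/D is left and produces q/z, up to an
error C V. The bound w ≤ c₂ z² keeps the quadratic term harmless. -/
theorem deriv_quotient_lower_bound' {z w D Q e q Dz num C c₂ : ℝ} (hz : 0 < z)
    (hw : 0 ≤ w) (hwc : w ≤ c₂ * z ^ 2) (hD : 0 < D) (hDz : 0 < Dz) (hDz' : Dz ≤ z * D)
    (hnum : num = z ^ 4 * e + w * (Q - 2 * w)) (hq0 : 0 < q) (hq : q * D ≤ e)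
    (hQ0 : 0 ≤ Q - 2 * (c₂ * z ^ 2))
    (hQ : -(C * z) * D ≤ Q - 2 * (c₂ * z ^ 2) - 4 * D) :
    q / z - C * (w / z ^ 4) ≤ (num / Dz * z ^ 4 - w * (4 * z ^ 3)) / (z ^ 4) ^ 2 := by
  set V := w / z ^ 4 with hV
  have hw' : w = V * z ^ 4 := by rw [hV]; field_simp
  have hV0 : 0 ≤ V := by rw [hV]; positivity
  have he : 0 < e := lt_of_lt_of_le (by positivity) hq
  set Q' := Q - 2 * (c₂ * z ^ 2) with hQ'
  have h1 : z ^ 3 * ((e + V * Q') / D) ≤ num / Dz := by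
    rw [le_div_iff₀ hDz]
    calc z ^ 3 * ((e + V * Q') / D) * Dz ≤ z ^ 3 * ((e + V * Q') / D) * (z * D) := by
          have : 0 ≤ e + V * Q' := by positivity
          gcongr
      _ = z ^ 4 * (e + V * Q') := by field_simp
      _ ≤ num := by
        rw [hnum]
        have : w * Q' ≤ w * (Q - 2 * w) := by
          apply mul_le_mul_of_nonneg_left _ hw
          rw [hQ']; linarith
        rw [hw'] at this ⊢
        nlinarith
  have h2 : (z ^ 3 * ((e + V * Q') / D) * z ^ 4 - w * (4 * z ^ 3)) / (z ^ 4) ^ 2 =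
      ((e + V * Q') / D - 4 * V) / z := by
    rw [hw']; field_simp
  have h3 : q - C * z * V ≤ (e + V * Q') / D - 4 * V := by
    have : (e + V * Q') / D - 4 * V = (e + V * (Q' - 4 * D)) / D := by field_simp; ring
    rw [this, le_div_iff₀ hD]
    nlinarith [mul_le_mul_of_nonneg_left hQ hV0]
  calc q / z - C * V = (q - C * z * V) / z := by field_simp
    _ ≤ ((e + V * Q') / D - 4 * V) / z := by gcongr
    _ ≤ _ := by rw [← h2]; gcongr

/-- The curve stays above its tangent at `Q₁`, if that is convex there. -/
theorem IsCurve.tangent_lt {k ℓ γ : ℝ} {u : ℝ → ℝ} (ha : Adm k ℓ γ)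
    (hs : SpecRel k ℓ γ) (hu : IsCurve k ℓ γ u) (hslope : 0 ≤ slope k ℓ γ)
    (hN : 0 < N₂ k (cA k ℓ γ) (cB k ℓ) (eps ℓ γ) (slope k ℓ γ)) :
    ∀ z ∈ Ioo 0 (1 / (k + 1)), eps ℓ γ + slope k ℓ γ * z < u z := by
  intro z hz
  have hk := ha.one_le_k
  -- The comparison starts near Q₀, where u is unbounded and hence above the tangent.
  have e1 := (hu.tendsto_atTop ha).eventually_gt_atTop (eps ℓ γ + slope k ℓ γ * 1)
  have e2 : ∀ᶠ c in 𝓝[<] (1 / (k + 1)), c ∈ Ioo z (1 / (k + 1)) := Ioo_mem_nhdsLT hz.2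
  obtain ⟨c, hc1, hc2⟩ := (e1.and e2).exists
  have hone : 1 / (k + 1) ≤ 1 := by rw [div_le_one (by linarith)]; linarith
  have hcc : slope k ℓ γ * c ≤ slope k ℓ γ * 1 :=
    mul_le_mul_of_nonneg_left (hc2.2.le.trans hone) hslope
  have h := hu.sol.gt_of_defect_pos hc2.2
    (hasDerivAt_quartic (eps ℓ γ) (slope k ℓ γ) 0 0 0) (fun x hx => ?_) ?_ z ⟨hz.1, hc2.1.le⟩
  · simpa [quartic] using h
  · rw [hs.defect_quartic]
    simp only [N₃, N₄, defectTail]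
    have hB : 2 * k - cB k ℓ = ℓ - 1 := by rw [cB]; ring
    have h1 : 0 ≤ (2 * k - cB k ℓ) * slope k ℓ γ := by
      rw [hB]; exact mul_nonneg (by linarith [ha.one_lt_ℓ]) hslope
    have hx0 := hx.1
    have h2 := mul_pos (pow_pos hx0 2) hN
    have h3 := mul_nonneg (pow_pos hx0 3).le h1
    nlinarith
  · simp only [quartic]; linarith

set_option maxHeartbeats 800000 in
/-- When `R = 4` and the curve is above its tangent, it comes above its third order Taylor
polynomial. -/
theorem SolOn.exists_cubic_lt {k ℓ γ c : ℝ} {u : ℝ → ℝ} (ha : Adm k ℓ γ)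
    (hs : SpecRel k ℓ γ) (hR : ratioR k ℓ γ = 4) (hu : SolOn k ℓ γ u (Ioo 0 (1 / (k + 1))))
    (htan : ∀ z ∈ Ioo 0 (1 / (k + 1)), eps ℓ γ + slope k ℓ γ * z < u z)
    (hN : 0 < N₄ k (cA k ℓ γ) (cB k ℓ) (slope k ℓ γ) (coeffL k ℓ γ 2) (coeffL k ℓ γ 3))
    (hc : 0 < c) :
    ∃ z ∈ Ioo 0 (1 / (k + 1)), z < c ∧
      quartic (eps ℓ γ) (slope k ℓ γ) (coeffL k ℓ γ 2) (coeffL k ℓ γ 3) 0 z < u z := by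
  by_contra! H
  have hk := ha.one_le_k
  have hk1 : 0 < k + 1 := by linarith
  have hδ := hs.lam_pos
  have h2 := coeffL_two (by rw [hR]; norm_num) hδ.ne' (k := k) (ℓ := ℓ) (γ := γ)
  have h3 := coeffL_three (by rw [hR]; norm_num) hδ.ne' (k := k) (ℓ := ℓ) (γ := γ)
  set δ := lamMinus k ℓ γ with hδd
  set a₁ := slope k ℓ γ with ha₁
  set a₂ := coeffL k ℓ γ 2
  set a₃ := coeffL k ℓ γ 3
  set ε := eps ℓ γ with hε
  set n₄ := N₄ k (cA k ℓ γ) (cB k ℓ) a₁ a₂ a₃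
  set p : ℝ → ℝ := quartic ε a₁ a₂ a₃ 0 with hp
  set p' : ℝ → ℝ := quarticDeriv a₁ a₂ a₃ 0 with hp'
  set e : ℝ → ℝ := fun z => n₄ + z * defectTail k (cA k ℓ γ) (cB k ℓ) a₁ a₂ a₃ 0 z with he
  set c₂ := |a₂| + |a₃| with hc₂
  set D : ℝ → ℝ := fun z => δ + ((k + 1) * a₁ - cA k ℓ γ - cB k ℓ) * z + cB k ℓ * z ^ 2
    - (1 - (k + 1) * z) * (a₂ * z + a₃ * z ^ 2) with hD
  -- Lying below the cubic p but above the tangent gives 0 ≤ p - u ≤ c₂ z². Hence Δ_z along u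
  -- exceeds Δ_z(z, p) = z D by at most c₂ z², that is, it is at most z D'.
  set D' : ℝ → ℝ := fun z => D z + c₂ * z with hD'
  set Q : ℝ → ℝ := fun z => (1 - (k + 1) * z) * p' z + 4 * p z +
    2 * (fPoly k ℓ γ z + k * z * (1 - z)) with hQ
  have hQ0 : Q 0 = 4 * δ := by
    have h1 := hs.slope_eq
    rw [hR, ← ha₁, ← hδd] at h1
    simp only [hQ, hp, hp', quartic, quarticDeriv, fPoly]; rw [← hε]; linear_combination h1
  have hD0 : D' 0 = δ := by simp [hD', hD]
  have he0 : e 0 = n₄ := by simp [he]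
  have hdef : ∀ z, DeltaSmallZ k ℓ γ z (p z) * p' z - DeltaU k ℓ γ z (p z) = z ^ 4 * e z := by
    intro z
    have h1 := hs.defect_quartic a₂ a₃ 0 z
    rw [← h2, ← h3] at h1
    simp only [hp, hp', he]
    rw [h1]; ring
  have hDz : ∀ z, DeltaSmallZ k ℓ γ z (p z) = z * D z := by
    intro z
    have h1 := hs.delta_eq
    rw [← hδd, ← ha₁, ← hε] at h1
    simp only [hp, quartic, hD, DeltaSmallZ, fPoly, ← h1, ← hε]; ring
  have cp : Differentiable ℝ p := fun z => (hasDerivAt_quartic _ _ _ _ _ z).differentiableAt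
  have cp' : Differentiable ℝ p' := by simp only [hp']; unfold quarticDeriv; fun_prop
  have cD : Differentiable ℝ D' := by simp only [hD', hD]; fun_prop
  have ce : Continuous e := by simp only [he]; unfold defectTail; fun_prop
  have cQ : Differentiable ℝ Q := by
    simp only [hQ]; unfold fPoly; fun_prop
  set F : ℝ → ℝ := fun z => Q z - 2 * (c₂ * z ^ 2) - 4 * D' z with hF
  have cF : Differentiable ℝ F := by simp only [hF]; fun_prop
  have hF0 : F 0 = 0 := by simp only [hF]; rw [hQ0, hD0]; ring
  -- F vanishes at 0 precisely because R = 4, so it is O(z); this is what bounds the error term by C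
  -- V.
  obtain ⟨C₀, hC₀⟩ := (cF 0).isBigO_sub.bound
  set C := 2 * |C₀| / δ with hC
  have hC0 : 0 ≤ C := by positivity
  set q := n₄ / (2 * δ) with hq
  have hq0 : 0 < q := by positivity
  have e1 : ∀ᶠ z in 𝓝 (0 : ℝ), δ / 2 < D' z :=
    cD.continuous.continuousAt.eventually_const_lt (by rw [hD0]; linarith)
  have e2 : ∀ᶠ z in 𝓝 (0 : ℝ), 0 < Q z - 2 * (c₂ * z ^ 2) := by
    have : Continuous fun z => Q z - 2 * (c₂ * z ^ 2) := by have := cQ.continuous; fun_prop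
    exact this.continuousAt.eventually_const_lt 
      (show 0 < Q 0 - 2 * (c₂ * 0 ^ 2) by rw [hQ0]; norm_num; linarith)
  have e3 : ∀ᶠ z in 𝓝 (0 : ℝ), 0 < e z - q * D' z := by
    have : Continuous fun z => e z - q * D' z := by have := cD.continuous; fun_prop
    refine this.continuousAt.eventually_const_lt ?_
    have : q * δ = n₄ / 2 := by rw [hq]; field_simp
    change 0 < e 0 - q * D' 0
    rw [hD0, he0, this]
    linarith
  have e4 : ∀ᶠ z in 𝓝 (0 : ℝ), z < min c (1 / (k + 1)) :=
    Iio_mem_nhds (lt_min hc (by positivity))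
  obtain ⟨r, hr, hball⟩ := Metric.eventually_nhds_iff.1 (e1.and (e2.and (e3.and (e4.and hC₀))))
  have hz : ∀ z ∈ Ioc 0 (r / 2), dist z 0 < r := fun z hz => by
    rw [Real.dist_eq, sub_zero, abs_of_pos hz.1]; linarith [hz.2]
  have hmem : ∀ z ∈ Ioc 0 (r / 2), z ∈ Ioo 0 (1 / (k + 1)) := fun z hzz =>
    ⟨hzz.1, ((hball (hz z hzz)).2.2.2.1).trans_le (min_le_right _ _)⟩
  have hge : ∀ z ∈ Ioc 0 (r / 2), 0 ≤ p z - u z := fun z hzz => by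
    have h1 := H z (hmem z hzz) (((hball (hz z hzz)).2.2.2.1).trans_le (min_le_left _ _))
    exact sub_nonneg.2 h1
  have hle : ∀ z ∈ Ioc 0 (r / 2), p z - u z ≤ c₂ * z ^ 2 := fun z hzz => by
    have h1 := htan z (hmem z hzz)
    have hz0 := hzz.1
    have hz1 : z ≤ 1 := (hmem z hzz).2.le.trans (by rw [div_le_one hk1]; linarith)
    have h2 : a₂ * z ^ 2 ≤ |a₂| * z ^ 2 := by gcongr; exact le_abs_self _
    have h3 : a₃ * z ^ 3 ≤ |a₃| * z ^ 2 := by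
      calc a₃ * z ^ 3 ≤ |a₃| * z ^ 3 := by gcongr; exact le_abs_self _
        _ ≤ |a₃| * z ^ 2 := by
          gcongr ?_ * ?_
          exact pow_le_pow_of_le_one hz0.le hz1 (by norm_num)
    simp only [hp, quartic, hc₂]
    nlinarith
  set V : ℝ → ℝ := fun z => (p z - u z) / z ^ 4 with hV
  set V' : ℝ → ℝ := fun z => ((p' z - DeltaU k ℓ γ z (u z) / DeltaSmallZ k ℓ γ z (u z)) * z ^ 4
      - (p z - u z) * (4 * z ^ 3)) / (z ^ 4) ^ 2 with hV'
  have hVd : ∀ z ∈ Ioc 0 (r / 2), HasDerivAt V (V' z) z := fun z hzz => by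
    have h1 := (hu.ode z (hmem z hzz)).hasDerivAt (Ioo_mem_nhds hzz.1 (hmem z hzz).2)
    have h2 : HasDerivAt p (p' z) z := hasDerivAt_quartic _ _ _ _ _ z
    have h3 : HasDerivAt (fun z : ℝ => z ^ 4) (4 * z ^ 3) z := by simpa using hasDerivAt_pow 4 z
    exact (h2.sub h1).div h3 (by have := hzz.1; positivity)
  have hVge : ∀ z ∈ Ioc 0 (r / 2), q / z - C * V z ≤ V' z := fun z hzz => by
    obtain ⟨g1, g2, g3, -, g5⟩ := hball (hz z hzz)
    have hden := hu.den_pos z (hmem z hzz)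
    have hw := hge z hzz
    have hwc := hle z hzz
    set w := p z - u z with hwd
    have huw : u z = p z + -w := by rw [hwd]; ring
    have hz0 := hzz.1
    have hkz : 0 ≤ 1 - (k + 1) * z := by
      have := (hmem z hzz).2; rw [lt_div_iff₀ hk1] at this; linarith
    have hnum : (p' z - DeltaU k ℓ γ z (u z) / DeltaSmallZ k ℓ γ z (u z)) =
        (p' z * DeltaSmallZ k ℓ γ z (u z) - DeltaU k ℓ γ z (u z)) / DeltaSmallZ k ℓ γ z (u z) := by
      field_simp
    have hg1 : 0 < D' z := by linarith
    simp only [hV, hV']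
    rw [← hwd, hnum]
    refine deriv_quotient_lower_bound' (D := D' z) (Q := Q z) (e := e z) (c₂ := c₂) hz0 hw hwc hg1
      hden ?_ ?_ hq0 (by linarith) g2.le ?_
    · rw [huw, DeltaSmallZ_add, hDz]
      have h5 : (1 - (k + 1) * z) * w ≤ 1 * (c₂ * z ^ 2) := by
        refine mul_le_mul ?_ hwc hw zero_le_one
        have := mul_pos hk1 hz0; linarith
      have h6 : z * D' z = z * D z + c₂ * z ^ 2 := by simp only [hD']; ring
      rw [h6]
      linarith
    · rw [huw, DeltaSmallZ_add, DeltaU_add]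
      have := hdef z
      simp only [hQ]
      linear_combination this
    · rw [hF0, sub_zero, sub_zero, Real.norm_eq_abs, Real.norm_eq_abs, abs_of_pos hz0] at g5
      have h6 := (abs_le.1 g5).1
      have h7 : C₀ * z ≤ C * z * D' z := by
        calc C₀ * z ≤ |C₀| * z := by gcongr; exact le_abs_self _
          _ = C * z * (δ / 2) := by rw [hC]; field_simp
          _ ≤ C * z * D' z := by gcongr
      simp only [hF] at h6
      linarith
  -- The integrating factor exp(Cz) absorbs the term -C V. The product has derivative at least q/z
  -- and becomes negative near 0, contrary to V ≥ 0.
  obtain ⟨z, hz1, hz2⟩ := exists_lt_of_deriv_ge_div (c := r / 2) (q := q)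
    (W := fun z => Real.exp (C * z) * V z)
    (W' := fun z => Real.exp (C * z) * C * V z + Real.exp (C * z) * V' z) (by linarith) hq0
    (fun z hzz => by
      have h1 : HasDerivAt (fun z => Real.exp (C * z)) (Real.exp (C * z) * C) z := by
        have := ((hasDerivAt_id z).const_mul C).exp
        simpa using this
      exact h1.mul (hVd z hzz))
    (fun z hzz => by
      have h1 := hVge z hzz
      have hz0 := hzz.1
      have h2 : 1 ≤ Real.exp (C * z) := Real.one_le_exp (by positivity)
      have h3 : 0 ≤ q / z := by positivity
      calc q / z ≤ Real.exp (C * z) * (q / z) := le_mul_of_one_le_left h3 h2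
        _ ≤ Real.exp (C * z) * (V' z + C * V z) := by gcongr; linarith
        _ = _ := by ring)
    0
  have h1 := hge z hz1
  have h0 := hz1.1
  have : 0 ≤ Real.exp (C * z) * V z := mul_nonneg (Real.exp_pos _).le (by simp only [hV]; positivity)
  linarith

/-! ### Position of the curve relative to Taylor polynomials, near `R = 3` and `R = 4` -/

theorem continuousAt_fst_comp {f : ℝ → ℝ} {γ₀ t : ℝ} (hf : ContinuousAt f γ₀) :
    ContinuousAt (fun p : ℝ × ℝ => f p.1) (γ₀, t) :=
  ContinuousAt.comp (f := fun p : ℝ × ℝ => p.1) hf continuousAt_fst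

/-- Near `R = 4`, the curve is above the third order Taylor polynomial. -/
theorem exists_eventually_cubic_lt_curve {k ℓ γ₀ : ℝ} (ha : Adm k ℓ γ₀) (hs : SpecRel k ℓ γ₀)
    (hR : ratioR k ℓ γ₀ = 4) (hslope : 0 ≤ slope k ℓ γ₀) (h₂ : 0 < coeffL k ℓ γ₀ 2)
    (h₄ : 0 < N₄ k (cA k ℓ γ₀) (cB k ℓ) (slope k ℓ γ₀) (coeffL k ℓ γ₀ 2) (coeffL k ℓ γ₀ 3)) :
    ∃ c ∈ Ioo 0 (1 / (k + 1)), ∀ᶠ γ in 𝓝 γ₀, ∀ z ∈ Ioc 0 c,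
      quartic (eps ℓ γ) (slope k ℓ γ) (coeffL k ℓ γ 2) (coeffL k ℓ γ 3) 0 z < curve k ℓ γ z := by
  have c2 := hs.continuousAt_coeffL 2 (fun m hm hm' => by
    rw [hR]; interval_cases m; norm_num)
  have c3 := hs.continuousAt_coeffL 3 (fun m hm hm' => by
    rw [hR]; interval_cases m <;> norm_num)
  have cε := (continuous_eps ℓ).continuousAt (x := γ₀)
  have cA' := (continuous_cA k ℓ).continuousAt (x := γ₀)
  have c1 := (continuous_slope k ℓ).continuousAt (x := γ₀)
  have p2 := continuousAt_fst_comp (t := 0) c2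
  have p3 := continuousAt_fst_comp (t := 0) c3
  have pA := continuousAt_fst_comp (t := 0) cA'
  have p1 := continuousAt_fst_comp (t := 0) c1
  obtain ⟨c, hc, hev⟩ := exists_forall_pos_of_continuousAt (γ₀ := γ₀)
    (F := fun p => N₄ k (cA k ℓ p.1) (cB k ℓ) (slope k ℓ p.1) (coeffL k ℓ p.1 2) (coeffL k ℓ p.1 3)
      + p.2 * defectTail k (cA k ℓ p.1) (cB k ℓ) (slope k ℓ p.1) (coeffL k ℓ p.1 2)
        (coeffL k ℓ p.1 3) 0 p.2)
    (by unfold N₄ defectTail; fun_prop) (by simpa using h₄)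
  have hN2 : 0 < N₂ k (cA k ℓ γ₀) (cB k ℓ) (eps ℓ γ₀) (slope k ℓ γ₀) := by
    rw [← coeffL_two (by rw [hR]; norm_num) hs.lam_pos.ne', hR]
    have := hs.lam_pos
    norm_num
    positivity
  -- At γ₀ the curve is above the cubic at a single point z' < c. This persists for nearby γ, and
  -- the sign of the defect on (0, c) spreads it to the whole of (0, z'].
  obtain ⟨z', hz', hz'c, hlt⟩ := ha.isCurve.sol.exists_cubic_lt ha hs hR
    (ha.isCurve.tangent_lt ha hs hslope hN2) h₄ hc
  refine ⟨z', hz', ?_⟩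
  have hev2 : ∀ᶠ γ in 𝓝 γ₀, quartic (eps ℓ γ) (slope k ℓ γ) (coeffL k ℓ γ 2) (coeffL k ℓ γ 3) 0 z' <
      curve k ℓ γ z' := by
    have hq : ContinuousAt (fun γ => quartic (eps ℓ γ) (slope k ℓ γ) (coeffL k ℓ γ 2)
        (coeffL k ℓ γ 3) 0 z') γ₀ := by unfold quartic; fun_prop
    exact hq.eventually_lt (continuousAt_curve ha hz') hlt
  have hRev : ∀ᶠ γ in 𝓝 γ₀, 3 < ratioR k ℓ γ :=
    hs.continuousAt_ratioR.eventually_const_lt (by rw [hR]; norm_num)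
  filter_upwards [hev, hev2, hs.eventually (by rw [hR]; norm_num), ha.eventually, hRev]
    with γ g1 g2 g3 g4 g5
  refine g4.isCurve.sol.gt_of_defect_pos hz'.2 (hasDerivAt_quartic _ _ _ _ _) (fun z hz => ?_) g2
  rw [g3.defect_quartic, coeffL_two (by linarith) g3.lam_pos.ne',
    coeffL_three (by linarith) g3.lam_pos.ne']
  have h1 := mul_pos (pow_pos hz.1 4) (g1 z ⟨hz.1.le, (hz.2.trans hz'c).le⟩)
  simp only [sub_self, mul_zero, sub_zero, zero_add]
  linarith

/-- Near `R = 3`, the curve is below a quartic perturbation of the third order Taylor polynomial,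
which in turn is below the fourth order Taylor polynomial. -/
theorem exists_eventually_curve_lt_quartic {k ℓ γ₀ : ℝ} (ha : Adm k ℓ γ₀) (hs : SpecRel k ℓ γ₀)
    (hR : ratioR k ℓ γ₀ = 3) (h₂ : 0 < coeffL k ℓ γ₀ 2)
    (h₃ : 0 < N₃ k (cB k ℓ) (slope k ℓ γ₀) (coeffL k ℓ γ₀ 2)) :
    ∃ K, ∀ᶠ γ in 𝓝 γ₀, 3 < ratioR k ℓ γ → ∃ c ∈ Ioo 0 (1 / (k + 1)),
      (∀ z ∈ Ioc 0 c, curve k ℓ γ z < quartic (eps ℓ γ) (slope k ℓ γ) (coeffL k ℓ γ 2)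
        (coeffL k ℓ γ 3) (-(K * coeffL k ℓ γ 3)) z) ∧
      -(K * coeffL k ℓ γ 3) < coeffL k ℓ γ 4 := by
  have c2 := hs.continuousAt_coeffL 2 (fun m hm hm' => by
    rw [hR]; interval_cases m; norm_num)
  have cε := (continuous_eps ℓ).continuousAt (x := γ₀)
  have cA' := (continuous_cA k ℓ).continuousAt (x := γ₀)
  have c1 := (continuous_slope k ℓ).continuousAt (x := γ₀)
  have cl := (continuous_lamMinus k ℓ).continuousAt (x := γ₀)
  have cR := hs.continuousAt_ratioR
  have hδ := hs.lam_pos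
  -- the parabola
  set M := coeffL k ℓ γ₀ 2 + 1 / 4 with hM
  have p1 := fun t => continuousAt_fst_comp (t := t) c1
  have p2 := fun t => continuousAt_fst_comp (t := t) c2
  have pA := fun t => continuousAt_fst_comp (t := t) cA'
  have pε := fun t => continuousAt_fst_comp (t := t) cε
  have pl := fun t => continuousAt_fst_comp (t := t) cl
  have pR := fun t => continuousAt_fst_comp (t := t) cR
  obtain ⟨c, hc, hev⟩ := exists_forall_pos_of_continuousAt (γ₀ := γ₀)
    (F := fun p => -(N₂ k (cA k ℓ p.1) (cB k ℓ) (eps ℓ p.1) (slope k ℓ p.1)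
        - (ratioR k ℓ p.1 - 2) * lamMinus k ℓ p.1 * M
      + p.2 * (N₃ k (cB k ℓ) (slope k ℓ p.1) M)
      + p.2 ^ 2 * (N₄ k (cA k ℓ p.1) (cB k ℓ) (slope k ℓ p.1) M 0)
      + p.2 ^ 3 * defectTail k (cA k ℓ p.1) (cB k ℓ) (slope k ℓ p.1) M 0 0 p.2))
    (by
      have := p1 0; have := pA 0; have := pε 0; have := pl 0; have := pR 0
      unfold N₂ N₃ N₄ defectTail; fun_prop)
    (by
      simp only [ne_eq, OfNat.ofNat_ne_zero, not_false_eq_true, zero_pow, zero_mul, add_zero]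
      rw [← coeffL_two (by rw [hR]; norm_num) hδ.ne', hR, hM]
      nlinarith)
  obtain ⟨z', hz', hz'c, hlt⟩ := ha.isCurve.sol.exists_lt_parabola (M := M) ha hs hR
    (by rw [hM]; linarith) (by rw [hM]; linarith) hc
  have hev2 : ∀ᶠ γ in 𝓝 γ₀, curve k ℓ γ z' < quartic (eps ℓ γ) (slope k ℓ γ) M 0 0 z' := by
    have hq : ContinuousAt (fun γ => quartic (eps ℓ γ) (slope k ℓ γ) M 0 0 z') γ₀ := by
      unfold quartic; fun_prop
    exact (continuousAt_curve ha hz').eventually_lt hq hlt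
  have hpar : ∀ᶠ γ in 𝓝 γ₀, ∀ z ∈ Ioc 0 z',
      curve k ℓ γ z < quartic (eps ℓ γ) (slope k ℓ γ) M 0 0 z := by
    filter_upwards [hev, hev2, hs.eventually (by rw [hR]; norm_num), ha.eventually]
      with γ g1 g2 g3 g4
    refine g4.isCurve.sol.lt_of_defect_neg hz'.2 (hasDerivAt_quartic _ _ _ _ _) (fun z hz => ?_) g2
    rw [g3.defect_quartic]
    have h1 := mul_pos (pow_pos hz.1 2) (g1 z ⟨hz.1.le, (hz.2.trans hz'c).le⟩)
    simp only [mul_zero, sub_zero] at h1 ⊢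
    linarith
  -- the quartic
  set P₀ := -5 * coeffL k ℓ γ₀ 2 + 4 * k * slope k ℓ γ₀ - (cA k ℓ γ₀ + 3 * cB k ℓ + 2 * k) with hP₀
  -- With this K the function Φ below equals P₀ - |P₀| - 1 - 3t at γ₀, which is negative for all t ≥
  -- 0.
  set K := (|P₀| + 1) / lamMinus k ℓ γ₀ with hK
  -- h = 1/a₃ is the natural length scale as R decreases to 3. With z = t h, the defect of the
  -- quartic with fourth coefficient -K a₃ is z⁴ Φ(γ, t)/h, where Φ stays continuous as h tends to
  -- 0.
  set h : ℝ → ℝ := fun γ => (ratioR k ℓ γ - 3) * lamMinus k ℓ γ /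
    N₃ k (cB k ℓ) (slope k ℓ γ) (coeffL k ℓ γ 2) with hh
  have cN3 : ContinuousAt (fun γ => N₃ k (cB k ℓ) (slope k ℓ γ) (coeffL k ℓ γ 2)) γ₀ := by
    unfold N₃; fun_prop
  have ch : ContinuousAt h γ₀ := ContinuousAt.div (by fun_prop) cN3 h₃.ne'
  have hh0 : h γ₀ = 0 := by simp [hh, hR]
  have ph := fun t => continuousAt_fst_comp (t := t) ch
  set Φ : ℝ → ℝ → ℝ := fun γ t =>
    -5 * coeffL k ℓ γ 2 + 4 * k * slope k ℓ γ - (cA k ℓ γ + 3 * cB k ℓ + 2 * k)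
    + h γ * (2 * k * coeffL k ℓ γ 2 ^ 2 + 2 * k * coeffL k ℓ γ 2)
    + (ratioR k ℓ γ - 4) * lamMinus k ℓ γ * K
    + t * (6 * K * coeffL k ℓ γ 2 * h γ - 3
      + (5 * k + 1) * (coeffL k ℓ γ 2 - K * slope k ℓ γ) * h γ
      + (2 * cA k ℓ γ + 4 * cB k ℓ + 2 * k) * K * h γ + (cB k ℓ + 2 * k) * h γ
      + t * h γ * (7 * K + (3 * k + 1) * (1 - 2 * K * coeffL k ℓ γ 2 * h γ)
        - (2 * cB k ℓ + 2 * k) * K * h γ)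
      + t ^ 2 * h γ ^ 2 * (-4 * K ^ 2 - (7 * k + 3) * K)
      + t ^ 3 * h γ ^ 3 * (4 * k + 2) * K ^ 2) with hΦ
  have hΦev : ∀ᶠ γ in 𝓝 γ₀, ∀ t ∈ Icc (0 : ℝ) 1, Φ γ t < 0 := by
    refine isCompact_Icc.eventually_forall_of_forall_eventually (fun t ht => ?_)
    have hcont : ContinuousAt (fun p : ℝ × ℝ => Φ p.1 p.2) (γ₀, t) := by
      have := p1 t; have := p2 t; have := pA t; have := pl t; have := pR t; have := ph t
      simp only [hΦ]; fun_prop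
    refine hcont.eventually_lt_const ?_
    have e1 : lamMinus k ℓ γ₀ * K = |P₀| + 1 := by rw [hK]; field_simp
    simp only [hΦ, hh0, hR, mul_zero, zero_mul, add_zero, zero_sub, ne_eq, OfNat.ofNat_ne_zero,
      not_false_eq_true, zero_pow, ← hP₀]
    have := le_abs_self P₀
    nlinarith [ht.1]
  have hsmall : ∀ᶠ γ in 𝓝 γ₀, h γ < z' := ch.eventually_lt_const (by rw [hh0]; exact hz'.1)
  -- At z = h the quadratic, cubic and quartic terms add up to (a₂ + 1 - K h) h², because a₃ h = 1.
  -- This exceeds M h², so the quartic starts above the parabola and hence above the curve.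
  have hend : ∀ᶠ γ in 𝓝 γ₀, M < coeffL k ℓ γ 2 + 1 - K * h γ := by
    have : ContinuousAt (fun γ => coeffL k ℓ γ 2 + 1 - K * h γ) γ₀ := by fun_prop
    refine this.eventually_const_lt ?_
    simp only [hh0, hM]; linarith
  refine ⟨K, ?_⟩
  filter_upwards [hpar, hΦev, hsmall, hend, hs.eventually (by rw [hR]; norm_num), ha.eventually,
    cN3.eventually_const_lt h₃, cR.eventually_lt_const (by rw [hR]; norm_num : _ < (4 : ℝ))]
    with γ g1 g2 g3 g4 gs ga gN gR hgt
  have hlam := gs.lam_pos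
  have hpos : 0 < h γ := div_pos (mul_pos (by linarith) hlam) gN
  have ha3 : coeffL k ℓ γ 3 = 1 / h γ := by
    have := coeffL_three (by linarith) hlam.ne' (k := k) (ℓ := ℓ) (γ := γ)
    simp only [hh]
    rw [one_div_div, eq_div_iff (mul_pos (by linarith) hlam).ne', ← this]; ring
  set η := h γ with hη
  set a₂ := coeffL k ℓ γ 2
  set a₁ := slope k ℓ γ
  rw [ha3]
  have hηm : η ∈ Ioo 0 (1 / (k + 1)) := ⟨hpos, g3.trans hz'.2⟩
  have hdefect : ∀ t, N₄ k (cA k ℓ γ) (cB k ℓ) a₁ a₂ (1 / η)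
      - (ratioR k ℓ γ - 4) * lamMinus k ℓ γ * (-(K * (1 / η)))
      + t * η * defectTail k (cA k ℓ γ) (cB k ℓ) a₁ a₂ (1 / η) (-(K * (1 / η))) (t * η) =
        Φ γ t / η := by
    intro t
    simp only [hΦ, ← hη, N₄, defectTail]
    field_simp
    ring
  refine ⟨η, hηm, ?_, ?_⟩
  · refine ga.isCurve.sol.lt_of_defect_neg hηm.2 (hasDerivAt_quartic _ _ _ _ _) (fun z hz => ?_) ?_
    · have e3 := coeffL_three (by linarith) hlam.ne' (k := k) (ℓ := ℓ) (γ := γ)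
      rw [ha3] at e3
      rw [gs.defect_quartic, coeffL_two (by linarith) hlam.ne', e3]
      have ht : z / η ∈ Icc (0 : ℝ) 1 := ⟨div_nonneg hz.1.le hpos.le,
        (div_le_one hpos).2 hz.2.le⟩
      have hd := hdefect (z / η)
      rw [div_mul_cancel₀ _ hpos.ne'] at hd
      have h1 := mul_neg_of_pos_of_neg (pow_pos hz.1 4) (div_neg_of_neg_of_pos (g2 _ ht) hpos)
      rw [← hd] at h1
      simp only [sub_self, mul_zero, zero_add]
      linarith
    · refine (g1 η ⟨hpos, g3.le⟩).trans ?_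
      simp only [quartic]
      have e1 : 1 / η * η ^ 3 = η ^ 2 := by field_simp
      have e2 : -(K * (1 / η)) * η ^ 4 = -(K * η) * η ^ 2 := by field_simp
      rw [e1, e2]
      have := mul_lt_mul_of_pos_right g4 (pow_pos hpos 2)
      nlinarith
  -- At t = 0 the defect estimate reads (R - 4)δ (a₄ + K a₃) < 0, and R < 4.
  · have hd := hdefect 0
    simp only [zero_mul, add_zero] at hd
    have h1 := div_neg_of_neg_of_pos (g2 0 ⟨le_rfl, zero_le_one⟩) hpos
    rw [← hd] at h1
    have e4 := coeffL_four (by linarith) hlam.ne' (k := k) (ℓ := ℓ) (γ := γ)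
    rw [ha3] at e4
    rw [← e4] at h1
    have h2 : (ratioR k ℓ γ - 4) * lamMinus k ℓ γ < 0 := mul_neg_of_neg_of_pos (by linarith) hlam
    nlinarith

/-! ### Matching the curve with the local analytic solution -/

/-- When R keeps distance g from 3 and 4, the factor |R - (n + 2)| is at least g(n + 3)/5, while the
coefficients of the recursion grow at most linearly in n. -/
theorem recBound_of_bounds {k ℓ γ g δ₀ A₀ : ℝ} (hk : 0 ≤ k) (hg : 0 < g) (hg1 : g ≤ 1 / 2)
    (hR1 : 3 + g ≤ ratioR k ℓ γ) (hR2 : ratioR k ℓ γ ≤ 4 - g) (hδ : 0 < δ₀)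
    (hl : δ₀ ≤ lamMinus k ℓ γ) (hA : |cA k ℓ γ| ≤ A₀) :
    RecBound (5 * (3 + 3 * k + A₀ + |cB k ℓ|) / (g * δ₀)) k ℓ γ := by
  set R := ratioR k ℓ γ
  set C := 3 + 3 * k + A₀ + |cB k ℓ| with hC
  have hA0 : 0 ≤ A₀ := (abs_nonneg _).trans hA
  have hB0 := abs_nonneg (cB k ℓ)
  have hden : ∀ n : ℕ, g * ((n : ℝ) + 3) / 5 ≤ |R - ((n : ℝ) + 2)| := by
    intro n
    rcases Nat.lt_or_ge n 3 with hn | hn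
    · interval_cases n
      · push_cast; rw [abs_of_pos (by linarith)]; linarith
      · push_cast; rw [abs_of_pos (by linarith)]; linarith
      · push_cast; rw [abs_of_neg (by linarith)]; linarith
    · have hn' : (3 : ℝ) ≤ n := by exact_mod_cast hn
      rw [abs_of_neg (by linarith)]
      nlinarith
  have key : ∀ (x : ℝ) (n : ℕ), x ≤ C * ((n : ℝ) + 3) →
      x ≤ 5 * C / (g * δ₀) * (|R - ((n : ℝ) + 2)| * |lamMinus k ℓ γ|) := by
    intro x n hx
    have hC0 : 0 ≤ C := by positivity
    have h1 : g * ((n : ℝ) + 3) / 5 * δ₀ ≤ |R - ((n : ℝ) + 2)| * |lamMinus k ℓ γ| :=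
      mul_le_mul (hden n) (hl.trans (le_abs_self _)) hδ.le (abs_nonneg _)
    calc x ≤ C * ((n : ℝ) + 3) := hx
      _ = 5 * C / (g * δ₀) * (g * ((n : ℝ) + 3) / 5 * δ₀) := by field_simp
      _ ≤ _ := by gcongr
  have hn0 : ∀ n : ℕ, (0 : ℝ) ≤ n := fun n => n.cast_nonneg
  have hmul : ∀ (n : ℕ) (m x X : ℝ), |m| ≤ (n : ℝ) + 3 → |x| ≤ X → |m * x| ≤ ((n : ℝ) + 3) * X :=
    fun n m x X hm hx => by
      rw [abs_mul]
      exact mul_le_mul hm hx (abs_nonneg _) (by linarith [hn0 n])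
  refine ⟨fun n => key _ n ?_, fun n => key _ n ?_, fun n => key _ n ?_, fun n => key _ n ?_⟩
  · nlinarith [hn0 n]
  · have hn := hn0 n
    refine (abs_sub _ _).trans ?_
    rw [abs_two, abs_of_nonneg (by positivity)]
    nlinarith
  · have hn := hn0 n
    have h1 := hmul n ((n : ℝ) + 2 - 3) _ _ (by rw [abs_le]; constructor <;> linarith) hA
    have h2 := hmul n ((n : ℝ) + 2 - 1) _ _ (by rw [abs_le]; constructor <;> linarith)
      (le_refl |cB k ℓ|)
    refine (abs_add_le _ _).trans ?_
    have h3 := abs_add_le (((n : ℝ) + 2 - 3) * cA k ℓ γ) (((n : ℝ) + 2 - 1) * cB k ℓ)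
    rw [abs_of_nonneg (by linarith : (0 : ℝ) ≤ 2 * k)]
    nlinarith
  · have hn := hn0 n
    have h2 := hmul n ((n : ℝ) + 2 - 4) _ _ (by rw [abs_le]; constructor <;> linarith)
      (le_refl |cB k ℓ|)
    refine (abs_add_le _ _).trans ?_
    rw [abs_of_nonneg (by linarith : (0 : ℝ) ≤ 2 * k)]
    nlinarith

/-- A uniform radius of convergence for the Taylor series at `Q₁`, for parameters in a compact
interval. -/
theorem exists_uniform_radius {k ℓ a b : ℝ} (hk : 0 ≤ k)
    (h : ∀ γ ∈ Icc a b, SpecRel k ℓ γ ∧ ratioR k ℓ γ ∈ Ioo (3 : ℝ) 4) :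
    ∃ r > 0, ∃ α, ∀ γ ∈ Icc a b, ∀ N, psNorm r N (uLps k ℓ γ) ≤ α := by
  rcases (Icc a b).eq_empty_or_nonempty with he | hne
  · exact ⟨1, one_pos, 0, fun γ hγ => by rw [he] at hγ; exact absurd hγ (notMem_empty _)⟩
  have cR : ContinuousOn (ratioR k ℓ) (Icc a b) := fun γ hγ =>
    (h γ hγ).1.continuousAt_ratioR.continuousWithinAt
  obtain ⟨γ₁, hγ₁, m₁⟩ := isCompact_Icc.exists_isMinOn hne cR
  obtain ⟨γ₂, hγ₂, m₂⟩ := isCompact_Icc.exists_isMaxOn hne cR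
  obtain ⟨γ₃, hγ₃, m₃⟩ := isCompact_Icc.exists_isMinOn hne (continuous_lamMinus k ℓ).continuousOn
  obtain ⟨A₀, hA₀⟩ := isCompact_Icc.exists_bound_of_continuousOn (continuous_cA k ℓ).continuousOn
    (s := Icc a b)
  obtain ⟨α₀, hα₀⟩ := isCompact_Icc.exists_bound_of_continuousOn (continuous_eps ℓ).continuousOn
    (s := Icc a b)
  obtain ⟨α₁, hα₁⟩ := isCompact_Icc.exists_bound_of_continuousOn (continuous_slope k ℓ).continuousOn
    (s := Icc a b)
  set g := min (min (ratioR k ℓ γ₁ - 3) (4 - ratioR k ℓ γ₂)) (1 / 2) with hg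
  have hg0 : 0 < g := lt_min (lt_min (sub_pos.2 (h γ₁ hγ₁).2.1) (sub_pos.2 (h γ₂ hγ₂).2.2))
    (by norm_num)
  set K := 5 * (3 + 3 * k + A₀ + |cB k ℓ|) / (g * lamMinus k ℓ γ₃) with hK
  obtain ⟨r, hr, H⟩ := exists_radius_uLps (K := max 1 K) (le_max_left _ _)
    ((norm_nonneg _).trans (hα₀ γ₁ hγ₁)) ((norm_nonneg _).trans (hα₁ γ₁ hγ₁))
  refine ⟨r, hr.1, α₀ + α₁ + 1, fun γ hγ => H k ℓ γ (hα₀ γ hγ) (hα₁ γ hγ) ?_⟩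
  have hb := recBound_of_bounds (k := k) (ℓ := ℓ) (γ := γ) (g := g) (δ₀ := lamMinus k ℓ γ₃)
    (A₀ := A₀) hk hg0 (min_le_right _ _)
    (by
      have h1 : g ≤ ratioR k ℓ γ₁ - 3 := (min_le_left _ _).trans (min_le_left _ _)
      have h2 : ratioR k ℓ γ₁ ≤ ratioR k ℓ γ := m₁ hγ
      linarith)
    (by
      have h1 : g ≤ 4 - ratioR k ℓ γ₂ := (min_le_left _ _).trans (min_le_right _ _)
      have h2 : ratioR k ℓ γ ≤ ratioR k ℓ γ₂ := m₂ hγ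
      linarith)
    (h γ₃ hγ₃).1.lam_pos (m₃ hγ) (hA₀ γ hγ)
  have hmono : ∀ x : ℝ, 0 ≤ x → K * x ≤ max 1 K * x := fun x hx =>
    mul_le_mul_of_nonneg_right (le_max_right _ _) hx
  exact ⟨fun n => (hb.quad₁ n).trans (hmono _ (by positivity)),
    fun n => (hb.quad₂ n).trans (hmono _ (by positivity)),
    fun n => (hb.lin₁ n).trans (hmono _ (by positivity)),
    fun n => (hb.lin₂ n).trans (hmono _ (by positivity))⟩

theorem eventually_abs_uL_sub_quartic {k ℓ γ r α : ℝ} (hr : 0 < r)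
    (h : ∀ N, psNorm r N (uLps k ℓ γ) ≤ α) {c : ℝ} (hc : 0 < c) :
    ∀ᶠ z in 𝓝[>] (0 : ℝ), |uL k ℓ γ z - quartic (eps ℓ γ) (slope k ℓ γ) (coeffL k ℓ γ 2)
      (coeffL k ℓ γ 3) (coeffL k ℓ γ 4) z| < c * z ^ 4 := by
  have h1 : ∀ᶠ z in 𝓝[>] (0 : ℝ), z ∈ Ioo 0 r := Ioo_mem_nhdsGT hr
  have hα : 0 ≤ α := by have := h 0; rwa [psNorm, Finset.sum_range_zero] at this
  have h2 : ∀ᶠ z in 𝓝[>] (0 : ℝ), z / r ^ 5 * α < c := by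
    have : ContinuousAt (fun z : ℝ => z / r ^ 5 * α) 0 := by fun_prop
    exact (this.eventually_lt_const (by simpa using hc)).filter_mono nhdsWithin_le_nhds
  filter_upwards [h1, h2] with z hz hz2
  have hz0 := hz.1
  have h3 := abs_psSum_sub_sum_le hr (psConv_of_psNorm_le hr.le h)
    (z := z) (by rw [abs_of_pos hz0]; exact hz.2.le) 5
  rw [← uL_eq_psSum, abs_of_pos hz0] at h3
  have e : ∑ i ∈ Finset.range 5, PowerSeries.coeff i (uLps k ℓ γ) * z ^ i =
      quartic (eps ℓ γ) (slope k ℓ γ) (coeffL k ℓ γ 2) (coeffL k ℓ γ 3) (coeffL k ℓ γ 4) z := by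
    simp [Finset.sum_range_succ, uLps, quartic, coeffL_zero, coeffL_one]
  rw [e] at h3
  calc _ ≤ (z / r) ^ 5 * _ := h3
    _ ≤ (z / r) ^ 5 * α := by gcongr; exact tsum_tail_le_of_psNorm_le hr.le h 5
    _ = z / r ^ 5 * α * z ^ 4 := by field_simp
    _ < c * z ^ 4 := by gcongr

/-- Along u_L the function Δ_z starts like δz. The error constant depends only on the Taylor data
and the radius, so positivity holds on an interval uniform over a compact set of parameters. -/
theorem DeltaSmallZ_uL_ge {k ℓ γ r α z : ℝ} (hk : 0 ≤ k) (hs : SpecRel k ℓ γ) (hr : 0 < r)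
    (h : ∀ N, psNorm r N (uLps k ℓ γ) ≤ α) (hz : z ∈ Ioc 0 r) (hz1 : (k + 1) * z ≤ 1) :
    z * (lamMinus k ℓ γ - (|(k + 1) * slope k ℓ γ - cA k ℓ γ - cB k ℓ| + |cB k ℓ| + α / r ^ 2) * z) ≤
      DeltaSmallZ k ℓ γ z (uL k ℓ γ z) := by
  have hz0 := hz.1
  have h3 := abs_psSum_sub_sum_le hr (psConv_of_psNorm_le hr.le h)
    (z := z) (by rw [abs_of_pos hz0]; exact hz.2) 2
  rw [← uL_eq_psSum, abs_of_pos hz0] at h3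
  have e : ∑ i ∈ Finset.range 2, PowerSeries.coeff i (uLps k ℓ γ) * z ^ i =
      eps ℓ γ + slope k ℓ γ * z := by
    simp [Finset.sum_range_succ, uLps, coeffL_zero, coeffL_one]
  rw [e] at h3
  have h4 : |uL k ℓ γ z - (eps ℓ γ + slope k ℓ γ * z)| ≤ α / r ^ 2 * z ^ 2 := by
    refine h3.trans ?_
    calc _ ≤ (z / r) ^ 2 * α := by gcongr; exact tsum_tail_le_of_psNorm_le hr.le h 2
      _ = _ := by field_simp
  set w := uL k ℓ γ z - (eps ℓ γ + slope k ℓ γ * z) with hw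
  have huw : uL k ℓ γ z = (eps ℓ γ + slope k ℓ γ * z) + w := by rw [hw]; ring
  have hDz : DeltaSmallZ k ℓ γ z (eps ℓ γ + slope k ℓ γ * z) = z * (lamMinus k ℓ γ +
      ((k + 1) * slope k ℓ γ - cA k ℓ γ - cB k ℓ) * z + cB k ℓ * z ^ 2) := by
    simp only [DeltaSmallZ, fPoly, ← hs.delta_eq]; ring
  rw [huw, DeltaSmallZ_add, hDz]
  have h5 : (1 - (k + 1) * z) * w ≤ α / r ^ 2 * z ^ 2 := by
    have h6 : |(1 - (k + 1) * z) * w| ≤ 1 * (α / r ^ 2 * z ^ 2) := by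
      rw [abs_mul]
      refine mul_le_mul ?_ h4 (abs_nonneg _) zero_le_one
      rw [abs_of_nonneg (by linarith)]
      have := mul_nonneg (by linarith : (0 : ℝ) ≤ k + 1) hz0.le
      linarith
    have := le_abs_self ((1 - (k + 1) * z) * w)
    linarith
  have hz1' : z ≤ 1 := by nlinarith
  have h7 : -|(k + 1) * slope k ℓ γ - cA k ℓ γ - cB k ℓ| * z ^ 2 ≤
      ((k + 1) * slope k ℓ γ - cA k ℓ γ - cB k ℓ) * z ^ 2 := by
    gcongr; exact neg_abs_le _
  have h8 : -|cB k ℓ| * z ^ 2 ≤ cB k ℓ * z ^ 3 := by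
    have h9 : -|cB k ℓ| * z ^ 3 ≤ cB k ℓ * z ^ 3 := by gcongr; exact neg_abs_le _
    have h10 : z ^ 3 ≤ z ^ 2 := pow_le_pow_of_le_one hz0.le hz1' (by norm_num)
    nlinarith [abs_nonneg (cB k ℓ)]
  nlinarith

theorem ratioR_ne_natCast {k ℓ γ : ℝ} (h : ratioR k ℓ γ ∈ Ioo (3 : ℝ) 4) (m : ℕ) :
    ratioR k ℓ γ ≠ m := by
  intro e
  rw [e] at h
  have h1 : 3 < m := by exact_mod_cast h.1
  have h2 : m < 4 := by exact_mod_cast h.2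
  omega

/-- If the curve is above the local analytic solution for `R` near `4` and below it for `R` near
`3`, the two coincide for some intermediate parameter. -/
theorem exists_matching {k ℓ γ₄ γ₃ : ℝ} (hlt : γ₄ < γ₃)
    (hmid : ∀ γ ∈ Ioo γ₄ γ₃, Adm k ℓ γ ∧ SpecRel k ℓ γ ∧ ratioR k ℓ γ ∈ Ioo (3 : ℝ) 4)
    (ha₄ : Adm k ℓ γ₄) (hs₄ : SpecRel k ℓ γ₄) (hR₄ : ratioR k ℓ γ₄ = 4)
    (hslope₄ : 0 ≤ slope k ℓ γ₄) (h₄₂ : 0 < coeffL k ℓ γ₄ 2)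
    (h₄₄ : 0 < N₄ k (cA k ℓ γ₄) (cB k ℓ) (slope k ℓ γ₄) (coeffL k ℓ γ₄ 2) (coeffL k ℓ γ₄ 3))
    (ha₃ : Adm k ℓ γ₃) (hs₃ : SpecRel k ℓ γ₃) (hR₃ : ratioR k ℓ γ₃ = 3)
    (h₃₂ : 0 < coeffL k ℓ γ₃ 2)
    (h₃₃ : 0 < N₃ k (cB k ℓ) (slope k ℓ γ₃) (coeffL k ℓ γ₃ 2)) :
    ∃ γ ∈ Ioo γ₄ γ₃, ∃ ζ ∈ Ioo 0 (1 / (k + 1)), ∃ r > ζ, PsConv r (uLps k ℓ γ) ∧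
      ∀ z ∈ Ioc 0 ζ, uL k ℓ γ z = curve k ℓ γ z := by
  have hk := ha₄.one_le_k
  have hk1 : 0 < k + 1 := by linarith
  obtain ⟨c, hc, hev₄⟩ := exists_eventually_cubic_lt_curve ha₄ hs₄ hR₄ hslope₄ h₄₂ h₄₄
  have hcN : ContinuousAt (fun γ => N₄ k (cA k ℓ γ) (cB k ℓ) (slope k ℓ γ) (coeffL k ℓ γ 2)
      (coeffL k ℓ γ 3)) γ₄ := by
    have c2 := hs₄.continuousAt_coeffL 2 (fun m hm hm' => by
      rw [hR₄]; interval_cases m; norm_num)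
    have c3 := hs₄.continuousAt_coeffL 3 (fun m hm hm' => by
      rw [hR₄]; interval_cases m <;> norm_num)
    have := (continuous_cA k ℓ).continuousAt (x := γ₄)
    have := (continuous_slope k ℓ).continuousAt (x := γ₄)
    unfold N₄; fun_prop
  obtain ⟨K, hev₃⟩ := exists_eventually_curve_lt_quartic ha₃ hs₃ hR₃ h₃₂ h₃₃
  -- The shooting takes place on a compact [γa, γb] inside (γ₄, γ₃), where R is bounded away from 3
  -- and 4 and the radius of convergence is uniform.
  obtain ⟨γa, ⟨hγa, hNa⟩, hγa'⟩ :=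
    (((hev₄.and (hcN.eventually_const_lt h₄₄)).filter_mono nhdsWithin_le_nhds).and
    (Ioo_mem_nhdsGT hlt : ∀ᶠ γ in 𝓝[>] γ₄, γ ∈ Ioo γ₄ γ₃)).exists
  obtain ⟨γb, hγb, hγb'⟩ := ((hev₃.filter_mono nhdsWithin_le_nhds).and
    (Ioo_mem_nhdsLT hγa'.2 : ∀ᶠ γ in 𝓝[<] γ₃, γ ∈ Ioo γa γ₃)).exists
  have hI : ∀ γ ∈ Icc γa γb, γ ∈ Ioo γ₄ γ₃ := fun γ hγ =>
    ⟨hγa'.1.trans_le hγ.1, hγ.2.trans_lt hγb'.2⟩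
  have hmb := hmid γb ⟨hγa'.1.trans hγb'.1, hγb'.2⟩
  have hma := hmid γa hγa'
  obtain ⟨cb, hcb, hγb1, hγb2⟩ := hγb hmb.2.2.1
  obtain ⟨r, hr, α, hα⟩ := exists_uniform_radius (by linarith : 0 ≤ k)
    (fun γ hγ => (hmid γ (hI γ hγ)).2)
  have hab : γa ≤ γb := hγb'.1.le
  have hmemA : γa ∈ Icc γa γb := ⟨le_rfl, hab⟩
  have hmemB : γb ∈ Icc γa γb := ⟨hab, le_rfl⟩
  have hne : (Icc γa γb).Nonempty := ⟨γa, hmemA⟩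
  obtain ⟨γm, hγm, mm⟩ := isCompact_Icc.exists_isMinOn hne (continuous_lamMinus k ℓ).continuousOn
  have hCc : Continuous fun γ => |(k + 1) * slope k ℓ γ - cA k ℓ γ - cB k ℓ| + |cB k ℓ| + α / r ^ 2 := by
    have := continuous_slope k ℓ
    have := continuous_cA k ℓ
    fun_prop
  obtain ⟨γM, hγM, mM⟩ := isCompact_Icc.exists_isMaxOn hne hCc.continuousOn
  set δ₀ := lamMinus k ℓ γm
  set C := |(k + 1) * slope k ℓ γM - cA k ℓ γM - cB k ℓ| + |cB k ℓ| + α / r ^ 2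
  have hδ₀ : 0 < δ₀ := (hmid γm (hI γm hγm)).2.1.lam_pos
  -- the sign of the difference at the two ends
  have ha4 : coeffL k ℓ γa 4 < 0 := by
    have h1 := coeffL_four (ratioR_ne_natCast hma.2.2 4) hma.2.1.lam_pos.ne'
    rw [← h1] at hNa
    have h2 : (ratioR k ℓ γa - 4) * lamMinus k ℓ γa < 0 :=
      mul_neg_of_neg_of_pos (sub_neg.2 hma.2.2.2) hma.2.1.lam_pos
    exact neg_of_mul_pos_right hNa h2.le
  have evA : ∀ᶠ z in 𝓝[>] (0 : ℝ), uL k ℓ γa z <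
      quartic (eps ℓ γa) (slope k ℓ γa) (coeffL k ℓ γa 2) (coeffL k ℓ γa 3) 0 z := by
    filter_upwards [eventually_abs_uL_sub_quartic hr (hα γa hmemA) (neg_pos.2 ha4)] with z hz
    have := (abs_lt.1 hz).2
    simp only [quartic] at this ⊢
    linarith
  have evB : ∀ᶠ z in 𝓝[>] (0 : ℝ), quartic (eps ℓ γb) (slope k ℓ γb) (coeffL k ℓ γb 2)
      (coeffL k ℓ γb 3) (-(K * coeffL k ℓ γb 3)) z < uL k ℓ γb z := by
    filter_upwards [eventually_abs_uL_sub_quartic hr (hα γb hmemB) (sub_pos.2 hγb2)] with z hz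
    have := (abs_lt.1 hz).1
    simp only [quartic] at this ⊢
    linarith
  have evC : ∀ᶠ z in 𝓝[>] (0 : ℝ), 0 < δ₀ - C * z := by
    have : ContinuousAt (fun z : ℝ => δ₀ - C * z) 0 := by fun_prop
    exact (this.eventually_const_lt (by simpa using hδ₀)).filter_mono nhdsWithin_le_nhds
  have evD : ∀ᶠ z in 𝓝[>] (0 : ℝ), z ∈ Ioo 0 (min (min c cb) r) :=
    Ioo_mem_nhdsGT (lt_min (lt_min hc.1 hcb.1) hr)
  -- A single ζ serves both end comparisons, and δ₀ - Cζ > 0 makes Δ_z positive along u_L on (0, ζ]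
  -- for every parameter in [γa, γb].
  obtain ⟨ζ, hζA, hζB, hζC, hζD⟩ := (evA.and (evB.and (evC.and evD))).exists
  have hζc : ζ < c := hζD.2.trans_le ((min_le_left _ _).trans (min_le_left _ _))
  have hζcb : ζ < cb := hζD.2.trans_le ((min_le_left _ _).trans (min_le_right _ _))
  have hζr : ζ < r := hζD.2.trans_le (min_le_right _ _)
  have hζm : ζ ∈ Ioo 0 (1 / (k + 1)) := ⟨hζD.1, hζc.trans hc.2⟩
  have hcurve : ContinuousOn (fun γ => curve k ℓ γ ζ) (Icc γa γb) := fun γ hγ =>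
    (continuousAt_curve (hmid γ (hI γ hγ)).1 hζm).continuousWithinAt
  have huL : ContinuousOn (fun γ => uL k ℓ γ ζ) (Icc γa γb) := by
    simp only [uL_eq_psSum]
    refine continuousOn_psSum_param hr (c := α) (fun n γ hγ => ?_) (fun γ hγ n => ?_)
      (by rw [abs_of_pos hζD.1]; exact hζr)
    · have hm := hmid γ (hI γ hγ)
      simp only [uLps, PowerSeries.coeff_mk]
      exact (hm.2.1.continuousAt_coeffL n
        (fun m _ _ => ratioR_ne_natCast hm.2.2 m)).continuousWithinAt
    · refine le_trans ?_ (hα γ hγ (n + 1))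
      rw [psNorm, Finset.sum_range_succ]
      have := psNorm_nonneg hr.le n (uLps k ℓ γ)
      rw [psNorm] at this
      linarith
  have hDa : uL k ℓ γa ζ < curve k ℓ γa ζ := hζA.trans (hγa ζ ⟨hζD.1, hζc.le⟩)
  have hDb : curve k ℓ γb ζ < uL k ℓ γb ζ := (hγb1 ζ ⟨hζD.1, hζcb.le⟩).trans hζB
  obtain ⟨γ, hγ, hγ0⟩ := intermediate_value_Icc' hab (hcurve.sub huL)
    (show (0 : ℝ) ∈ Icc _ _ from ⟨by simp only [Pi.sub_apply]; linarith, by simp only [Pi.sub_apply]; linarith⟩)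
  have hval : uL k ℓ γ ζ = curve k ℓ γ ζ := (sub_eq_zero.1 hγ0).symm
  obtain ⟨ga, gs, gR⟩ := hmid γ (hI γ hγ)
  have hconv := psConv_of_psNorm_le hr.le (hα γ hγ)
  refine ⟨γ, hI γ hγ, ζ, hζm, r, hζr, hconv, fun z hz => ?_⟩
  have hkζ : (k + 1) * ζ ≤ 1 := by
    have := hζm.2; rw [lt_div_iff₀ hk1] at this; linarith
  have hDz : ∀ x ∈ Icc z ζ, 0 < DeltaSmallZ k ℓ γ x (uL k ℓ γ x) := by
    intro x hx
    have hx0 : 0 < x := hz.1.trans_le hx.1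
    refine lt_of_lt_of_le ?_ (DeltaSmallZ_uL_ge (by linarith) gs hr (hα γ hγ)
      ⟨hx0, hx.2.trans hζr.le⟩ ?_)
    · refine mul_pos hx0 ?_
      have h1 : δ₀ ≤ lamMinus k ℓ γ := mm hγ
      have h2 : |(k + 1) * slope k ℓ γ - cA k ℓ γ - cB k ℓ| + |cB k ℓ| + α / r ^ 2 ≤ C := mM hγ
      have hα0 : 0 ≤ α := by have := hα γ hγ 0; rwa [psNorm, Finset.sum_range_zero] at this
      have h3 : 0 ≤ C := le_trans (by positivity) h2
      have h4 : (|(k + 1) * slope k ℓ γ - cA k ℓ γ - cB k ℓ| + |cB k ℓ| + α / r ^ 2) * x ≤ C * ζ :=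
        mul_le_mul h2 hx.2 hx0.le h3
      linarith
    · have := mul_le_mul_of_nonneg_left hx.2 hk1.le
      linarith
  -- Where Δ_z > 0 along u_L the quasi-linear equation can be divided. Then u_L is a solution in the
  -- same region as the curve, and equality at ζ propagates to the left.
  have hode : ∀ x ∈ Icc z ζ, HasDerivWithinAt (uL k ℓ γ)
      (DeltaU k ℓ γ x (uL k ℓ γ x) / DeltaSmallZ k ℓ γ x (uL k ℓ γ x)) (Icc z ζ) x := by
    intro x hx
    have hx0 : 0 < x := hz.1.trans_le hx.1
    obtain ⟨h1, h2⟩ := uL_solves gs (fun n => by exact_mod_cast ratioR_ne_natCast gR (n + 2)) hconv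
      (z := x) (by rw [abs_of_pos hx0]; exact hx.2.trans_lt hζr)
    rw [← h2, mul_div_cancel_left₀ _ (hDz x hx).ne']
    exact h1.hasDerivAt.hasDerivWithinAt
  have hsub : Icc z ζ ⊆ Ioo 0 (1 / (k + 1)) := fun x hx =>
    ⟨hz.1.trans_le hx.1, hx.2.trans_lt hζm.2⟩
  have habove := uSonic_lt_of_lt_right ga hz.1 hode (fun _ _ _ => rfl)
    (by rw [hval]; exact ga.isCurve.sol.above ζ hζm)
  exact SolOn.eqOn ga hz.1.le hζm.2.le ⟨hode, hDz, habove⟩ (ga.isCurve.sol.mono hsub) hval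
    ⟨le_rfl, hz.2⟩

/-! ### Parameters with prescribed ratio of eigenvalues -/

/-- `T = R δ / ε` and `D = √(T² - 2 k R)` parametrize the `γ` for which the ratio of the eigenvalues
is `R`. -/
structure RootData (R k ℓ T D : ℝ) : Prop where
  D_pos : 0 < D
  D_sq : D ^ 2 = T ^ 2 - 2 * k * R
  eq : ((k + 2) * T - 2 * k * (R + 1)) * √ℓ = (k - 2 * ℓ) * D
  A_pos : (k + 2) * R < (R + 1) * T
  lt_top : T < (k * R + 2) / 2

/-- The value of `γ`. -/
def gammaOf (ℓ T D : ℝ) : ℝ := T / (D * √ℓ)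

/-- The value of `ε`. -/
def epsOf (R k D : ℝ) : ℝ := 2 * k * R / D ^ 2

/-- All spectral data are expressed by T = Rδ/ε and ε. Modulo the relation `rel` between the two,
the sign conditions become polynomial inequalities in T, k and ν = (ℓ - 1)/ε. -/
structure SpecValues (R k ℓ γ T ε : ℝ) : Prop where
  adm : Adm k ℓ γ
  spec : SpecRel k ℓ γ
  ratio : ratioR k ℓ γ = R
  ε_pos : 0 < ε
  eps_eq : eps ℓ γ = ε
  lam_eq : lamMinus k ℓ γ = T * ε / R
  A_eq : cA k ℓ γ = ε * ((R + 1) * T / R - (k + 2))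
  slope_eq : slope k ℓ γ = ε * (T - 2)
  rel : ε * (T ^ 2 - 2 * k * R) = 2 * k * R

theorem RootData.T_pos {R k ℓ T D : ℝ} (h : RootData R k ℓ T D) (hk : 1 ≤ k) (hR : 1 < R) :
    0 < T := by
  have h1 := h.A_pos
  have h2 : 0 < (k + 2) * R := by positivity
  exact pos_of_mul_pos_right (h2.trans h1) (by linarith)

/-- The choice γ = T/(D√ℓ) gives 1 + ε = T²/D², and the equation of `RootData` then turns the
definition of A into a formula in T and ε. With δ = Tε/R the trace is (R + 1)δ and the determinant
Rδ², which identifies the eigenvalues. -/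
theorem RootData.specValues {R k ℓ T D : ℝ} (h : RootData R k ℓ T D) (hk : 1 ≤ k) (hℓ : 1 < ℓ)
    (hR : 1 < R) : SpecValues R k ℓ (gammaOf ℓ T D) T (epsOf R k D) := by
  have hD := h.D_pos
  have hT := h.T_pos hk hR
  have hs : 0 < √ℓ := Real.sqrt_pos.2 (by linarith)
  have hs2 : √ℓ ^ 2 = ℓ := Real.sq_sqrt (by linarith)
  have hDsq := h.D_sq
  have hε : 0 < epsOf R k D := by rw [epsOf]; positivity
  have hrel : epsOf R k D * (T ^ 2 - 2 * k * R) = 2 * k * R := by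
    rw [← hDsq, epsOf]; field_simp
  have heps : eps ℓ (gammaOf ℓ T D) = epsOf R k D := by
    rw [eps, gammaOf, div_pow, mul_pow, hs2, epsOf]
    have : T ^ 2 = D ^ 2 + 2 * k * R := by linarith
    rw [this]
    field_simp
    ring
  have hγD : gammaOf ℓ T D * (D * √ℓ) = T := by rw [gammaOf]; field_simp
  have hAeq : cA k ℓ (gammaOf ℓ T D) = epsOf R k D * ((R + 1) * T / R - (k + 2)) := by
    have h1 : (k - 2 * ℓ) * gammaOf ℓ T D = T * ((k + 2) * T - 2 * k * (R + 1)) / D ^ 2 := by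
      rw [gammaOf, eq_div_iff (by positivity)]
      have e := h.eq
      field_simp
      linear_combination (-1) * e
    rw [cA, h1, epsOf]
    field_simp
    linear_combination (k + 2) * hDsq
  have hA : 0 < cA k ℓ (gammaOf ℓ T D) := by
    rw [hAeq]
    refine mul_pos hε ?_
    rw [sub_pos, lt_div_iff₀ (by linarith)]
    exact h.A_pos
  have hγ : 1 / √ℓ < gammaOf ℓ T D := by
    rw [gammaOf, div_lt_div_iff₀ hs (by positivity), one_mul]
    have : D < T := by
      have : D ^ 2 < T ^ 2 := by
        have : 0 < 2 * k * R := by positivity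
        linarith
      exact lt_of_pow_lt_pow_left₀ 2 hT.le this
    gcongr
  have hsum : (k + 2) * eps ℓ (gammaOf ℓ T D) + cA k ℓ (gammaOf ℓ T D) =
      (R + 1) * (T * epsOf R k D / R) := by rw [heps, hAeq]; field_simp; ring
  have hprod : 2 * k * eps ℓ (gammaOf ℓ T D) * (1 + eps ℓ (gammaOf ℓ T D)) =
      R * (T * epsOf R k D / R) ^ 2 := by
    rw [heps]
    have e : R * (T * epsOf R k D / R) ^ 2 = epsOf R k D * (T ^ 2 * epsOf R k D) / R := by
      field_simp
    rw [e, eq_div_iff (by linarith)]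
    linear_combination (-epsOf R k D) * hrel
  obtain ⟨h1, h2, h3⟩ := ratioR_eq_of_sum_prod (by positivity) hR.le hsum hprod
  have hsp := specRel_of_lamMinus_pos h3 (by rw [h1]; positivity)
  refine ⟨⟨hk, hℓ, hγ, hA⟩, hsp, h2, hε, heps, h1, hAeq, ?_, hrel⟩
  rw [hsp.slope_eq, h1, h2, heps]
  field_simp

/-- Signs of the Taylor data when `R = 3`. -/
theorem SpecValues.pos_three {k ℓ γ T ε ν : ℝ} (h : SpecValues 3 k ℓ γ T ε) (hν : ℓ - 1 = ν * ε)
    (hν0 : 0 < ν) (hT : 2 < T) (hT0 : 2 * T ≤ 3 * k + 2)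
    (hb : 4 * ν ≤ 3 * ((T - 2) * (T - k - 1))) :
    0 < coeffL k ℓ γ 2 ∧ 0 < N₃ k (cB k ℓ) (slope k ℓ γ) (coeffL k ℓ γ 2) := by
  have hε := h.ε_pos
  have hB : cB k ℓ = 2 * k - ν * ε := by rw [cB, ← hν]; ring
  have h2 := coeffL_two (by rw [h.ratio]; norm_num) h.spec.lam_pos.ne'
  have hrel := h.rel
  have ha2 : coeffL k ℓ γ 2 = ε * ((T - 1) * (3 * k + 2 - 2 * T) + 3 * ν) := by
    rw [h.ratio, h.lam_eq, h.A_eq, h.eps_eq, h.slope_eq, hB] at h2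
    have hne : T * ε / 3 ≠ 0 := by positivity
    apply mul_left_cancel₀ hne
    rw [N₂] at h2
    linear_combination h2 + ε * (2 * T - 3) / 3 * hrel
  have hP : 0 ≤ (T - 1) * (3 * k + 2 - 2 * T) := mul_nonneg (by linarith) (by linarith)
  rw [ha2, h.slope_eq, hB]
  refine ⟨by positivity, ?_⟩
  set P := (T - 1) * (3 * k + 2 - 2 * T) with hPd
  -- Modulo `rel`, `N₃` splits into a product made nonnegative by `hb` and the strictly positive
  -- remainder ν(T - 2).
  have e : N₃ k (2 * k - ν * ε) (ε * (T - 2)) (ε * (P + 3 * ν)) =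
      ε ^ 2 * ((P + 3 * ν) * (3 * ((T - 2) * (T - k - 1)) - 4 * ν) + ν * (T - 2)) := by
    rw [N₃, hPd]
    linear_combination (ε * ((T - 1) * (3 * k + 2 - 2 * T) + 3 * ν)) * hrel
  rw [e]
  have h1 : 0 ≤ (P + 3 * ν) * (3 * ((T - 2) * (T - k - 1)) - 4 * ν) :=
    mul_nonneg (by positivity) (by linarith)
  have h2 : 0 < ν * (T - 2) := mul_pos hν0 (by linarith)
  positivity

/-- The Taylor data when `R = 4`. -/
theorem SpecValues.coeffs_four {k ℓ γ T ε ν P J : ℝ} (h : SpecValues 4 k ℓ γ T ε)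
    (hν : ℓ - 1 = ν * ε) (hT : 0 < T) (hP : P = (T - 1) * (2 * k + 1 - T))
    (hJ : J = (5 * T ^ 2 - 4 * (k + 5) * T + 16 * (k + 1)) / 4) :
    coeffL k ℓ γ 2 = ε * (P + 2 * ν) ∧
      N₄ k (cA k ℓ γ) (cB k ℓ) (slope k ℓ γ) (coeffL k ℓ γ 2) (coeffL k ℓ γ 3) =
        ε ^ 2 * (4 / T * ((P + 2 * ν) * (J - 2 * ν) + ν * (T - 2)) *
          (4 * T ^ 2 - (6 * k + 45 / 4) * T + 11 * k + 7 - 7 * ν) +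
          (P + 2 * ν) * (2 * k * (P + 2 * ν) + T ^ 2 / 4 - 2 * k)) := by
  have hε := h.ε_pos
  have hB : cB k ℓ = 2 * k - ν * ε := by rw [cB, ← hν]; ring
  have h2 := coeffL_two (by rw [h.ratio]; norm_num) h.spec.lam_pos.ne'
  have h3 := coeffL_three (by rw [h.ratio]; norm_num) h.spec.lam_pos.ne'
  have hrel := h.rel
  have ha2 : coeffL k ℓ γ 2 = ε * (P + 2 * ν) := by
    rw [h.ratio, h.lam_eq, h.A_eq, h.eps_eq, h.slope_eq, hB] at h2
    have hne : (4 - 2) * (T * ε / 4) ≠ 0 := by positivity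
    apply mul_left_cancel₀ hne
    rw [h2, N₂, hP]
    linear_combination (ε * (2 * T - 3) / 4 * hrel)
  have ha3 : coeffL k ℓ γ 3 = ε * (4 / T * ((P + 2 * ν) * (J - 2 * ν) + ν * (T - 2))) := by
    rw [h.ratio, h.lam_eq, ha2, h.slope_eq, hB] at h3
    have hne : (4 - 3) * (T * ε / 4) ≠ 0 := by positivity
    apply mul_left_cancel₀ hne
    rw [h3, N₃]
    have e : (4 - 3) * (T * ε / 4) * (ε * (4 / T * ((P + 2 * ν) * (J - 2 * ν) + ν * (T - 2)))) =
        ε ^ 2 * ((P + 2 * ν) * (J - 2 * ν) + ν * (T - 2)) := by field_simp; ring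
    rw [e, hP, hJ]
    linear_combination (3 / 4 * ε * ((T - 1) * (2 * k + 1 - T) + 2 * ν) * hrel)
  refine ⟨ha2, ?_⟩
  rw [ha3, ha2, h.slope_eq, hB, h.A_eq]
  generalize 4 / T * ((P + 2 * ν) * (J - 2 * ν) + ν * (T - 2)) = α₃
  rw [N₄, hP]
  linear_combination (ε * α₃ - ε * ((T - 1) * (2 * k + 1 - T) + 2 * ν) / 4) * hrel

/-- `ν = (ℓ - 1) / ε`. -/
theorem nu_mul_epsOf {R k ℓ D : ℝ} (hD : 0 < D) (hk : 1 ≤ k) (hR : 1 < R) :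
    ℓ - 1 = ((ℓ - 1) * D ^ 2 / (2 * k * R)) * epsOf R k D := by
  rw [epsOf]; field_simp

/-- With `y = √ℓ D`, the equation for `T` is quadratic in `y`. -/
theorem RootData.quadratic {R k ℓ T D : ℝ} (h : RootData R k ℓ T D) (hℓ : 1 < ℓ) :
    2 * (√ℓ * D) ^ 2 + ((k + 2) * T - 2 * k * (R + 1)) * (√ℓ * D) = k * D ^ 2 := by
  have hs2 : √ℓ ^ 2 = ℓ := Real.sq_sqrt (by linarith)
  rw [mul_pow, hs2]
  linear_combination D * h.eq

theorem RootData.D_lt_y {R k ℓ T D : ℝ} (h : RootData R k ℓ T D) (hℓ : 1 < ℓ) : D < √ℓ * D := by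
  have hs1 : 1 < √ℓ := by rw [Real.lt_sqrt] <;> linarith
  have := h.D_pos
  nlinarith

/-- y = √ℓ D is the positive root of the quadratic 2y² + Cy = kD², so any Y ≥ 0 at which the
left-hand side has reached kD² lies to the right of it. -/
theorem RootData.y_le {R k ℓ T D Y : ℝ} (h : RootData R k ℓ T D) (hℓ : 1 < ℓ) (hY : 0 ≤ Y)
    (hY2 : k * D ^ 2 ≤ 2 * Y ^ 2 + ((k + 2) * T - 2 * k * (R + 1)) * Y)
    (hk : 0 < k) : √ℓ * D ≤ Y := by
  have hq := h.quadratic hℓ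
  have hy : 0 < √ℓ * D := h.D_pos.trans (h.D_lt_y hℓ)
  set y := √ℓ * D
  by_contra! hlt
  have hD := h.D_pos
  have h1 : 0 < k * D ^ 2 := by positivity
  have h3 : 0 < 2 * y + ((k + 2) * T - 2 * k * (R + 1)) := by
    have : 0 < y * (2 * y + ((k + 2) * T - 2 * k * (R + 1))) := by nlinarith
    exact (mul_pos_iff_of_pos_left hy).1 this
  have h4 : Y * (2 * Y + ((k + 2) * T - 2 * k * (R + 1))) <
      y * (2 * y + ((k + 2) * T - 2 * k * (R + 1))) := by
    have h5 : Y * (2 * Y + ((k + 2) * T - 2 * k * (R + 1))) ≤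
        Y * (2 * y + ((k + 2) * T - 2 * k * (R + 1))) := by
      apply mul_le_mul_of_nonneg_left _ hY; linarith
    have h6 := mul_lt_mul_of_pos_right hlt h3
    linarith
  nlinarith

/-- The bound for `ν` when the coefficient of the quadratic equation is nonnegative. -/
theorem RootData.nu_le {R k ℓ T D : ℝ} (h : RootData R k ℓ T D) (hk : 2 ≤ k) (hℓ : 1 < ℓ)
    (hR : 1 < R) (hC : 0 ≤ (k + 2) * T - 2 * k * (R + 1)) (hT : 2 ≤ T) :
    (ℓ - 1) * D ^ 2 / (2 * k * R) ≤ (T - 2) * ((k * R + 2) / 2 - T) / (k * R) := by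
  have hq := h.quadratic hℓ
  have hDy := h.D_lt_y hℓ
  have hs2 : √ℓ ^ 2 = ℓ := Real.sq_sqrt (by linarith)
  have hy2 : (√ℓ * D) ^ 2 = ℓ * D ^ 2 := by rw [mul_pow, hs2]
  have hD := h.D_pos
  -- D² ≤ (T - 2)² is equivalent to T ≤ (kR + 2)/2.
  have hDT : D ≤ T - 2 := by
    refine abs_le_of_sq_le_sq' ?_ (by linarith) |>.2
    have := h.D_sq
    have := h.lt_top
    nlinarith
  set C := (k + 2) * T - 2 * k * (R + 1) with hCd
  -- The quadratic gives 2(ℓ - 1)D² = (k - 2)D² - Cy, and y ≥ D with C ≥ 0.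
  have h1 : 2 * ((ℓ - 1) * D ^ 2) ≤ D * ((k - 2) * D - C) := by
    have := mul_le_mul_of_nonneg_left hDy.le hC
    nlinarith
  have h2 : (k - 2) * D - C ≤ 4 * ((k * R + 2) / 2 - T) := by
    have := mul_le_mul_of_nonneg_left hDT (by linarith : 0 ≤ k - 2)
    rw [hCd]; nlinarith
  have h3 : 0 ≤ 4 * ((k * R + 2) / 2 - T) := by have := h.lt_top; linarith
  have h4 : D * ((k - 2) * D - C) ≤ (T - 2) * (4 * ((k * R + 2) / 2 - T)) :=
    (mul_le_mul_of_nonneg_left h2 hD.le).trans (mul_le_mul_of_nonneg_right hDT h3)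
  rw [div_le_div_iff₀ (by positivity) (by positivity)]
  have h5 : (ℓ - 1) * D ^ 2 ≤ 2 * ((T - 2) * ((k * R + 2) / 2 - T)) := by linarith
  have := mul_le_mul_of_nonneg_right h5 (by positivity : 0 ≤ k * R)
  nlinarith

/-- Existence of `T`, by the intermediate value theorem. -/
theorem exists_rootData {R k ℓ Tl : ℝ} (hk : 1 ≤ k) (hℓ : 1 < ℓ) (hR : 3 ≤ R)
    (hTl : 2 * k * R ≤ Tl ^ 2) (hTl0 : 0 ≤ Tl) (hTl1 : Tl < (k * R + 2) / 2)
    (hneg : (k + 2) * Tl - 2 * k * (R + 1) < (k / √ℓ - 2 * √ℓ) * √(Tl ^ 2 - 2 * k * R))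
    (hA : (k + 2) * R ≤ (R + 1) * Tl) :
    ∃ T ∈ Ioo Tl ((k * R + 2) / 2), ∃ D, RootData R k ℓ T D := by
  set T₀ := (k * R + 2) / 2 with hT₀
  have hs : 0 < √ℓ := Real.sqrt_pos.2 (by linarith)
  have hs1 : 1 < √ℓ := by rw [Real.lt_sqrt] <;> linarith
  have hs2 : √ℓ ^ 2 = ℓ := Real.sq_sqrt (by linarith)
  set φ := k / √ℓ - 2 * √ℓ with hφ
  have hφlt : φ < k - 2 := by
    have : k / √ℓ ≤ k := div_le_self (by linarith) hs1.le
    rw [hφ]; linarith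
  -- A zero of g is the equation of `RootData`. At T₀ the square root equals (kR - 2)/2 and the
  -- linear part is k - 2 times that, so g(T₀) > 0 follows from φ < k - 2, that is, from ℓ > 1.
  set g : ℝ → ℝ := fun T => (k + 2) * T - 2 * k * (R + 1) - φ * √(T ^ 2 - 2 * k * R) with hg
  have hgc : ContinuousOn g (Icc Tl T₀) := by
    apply Continuous.continuousOn; simp only [hg]; fun_prop
  have hkR : 0 < (k * R - 2) / 2 := by nlinarith
  have hg0 : 0 < g T₀ := by
    have e : T₀ ^ 2 - 2 * k * R = ((k * R - 2) / 2) ^ 2 := by rw [hT₀]; ring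
    simp only [hg]
    rw [e, Real.sqrt_sq hkR.le, hT₀]
    have := mul_pos (sub_pos.2 hφlt) hkR
    nlinarith
  obtain ⟨T, hT, hT0⟩ := intermediate_value_Ioo hTl1.le hgc
    (show (0 : ℝ) ∈ Ioo (g Tl) (g T₀) from ⟨by simp only [hg]; linarith, hg0⟩)
  have hsq : 0 < T ^ 2 - 2 * k * R := by
    have := hT.1
    nlinarith
  refine ⟨T, hT, √(T ^ 2 - 2 * k * R), Real.sqrt_pos.2 hsq, Real.sq_sqrt hsq.le, ?_, ?_, hT.2⟩
  · have h1 : (k + 2) * T - 2 * k * (R + 1) = φ * √(T ^ 2 - 2 * k * R) := sub_eq_zero.1 hT0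
    rw [h1, hφ]
    have h2 : (k / √ℓ - 2 * √ℓ) * √ℓ = k - 2 * ℓ := by
      rw [sub_mul, div_mul_cancel₀ _ hs.ne', mul_assoc, Real.mul_self_sqrt (by linarith)]
    linear_combination √(T ^ 2 - 2 * k * R) * h2
  · have := mul_lt_mul_of_pos_left hT.1 (by linarith : 0 < R + 1)
    linarith

/-- Starting the search for T at √(2kR), where D vanishes, removes ℓ from the condition at the left
end. This is the argument for k = 1, 2. -/
theorem exists_rootData_of_small {R k ℓ : ℝ} (hk : 1 ≤ k) (hℓ : 1 < ℓ) (hR : 3 ≤ R)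
    (h1 : (k + 2) ^ 2 * R < 2 * k * (R + 1) ^ 2) (h2 : 8 * k * R < (k * R + 2) ^ 2) :
    ∃ T ∈ Ioo (√(2 * k * R)) ((k * R + 2) / 2), ∃ D, RootData R k ℓ T D := by
  have h0 : 0 < 2 * k * R := by positivity
  have hsq := Real.sq_sqrt h0.le
  have hs := Real.sqrt_pos.2 h0
  set q := √(2 * k * R)
  refine exists_rootData hk hℓ hR hsq.ge hs.le ?_ ?_ ?_
  · refine lt_of_pow_lt_pow_left₀ 2 (by positivity) ?_
    rw [hsq]; nlinarith
  · rw [hsq, sub_self, Real.sqrt_zero, mul_zero, sub_neg]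
    refine lt_of_pow_lt_pow_left₀ 2 (by positivity) ?_
    rw [mul_pow, hsq]; nlinarith
  · refine le_of_lt (lt_of_pow_lt_pow_left₀ 2 (by positivity) ?_)
    rw [mul_pow, mul_pow, hsq]; nlinarith

/-! ### The case `R = 3`, `R = 4` for `k = 1, 2` -/

/-- The conclusions needed at `R = 3`. -/
structure GoodThree (k ℓ γ : ℝ) : Prop where
  adm : Adm k ℓ γ
  spec : SpecRel k ℓ γ
  ratio : ratioR k ℓ γ = 3
  two : 0 < coeffL k ℓ γ 2
  three : 0 < N₃ k (cB k ℓ) (slope k ℓ γ) (coeffL k ℓ γ 2)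

/-- The conclusions needed at `R = 4`. -/
structure GoodFour (k ℓ γ : ℝ) : Prop where
  adm : Adm k ℓ γ
  spec : SpecRel k ℓ γ
  ratio : ratioR k ℓ γ = 4
  slope : 0 ≤ slope k ℓ γ
  two : 0 < coeffL k ℓ γ 2
  four : 0 < N₄ k (cA k ℓ γ) (cB k ℓ) (RelEuler.slope k ℓ γ) (coeffL k ℓ γ 2) (coeffL k ℓ γ 3)

theorem RootData.goodThree {k ℓ T D : ℝ} (h : RootData 3 k ℓ T D) (hk : 1 ≤ k) (hℓ : 1 < ℓ)
    (hT : 2 < T)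
    (hb : 4 * ((ℓ - 1) * D ^ 2 / (2 * k * 3)) ≤ 3 * ((T - 2) * (T - k - 1))) :
    GoodThree k ℓ (gammaOf ℓ T D) := by
  have hv := h.specValues hk hℓ (by norm_num)
  have hD := h.D_pos
  have hν0 : 0 < (ℓ - 1) * D ^ 2 / (2 * k * 3) := by
    have : 0 < ℓ - 1 := by linarith
    positivity
  obtain ⟨h1, h2⟩ := hv.pos_three (nu_mul_epsOf hD hk (by norm_num)) hν0 hT
    (by have := h.lt_top; linarith) hb
  exact ⟨hv.adm, hv.spec, hv.ratio, h1, h2⟩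

theorem RootData.goodFour {k ℓ T D : ℝ} (h : RootData 4 k ℓ T D) (hk : 1 ≤ k) (hℓ : 1 < ℓ)
    (hT : 2 < T)
    (hb : ∀ ν P J : ℝ, ν = (ℓ - 1) * D ^ 2 / (2 * k * 4) → 0 < ν → P = (T - 1) * (2 * k + 1 - T) →
      0 < P → J = (5 * T ^ 2 - 4 * (k + 5) * T + 16 * (k + 1)) / 4 →
      0 ≤ 4 / T * ((P + 2 * ν) * (J - 2 * ν) + ν * (T - 2)) *
          (4 * T ^ 2 - (6 * k + 45 / 4) * T + 11 * k + 7 - 7 * ν) +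
          (P + 2 * ν) * (2 * k * (P + 2 * ν))) :
    GoodFour k ℓ (gammaOf ℓ T D) := by
  have hv := h.specValues hk hℓ (by norm_num)
  have hD := h.D_pos
  have hν0 : 0 < (ℓ - 1) * D ^ 2 / (2 * k * 4) := by
    have : 0 < ℓ - 1 := by linarith
    positivity
  set ν := (ℓ - 1) * D ^ 2 / (2 * k * 4) with hν
  have hP0 : 0 < (T - 1) * (2 * k + 1 - T) :=
    mul_pos (by linarith) (by have := h.lt_top; linarith)
  obtain ⟨h1, h2⟩ := hv.coeffs_four (nu_mul_epsOf hD hk (by norm_num)) (by linarith) rfl rfl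
  have hε := hv.ε_pos
  refine ⟨hv.adm, hv.spec, hv.ratio, ?_, ?_, ?_⟩
  · rw [hv.slope_eq]; exact mul_nonneg hε.le (by linarith)
  · rw [h1]; positivity
  · rw [h2]
    refine mul_pos (by positivity) ?_
    have h3 := hb ν _ _ hν hν0 rfl hP0 rfl
    have h4 := h.D_sq
    -- The summand T²/4 - 2k equals D²/4 > 0; it supplies strictness, so `hb` need not be strict.
    have h5 : 0 < ((T - 1) * (2 * k + 1 - T) + 2 * ν) * (D ^ 2 / 4) := by positivity
    rw [h4] at h5
    linarith

theorem exists_goodThree_one {ℓ : ℝ} (hℓ : 1 < ℓ) : ∃ γ, GoodThree 1 ℓ γ := by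
  obtain ⟨T, hT, D, h⟩ := exists_rootData_of_small (R := 3) (k := 1) le_rfl hℓ le_rfl
    (by norm_num) (by norm_num)
  have hT2 : 6 < T ^ 2 := by
    have := h.D_sq; have := h.D_pos; nlinarith
  have hT0 := h.T_pos le_rfl (by norm_num)
  have hT1 : T < 5 / 2 := by have := h.lt_top; linarith
  have hTl : 12 / 5 < T := by nlinarith
  refine ⟨_, h.goodThree le_rfl hℓ (by linarith) ?_⟩
  -- Y = (kR - 2)/2 is the value of D at the upper end T = (kR + 2)/2; the other cases with k ≤ 2
  -- use the same choice.
  have hy := h.y_le hℓ (Y := 1 / 2) (by norm_num) (by rw [h.D_sq]; nlinarith) one_pos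
  have hs2 : √ℓ ^ 2 = ℓ := Real.sq_sqrt (by linarith)
  have hy2 : (√ℓ * D) ^ 2 = ℓ * D ^ 2 := by rw [mul_pow, hs2]
  have hy0 : 0 < √ℓ * D := h.D_pos.trans (h.D_lt_y hℓ)
  have h1 : ℓ * D ^ 2 ≤ 1 / 4 := by rw [← hy2]; nlinarith
  have h2 := sq_nonneg D
  nlinarith

theorem exists_goodFour_one {ℓ : ℝ} (hℓ : 1 < ℓ) : ∃ γ, GoodFour 1 ℓ γ := by
  obtain ⟨T, hT, D, h⟩ := exists_rootData_of_small (R := 4) (k := 1) le_rfl hℓ (by norm_num)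
    (by norm_num) (by norm_num)
  have hT2 : 8 < T ^ 2 := by
    have := h.D_sq; have := h.D_pos; nlinarith
  have hT0 := h.T_pos le_rfl (by norm_num)
  have hT1 : T < 3 := by have := h.lt_top; linarith
  have hTl : 14 / 5 < T := by nlinarith
  refine ⟨_, h.goodFour le_rfl hℓ (by linarith) (fun ν P J hν hν0 hP hP0 hJ => ?_)⟩
  have hy := h.y_le hℓ (Y := 1) (by norm_num) (by rw [h.D_sq]; nlinarith) one_pos
  have hs2 : √ℓ ^ 2 = ℓ := Real.sq_sqrt (by linarith)
  have hy2 : (√ℓ * D) ^ 2 = ℓ * D ^ 2 := by rw [mul_pow, hs2]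
  have hy0 : 0 < √ℓ * D := h.D_pos.trans (h.D_lt_y hℓ)
  have h1 : ℓ * D ^ 2 ≤ 1 := by rw [← hy2]; nlinarith
  have h2 := sq_nonneg D
  have hν1 : ν ≤ 1 / 8 := by rw [hν]; linarith
  have hJ1 : 3 / 4 ≤ J := by rw [hJ]; nlinarith
  have hX : 0 ≤ 4 * T ^ 2 - (6 * 1 + 45 / 4) * T + 11 * 1 + 7 - 7 * ν := by nlinarith
  have h3 : 0 ≤ (P + 2 * ν) * (J - 2 * ν) := mul_nonneg (by positivity) (by linarith)
  have h4 : 0 ≤ ν * (T - 2) := mul_nonneg hν0.le (by linarith)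
  positivity

theorem exists_goodThree_two {ℓ : ℝ} (hℓ : 1 < ℓ) : ∃ γ, GoodThree 2 ℓ γ := by
  obtain ⟨T, hT, D, h⟩ := exists_rootData_of_small (R := 3) (k := 2) one_le_two hℓ le_rfl
    (by norm_num) (by norm_num)
  have hT2 : 12 < T ^ 2 := by
    have := h.D_sq; have := h.D_pos; nlinarith
  have hT0 := h.T_pos one_le_two (by norm_num)
  have hT1 : T < 4 := by have := h.lt_top; linarith
  have hTl : 17 / 5 < T := by nlinarith
  refine ⟨_, h.goodThree one_le_two hℓ (by linarith) ?_⟩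
  have hy := h.y_le hℓ (Y := 2) (by norm_num) (by rw [h.D_sq]; nlinarith) two_pos
  have hq := h.quadratic hℓ
  have hs2 : √ℓ ^ 2 = ℓ := Real.sq_sqrt (by linarith)
  have hy2 : (√ℓ * D) ^ 2 = ℓ * D ^ 2 := by rw [mul_pow, hs2]
  have hy0 : 0 < √ℓ * D := h.D_pos.trans (h.D_lt_y hℓ)
  -- For k = 2 the quadratic contains 2y² - 2D² = 2(ℓ - 1)D², so ν is linear in y.
  have h1 : (ℓ - 1) * D ^ 2 = 2 * (4 - T) * (√ℓ * D) := by
    rw [hy2] at hq; linear_combination (1 / 2) * hq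
  have h2 : 2 * (4 - T) * (√ℓ * D) ≤ 2 * (4 - T) * 2 :=
    mul_le_mul_of_nonneg_left hy (by linarith)
  rw [h1]
  nlinarith

/-- With x = 5 - T. If X - 7ν ≥ 0, every term is nonnegative. Otherwise 4/(5 - x) ≤ 1 and the bound
on ν reduce the negative product to at most 4(P + 2ν)², by a polynomial inequality in x alone, and
the last summand compensates for it. -/
theorem four_ineq_two {x ν P J X : ℝ} (hx0 : 0 < x) (hx1 : x < 1) (hν0 : 0 < ν)
    (hν1 : ν ≤ 3 * x / 8) (hJ : J = (33 - 22 * x + 5 * x ^ 2) / 4) (hP : P = (4 - x) * x)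
    (hX : X = (1 - x) * (51 / 4 - 4 * x)) :
    0 ≤ 4 / (5 - x) * ((P + 2 * ν) * (J - 2 * ν) + ν * (5 - x - 2)) * (X - 7 * ν) +
      (P + 2 * ν) * (2 * 2 * (P + 2 * ν)) := by
  have hJ1 : 4 ≤ J := by rw [hJ]; nlinarith
  have hPx : 3 * x ≤ P := by
    rw [hP]; exact mul_le_mul_of_nonneg_right (by linarith) hx0.le
  have hP9 : (21 / 8 * x - X) * (J + 3 / 8) ≤ 4 * P := by
    rw [hJ, hP, hX]
    obtain ⟨w, rfl⟩ : ∃ w, x = 1 - w := ⟨1 - x, by ring⟩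
    have hw : 0 < w := by linarith
    rw [← sub_nonneg]
    ring_nf
    positivity
  clear hJ hP hX
  have hS : 0 < P + 2 * ν := by linarith
  have h4 : 0 ≤ ν * (5 - x - 2) := mul_nonneg hν0.le (by linarith)
  have h3 : 0 ≤ (P + 2 * ν) * (J - 2 * ν) := mul_nonneg hS.le (by linarith)
  have h7 : ν * (5 - x - 2) ≤ (P + 2 * ν) * (3 / 8) := by
    have h8 : ν * (5 - x - 2) ≤ ν * 3 := mul_le_mul_of_nonneg_left (by linarith) hν0.le
    linarith
  have h8 : (P + 2 * ν) * (J - 2 * ν) ≤ (P + 2 * ν) * J :=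
    mul_le_mul_of_nonneg_left (by linarith) hS.le
  obtain ⟨Q, hQ⟩ : ∃ Q, Q = (P + 2 * ν) * (J - 2 * ν) + ν * (5 - x - 2) := ⟨_, rfl⟩
  rw [← hQ]
  have hQ0 : 0 ≤ Q := by linarith
  have h6 : Q ≤ (P + 2 * ν) * (J + 3 / 8) := by linarith
  rcases le_or_gt 0 (X - 7 * ν) with hc | hc
  · have h5 : 0 ≤ 4 / (5 - x) * Q := mul_nonneg (div_nonneg (by norm_num) (by linarith)) hQ0
    have h6 : 0 ≤ (P + 2 * ν) * (2 * 2 * (P + 2 * ν)) := by positivity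
    exact add_nonneg (mul_nonneg h5 hc) h6
  · have hfrac : 4 / (5 - x) ≤ 1 := by rw [div_le_one (by linarith)]; linarith
    have h5 : 4 / (5 - x) * Q ≤ Q := mul_le_of_le_one_left hQ0 hfrac
    have h10 : (7 * ν - X) * (J + 3 / 8) ≤ (21 / 8 * x - X) * (J + 3 / 8) :=
      mul_le_mul_of_nonneg_right (by linarith) (by linarith)
    have h11 : 4 / (5 - x) * Q * (7 * ν - X) ≤ (P + 2 * ν) * (J + 3 / 8) * (7 * ν - X) :=
      mul_le_mul_of_nonneg_right (h5.trans h6) (by linarith)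
    have h12 : (P + 2 * ν) * ((7 * ν - X) * (J + 3 / 8)) ≤ (P + 2 * ν) * (4 * (P + 2 * ν)) :=
      mul_le_mul_of_nonneg_left (by linarith) hS.le
    calc (0 : ℝ) ≤ (P + 2 * ν) * (4 * (P + 2 * ν)) - 4 / (5 - x) * Q * (7 * ν - X) := by linarith
      _ = _ := by ring

theorem exists_goodFour_two {ℓ : ℝ} (hℓ : 1 < ℓ) : ∃ γ, GoodFour 2 ℓ γ := by
  obtain ⟨T, hT, D, h⟩ := exists_rootData_of_small (R := 4) (k := 2) one_le_two hℓ (by norm_num)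
    (by norm_num) (by norm_num)
  have hT2 : 16 < T ^ 2 := by
    have := h.D_sq; have := h.D_pos; nlinarith
  have hT0 := h.T_pos one_le_two (by norm_num)
  have hT1 : T < 5 := by have := h.lt_top; linarith
  have hTl : 4 < T := by nlinarith
  refine ⟨_, h.goodFour one_le_two hℓ (by linarith) (fun ν P J hν hν0 hP hP0 hJ => ?_)⟩
  have hy := h.y_le hℓ (Y := 3) (by norm_num) (by rw [h.D_sq]; nlinarith) two_pos
  have hq := h.quadratic hℓ
  have hs2 : √ℓ ^ 2 = ℓ := Real.sq_sqrt (by linarith)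
  have hy2 : (√ℓ * D) ^ 2 = ℓ * D ^ 2 := by rw [mul_pow, hs2]
  have h1 : (ℓ - 1) * D ^ 2 = 2 * (5 - T) * (√ℓ * D) := by
    rw [hy2] at hq; linear_combination (1 / 2) * hq
  have h2 : 2 * (5 - T) * (√ℓ * D) ≤ 2 * (5 - T) * 3 :=
    mul_le_mul_of_nonneg_left hy (by linarith)
  obtain ⟨x, rfl⟩ : ∃ x, T = 5 - x := ⟨5 - T, by ring⟩
  have hx0 : 0 < x := by linarith
  have hx1 : x < 1 := by linarith
  have hν1 : ν ≤ 3 * x / 8 := by rw [hν, h1]; linarith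
  have hJx : J = (33 - 22 * x + 5 * x ^ 2) / 4 := by rw [hJ]; ring
  have hPx : P = (4 - x) * x := by rw [hP]; ring
  have e1 : 4 * (5 - x) ^ 2 - (6 * 2 + 45 / 4) * (5 - x) + 11 * 2 + 7 - 7 * ν =
      (1 - x) * (51 / 4 - 4 * x) - 7 * ν := by ring
  rw [e1]
  exact four_ineq_two hx0 hx1 hν0 hν1 hJx hPx rfl

/-! ### The cases `R = 3`, `R = 4` for `k ≥ 3` -/

/-- Above this threshold the linear coefficient of the quadratic for y is nonnegative, so
`RootData.nu_le` bounds ν. After division by T - 2, the remaining inequality is linear in T. -/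
theorem RootData.goodThree_of_three_le {k ℓ T D : ℝ} (h : RootData 3 k ℓ T D) (hk : 3 ≤ k)
    (hℓ : 1 < ℓ) (hT : (25 * k + 21) / 20 < T) : GoodThree k ℓ (gammaOf ℓ T D) := by
  have hC : 0 ≤ (k + 2) * T - 2 * k * (3 + 1) := by
    have : (k + 2) * ((25 * k + 21) / 20) ≤ (k + 2) * T :=
      mul_le_mul_of_nonneg_left hT.le (by linarith)
    nlinarith
  refine h.goodThree (by linarith) hℓ (by linarith) ?_
  have h1 := h.nu_le (by linarith) hℓ (by norm_num) hC (by linarith)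
  have h2 : 4 * ((k * 3 + 2) / 2 - T) ≤ 3 * (T - k - 1) * (k * 3) := by
    have : k * ((25 * k + 21) / 20) ≤ k * T := mul_le_mul_of_nonneg_left hT.le (by linarith)
    nlinarith
  have h3 : 4 * ((T - 2) * ((k * 3 + 2) / 2 - T) / (k * 3)) ≤ 3 * ((T - 2) * (T - k - 1)) := by
    rw [← mul_div_assoc, div_le_iff₀ (by linarith)]
    have := mul_le_mul_of_nonneg_left h2 (by linarith : 0 ≤ T - 2)
    linarith
  linarith

/-- Above this threshold ν is small enough for both J - 2ν and the last bracket to be nonnegative,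
so no term of the expression for `N₄` is negative. -/
theorem RootData.goodFour_of_three_le {k ℓ T D : ℝ} (h : RootData 4 k ℓ T D) (hk : 3 ≤ k)
    (hℓ : 1 < ℓ) (hT : (17 * k + 9) / 10 < T) : GoodFour k ℓ (gammaOf ℓ T D) := by
  have hC : 0 ≤ (k + 2) * T - 2 * k * (4 + 1) := by
    have : (k + 2) * ((17 * k + 9) / 10) ≤ (k + 2) * T :=
      mul_le_mul_of_nonneg_left hT.le (by linarith)
    nlinarith
  refine h.goodFour (by linarith) hℓ (by linarith) (fun ν P J hν hν0 hP hP0 hJ => ?_)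
  have h1 := h.nu_le (by linarith) hℓ (by norm_num) hC (by linarith)
  rw [← hν] at h1
  have hTt := h.lt_top
  have h2 : ν ≤ ((k * 4 + 2) / 2 - T) / 2 := by
    refine h1.trans ?_
    rw [div_le_iff₀ (by linarith)]
    have := mul_le_mul_of_nonneg_right (by linarith : T - 2 ≤ 2 * k)
      (by linarith : 0 ≤ (k * 4 + 2) / 2 - T)
    linarith
  obtain ⟨t, rfl⟩ : ∃ t, T = (17 * k + 9) / 10 + t := ⟨T - (17 * k + 9) / 10, by ring⟩
  have ht : 0 < t := by linarith
  have hkt : 0 < k * t := by positivity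
  have hJ1 : 0 ≤ J - 2 * ν := by rw [hJ]; nlinarith
  have hX : 0 ≤ 4 * ((17 * k + 9) / 10 + t) ^ 2 - (6 * k + 45 / 4) * ((17 * k + 9) / 10 + t) +
      11 * k + 7 - 7 * ν := by nlinarith
  have h3 : 0 ≤ (P + 2 * ν) * (J - 2 * ν) := mul_nonneg (by positivity) hJ1
  have h4 : 0 ≤ ν * ((17 * k + 9) / 10 + t - 2) := mul_nonneg hν0.le (by linarith)
  have h5 : 0 ≤ 4 / ((17 * k + 9) / 10 + t) := by positivity
  have h6 : 0 ≤ (P + 2 * ν) * (2 * k * (P + 2 * ν)) := by positivity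
  exact add_nonneg (mul_nonneg (mul_nonneg h5 (add_nonneg h3 h4)) hX) h6

/-- The positive root `s` of `2 s² + c s = k`. -/
def posRoot (k c : ℝ) : ℝ := (-c + √(c ^ 2 + 8 * k)) / 4

theorem posRoot_eq {k c : ℝ} (hk : 0 ≤ k) : 2 * posRoot k c ^ 2 + c * posRoot k c = k := by
  have h := Real.sq_sqrt (by positivity : 0 ≤ c ^ 2 + 8 * k)
  rw [posRoot]
  linear_combination (1 / 8) * h

theorem one_lt_posRoot {k c : ℝ} (hc : c < k - 2) : 1 < posRoot k c := by
  have h : 4 + c < √(c ^ 2 + 8 * k) := Real.lt_sqrt_of_sq_lt (by nlinarith)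
  rw [posRoot]; linarith

/-- The function of `T` whose zero gives the critical value `ℓ₁`. -/
theorem exists_critical {k : ℝ} (hk : 3 ≤ k) :
    ∃ T ∈ Ioo ((25 * k + 21) / 20) ((3 * k + 2) / 2), ∃ D > 0, ∃ s > 1, D ^ 2 = T ^ 2 - 6 * k ∧
      2 * s ^ 2 * D + ((k + 2) * T - 8 * k) * s = k * D ∧
      26 / 3 * T ^ 2 - (11 * k + 64 / 3) * T + 16 * k + 12 =
        12 * (s ^ 2 - 1) * (D ^ 2 / (6 * k)) := by
  have hpos : ∀ T, (25 * k + 21) / 20 ≤ T → 0 < T ^ 2 - 6 * k := by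
    intro T hT
    have : ((25 * k + 21) / 20) ^ 2 ≤ T ^ 2 := by gcongr
    nlinarith
  set D : ℝ → ℝ := fun T => √(T ^ 2 - 6 * k) with hD
  set c : ℝ → ℝ := fun T => ((k + 2) * T - 8 * k) / D T with hc
  -- Put ε = 6k/(T² - 6k), s = `posRoot` and ℓ = s². The first equation defining ℓ₁ becomes c T =
  -- k/s - 2s, and F is the second one multiplied by (T² - 6k)/(6k).
  set F : ℝ → ℝ := fun T => 26 / 3 * T ^ 2 - (11 * k + 64 / 3) * T + 16 * k + 12 -
    12 * (posRoot k (c T) ^ 2 - 1) * ((T ^ 2 - 6 * k) / (6 * k)) with hF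
  have hlt : ∀ T, (25 * k + 21) / 20 ≤ T → T < (3 * k + 2) / 2 → c T < k - 2 := by
    intro T hT hT'
    have hDp := Real.sqrt_pos.2 (hpos T hT)
    have hDs := Real.sq_sqrt (hpos T hT).le
    simp only [hc, hD]
    rw [div_lt_iff₀ hDp]
    refine lt_of_pow_lt_pow_left₀ 2 (mul_nonneg (by linarith) hDp.le) ?_
    rw [mul_pow, hDs]
    have h1 : 0 < 8 * k * (((3 * k + 2) / 2 - T) * (T - (k + 6) / 2)) :=
      mul_pos (by linarith) (mul_pos (by linarith) (by linarith))
    linarith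
  have hcont : ContinuousOn F (Icc ((25 * k + 21) / 20) ((3 * k + 2) / 2)) := by
    have hDc : ContinuousOn D (Icc ((25 * k + 21) / 20) ((3 * k + 2) / 2)) := by
      simp only [hD]; fun_prop
    have hcc : ContinuousOn c (Icc ((25 * k + 21) / 20) ((3 * k + 2) / 2)) :=
      ContinuousOn.div (by fun_prop) hDc fun T hT => (Real.sqrt_pos.2 (hpos T hT.1)).ne'
    simp only [hF, posRoot]
    fun_prop
  -- At the left end the polynomial part alone is negative. At the right end s = 1, so the
  -- subtracted term vanishes and the polynomial part is positive.
  have h1 : F ((25 * k + 21) / 20) < 0 := by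
    have hs := one_lt_posRoot (hlt _ le_rfl (by linarith))
    have hp := hpos _ le_rfl
    have h2 : 0 < 12 * (posRoot k (c ((25 * k + 21) / 20)) ^ 2 - 1) *
        ((((25 * k + 21) / 20) ^ 2 - 6 * k) / (6 * k)) := by
      have : 0 < posRoot k (c ((25 * k + 21) / 20)) ^ 2 - 1 := by nlinarith
      positivity
    have h3 : 26 / 3 * ((25 * k + 21) / 20) ^ 2 - (11 * k + 64 / 3) * ((25 * k + 21) / 20) +
      16 * k + 12 < 0 := by nlinarith
    simp only [hF]; linarith
  have h2 : 0 < F ((3 * k + 2) / 2) := by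
    have e : ((3 * k + 2) / 2) ^ 2 - 6 * k = ((3 * k - 2) / 2) ^ 2 := by ring
    have e2 : c ((3 * k + 2) / 2) = k - 2 := by
      simp only [hc, hD]
      rw [e, Real.sqrt_sq (by linarith), div_eq_iff (by linarith)]
      ring
    have e3 : posRoot k (k - 2) = 1 := by
      have : (k - 2) ^ 2 + 8 * k = (k + 2) ^ 2 := by ring
      rw [posRoot, this, Real.sqrt_sq (by linarith)]; ring
    simp only [hF]
    rw [e2, e3]
    nlinarith
  obtain ⟨T, hT, hT0⟩ := intermediate_value_Ioo (by linarith) hcont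
    (show (0 : ℝ) ∈ Ioo _ _ from ⟨h1, h2⟩)
  have hp := hpos T hT.1.le
  have hDp : 0 < D T := Real.sqrt_pos.2 hp
  have hDs : D T ^ 2 = T ^ 2 - 6 * k := Real.sq_sqrt hp.le
  refine ⟨T, hT, D T, hDp, posRoot k (c T), one_lt_posRoot (hlt T hT.1.le hT.2), hDs, ?_, ?_⟩
  · have h3 := posRoot_eq (k := k) (c := c T) (by linarith)
    have h4 : c T * D T = (k + 2) * T - 8 * k := div_mul_cancel₀ _ hDp.ne'
    rw [← h4]
    linear_combination D T * h3
  · rw [hDs]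
    exact sub_eq_zero.1 hT0

/-- The critical value `ℓ₁` in terms of `T`. -/
theorem ellOne_le_critical {k : ℕ} (hk : 3 ≤ k) :
    ∃ T ∈ Ioo ((25 * (k : ℝ) + 21) / 20) ((3 * (k : ℝ) + 2) / 2), ∃ D > 0, ∃ s > 1,
      D ^ 2 = T ^ 2 - 6 * k ∧ 2 * s ^ 2 * D + ((k + 2) * T - 8 * k) * s = k * D ∧
      ellOne k ≤ s ^ 2 := by
  have hk' : (3 : ℝ) ≤ k := by exact_mod_cast hk
  obtain ⟨T, hT, D, hD, s, hs, hDs, hq, hF⟩ := exists_critical hk'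
  refine ⟨T, hT, D, hD, s, hs, hDs, hq, ?_⟩
  have hT0 : 0 < T := by linarith [hT.1]
  -- s² belongs to the set whose infimum is ℓ₁, which is bounded below by 1. Only ℓ₁ ≤ s² is needed,
  -- not uniqueness.
  refine csInf_le ⟨1, fun x hx => hx.1.le⟩ ⟨by nlinarith, 6 * k / D ^ 2, ?_, ?_, ?_⟩
  · have hpos : 0 < 6 * (k : ℝ) / D ^ 2 := by positivity
    rw [epsRange]
    split_ifs with h6
    · exact hpos
    · refine ⟨hpos, ?_⟩
      have h7 : (7 : ℝ) ≤ k := by exact_mod_cast (by omega : 7 ≤ k)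
      have h8 : 0 < (3 * (k : ℝ) - 2) * (k - 6) := mul_pos (by linarith) (by linarith)
      rw [div_lt_div_iff₀ (by positivity) h8, hDs]
      -- With D² = T² - 6k, the upper bound defining E_k is equivalent to (4T)² > (3(k + 2))².
      have h9 : 3 * ((k : ℝ) + 2) < 4 * T := by linarith [hT.1]
      have h10 : (3 * ((k : ℝ) + 2)) ^ 2 < (4 * T) ^ 2 := by gcongr
      have h11 := mul_lt_mul_of_pos_left h10 (by linarith : (0 : ℝ) < 2 * k)
      nlinarith
  · have e1 : 1 + 6 * (k : ℝ) / D ^ 2 = (T / D) ^ 2 := by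
      rw [div_pow, eq_div_iff (by positivity), add_mul, div_mul_cancel₀ _ (by positivity)]
      linarith
    have e2 : 2 * (k : ℝ) * (6 * k / D ^ 2) / 3 = (2 * k / D) ^ 2 := by field_simp; ring
    rw [f₁, f₂, e1, e2, Real.sqrt_sq (by positivity), Real.sqrt_sq (by positivity),
      Real.sqrt_sq (by linarith)]
    field_simp
    linear_combination hq
  · have e1 : 6 * (k : ℝ) / D ^ 2 * (1 + 6 * k / D ^ 2) = 6 * k * T ^ 2 / (D ^ 2) ^ 2 := by
      have : T ^ 2 = D ^ 2 + 6 * k := by linarith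
      rw [this]; field_simp
    have e2 : √(2 * (k : ℝ) / 3) * √(6 * (k : ℝ) / D ^ 2 * (1 + 6 * k / D ^ 2)) =
        2 * k * T / D ^ 2 := by
      rw [e1, ← Real.sqrt_mul (by positivity)]
      have : 2 * (k : ℝ) / 3 * (6 * k * T ^ 2 / (D ^ 2) ^ 2) = (2 * k * T / D ^ 2) ^ 2 := by
        field_simp; ring
      rw [this, Real.sqrt_sq (by positivity)]
    rw [f₃, mul_assoc, e2]
    have hk0 : (k : ℝ) ≠ 0 := by linarith
    field_simp at hF ⊢
    rw [hDs] at hF ⊢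
    linear_combination (1 / 3) * hF

/-- The function ℓ ↦ k/√ℓ - 2√ℓ is decreasing and equals C/D at ℓ = s². For ℓ < s² the function of
`exists_rootData` is therefore negative at the critical T, and its zero lies further to the right.
-/
theorem critical_lt {k s ℓ D C : ℝ} (hk : 0 < k) (hℓ : 1 < ℓ) (hs : 1 < s) (hD : 0 < D)
    (hlt : ℓ < s ^ 2) (hq : 2 * s ^ 2 * D + C * s = k * D) : C / D < k / √ℓ - 2 * √ℓ := by
  have h0 : 0 < √ℓ := Real.sqrt_pos.2 (by linarith)
  have h1 : √ℓ < s := (Real.sqrt_lt' (by linarith)).2 hlt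
  have h2 : C / D = k / s - 2 * s := by
    field_simp
    linear_combination hq
  rw [h2]
  have h3 : k / s < k / √ℓ := div_lt_div_of_pos_left hk h0 h1
  linarith

/-- Comparison of the coefficients of the two quadratic equations. -/
theorem critical_four_le {k T D D' : ℝ} (hk : 3 ≤ k) (hT : (25 * k + 21) / 20 ≤ T) (hD : 0 < D)
    (hDs : D ^ 2 = T ^ 2 - 6 * k) (hD' : 0 < D')
    (hDs' : D' ^ 2 = ((17 * k + 9) / 10) ^ 2 - 8 * k) :
    (k + 2) * ((17 * k + 9) / 10) - 10 * k ≤ ((k + 2) * T - 8 * k) / D * D' := by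
  have hC : 0 ≤ (k + 2) * T - 8 * k := by
    have : (k + 2) * ((25 * k + 21) / 20) ≤ (k + 2) * T :=
      mul_le_mul_of_nonneg_left hT (by linarith)
    nlinarith
  rw [div_mul_eq_mul_div, le_div_iff₀ hD]
  refine le_of_sq_le_sq ?_ (mul_nonneg hC hD'.le)
  rw [mul_pow, mul_pow, hDs, hDs', ← sub_nonneg]
  -- In the shifted variables t, j ≥ 0 the difference of the squares expands into nonnegative terms.
  obtain ⟨t, rfl⟩ : ∃ t, T = (25 * k + 21) / 20 + t := ⟨T - (25 * k + 21) / 20, by ring⟩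
  obtain ⟨j, rfl⟩ : ∃ j, k = 3 + j := ⟨k - 3, by ring⟩
  have ht : 0 ≤ t := by linarith
  have hj : 0 ≤ j := by linarith
  ring_nf
  positivity

/-- The critical T is the left end of the search at R = 3. The same comparison of ℓ with s²,
transferred by `critical_four_le`, justifies the left end (17k + 9)/10 at R = 4. -/
theorem exists_good_of_three_le {k : ℕ} {ℓ : ℝ} (hk : 3 ≤ k) (hℓ : 1 < ℓ) (h : ℓ < ellOne k) :
    (∃ γ, GoodThree k ℓ γ) ∧ ∃ γ, GoodFour k ℓ γ := by
  have hk' : (3 : ℝ) ≤ k := by exact_mod_cast hk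
  obtain ⟨T, hT, D, hD, s, hs, hDs, hq, hle⟩ := ellOne_le_critical hk
  have hφ := critical_lt (by linarith) hℓ hs hD (h.trans_le hle) hq
  constructor
  · have e : T ^ 2 - 2 * k * 3 = D ^ 2 := by rw [hDs]; ring
    have e' : ((k : ℝ) + 2) * T - 2 * k * (3 + 1) = (k + 2) * T - 8 * k := by ring
    obtain ⟨T', hT', D', hr⟩ := exists_rootData (R := 3) (k := k) (Tl := T) (by linarith) hℓ le_rfl
      (by nlinarith [sq_nonneg D]) (by linarith [hT.1]) (by linarith [hT.2])
      (by rw [e, Real.sqrt_sq hD.le, ← div_lt_iff₀ hD, e']; exact hφ)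
      (by linarith [hT.1])
    exact ⟨_, hr.goodThree_of_three_le hk' hℓ (hT.1.trans hT'.1)⟩
  · have hpos : 0 < ((17 * (k : ℝ) + 9) / 10) ^ 2 - 8 * k := by nlinarith
    have h1 := critical_four_le hk' hT.1.le hD hDs (Real.sqrt_pos.2 hpos) (Real.sq_sqrt hpos.le)
    have h2 := mul_lt_mul_of_pos_right hφ (Real.sqrt_pos.2 hpos)
    have e : ((17 * (k : ℝ) + 9) / 10) ^ 2 - 2 * k * 4 = ((17 * (k : ℝ) + 9) / 10) ^ 2 - 8 * k := by
      ring
    obtain ⟨T', hT', D', hr⟩ := exists_rootData (R := 4) (k := k) (Tl := (17 * (k : ℝ) + 9) / 10)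
      (by linarith) hℓ (by norm_num) (by linarith) (by linarith) (by linarith)
      (by rw [e]; linarith) (by linarith)
    exact ⟨_, hr.goodFour_of_three_le hk' hℓ hT'.1⟩

theorem exists_good {k : ℕ} {ℓ : ℝ} (h : (k, ℓ) ∈ setKStar) :
    (∃ γ, GoodThree k ℓ γ) ∧ ∃ γ, GoodFour k ℓ γ := by
  obtain ⟨hK, hℓ, hs⟩ := h
  have hk : 1 ≤ k := hK.1
  simp only at hℓ hs
  rcases lt_or_ge k 3 with h3 | h3
  · interval_cases k
    · simpa using And.intro (exists_goodThree_one hℓ) (exists_goodFour_one hℓ)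
    · simpa using And.intro (exists_goodThree_two hℓ) (exists_goodFour_two hℓ)
  · rw [ellStar, if_neg (by omega), EReal.coe_lt_coe_iff] at hs
    exact exists_good_of_three_le h3 hℓ hs

/-! ### Monotonicity of the ratio of the eigenvalues -/

/-- The trace of the linearization at `Q₁` divided by `γ`. -/
def traceFactor (k ℓ γ : ℝ) : ℝ := (k + 2) * ℓ * γ - (k - 2 * ℓ)

theorem gamma_mul_traceFactor (k ℓ γ : ℝ) :
    γ * traceFactor k ℓ γ = (k + 2) * eps ℓ γ + cA k ℓ γ := by
  rw [traceFactor, eps, cA]; ring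

theorem Adm.traceFactor_pos {k ℓ γ : ℝ} (h : Adm k ℓ γ) : 0 < traceFactor k ℓ γ := by
  have h1 := eps_pos h.one_lt_ℓ h.γ_gt
  have h2 := gamma_pos h.one_lt_ℓ h.γ_gt
  have h3 := h.A_pos
  have h4 := h.one_le_k
  have h5 : 0 < γ * traceFactor k ℓ γ := by rw [gamma_mul_traceFactor]; positivity
  exact (mul_pos_iff_of_pos_left h2).1 h5

/-- `γ ↦ (trace)² / determinant` is strictly decreasing. -/
theorem traceFactor_sq_mul_eps_lt {k ℓ γ γ' : ℝ} (h : Adm k ℓ γ) (h' : Adm k ℓ γ') (hlt : γ < γ') :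
    traceFactor k ℓ γ' ^ 2 * eps ℓ γ < traceFactor k ℓ γ ^ 2 * eps ℓ γ' := by
  have hℓ : 0 < ℓ := by linarith [h.one_lt_ℓ]
  have h1 : 0 < (γ' - γ) * ((ℓ * cA k ℓ γ) * traceFactor k ℓ γ' +
      (ℓ * cA k ℓ γ') * traceFactor k ℓ γ) := by
    have := h.A_pos; have := h'.A_pos; have := h.traceFactor_pos; have := h'.traceFactor_pos
    have := sub_pos.2 hlt
    positivity
  -- The difference factors with coefficients A(γ) and A(γ'); this is where A > 0 enters.
  have e : (γ' - γ) * ((ℓ * cA k ℓ γ) * traceFactor k ℓ γ' +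
      (ℓ * cA k ℓ γ') * traceFactor k ℓ γ) =
      traceFactor k ℓ γ ^ 2 * eps ℓ γ' - traceFactor k ℓ γ' ^ 2 * eps ℓ γ := by
    simp only [cA, traceFactor, eps]; ring
  linarith

/-- This is trace²/determinant = (R + 1)²/R, in which γ² cancels because 1 + ε = ℓγ². The right-hand
side is 16/3 at R = 3 and 25/4 at R = 4. -/
theorem SpecRel.traceFactor_sq {k ℓ γ : ℝ} (hs : SpecRel k ℓ γ) (ha : Adm k ℓ γ) :
    ratioR k ℓ γ * traceFactor k ℓ γ ^ 2 = (ratioR k ℓ γ + 1) ^ 2 * (2 * k * ℓ * eps ℓ γ) := by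
  have h0 := gamma_pos ha.one_lt_ℓ ha.γ_gt
  have h1 := gamma_mul_traceFactor k ℓ γ
  have h2 : 1 + eps ℓ γ = ℓ * γ ^ 2 := by rw [eps]; ring
  have h3 := hs.prod_eq
  rw [h2] at h3
  rw [hs.sum_eq] at h1
  have h4 : γ ^ 2 ≠ 0 := by positivity
  apply mul_left_cancel₀ h4
  calc γ ^ 2 * (ratioR k ℓ γ * traceFactor k ℓ γ ^ 2)
      = ratioR k ℓ γ * (γ * traceFactor k ℓ γ) ^ 2 := by ring
    _ = (ratioR k ℓ γ + 1) ^ 2 * (ratioR k ℓ γ * lamMinus k ℓ γ ^ 2) := by rw [h1]; ring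
    _ = _ := by rw [h3]; ring

theorem Adm.of_mem_Ioo {k ℓ γ γ' t : ℝ} (h : Adm k ℓ γ) (h' : Adm k ℓ γ') (ht : t ∈ Ioo γ γ') :
    Adm k ℓ t := by
  refine ⟨h.one_le_k, h.one_lt_ℓ, h.γ_gt.trans ht.1, ?_⟩
  have h1 := h.A_pos
  have h2 := h'.A_pos
  rw [cA] at h1 h2 ⊢
  rcases le_total 0 (k - 2 * ℓ) with h3 | h3
  · have := mul_le_mul_of_nonneg_left ht.2.le h3; linarith
  · have := mul_le_mul_of_nonpos_left ht.1.le h3; linarith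

/-- Bounds for `(trace)² / determinant` give bounds for the ratio. -/
theorem Adm.ratio_mem {k ℓ γ : ℝ} (h : Adm k ℓ γ)
    (h3 : 16 / 3 * (2 * k * ℓ * eps ℓ γ) < traceFactor k ℓ γ ^ 2)
    (h4 : traceFactor k ℓ γ ^ 2 < 25 / 4 * (2 * k * ℓ * eps ℓ γ)) :
    SpecRel k ℓ γ ∧ ratioR k ℓ γ ∈ Ioo 3 4 := by
  have hε := eps_pos h.one_lt_ℓ h.γ_gt
  have hγ := gamma_pos h.one_lt_ℓ h.γ_gt
  have hA := h.A_pos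
  have hk := h.one_le_k
  have hℓ := h.one_lt_ℓ
  have hd : disc k ℓ γ = γ ^ 2 * (traceFactor k ℓ γ ^ 2 - 4 * (2 * k * ℓ * eps ℓ γ)) := by
    rw [disc, c₁, c₃, c₄, traceFactor, eps, cA]; ring
  have hS : c₁ ℓ γ + c₄ k ℓ γ = (k + 2) * eps ℓ γ + cA k ℓ γ := by rw [c₁, c₄]; ring
  have hP : 0 < 2 * k * ℓ * eps ℓ γ := by positivity
  have hd0 : 0 < disc k ℓ γ := by
    rw [hd]; exact mul_pos (by positivity) (by linarith)
  have hsq : √(disc k ℓ γ) < (k + 2) * eps ℓ γ + cA k ℓ γ := by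
    refine (Real.sqrt_lt' (by positivity)).2 ?_
    rw [hd, ← gamma_mul_traceFactor, mul_pow]
    exact mul_lt_mul_of_pos_left (by linarith) (by positivity)
  have hl : 0 < lamMinus k ℓ γ := by rw [lamMinus, hS]; linarith
  have hsp := specRel_of_lamMinus_pos hd0.le hl
  refine ⟨hsp, ?_⟩
  have hR1 : 1 ≤ ratioR k ℓ γ := by
    rw [ratioR, le_div_iff₀ hl, lamPlus, lamMinus]
    have := Real.sqrt_nonneg (disc k ℓ γ)
    linarith
  have ht := hsp.traceFactor_sq h
  set R := ratioR k ℓ γ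
  set X := 2 * k * ℓ * eps ℓ γ
  have h5 : (16 / 3 * R) * X < (R + 1) ^ 2 * X := by
    rw [← ht]; nlinarith
  have h6 : (R + 1) ^ 2 * X < (25 / 4 * R) * X := by
    rw [← ht]; nlinarith
  have h7 := lt_of_mul_lt_mul_right h5 hP.le
  have h8 := lt_of_mul_lt_mul_right h6 hP.le
  constructor <;> nlinarith

/-- Between the parameters for `R = 4` and `R = 3` the ratio lies in `(3, 4)`. -/
theorem good_interval {k ℓ γ₃ γ₄ : ℝ} (h₃ : GoodThree k ℓ γ₃) (h₄ : GoodFour k ℓ γ₄) :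
    γ₄ < γ₃ ∧ ∀ γ ∈ Ioo γ₄ γ₃, Adm k ℓ γ ∧ SpecRel k ℓ γ ∧ ratioR k ℓ γ ∈ Ioo 3 4 := by
  have e₃ := h₃.spec.traceFactor_sq h₃.adm
  have e₄ := h₄.spec.traceFactor_sq h₄.adm
  rw [h₃.ratio] at e₃
  rw [h₄.ratio] at e₄
  have hk := h₃.adm.one_le_k
  have hℓ := h₃.adm.one_lt_ℓ
  have p₃ := eps_pos hℓ h₃.adm.γ_gt
  have p₄ := eps_pos hℓ h₄.adm.γ_gt
  have e₃' : traceFactor k ℓ γ₃ ^ 2 = 16 / 3 * (2 * k * ℓ) * eps ℓ γ₃ := by linarith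
  have e₄' : traceFactor k ℓ γ₄ ^ 2 = 25 / 4 * (2 * k * ℓ) * eps ℓ γ₄ := by linarith
  have hP : 0 < (2 * k * ℓ) * (eps ℓ γ₃ * eps ℓ γ₄) := by positivity
  constructor
  · by_contra! hle
    rcases hle.lt_or_eq with hlt | heq
    · have := traceFactor_sq_mul_eps_lt h₃.adm h₄.adm hlt
      rw [e₃', e₄'] at this
      linarith
    · have h1 := h₃.ratio
      rw [heq, h₄.ratio] at h1
      norm_num at h1
  · intro γ hγ
    have ha := h₄.adm.of_mem_Ioo h₃.adm hγ
    have h1 := traceFactor_sq_mul_eps_lt h₄.adm ha hγ.1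
    have h2 := traceFactor_sq_mul_eps_lt ha h₃.adm hγ.2
    rw [e₄'] at h1
    rw [e₃'] at h2
    refine ⟨ha, ha.ratio_mem ?_ ?_⟩
    · refine lt_of_mul_lt_mul_right ?_ p₃.le
      linarith
    · refine lt_of_mul_lt_mul_right ?_ p₄.le
      linarith

theorem exists_matching_of_mem {k : ℕ} {ℓ : ℝ} (h : (k, ℓ) ∈ setKStar) :
    ∃ γ, Adm k ℓ γ ∧ SpecRel k ℓ γ ∧ ratioR k ℓ γ ∈ Ioo 3 4 ∧
      ∃ ζ ∈ Ioo (0 : ℝ) (1 / (k + 1)), ∃ r > ζ, PsConv r (uLps k ℓ γ) ∧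
        ∀ z ∈ Ioc 0 ζ, uL k ℓ γ z = curve k ℓ γ z := by
  obtain ⟨⟨γ₃, h₃⟩, γ₄, h₄⟩ := exists_good h
  obtain ⟨hlt, hmid⟩ := good_interval h₃ h₄
  obtain ⟨γ, hγ, H⟩ := exists_matching hlt hmid h₄.adm h₄.spec h₄.ratio h₄.slope h₄.two h₄.four
    h₃.adm h₃.spec h₃.ratio h₃.two h₃.three
  exact ⟨γ, (hmid γ hγ).1, (hmid γ hγ).2.1, (hmid γ hγ).2.2, H⟩

/-! ### The inverse of `Ψ` -/

/-- The square root in the inverse of `Ψ`. -/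
def invRoot (z u : ℝ) : ℝ := √(u + (1 - z) ^ 2)

/-- The denominator in the inverse of `Ψ`. -/
def invDen (k γ z u : ℝ) : ℝ := mPar k γ * u + k * (1 - z)

/-- The `Z`-component of the inverse of `Ψ`. -/
def invZ (k γ z u : ℝ) : ℝ := k * invRoot z u / invDen k γ z u

/-- The `v`-component of the inverse of `Ψ`. -/
def invV (z u : ℝ) : ℝ := (1 - z) / invRoot z u

/-- Numerator of the derivative of `invZ` along a curve with slope `d`. -/
def invZSlope (k γ z u d : ℝ) : ℝ :=
  (d - 2 * (1 - z)) * invDen k γ z u - 2 * (u + (1 - z) ^ 2) * (mPar k γ * d - k)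

theorem mPar_pos {k γ : ℝ} (hk : 0 < k) (hγ : 0 < γ) : 0 < mPar k γ := by
  rw [mPar]; positivity

theorem eq_mPar_mul {k γ : ℝ} (hγ : 0 < γ) : k = mPar k γ * (1 + γ) := by
  rw [mPar]; field_simp

theorem invRoot_sq {z u : ℝ} (hu : 0 < u) : invRoot z u ^ 2 = u + (1 - z) ^ 2 :=
  Real.sq_sqrt (by positivity)

theorem invRoot_pos {z u : ℝ} (hu : 0 < u) : 0 < invRoot z u :=
  Real.sqrt_pos.2 (by positivity)

theorem invDen_pos {k γ z u : ℝ} (hk : 0 < k) (hγ : 0 < γ) (hu : 0 < u) (hz : z < 1) :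
    0 < invDen k γ z u := by
  have := mPar_pos hk hγ
  have := mul_pos hk (sub_pos.2 hz)
  rw [invDen]; positivity

theorem invZ_pos {k γ z u : ℝ} (hk : 0 < k) (hγ : 0 < γ) (hu : 0 < u) (hz : z < 1) :
    0 < invZ k γ z u :=
  div_pos (mul_pos hk (invRoot_pos hu)) (invDen_pos hk hγ hu hz)

theorem one_sub_invV_sq {z u : ℝ} (hu : 0 < u) : 1 - invV z u ^ 2 = u / invRoot z u ^ 2 := by
  have h := invRoot_sq (z := z) hu
  have h0 := invRoot_pos (z := z) hu
  rw [invV, div_pow, eq_div_iff (by positivity), sub_mul, div_mul_cancel₀ _ (by positivity), h]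
  ring

theorem one_sub_invV_mul_invZ {k γ z u : ℝ} (hk : 0 < k) (hγ : 0 < γ) (hu : 0 < u) (hz : z < 1) :
    1 - invV z u * invZ k γ z u = mPar k γ * u / invDen k γ z u := by
  have h0 := invRoot_pos (z := z) hu
  have h1 := invDen_pos hk hγ hu hz
  have e : invV z u * invZ k γ z u = k * (1 - z) / invDen k γ z u := by
    rw [invV, invZ]; field_simp
  rw [e, eq_div_iff h1.ne', sub_mul, div_mul_cancel₀ _ h1.ne', invDen]
  ring

theorem invV_sub_invZ {k γ z u : ℝ} (hk : 0 < k) (hγ : 0 < γ) (hu : 0 < u) (hz : z < 1) :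
    invV z u - invZ k γ z u =
      -(mPar k γ * u * (γ + z) / (invRoot z u * invDen k γ z u)) := by
  have h0 := invRoot_pos (z := z) hu
  have h1 := invDen_pos hk hγ hu hz
  have h2 := invRoot_sq (z := z) hu
  rw [invV, invZ, div_sub_div _ _ h0.ne' h1.ne', ← neg_div]
  congr 1
  have h3 : invRoot z u * (k * invRoot z u) = k * invRoot z u ^ 2 := by ring
  rw [h3, h2, invDen]
  linear_combination -u * (eq_mPar_mul (k := k) hγ)

theorem transport_bracket {k γ z u : ℝ} (hk : 0 < k) (hγ : 0 < γ) (hu : 0 < u) (hz : z < 1) :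
    mPar k γ * (1 - invV z u ^ 2) * invZ k γ z u - k * invV z u * (1 - invV z u * invZ k γ z u) =
      mPar k γ * k * u * z / (invRoot z u * invDen k γ z u) := by
  have h0 := invRoot_pos (z := z) hu
  have h1 := invDen_pos hk hγ hu hz
  rw [one_sub_invV_sq hu, one_sub_invV_mul_invZ hk hγ hu hz, invV, invZ]
  field_simp
  ring

theorem Psi_inv {k γ z u : ℝ} (hk : 0 < k) (hγ : 0 < γ) (hu : 0 < u) (hz : z < 1) :
    Psi k γ (invZ k γ z u) (invV z u) = (z, u) := by
  have h0 := invRoot_pos (z := z) hu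
  have h1 := invDen_pos hk hγ hu hz
  have hm := mPar_pos hk hγ
  rw [Psi, transport_bracket hk hγ hu hz, one_sub_invV_sq hu, one_sub_invV_mul_invZ hk hγ hu hz,
    invZ]
  refine Prod.ext ?_ ?_ <;> simp only <;> field_simp

theorem DeltaV_inv {k γ z u : ℝ} (hk : 0 < k) (hγ : 0 < γ) (hu : 0 < u) (hz : z < 1) :
    DeltaV k γ (invZ k γ z u) (invV z u) =
      mPar k γ * k * u ^ 2 * z / (invRoot z u ^ 3 * invDen k γ z u) := by
  have h0 := invRoot_pos (z := z) hu
  have h1 := invDen_pos hk hγ hu hz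
  rw [DeltaV, transport_bracket hk hγ hu hz, one_sub_invV_sq hu]
  field_simp

theorem DeltaZ_inv {k ℓ γ z u : ℝ} (hk : 0 < k) (hγ : 0 < γ) (hu : 0 < u) (hz : z < 1) :
    DeltaZ ℓ (invZ k γ z u) (invV z u) = k * mPar k γ ^ 2 * u ^ 2 * (u - uSonic ℓ γ z) /
      (invRoot z u * invDen k γ z u ^ 3) := by
  have h0 := invRoot_pos (z := z) hu
  have h1 := invDen_pos hk hγ hu hz
  have h2 := invRoot_sq (z := z) hu
  have h3 : u - uSonic ℓ γ z = invRoot z u ^ 2 - ℓ * (γ + z) ^ 2 := by rw [h2, uSonic]; ring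
  rw [DeltaZ, invV_sub_invZ hk hγ hu hz, mul_comm (invZ k γ z u) (invV z u),
    one_sub_invV_mul_invZ hk hγ hu hz, h3, invZ]
  field_simp

section

variable {k ℓ γ z d : ℝ} {U : ℝ → ℝ}

theorem hasDerivAt_invRoot (hu : 0 < U z) (hU : HasDerivAt U d z) :
    HasDerivAt (fun z => invRoot z (U z)) ((d - 2 * (1 - z)) / (2 * invRoot z (U z))) z := by
  have h1 : HasDerivAt (fun z => U z + (1 - z) ^ 2) (d - 2 * (1 - z)) z := by
    have h2 : HasDerivAt (fun z : ℝ => (1 - z) ^ 2) (-(2 * (1 - z))) z := by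
      refine (((hasDerivAt_id z).const_sub 1).pow 2).congr_deriv ?_
      simp
    exact hU.add h2
  exact h1.sqrt (by positivity)

theorem hasDerivAt_invV (hu : 0 < U z) (hU : HasDerivAt U d z) :
    HasDerivAt (fun z => invV z (U z))
      (-(2 * U z + (1 - z) * d) / (2 * invRoot z (U z) ^ 3)) z := by
  have h0 := invRoot_pos (z := z) hu
  have h2 := invRoot_sq (z := z) hu
  have h := ((hasDerivAt_id z).const_sub 1).div (hasDerivAt_invRoot hu hU) h0.ne'
  refine h.congr_deriv ?_
  simp only [id]
  have h3 : U z = invRoot z (U z) ^ 2 - (1 - z) ^ 2 := by linarith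
  generalize invRoot z (U z) = N at *
  rw [h3]
  field_simp
  ring

theorem hasDerivAt_invZ (hk : 0 < k) (hγ : 0 < γ) (hu : 0 < U z) (hz : z < 1)
    (hU : HasDerivAt U d z) :
    HasDerivAt (fun z => invZ k γ z (U z))
      (k * invZSlope k γ z (U z) d / (2 * invRoot z (U z) * invDen k γ z (U z) ^ 2)) z := by
  have h0 := invRoot_pos (z := z) hu
  have h1 := invDen_pos hk hγ hu hz
  have h2 := invRoot_sq (z := z) hu
  have hE : HasDerivAt (fun z => invDen k γ z (U z)) (mPar k γ * d - k) z := by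
    have := (hU.const_mul (mPar k γ)).add (((hasDerivAt_id z).const_sub 1).const_mul k)
    refine this.congr_deriv ?_
    ring
  have h := ((hasDerivAt_invRoot hu hU).const_mul k).div hE h1.ne'
  refine h.congr_deriv ?_
  rw [invZSlope, ← h2]
  field_simp

/-- The `z-u` equation is transformed into the `Z-v` equation. -/
theorem transport_ode (hk : 0 < k) (hγ : 0 < γ) {u : ℝ} (hu : 0 < u) (hz : z < 1)
    (hd : DeltaSmallZ k ℓ γ z u * d = DeltaU k ℓ γ z u) :
    DeltaZ ℓ (invZ k γ z u) (invV z u) * (-(2 * u + (1 - z) * d) / (2 * invRoot z u ^ 3)) =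
      DeltaV k γ (invZ k γ z u) (invV z u) *
        (k * invZSlope k γ z u d / (2 * invRoot z u * invDen k γ z u ^ 2)) := by
  have h0 := invRoot_pos (z := z) hu
  have h1 := invDen_pos hk hγ hu hz
  -- After k = m(1 + γ) is substituted, this identity is m times the z-u equation; the rest is
  -- clearing denominators.
  have key : mPar k γ * (u - uSonic ℓ γ z) * -(2 * u + (1 - z) * d) =
      z * k * invZSlope k γ z u d := by
    have hkm := eq_mPar_mul (k := k) hγ
    simp only [DeltaSmallZ, DeltaU, fPoly, eps, cA, cB] at hd
    simp only [invZSlope, invDen, uSonic]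
    generalize mPar k γ = m at *
    subst hkm
    linear_combination m * hd
  rw [DeltaZ_inv hk hγ hu hz, DeltaV_inv hk hγ hu hz]
  field_simp
  linear_combination mPar k γ * key

/-- On solutions the product of this slope with Δ_z is -2mu(u + (1 - z)²)(u - u_S), where u_S is the
sonic parabola. Hence Z decreases in z wherever the solution is above the parabola and Δ_z > 0. -/
theorem invZSlope_neg (hk : 0 < k) (hγ : 0 < γ) {u : ℝ} (hu : 0 < u)
    (hd : DeltaSmallZ k ℓ γ z u * d = DeltaU k ℓ γ z u) (hs : uSonic ℓ γ z < u)
    (hpos : 0 < DeltaSmallZ k ℓ γ z u) : invZSlope k γ z u d < 0 := by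
  have key : invZSlope k γ z u d * DeltaSmallZ k ℓ γ z u =
      -(2 * mPar k γ * u * (u + (1 - z) ^ 2) * (u - uSonic ℓ γ z)) := by
    have hkm := eq_mPar_mul (k := k) hγ
    simp only [DeltaSmallZ, DeltaU, fPoly, eps, cA, cB] at hd
    simp only [invZSlope, invDen, uSonic, DeltaSmallZ, fPoly, eps, cA, cB]
    generalize mPar k γ = m at *
    subst hkm
    linear_combination (m * u + m * (1 + γ) * (1 - z) - 2 * (u + (1 - z) ^ 2) * m) * hd
  have h1 : 0 < 2 * mPar k γ * u * (u + (1 - z) ^ 2) * (u - uSonic ℓ γ z) := by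
    have := mPar_pos hk hγ
    have := sub_pos.2 hs
    positivity
  by_contra! h
  have := mul_nonneg h hpos.le
  linarith

/-- At Q₁ both Δ_z and u - u_S vanish and the identity behind `invZSlope_neg` is void. The sign
comes instead from a lower bound on d by the slope of the sonic parabola. -/
theorem invZSlope_zero_neg (ha : Adm k ℓ γ) (hd : 2 * (1 + ℓ * γ) ≤ d) :
    invZSlope k γ 0 (eps ℓ γ) d < 0 := by
  have hℓ := ha.one_lt_ℓ
  have hγ := gamma_pos hℓ ha.γ_gt
  have hm := mPar_pos (by linarith [ha.one_le_k] : 0 < k) hγ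
  have hkm := eq_mPar_mul (k := k) hγ
  have hε := eps_pos hℓ ha.γ_gt
  have hlg : 1 < ℓ * γ := by
    rw [eps] at hε
    have h1 : 1 < ℓ * γ * (ℓ * γ) := by nlinarith
    by_contra! h
    have h2 : 0 < ℓ * γ := by positivity
    nlinarith
  have e : invZSlope k γ 0 (eps ℓ γ) d =
      mPar k γ * γ * (2 * (ℓ * γ ^ 2 - 1) - d * (ℓ * γ - 1)) := by
    simp only [invZSlope, invDen, eps]
    generalize mPar k γ = m at *
    subst hkm
    ring
  rw [e]
  refine mul_neg_of_pos_of_neg (by positivity) ?_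
  have h1 := mul_le_mul_of_nonneg_right hd (by linarith : 0 ≤ ℓ * γ - 1)
  have h2 : 0 < ℓ * γ ^ 2 * (ℓ - 1) := mul_pos (by positivity) (by linarith)
  nlinarith

end

theorem invZ_zero {k ℓ γ : ℝ} (ha : Adm k ℓ γ) : invZ k γ 0 (eps ℓ γ) = Z₁ k ℓ γ := by
  have hℓ : 0 < ℓ := by linarith [ha.one_lt_ℓ]
  have hγ := gamma_pos ha.one_lt_ℓ ha.γ_gt
  have hk : 0 < k := by linarith [ha.one_le_k]
  have hm := mPar_pos hk hγ
  have hkm := eq_mPar_mul (k := k) hγ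
  have h1 : invRoot 0 (eps ℓ γ) = √ℓ * γ := by
    have : eps ℓ γ + (1 - 0) ^ 2 = ℓ * γ ^ 2 := by rw [eps]; ring
    rw [invRoot, this, Real.sqrt_mul hℓ.le, Real.sqrt_sq hγ.le]
  have h2 : invDen k γ 0 (eps ℓ γ) = γ * (ℓ * (k - mPar k γ) + mPar k γ) := by
    rw [invDen, eps]
    generalize mPar k γ = m at *
    subst hkm
    ring
  have h3 : 0 < ℓ * (k - mPar k γ) + mPar k γ := by
    have : k - mPar k γ = mPar k γ * γ := by linarith
    rw [this]; positivity
  rw [invZ, h1, h2, Z₁]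
  field_simp

theorem invV_zero {k ℓ γ : ℝ} (ha : Adm k ℓ γ) : invV 0 (eps ℓ γ) = v₁ k ℓ γ := by
  have hℓ : 0 < ℓ := by linarith [ha.one_lt_ℓ]
  have hγ := gamma_pos ha.one_lt_ℓ ha.γ_gt
  have hk : 0 < k := by linarith [ha.one_le_k]
  have hm := mPar_pos hk hγ
  have hkm := eq_mPar_mul (k := k) hγ
  have hs := Real.sqrt_pos.2 hℓ
  have h1 : invRoot 0 (eps ℓ γ) = √ℓ * γ := by
    have : eps ℓ γ + (1 - 0) ^ 2 = ℓ * γ ^ 2 := by rw [eps]; ring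
    rw [invRoot, this, Real.sqrt_mul hℓ.le, Real.sqrt_sq hγ.le]
  have h2 : k - mPar k γ = mPar k γ * γ := by linarith
  rw [invV, h1, v₁, h2]
  field_simp
  ring

/-- Inverse function theorem on an interval, in the smooth category. -/
theorem exists_smooth_inverse_Ioo {f : ℝ → ℝ} {a b : ℝ} (hf : ContDiffOn ℝ ∞ f (Ioo a b))
    (hpos : ∀ x ∈ Ioo a b, 0 < deriv f x) :
    ∃ g : ℝ → ℝ, (∀ x ∈ Ioo a b, g (f x) = x) ∧
      (∀ x ∈ Ioo a b, HasDerivAt g (deriv f x)⁻¹ (f x)) ∧ IsOpen (f '' Ioo a b) ∧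
      ContDiffOn ℝ ∞ g (f '' Ioo a b) := by
  obtain ⟨g, h1, h2, h3⟩ := exists_inverse_Ioo (f := f) (f' := deriv f) (a := a) (b := b)
    (fun x hx => ((hf.contDiffAt (Ioo_mem_nhds hx.1 hx.2)).differentiableAt (by simp)).hasDerivAt)
    hpos
  have hopen : IsOpen (f '' Ioo a b) := by
    rw [isOpen_iff_mem_nhds]
    rintro _ ⟨x, hx, rfl⟩
    exact h3 x hx
  refine ⟨g, h1, h2, hopen, ?_⟩
  have hd : ContDiffOn ℝ ∞ (deriv f) (Ioo a b) := hf.deriv_of_isOpen isOpen_Ioo (by simp)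
  refine contDiffOn_of_hasDerivAt_comp (F := fun p => (deriv f p.2)⁻¹) hopen ?_ ?_
  · rintro _ ⟨x, hx, rfl⟩
    have h4 : ContDiffAt ℝ ∞ (deriv f) (g (f x)) := by
      rw [h1 x hx]; exact hd.contDiffAt (Ioo_mem_nhds hx.1 hx.2)
    have h5 : ContDiffAt ℝ ∞ (fun p : ℝ × ℝ => deriv f p.2) (f x, g (f x)) :=
      ContDiffAt.comp (g := deriv f) (f x, g (f x)) h4 contDiffAt_snd
    refine h5.inv ?_
    simp only [h1 x hx]
    exact (hpos x hx).ne'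
  · rintro _ ⟨x, hx, rfl⟩
    simp only [h1 x hx]
    exact h2 x hx

/-! ### Continuation of the curve through `Q₁` -/

/-- `U` continues the `Q₀-Q₁` curve to `(-ζ, 1/(k+1))`. -/
structure Continuation (k ℓ γ ζ : ℝ) (U : ℝ → ℝ) : Prop where
  ζ_pos : 0 < ζ
  smooth : ContDiffOn ℝ ∞ U (Ioo (-ζ) (1 / (k + 1)))
  solves : ∀ z ∈ Ioo (-ζ) (1 / (k + 1)), SolvesZU k ℓ γ U z
  zero : U 0 = eps ℓ γ
  eq : ∀ z ∈ Ioo 0 (1 / (k + 1)), U z = curve k ℓ γ z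

theorem uL_zero (k ℓ γ : ℝ) : uL k ℓ γ 0 = eps ℓ γ := by
  rw [uL, tsum_eq_single 0 (fun n hn => by simp [hn]), coeffL_zero]; simp

theorem SolvesZU.congr {k ℓ γ z : ℝ} {u w : ℝ → ℝ} (h : SolvesZU k ℓ γ u z) (hw : w =ᶠ[𝓝 z] u) :
    SolvesZU k ℓ γ w z := by
  refine ⟨hw.differentiableAt_iff.2 h.1, ?_⟩
  rw [hw.deriv_eq, hw.eq_of_nhds]
  exact h.2

theorem IsCurve.solvesZU {k ℓ γ z : ℝ} {u : ℝ → ℝ} (h : IsCurve k ℓ γ u)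
    (hz : z ∈ Ioo 0 (1 / (k + 1))) : SolvesZU k ℓ γ u z := by
  have hd := h.hasDerivAt hz
  refine ⟨hd.differentiableAt, ?_⟩
  rw [hd.deriv, mul_div_cancel₀ _ (h.sol.den_pos z hz).ne']

theorem IsCurve.contDiffOn {k ℓ γ : ℝ} {u : ℝ → ℝ} (h : IsCurve k ℓ γ u) :
    ContDiffOn ℝ ∞ u (Ioo 0 (1 / (k + 1))) := by
  refine contDiffOn_of_hasDerivAt_comp
    (F := fun p => DeltaU k ℓ γ p.1 p.2 / DeltaSmallZ k ℓ γ p.1 p.2) isOpen_Ioo ?_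
    (fun z hz => h.hasDerivAt hz)
  intro z hz
  refine ContDiffAt.div ?_ ?_ (h.sol.den_pos z hz).ne'
  · unfold DeltaU fPoly; fun_prop
  · unfold DeltaSmallZ fPoly; fun_prop

/-- The Taylor series for z ≤ 0 and the curve for z > 0 agree on (0, ζ]. So near each point the
glued function coincides with one of two smooth solutions. -/
theorem exists_continuation {k ℓ γ ζ r : ℝ} (ha : Adm k ℓ γ) (hs : SpecRel k ℓ γ)
    (hR : ratioR k ℓ γ ∈ Ioo 3 4) (hζ : ζ ∈ Ioo 0 (1 / (k + 1))) (hr : ζ < r)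
    (hc : PsConv r (uLps k ℓ γ)) (hm : ∀ z ∈ Ioc 0 ζ, uL k ℓ γ z = curve k ℓ γ z) :
    (∀ z ∈ Icc (-ζ) ζ, Summable fun n : ℕ => coeffL k ℓ γ n * z ^ n) ∧
      AnalyticOnNhd ℝ (uL k ℓ γ) (Ioo (-ζ) ζ) ∧
      (∀ z ∈ Ioo (-ζ) ζ, SolvesZU k ℓ γ (uL k ℓ γ) z) ∧
      ∃ U, Continuation k ℓ γ ζ U ∧ ∀ z ∈ Ioo (-ζ) ζ, U z = uL k ℓ γ z := by
  have habs : ∀ z ∈ Icc (-ζ) ζ, |z| ≤ ζ := fun z hz => abs_le.2 hz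
  have hsol : ∀ z ∈ Ioo (-ζ) ζ, SolvesZU k ℓ γ (uL k ℓ γ) z := fun z hz =>
    uL_solves hs (fun n => by have := ratioR_ne_natCast hR (n + 2); push_cast at this; exact this)
      hc ((habs z (Ioo_subset_Icc_self hz)).trans_lt hr)
  have han : AnalyticOnNhd ℝ (uL k ℓ γ) (Ioo (-ζ) ζ) := by
    rw [uL_eq_psSum]
    exact (analyticOnNhd_psSum hc).mono (Ioo_subset_Ioo (by linarith) hr.le)
  refine ⟨fun z hz => ?_, han, hsol, ?_⟩
  · simpa [uLps] using hc.summable ((habs z hz).trans hr.le)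
  set U : ℝ → ℝ := fun z => if z ≤ 0 then uL k ℓ γ z else curve k ℓ γ z with hU
  have hUL : ∀ z ∈ Ioo (-ζ) ζ, U z = uL k ℓ γ z := by
    intro z hz
    simp only [hU]
    split_ifs with h
    · rfl
    · exact (hm z ⟨not_le.1 h, hz.2.le⟩).symm
  have hUF : ∀ z ∈ Ioo 0 (1 / (k + 1)), U z = curve k ℓ γ z := fun z hz => by
    simp only [hU]; rw [if_neg (not_le.2 hz.1)]
  have hcov : ∀ z ∈ Ioo (-ζ) (1 / (k + 1)),
      (z ∈ Ioo (-ζ) ζ ∧ U =ᶠ[𝓝 z] uL k ℓ γ) ∨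
        (z ∈ Ioo 0 (1 / (k + 1)) ∧ U =ᶠ[𝓝 z] curve k ℓ γ) := by
    intro z hz
    rcases le_or_gt z 0 with h | h
    · have hz' : z ∈ Ioo (-ζ) ζ := ⟨hz.1, by linarith [hζ.1]⟩
      exact Or.inl ⟨hz', mem_of_superset (Ioo_mem_nhds hz'.1 hz'.2) hUL⟩
    · have hz' : z ∈ Ioo 0 (1 / (k + 1)) := ⟨h, hz.2⟩
      exact Or.inr ⟨hz', mem_of_superset (Ioo_mem_nhds hz'.1 hz'.2) hUF⟩
  refine ⟨U, ⟨hζ.1, fun z hz => ?_, fun z hz => ?_, ?_, hUF⟩, hUL⟩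
  · rcases hcov z hz with ⟨hz', he⟩ | ⟨hz', he⟩
    · exact ((han z hz').contDiffAt.congr_of_eventuallyEq he).contDiffWithinAt
    · exact ((ha.isCurve.contDiffOn.contDiffAt
        (Ioo_mem_nhds hz'.1 hz'.2)).congr_of_eventuallyEq he).contDiffWithinAt
  · rcases hcov z hz with ⟨hz', he⟩ | ⟨hz', he⟩
    · exact (hsol z hz').congr he
    · exact (ha.isCurve.solvesZU hz').congr he
  · rw [hUL 0 ⟨by linarith [hζ.1], hζ.1⟩, uL_zero]

section

variable {k ℓ γ ζ : ℝ} {U : ℝ → ℝ}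

theorem Continuation.contDiffAt (h : Continuation k ℓ γ ζ U) {z : ℝ}
    (hz : z ∈ Ioo (-ζ) (1 / (k + 1))) : ContDiffAt ℝ ∞ U z :=
  h.smooth.contDiffAt (Ioo_mem_nhds hz.1 hz.2)

theorem Continuation.hasDerivAt (h : Continuation k ℓ γ ζ U) {z : ℝ}
    (hz : z ∈ Ioo (-ζ) (1 / (k + 1))) : HasDerivAt U (deriv U z) z :=
  (h.solves z hz).1.hasDerivAt

theorem Continuation.zero_mem (h : Continuation k ℓ γ ζ U) (ha : Adm k ℓ γ) :
    (0 : ℝ) ∈ Ioo (-ζ) (1 / (k + 1)) :=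
  ⟨by linarith [h.ζ_pos], by have := ha.one_le_k; positivity⟩

/-- At `Q₁` the continuation is at least as steep as the sonic parabola. -/
theorem Continuation.le_deriv_zero (h : Continuation k ℓ γ ζ U) (ha : Adm k ℓ γ) :
    2 * (1 + ℓ * γ) ≤ deriv U 0 := by
  have h0 := h.zero_mem ha
  have hS : HasDerivAt (uSonic ℓ γ) (2 * (1 + ℓ * γ)) 0 := by
    have e : uSonic ℓ γ = fun z => eps ℓ γ + 2 * (1 + ℓ * γ) * z + (ℓ - 1) * z ^ 2 := by
      funext z; exact uSonic_eq ℓ γ z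
    rw [e]
    have h1 := (((hasDerivAt_id (0 : ℝ)).const_mul (2 * (1 + ℓ * γ))).const_add (eps ℓ γ)).add
      (((hasDerivAt_id (0 : ℝ)).pow 2).const_mul (ℓ - 1))
    refine h1.congr_deriv ?_
    simp
  have hd := (h.hasDerivAt h0).sub hS
  rw [← sub_nonneg]
  -- The curve lies above the parabola for t > 0 and meets it at t = 0.
  have ht := hd.tendsto_slope_zero_right
  refine ge_of_tendsto ht ?_
  filter_upwards [Ioo_mem_nhdsGT h0.2] with t ht
  have h1 := ha.isCurve.sol.above t ht
  rw [← h.eq t ht] at h1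
  have h2 : uSonic ℓ γ 0 = eps ℓ γ := by rw [uSonic_eq]; ring
  simp only [zero_add, Pi.sub_apply, h.zero, h2, sub_self, sub_zero, smul_eq_mul]
  have : 0 < t := ht.1
  have : 0 < U t - uSonic ℓ γ t := by linarith
  positivity

/-- The range on which the inverse of `Ψ` along the continuation is regular. -/
theorem Continuation.exists_regular (h : Continuation k ℓ γ ζ U) (ha : Adm k ℓ γ) :
    ∃ η ∈ Ioo 0 ζ, ∀ z ∈ Ioo (-η) (1 / (k + 1)),
      0 < U z ∧ invZSlope k γ z (U z) (deriv U z) < 0 := by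
  have h0 := h.zero_mem ha
  have hγ := gamma_pos ha.one_lt_ℓ ha.γ_gt
  have hk : 0 < k := by linarith [ha.one_le_k]
  have hUc : ContinuousAt U 0 := (h.contDiffAt h0).continuousAt
  have hdc : ContinuousAt (deriv U) 0 :=
    ((h.smooth.deriv_of_isOpen isOpen_Ioo (m := ∞) (by simp)).contDiffAt
      (Ioo_mem_nhds h0.1 h0.2)).continuousAt
  have hsl : ContinuousAt (fun z => invZSlope k γ z (U z) (deriv U z)) 0 := by
    unfold invZSlope invDen; fun_prop
  have h1 : ∀ᶠ z in 𝓝 (0 : ℝ), 0 < U z :=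
    hUc.eventually_const_lt (by rw [h.zero]; exact eps_pos ha.one_lt_ℓ ha.γ_gt)
  have h2 : ∀ᶠ z in 𝓝 (0 : ℝ), invZSlope k γ z (U z) (deriv U z) < 0 :=
    hsl.eventually_lt_const
      (by simp only [h.zero]; exact invZSlope_zero_neg ha (h.le_deriv_zero ha))
  obtain ⟨δ, hδ, hball⟩ := Metric.eventually_nhds_iff.1 (h1.and h2)
  have hζ := h.ζ_pos
  have hmin : 0 < min δ (ζ / 2) := lt_min hδ (by linarith)
  refine ⟨min δ (ζ / 2), ⟨hmin, (min_le_right _ _).trans_lt (by linarith)⟩, fun z hz => ?_⟩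
  rcases le_or_gt z 0 with hz0 | hz0
  · apply hball
    rw [Real.dist_eq, sub_zero, abs_of_nonpos hz0]
    have := min_le_left δ (ζ / 2)
    linarith [hz.1]
  · have hz' : z ∈ Ioo 0 (1 / (k + 1)) := ⟨hz0, hz.2⟩
    have hs := ha.isCurve.sol.above z hz'
    have hp := ha.isCurve.sol.den_pos z hz'
    rw [← h.eq z hz'] at hs hp
    have hU0 : 0 < U z := (uSonic_pos ha.one_lt_ℓ ha.γ_gt hz0.le).trans hs
    exact ⟨hU0, invZSlope_neg hk hγ hU0 (h.solves z ⟨by linarith, hz.2⟩).2 hs hp⟩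

end

/-! ### The solution near the origin -/

theorem one_div_succ_lt_one {k : ℝ} (hk : 1 ≤ k) : 1 / (k + 1) < 1 := by
  rw [div_lt_one (by linarith)]; linarith

/-- With x = u^(-1/2), that is y = x², both Z = x w(x) and v are smooth functions of x up to x = 0,
and dZ/dx = w(0) = k/m > 0 there. Inverting Z gives v as a smooth function of Z at the origin. -/
theorem exists_smooth_near_origin {k ℓ γ : ℝ} (ha : Adm k ℓ γ) :
    ∃ W : ℝ → ℝ, ContDiffAt ℝ ∞ W 0 ∧ W 0 = 0 ∧ ∀ᶠ Z in 𝓝 (0 : ℝ), 0 < Z →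
      ∃ z ∈ Ioo 0 (1 / (k + 1)), invZ k γ z (curve k ℓ γ z) = Z ∧
        invV z (curve k ℓ γ z) = W Z := by
  have hγ := gamma_pos ha.one_lt_ℓ ha.γ_gt
  have hk : 0 < k := by linarith [ha.one_le_k]
  have hm := mPar_pos hk hγ
  have hκ := one_div_succ_lt_one ha.one_le_k
  obtain ⟨y₁, -, hev⟩ := ha.exists_chartOn
  have hch := hev.self_of_nhds
  obtain ⟨r, hr, hc⟩ := hch.conv
  have hy₁ := hch.pos
  set b := √y₁ with hb
  have hb0 : 0 < b := Real.sqrt_pos.2 hy₁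
  have hb2 : b ^ 2 = y₁ := Real.sq_sqrt hy₁.le
  have hsq : ∀ x ∈ Ioo (-b) b, x ^ 2 < y₁ := fun x hx => by
    rw [← hb2]; exact sq_lt_sq' hx.1 hx.2
  set q : ℝ → ℝ := fun x => 1 - chartZ k ℓ γ (x ^ 2) with hq
  have hqs : ContDiffOn ℝ ∞ q (Ioo (-b) b) := by
    have h1 : ContDiffOn ℝ ∞ (fun x : ℝ => psSum (chartPs k ℓ γ) (x ^ 2)) (Ioo (-b) b) := by
      refine (contDiffOn_psSum hc).comp (by fun_prop) (fun x hx => ?_)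
      have := hsq x hx
      exact ⟨by nlinarith [sq_nonneg x], by linarith⟩
    simp only [hq, chartZ]
    fun_prop
  have hqp : ∀ x ∈ Ioo (-b) b, 0 < q x := by
    intro x hx
    simp only [hq]
    rcases eq_or_ne x 0 with rfl | hx0
    · rw [chartZ]; norm_num [psSum_chartPs_zero] at hκ ⊢; exact hκ
    · have := (hch.chartZ_mem ha ⟨by positivity, (hsq x hx).le⟩).2
      linarith
  set ρ : ℝ → ℝ := fun x => √(1 + x ^ 2 * q x ^ 2) with hρ
  have hρp : ∀ x, 0 < ρ x := fun x => Real.sqrt_pos.2 (by positivity)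
  have hρs : ContDiffOn ℝ ∞ ρ (Ioo (-b) b) := by
    refine ContDiffOn.sqrt (by fun_prop) (fun x hx => ?_)
    positivity
  set e : ℝ → ℝ := fun x => mPar k γ + k * q x * x ^ 2 with he
  have hep : ∀ x ∈ Ioo (-b) b, 0 < e x := fun x hx => by
    have := hqp x hx
    simp only [he]; positivity
  have hes : ContDiffOn ℝ ∞ e (Ioo (-b) b) := by simp only [he]; fun_prop
  set w : ℝ → ℝ := fun x => k * ρ x / e x with hw
  have hws : ContDiffOn ℝ ∞ w (Ioo (-b) b) :=
    (contDiffOn_const.mul hρs).div hes (fun x hx => (hep x hx).ne')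
  have hwp : ∀ x ∈ Ioo (-b) b, 0 < w x := fun x hx =>
    div_pos (mul_pos hk (hρp x)) (hep x hx)
  set f : ℝ → ℝ := fun x => x * w x with hf
  have hfs : ContDiffOn ℝ ∞ f (Ioo (-b) b) := contDiffOn_id.mul hws
  have h0b : (0 : ℝ) ∈ Ioo (-b) b := ⟨by linarith, hb0⟩
  have hd0 : 0 < deriv f 0 := by
    have hwd : HasDerivAt w (deriv w 0) 0 :=
      ((hws.contDiffAt (Ioo_mem_nhds h0b.1 h0b.2)).differentiableAt (by simp)).hasDerivAt
    have := (hasDerivAt_id (0 : ℝ)).mul hwd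
    have h1 : HasDerivAt f (w 0) 0 := this.congr_deriv (by simp)
    rw [h1.deriv]
    exact hwp 0 h0b
  have hdc : ContinuousAt (deriv f) 0 :=
    ((hfs.deriv_of_isOpen isOpen_Ioo (m := ∞) (by simp)).contDiffAt
      (Ioo_mem_nhds h0b.1 h0b.2)).continuousAt
  obtain ⟨δ', hδ', hball⟩ := Metric.eventually_nhds_iff.1 (hdc.eventually_const_lt hd0)
  set δ := min δ' b with hδ
  have hδ0 : 0 < δ := lt_min hδ' hb0
  have hsub : Ioo (-δ) δ ⊆ Ioo (-b) b :=
    Ioo_subset_Ioo (neg_le_neg (min_le_right _ _)) (min_le_right _ _)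
  have h0δ : (0 : ℝ) ∈ Ioo (-δ) δ := ⟨by linarith, hδ0⟩
  obtain ⟨g, hg1, -, hopen, hgs⟩ := exists_smooth_inverse_Ioo (hfs.mono hsub) (fun x hx => by
    apply hball
    rw [Real.dist_eq, sub_zero]
    exact (abs_lt.2 hx).trans_le (min_le_left _ _))
  have hf0 : f 0 = 0 := by simp [hf]
  have hg0 : g 0 = 0 := by have := hg1 0 h0δ; rwa [hf0] at this
  have him : f '' Ioo (-δ) δ ∈ 𝓝 (0 : ℝ) := hopen.mem_nhds ⟨0, h0δ, hf0⟩
  set vη : ℝ → ℝ := fun x => q x * x / ρ x with hvη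
  have hvs : ContDiffOn ℝ ∞ vη (Ioo (-b) b) :=
    (hqs.mul contDiffOn_id).div hρs (fun x _ => (hρp x).ne')
  refine ⟨fun Z => vη (g Z), ?_, by simp [hg0, hvη], ?_⟩
  · have h1 : ContDiffAt ℝ ∞ vη (g 0) := by
      rw [hg0]; exact hvs.contDiffAt (Ioo_mem_nhds h0b.1 h0b.2)
    exact ContDiffAt.comp (g := vη) 0 h1 (hgs.contDiffAt him)
  · filter_upwards [him] with Z hZ hZ0
    obtain ⟨x, hx, rfl⟩ := hZ
    have hxb := hsub hx
    have hx0 : 0 < x := (mul_pos_iff_of_pos_right (hwp x hxb)).1 hZ0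
    have hy : x ^ 2 ∈ Ioo 0 y₁ := ⟨by positivity, hsq x hxb⟩
    have hcz := hch.curve_chartZ ha hy
    have hroot : invRoot (chartZ k ℓ γ (x ^ 2)) (1 / x ^ 2) = ρ x / x := by
      have e1 : 1 / x ^ 2 + (1 - chartZ k ℓ γ (x ^ 2)) ^ 2 = (1 + x ^ 2 * q x ^ 2) / x ^ 2 := by
        simp only [hq]; field_simp
      rw [invRoot, e1, Real.sqrt_div (by positivity), Real.sqrt_sq hx0.le]
    have hden : invDen k γ (chartZ k ℓ γ (x ^ 2)) (1 / x ^ 2) = e x / x ^ 2 := by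
      simp only [invDen, he, hq]; field_simp
    refine ⟨chartZ k ℓ γ (x ^ 2), hch.chartZ_mem ha ⟨hy.1, hy.2.le⟩, ?_, ?_⟩
    · rw [hcz, invZ, hroot, hden]
      have := hep x hxb
      simp only [hf, hw]
      field_simp
    · rw [hcz, invV, hroot, hg1 x hx]
      have := hρp x
      simp only [hvη, hq]
      field_simp

/-! ### The solution of the `Z-v` equation -/

/-- Smooth parametrization of the solution `V` of the `Z-v` equation by the continuation `U` of the
`Q₀-Q₁` curve. -/
structure Transport (k ℓ γ η : ℝ) (U V : ℝ → ℝ) : Prop where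
  η_pos : 0 < η
  U_pos : ∀ z ∈ Ioo (-η) (1 / (k + 1)), 0 < U z
  anti : StrictAntiOn (fun z => invZ k γ z (U z)) (Ioo (-η) (1 / (k + 1)))
  surj : ∀ Z, 0 < Z → ∀ z₀ ∈ Ioo (-η) (1 / (k + 1)), Z < invZ k γ z₀ (U z₀) →
    ∃ z ∈ Ioo z₀ (1 / (k + 1)), invZ k γ z (U z) = Z
  value : ∀ z ∈ Ioo (-η) (1 / (k + 1)), V (invZ k γ z (U z)) = invV z (U z)
  smooth : ∀ z ∈ Ioo (-η) (1 / (k + 1)), ContDiffAt ℝ ∞ V (invZ k γ z (U z))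
  smooth_zero : ContDiffWithinAt ℝ ∞ V (Ici 0) 0
  init : V 0 = 0
  ode : ∀ z ∈ Ioo (-η) (1 / (k + 1)), DeltaZ ℓ (invZ k γ z (U z)) (invV z (U z)) *
    deriv V (invZ k γ z (U z)) = DeltaV k γ (invZ k γ z (U z)) (invV z (U z))

/-- Since Z = `invZ` is strictly decreasing and smooth along the continuation, also for slightly
negative z, v can be written as a smooth function of Z across Z₁. Smoothness at Z = 0, the image of
Q₀, comes from `exists_smooth_near_origin`. -/
theorem Continuation.exists_transport {k ℓ γ ζ : ℝ} {U : ℝ → ℝ} (h : Continuation k ℓ γ ζ U)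
    (ha : Adm k ℓ γ) : ∃ η V, Transport k ℓ γ η U V := by
  have hγ := gamma_pos ha.one_lt_ℓ ha.γ_gt
  have hk : 0 < k := by linarith [ha.one_le_k]
  have hκ := one_div_succ_lt_one ha.one_le_k
  obtain ⟨η, hη, hreg⟩ := h.exists_regular ha
  set κ := 1 / (k + 1) with hκd
  have hsub : Ioo (-η) κ ⊆ Ioo (-ζ) κ := Ioo_subset_Ioo (by linarith [hη.2]) le_rfl
  have hUp : ∀ z ∈ Ioo (-η) κ, 0 < U z := fun z hz => (hreg z hz).1
  have hlt : ∀ z ∈ Ioo (-η) κ, z < 1 := fun z hz => hz.2.trans hκ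
  set X : ℝ → ℝ := fun z => invZ k γ z (U z) with hX
  have hXp : ∀ z ∈ Ioo (-η) κ, 0 < X z := fun z hz => invZ_pos hk hγ (hUp z hz) (hlt z hz)
  set dX : ℝ → ℝ := fun z => k * invZSlope k γ z (U z) (deriv U z) /
    (2 * invRoot z (U z) * invDen k γ z (U z) ^ 2) with hdX
  have hXd : ∀ z ∈ Ioo (-η) κ, HasDerivAt X (dX z) z := fun z hz =>
    hasDerivAt_invZ hk hγ (hUp z hz) (hlt z hz) (h.hasDerivAt (hsub hz))
  have hdXn : ∀ z ∈ Ioo (-η) κ, dX z < 0 := fun z hz => by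
    have h0 := invRoot_pos (z := z) (hUp z hz)
    have h1 := invDen_pos hk hγ (hUp z hz) (hlt z hz)
    exact div_neg_of_neg_of_pos (mul_neg_of_pos_of_neg hk (hreg z hz).2) (by positivity)
  have hroot : ContDiffOn ℝ ∞ (fun z => invRoot z (U z)) (Ioo (-η) κ) := by
    have := h.smooth.mono hsub
    unfold invRoot
    refine ContDiffOn.sqrt (by fun_prop) (fun z hz => ?_)
    have := hUp z hz
    positivity
  have hXs : ContDiffOn ℝ ∞ X (Ioo (-η) κ) := by
    have := h.smooth.mono hsub
    refine (contDiffOn_const.mul hroot).div ?_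
      (fun z hz => (invDen_pos hk hγ (hUp z hz) (hlt z hz)).ne')
    unfold invDen; fun_prop
  have hVs : ContDiffOn ℝ ∞ (fun z => invV z (U z)) (Ioo (-η) κ) :=
    ContDiffOn.div (by fun_prop) hroot (fun z hz => (invRoot_pos (hUp z hz)).ne')
  have hneg : ∀ x ∈ Ioo (-κ) η, -x ∈ Ioo (-η) κ := fun x hx => ⟨by linarith [hx.2], by linarith [hx.1]⟩
  have hneg' : ∀ z ∈ Ioo (-η) κ, -z ∈ Ioo (-κ) η :=
    fun z hz => ⟨by linarith [hz.2], by linarith [hz.1]⟩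
  have hfd : ∀ x ∈ Ioo (-κ) η, HasDerivAt (fun x => X (-x)) (-dX (-x)) x := fun x hx =>
    ((hXd (-x) (hneg x hx)).comp x (hasDerivAt_neg x)).congr_deriv (by ring)
  -- The inverse function lemma is for increasing functions, so z is reflected and g(Z) = -z.
  obtain ⟨g, hg1, hg2, hopen, hgs⟩ := exists_smooth_inverse_Ioo (f := fun x => X (-x))
    (a := -κ) (b := η) (hXs.comp contDiff_neg.contDiffOn hneg) (fun x hx => by
      rw [(hfd x hx).deriv]; exact neg_pos.2 (hdXn _ (hneg x hx)))
  have hgX : ∀ z ∈ Ioo (-η) κ, g (X z) = -z := fun z hz => by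
    have := hg1 (-z) (hneg' z hz); simpa using this
  have hgd : ∀ z ∈ Ioo (-η) κ, HasDerivAt g (-dX z)⁻¹ (X z) := fun z hz => by
    have := hg2 (-z) (hneg' z hz)
    rw [(hfd _ (hneg' z hz)).deriv] at this
    simpa using this
  have hnhds : ∀ z ∈ Ioo (-η) κ, (fun x => X (-x)) '' Ioo (-κ) η ∈ 𝓝 (X z) := fun z hz =>
    hopen.mem_nhds ⟨-z, hneg' z hz, by simp⟩
  have hanti : StrictAntiOn X (Ioo (-η) κ) :=
    strictAntiOn_of_deriv_neg (convex_Ioo _ _) hXs.continuousOn (fun z hz => by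
      rw [interior_Ioo] at hz
      rw [(hXd z hz).deriv]; exact hdXn z hz)
  obtain ⟨W, hWs, hW0, hWev⟩ := exists_smooth_near_origin ha
  have hpos_mem : ∀ z ∈ Ioo 0 κ, z ∈ Ioo (-η) κ := fun z hz => ⟨by linarith [hz.1, hη.1], hz.2⟩
  -- The value 0 for Z ≤ 0 matters only at Z = 0: smoothness at the origin is one-sided.
  set V : ℝ → ℝ := fun Z => if Z ≤ 0 then 0 else invV (-g Z) (U (-g Z)) with hV
  have hVev : ∀ z ∈ Ioo (-η) κ, V =ᶠ[𝓝 (X z)] fun Z => invV (-g Z) (U (-g Z)) := fun z hz =>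
    mem_of_superset (Ioi_mem_nhds (hXp z hz)) fun Z hZ => by
      exact if_neg (not_le.2 hZ)
  have hval : ∀ z ∈ Ioo (-η) κ, V (X z) = invV z (U z) := fun z hz => by
    rw [(hVev z hz).eq_of_nhds, hgX z hz, neg_neg]
  have hW : ∀ᶠ Z in 𝓝 (0 : ℝ), 0 < Z → ∃ z ∈ Ioo 0 κ, X z = Z ∧ V Z = W Z := by
    filter_upwards [hWev] with Z hZ hZ0
    obtain ⟨z, hz, h1, h2⟩ := hZ hZ0
    rw [← h.eq z hz] at h1 h2
    refine ⟨z, hz, h1, ?_⟩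
    rw [← h1] at h2 ⊢
    rw [← h2]
    exact hval z (hpos_mem z hz)
  have hV0 : V 0 = 0 := by simp [hV]
  refine ⟨η, V, hη.1, hUp, hanti, ?_, hval, ?_, ?_, hV0, ?_⟩
  · intro Z hZ z₀ hz₀ hlt₀
    obtain ⟨δ, hδ, hball⟩ := Metric.eventually_nhds_iff.1 hW
    -- Some smaller value Z' is attained near Q₀ by the local parametrization at the origin; the
    -- intermediate value theorem then gives Z.
    set Z' := min Z δ / 2 with hZ'
    have hmin : 0 < min Z δ := lt_min hZ hδ
    have hZ'0 : 0 < Z' := by positivity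
    obtain ⟨z', hz', hXz', -⟩ := hball (y := Z') (by
      rw [Real.dist_eq, sub_zero, abs_of_pos hZ'0]
      have := min_le_right Z δ
      linarith) hZ'0
    have hZ'Z : Z' < Z := by
      have := min_le_left Z δ
      linarith
    have hz'm := hpos_mem z' hz'
    have hzz : z₀ < z' := by
      by_contra! hle
      have := hanti.antitoneOn hz'm hz₀ hle
      simp only [hXz'] at this
      have h3 : Z < X z₀ := hlt₀
      linarith
    have hcont : ContinuousOn X (Icc z₀ z') :=
      hXs.continuousOn.mono (Icc_subset_Ioo hz₀.1 hz'm.2)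
    obtain ⟨z, hz, hzZ⟩ := intermediate_value_Ioo' hzz.le hcont
      (show Z ∈ Ioo (X z') (X z₀) from ⟨by rw [hXz']; exact hZ'Z, hlt₀⟩)
    exact ⟨z, ⟨hz.1, hz.2.trans hz'.2⟩, hzZ⟩
  · intro z hz
    refine ContDiffAt.congr_of_eventuallyEq ?_ (hVev z hz)
    have h1 : ContDiffAt ℝ ∞ (fun z => invV z (U z)) (-g (X z)) := by
      rw [hgX z hz, neg_neg]; exact hVs.contDiffAt (Ioo_mem_nhds hz.1 hz.2)
    exact ContDiffAt.comp (g := fun z => invV z (U z)) (X z) h1 (hgs.contDiffAt (hnhds z hz)).neg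
  · refine hWs.contDiffWithinAt.congr_of_eventuallyEq ?_ (by rw [hV0, hW0])
    filter_upwards [nhdsWithin_le_nhds hW, self_mem_nhdsWithin] with Z hZ hZ0
    rcases (show (0 : ℝ) ≤ Z from hZ0).eq_or_lt with rfl | hlt0
    · rw [hV0, hW0]
    · obtain ⟨z, -, -, hz⟩ := hZ hlt0
      exact hz
  · intro z hz
    have h1 : HasDerivAt (fun z => invV z (U z))
        (-(2 * U z + (1 - z) * deriv U z) / (2 * invRoot z (U z) ^ 3)) (-g (X z)) := by
      rw [hgX z hz, neg_neg]
      exact hasDerivAt_invV (hUp z hz) (h.hasDerivAt (hsub hz))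
    have h2 := (h1.comp (X z) (hgd z hz).neg).congr_of_eventuallyEq (hVev z hz)
    have h3 := transport_ode hk hγ (hUp z hz) (hlt z hz) (h.solves z (hsub hz)).2
    have hne := (hdXn z hz).ne
    have h4 : deriv V (X z) =
        -(2 * U z + (1 - z) * deriv U z) / (2 * invRoot z (U z) ^ 3) / dX z := by
      rw [h2.deriv, inv_neg, neg_neg, div_eq_mul_inv _ (dX z)]
    change _ * deriv V (X z) = _
    rw [h4, ← mul_div_assoc, div_eq_iff hne]
    exact h3

section

variable {k ℓ γ ζ η : ℝ} {U V : ℝ → ℝ}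

theorem Transport.zero_mem (h : Transport k ℓ γ η U V) (ha : Adm k ℓ γ) :
    (0 : ℝ) ∈ Ioo (-η) (1 / (k + 1)) :=
  ⟨by linarith [h.η_pos], by have := ha.one_le_k; positivity⟩

theorem Transport.exists_of_lt (h : Transport k ℓ γ η U V) (hc : Continuation k ℓ γ ζ U)
    (ha : Adm k ℓ γ) {Z : ℝ} (hZ : Z ∈ Ioo 0 (Z₁ k ℓ γ)) :
    ∃ z ∈ Ioo 0 (1 / (k + 1)), invZ k γ z (U z) = Z :=
  h.surj Z hZ.1 0 (h.zero_mem ha) (by rw [hc.zero, invZ_zero ha]; exact hZ.2)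

theorem Transport.contDiffAt_of_lt (h : Transport k ℓ γ η U V) {Z z₀ : ℝ} (hZ : 0 < Z)
    (hz₀ : z₀ ∈ Ioo (-η) (1 / (k + 1))) (hlt : Z < invZ k γ z₀ (U z₀)) : ContDiffAt ℝ ∞ V Z := by
  obtain ⟨z, hz, rfl⟩ := h.surj Z hZ z₀ hz₀ hlt
  exact h.smooth z ⟨hz₀.1.trans hz.1, hz.2⟩

theorem Transport.contDiffOn (h : Transport k ℓ γ η U V) {z₀ : ℝ}
    (hz₀ : z₀ ∈ Ioo (-η) (1 / (k + 1))) : ContDiffOn ℝ ∞ V (Ico 0 (invZ k γ z₀ (U z₀))) := by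
  intro Z hZ
  rcases hZ.1.eq_or_lt with rfl | h0
  · exact h.smooth_zero.mono Ico_subset_Ici_self
  · exact (h.contDiffAt_of_lt h0 hz₀ hZ.2).contDiffWithinAt

theorem Transport.isP0P1Solution (h : Transport k ℓ γ η U V) (hc : Continuation k ℓ γ ζ U)
    (ha : Adm k ℓ γ) : IsP0P1Solution k ℓ γ V := by
  have hγ := gamma_pos ha.one_lt_ℓ ha.γ_gt
  have hk : 0 < k := by linarith [ha.one_le_k]
  have h0 := h.zero_mem ha
  have hκ := one_div_succ_lt_one ha.one_le_k
  have hreg : ∀ z ∈ Ioo 0 (1 / (k + 1)), DeltaZ ℓ (invZ k γ z (U z)) (invV z (U z)) ≠ 0 := by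
    intro z hz
    have hz' : z ∈ Ioo (-η) (1 / (k + 1)) := ⟨h0.1.trans hz.1, hz.2⟩
    have hU := h.U_pos z hz'
    have hs := ha.isCurve.sol.above z hz
    rw [← hc.eq z hz] at hs
    rw [DeltaZ_inv hk hγ hU (hz.2.trans hκ)]
    have := invRoot_pos (z := z) hU
    have := invDen_pos hk hγ hU (hz.2.trans hκ)
    have := mPar_pos hk hγ
    have := sub_pos.2 hs
    positivity
  refine ⟨?_, h.init, ?_, ?_⟩
  · have := h.contDiffOn h0
    rwa [hc.zero, invZ_zero ha] at this
  · intro Z hZ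
    obtain ⟨z, hz, rfl⟩ := h.exists_of_lt hc ha hZ
    rw [h.value z ⟨h0.1.trans hz.1, hz.2⟩]
    exact hreg z hz
  · intro Z hZ
    obtain ⟨z, hz, rfl⟩ := h.exists_of_lt hc ha hZ
    have hz' : z ∈ Ioo (-η) (1 / (k + 1)) := ⟨h0.1.trans hz.1, hz.2⟩
    rw [h.value z hz', ← h.ode z hz', mul_div_cancel_left₀ _ (hreg z hz)]
    exact ((h.smooth z hz').differentiableAt (by simp)).hasDerivAt

theorem Transport.isQ0Q1Curve (h : Transport k ℓ γ η U V) (hc : Continuation k ℓ γ ζ U)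
    (ha : Adm k ℓ γ) : IsQ0Q1Curve k ℓ γ V (curve k ℓ γ) := by
  have hγ := gamma_pos ha.one_lt_ℓ ha.γ_gt
  have hk : 0 < k := by linarith [ha.one_le_k]
  have h0 := h.zero_mem ha
  have hκ := one_div_succ_lt_one ha.one_le_k
  have hPsi : ∀ z ∈ Ioo 0 (1 / (k + 1)),
      Psi k γ (invZ k γ z (U z)) (V (invZ k γ z (U z))) = (z, curve k ℓ γ z) := by
    intro z hz
    have hz' : z ∈ Ioo (-η) (1 / (k + 1)) := ⟨h0.1.trans hz.1, hz.2⟩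
    rw [h.value z hz', Psi_inv hk hγ (h.U_pos z hz') (hz.2.trans hκ), hc.eq z hz]
  refine ⟨?_, ?_, ha.isCurve.tendsto_atTop ha⟩
  · apply Subset.antisymm
    · rintro _ ⟨z, hz, rfl⟩
      have hz' : z ∈ Ioo (-η) (1 / (k + 1)) := ⟨h0.1.trans hz.1, hz.2⟩
      refine ⟨invZ k γ z (U z), ⟨invZ_pos hk hγ (h.U_pos z hz') (hz.2.trans hκ), ?_⟩, hPsi z hz⟩
      have := h.anti h0 hz' hz.1
      simp only [hc.zero, invZ_zero ha] at this
      exact this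
    · rintro _ ⟨Z, hZ, rfl⟩
      obtain ⟨z, hz, rfl⟩ := h.exists_of_lt hc ha hZ
      exact ⟨z, hz, (hPsi z hz).symm⟩
  · have hcont := (hc.contDiffAt (hc.zero_mem ha)).continuousAt.tendsto
    rw [hc.zero] at hcont
    refine (hcont.mono_left nhdsWithin_le_nhds).congr' ?_
    filter_upwards [Ioo_mem_nhdsGT h0.2] with z hz using hc.eq z hz

theorem Transport.exists_extension (h : Transport k ℓ γ η U V) (hc : Continuation k ℓ γ ζ U)
    (ha : Adm k ℓ γ) :
    ∃ υ > (0 : ℝ), ContDiffOn ℝ ∞ V (Ico 0 (Z₁ k ℓ γ + υ)) ∧ V (Z₁ k ℓ γ) = v₁ k ℓ γ ∧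
      ∀ Z ∈ Ioo 0 (Z₁ k ℓ γ + υ), DeltaZ ℓ Z (V Z) * deriv V Z = DeltaV k γ Z (V Z) := by
  have h0 := h.zero_mem ha
  have hη := h.η_pos
  -- As Z decreases in z, the negative z in (-η/2, 0) parametrize the values Z just beyond Z₁.
  have hm : -(η / 2) ∈ Ioo (-η) (1 / (k + 1)) := ⟨by linarith, by linarith [h0.2]⟩
  have hlt := h.anti hm h0 (by linarith)
  simp only [hc.zero, invZ_zero ha] at hlt
  refine ⟨invZ k γ (-(η / 2)) (U (-(η / 2))) - Z₁ k ℓ γ, sub_pos.2 hlt, ?_, ?_, ?_⟩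
  · rw [add_sub_cancel]; exact h.contDiffOn hm
  · have := h.value 0 h0
    rwa [hc.zero, invZ_zero ha, invV_zero ha] at this
  · rw [add_sub_cancel]
    intro Z hZ
    obtain ⟨z, hz, rfl⟩ := h.surj Z hZ.1 _ hm hZ.2
    have hz' : z ∈ Ioo (-η) (1 / (k + 1)) := ⟨hm.1.trans hz.1, hz.2⟩
    rw [h.value z hz']
    exact h.ode z hz'

end

end RelEuler

end

/-! ### Assembly of the proposition -/

theorem proposition3 (k : ℕ) (ℓ : ℝ) (hkℓ : (k, ℓ) ∈ RelEuler.setKStar) :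
    ∃ R₀ ∈ Set.Ioo (3 : ℝ) 4, ∃ γ ∈ RelEuler.GammaSet k ℓ, RelEuler.ratioR k ℓ γ = R₀ ∧
      -- the `P₀-P₁` solution `v_F` and the `Q₀-Q₁` curve `u_F` for this parameter
      ∃ vF uF : ℝ → ℝ, RelEuler.IsP0P1Solution k ℓ γ vF ∧ RelEuler.IsQ0Q1Curve k ℓ γ vF uF ∧
        -- `u_L` is an analytic solution near `Q₁`, coincides with `u_F`,
        -- and `u_F` continues smoothly through `Q₁` by means of `u_L`
        (∃ ζ ∈ Set.Ioo (0 : ℝ) (1 / (k + 1)),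
          (∀ z ∈ Set.Icc (-ζ) ζ, Summable fun n : ℕ => RelEuler.coeffL k ℓ γ n * z ^ n) ∧
          AnalyticOnNhd ℝ (RelEuler.uL k ℓ γ) (Set.Ioo (-ζ) ζ) ∧
          (∀ z ∈ Set.Ioo (-ζ) ζ, RelEuler.SolvesZU k ℓ γ (RelEuler.uL k ℓ γ) z) ∧
          (∀ z ∈ Set.Ioo 0 ζ, RelEuler.uL k ℓ γ z = uF z) ∧
          ∃ U : ℝ → ℝ, ContDiffOn ℝ ∞ U (Set.Ioo (-ζ) (1 / (k + 1))) ∧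
            (∀ z ∈ Set.Ioo (0 : ℝ) (1 / (k + 1)), U z = uF z) ∧
            (∀ z ∈ Set.Ioo (-ζ) ζ, U z = RelEuler.uL k ℓ γ z) ∧
            U 0 = RelEuler.eps ℓ γ ∧
            ∀ z ∈ Set.Ioo (-ζ) (1 / (k + 1)), RelEuler.SolvesZU k ℓ γ U z) ∧
        -- `v_F` continues smoothly through `P₁`
        (∃ υ > (0 : ℝ), ∃ V : ℝ → ℝ,
          ContDiffOn ℝ ∞ V (Set.Ico 0 (RelEuler.Z₁ k ℓ γ + υ)) ∧
          (∀ Z ∈ Set.Ico 0 (RelEuler.Z₁ k ℓ γ), V Z = vF Z) ∧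
          V (RelEuler.Z₁ k ℓ γ) = RelEuler.v₁ k ℓ γ ∧
          ∀ Z ∈ Set.Ioo 0 (RelEuler.Z₁ k ℓ γ + υ),
            RelEuler.DeltaZ ℓ Z (V Z) * deriv V Z = RelEuler.DeltaV k γ Z (V Z)) := by
  obtain ⟨γ, ha, hs, hR, ζ, hζ, r, hr, hc, hm⟩ := RelEuler.exists_matching_of_mem hkℓ
  obtain ⟨h1, h2, h3, U, hU, hUL⟩ := RelEuler.exists_continuation ha hs hR hζ hr hc hm
  obtain ⟨η, V, hT⟩ := hU.exists_transport ha
  obtain ⟨υ, hυ, hV1, hV2, hV3⟩ := hT.exists_extension hU ha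
  -- The same V serves as v_F and as its continuation, since `IsP0P1Solution` concerns only [0, Z₁).
  exact ⟨_, hR, γ, ⟨ha.γ_gt, ha.A_pos⟩, rfl, V, RelEuler.curve k ℓ γ, hT.isP0P1Solution hU ha,
    hT.isQ0Q1Curve hU ha,
    ⟨ζ, hζ, h1, h2, h3, fun z hz => hm z ⟨hz.1, hz.2.le⟩, U, hU.smooth, hU.eq, hUL, hU.zero,
      hU.solves⟩,
    υ, hυ, V, hV1, fun _ _ => rfl, hV2, hV3⟩
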